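/- For integers $t\ge 2$ and $r\ge 1$ let $f_t(r)$ be the number of solutions of $\sum_{i=1}^r t^{-x_i}=1$ in integers $0\le x_1\le x_2\le\dots\le x_r$, and put $g_t(n)=f_t(1+n(t-1))$ for $n\ge 0$ (the number of canonical rooted $t$-ary trees with $n$ inner vertices). For every $t\ge2$ there are real numbers $\rho>\rho_2>r_3$ and positive real numbers $R,R_2,R_3$, depending only on $t$, such that for all $n\ge0$ \[ g_t(n)=R\rho^{n+1}+R_2\rho_2^{n+1}+R_3\,r_3^{\,n}\,\varepsilon_1(t,n),\qquad |\varepsilon_1(t,n)|\le 1, \] and which are specified as follows, where each $\varepsilon_j(t)$ is a real number with $|\varepsilon_j(t)|\le1$ and $\log$ is the natural logarithm. For $t\ge16$, \begin{align*} \rho&=2-\frac1{2^{t+1}}-\frac{t+3}{2^{2t+3}}-\frac{3t^2+19t+24}{2^{3t+6}}+\frac{0.28\,t^3}{2^{4t}}\varepsilon_2(t),\tag{1}\\ \rho_2&=1+\frac{\log2}{t}-\frac{\log2-\log^22}{2t^2}+\frac{4\log^32+3\log^22+6\log2}{24t^3}\\ &\qquad+\frac{2\log^42+54\log^32-27\log^22-6\log2}{48t^4}+\frac{0.26}{t^5}\varepsilon_3(t),\tag{2}\\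 r_3&=1+\frac{\log2}{t}-\frac{\log2-\log^22}{2t^2},\tag{3}\\ R&=\frac18+\frac{t-2}{2^{t+5}}+\frac{2t^2+3t-5}{2^{2t+7}}+\frac{9t^3+45t^2+20t-68}{2^{3t+10}}+\frac{t^4}{50\cdot2^{4t}}\varepsilon_4(t),\tag{4}\\ R_2&=\frac1{4t}-\frac{4\log2+1}{8t^2}+\frac{0.77}{t^3}\varepsilon_5(t),\tag{5}\\ R_3&=5t^4.\tag{6} \end{align*} For $2\le t\le15$ the constants are given by the following table. The entries for $r_3$ and $R_3$ are exact; the entries for $\rho,\rho_2,R,R_2$ are decimal values that are correct up to one unit in the last printed digit. \[\begin{array}{|c|l|l|l|l|l|l|}\hline t&\rho&\rho_2&r_3&R&R_2&R_3\\\hline 2 & 1.794147187541686 & 1.279549134726681 & 1.123 & 0.1418532020854094 & 0.0612410410312 & 36.6 \\ 3 & 1.920712538405631 & 1.211479378117327 & 1.098 & 0.1338681353605138 & 0.05040725710011751 & 39.0 \\ 4 & 1.964624757813775 & 1.165158374565692 & 1.083 & 0.1305243270109503 & 0.04239969309700251 & 58.4 \\ 5 & 1.983293986764127 & 1.134459698442781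 & 1.074 & 0.1284678647212778 & 0.03633182386516354 & 70.7 \\ 6 & 1.991897175722647 & 1.113019849812048 & 1.068 & 0.1271299952558400 & 0.03168855397536632 & 50.0 \\ 7 & 1.996015107731262 & 1.097324075593615 & 1.063 & 0.1262776860399922 & 0.02807600275247040 & 59.6 \\ 8 & 1.998025544625657 & 1.085389242111509 & 1.059 & 0.1257503987658994 & 0.02520568904841775 & 48.1 \\ 9 & 1.999017663916874 & 1.076032488551186 & 1.056 & 0.1254328058843682 & 0.02287594728315024 & 24.0 \\ 10 & 1.999510161506312 & 1.068511410911158 & 1.053 & 0.1252458295005635 & 0.02094759256441895 & 19.7 \\ 11 & 1.999755441055006 & 1.062339511503337 & 1.050 & 0.1251378340222618 & 0.01932397366876184 & 20.1 \\ 12 & 1.999877817773010 & 1.057186165846774 & 1.047 & 0.1250764428075050 & 0.01793689446751572 & 26.6 \\ 13 & 1.999938935019296 & 1.052819586914068 & 1.044 & 0.1250420050254539 & 0.01673722535920120 & 80.6 \\ 14 & 1.999969474502513 & 1.049072853620226 & 1.042 & 0.1250229006766309 & 0.01568876914448585 & 43.3 \\ 15 & 1.999984739115025 & 1.045822904924682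 & 1.040 & 0.1250124013324635 & 0.01476426249364319 & 39.0 \\ \hline\end{array}\] Moreover, (1) also holds for $3\le t\le15$, (4) also holds for $6\le t\le15$, and (5) also holds for $2\le t\le15$. -/

import Mathlib

/-- The number `f_t(r)` of solutions of `1 / t ^ x₁ + ⋯ + 1 / t ^ x_r = 1` in nonnegative integers
`x₁ ≤ ⋯ ≤ x_r`. -/
noncomputable def huffmanCount (t r : ℕ) : ℕ :=
  Nat.card {x : Fin r → ℕ // Monotone x ∧ ∑ i, (1 : ℚ) / (t : ℚ) ^ x i = 1}

/-- `g_t(n) = f_t(1 + n (t - 1))`, the number of canonical `t`-ary trees with `n` inner vertices. -/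
noncomputable def gCount (t n : ℕ) : ℕ :=
  huffmanCount t (1 + n * (t - 1))

/-- The six real constants (depending on `t`) of the asymptotic formula. -/
structure AsympConstants where
  rho : ℝ
  rho2 : ℝ
  r3 : ℝ
  R : ℝ
  R2 : ℝ
  R3 : ℝ

namespace AsympConstants

/-- The constants agree with a row of the numerical table: `r3` and `R3` are exactly the tabulated
numbers; `rho`, `rho2`, `R`, `R2` agree with the tabulated decimals up to one unit in the last
printed digit (`u` is this unit for `R2`). -/
def Fits (c : AsympConstants) (rho rho2 r3 R R2 u R3 : ℝ) : Prop :=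
  |c.rho - rho| ≤ 1e-15 ∧ |c.rho2 - rho2| ≤ 1e-15 ∧ c.r3 = r3 ∧
    |c.R - R| ≤ 1e-16 ∧ |c.R2 - R2| ≤ u ∧ c.R3 = R3

/-- The numerical table for `2 ≤ t ≤ 15`; no condition for other `t`. The columns are
`rho`, `rho2`, `r3`, `R`, `R2`, the unit of the last printed digit of `R2`, and `R3`. -/
def MatchesTable (c : AsympConstants) (t : ℕ) : Prop :=
  match t with
  | 2 => c.Fits 1.794147187541686 1.279549134726681 1.123
      0.1418532020854094 0.0612410410312 1e-13 36.6
  | 3 => c.Fits 1.920712538405631 1.211479378117327 1.098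
      0.1338681353605138 0.05040725710011751 1e-17 39.0
  | 4 => c.Fits 1.964624757813775 1.165158374565692 1.083
      0.1305243270109503 0.04239969309700251 1e-17 58.4
  | 5 => c.Fits 1.983293986764127 1.134459698442781 1.074
      0.1284678647212778 0.03633182386516354 1e-17 70.7
  | 6 => c.Fits 1.991897175722647 1.113019849812048 1.068
      0.1271299952558400 0.03168855397536632 1e-17 50.0
  | 7 => c.Fits 1.996015107731262 1.097324075593615 1.063
      0.1262776860399922 0.02807600275247040 1e-17 59.6
  | 8 => c.Fits 1.998025544625657 1.085389242111509 1.059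
      0.1257503987658994 0.02520568904841775 1e-17 48.1
  | 9 => c.Fits 1.999017663916874 1.076032488551186 1.056
      0.1254328058843682 0.02287594728315024 1e-17 24.0
  | 10 => c.Fits 1.999510161506312 1.068511410911158 1.053
      0.1252458295005635 0.02094759256441895 1e-17 19.7
  | 11 => c.Fits 1.999755441055006 1.062339511503337 1.050
      0.1251378340222618 0.01932397366876184 1e-17 20.1
  | 12 => c.Fits 1.999877817773010 1.057186165846774 1.047
      0.1250764428075050 0.01793689446751572 1e-17 26.6
  | 13 => c.Fits 1.999938935019296 1.052819586914068 1.044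
      0.1250420050254539 0.01673722535920120 1e-17 80.6
  | 14 => c.Fits 1.999969474502513 1.049072853620226 1.042
      0.1250229006766309 0.01568876914448585 1e-17 43.3
  | 15 => c.Fits 1.999984739115025 1.045822904924682 1.040
      0.1250124013324635 0.01476426249364319 1e-17 39.0
  | _ => True

end AsympConstants

/-! Let F_m(q) count canonical forests with m roots by their number of inner vertices. A forest with
m+1 roots either has a leaf among its roots or has only inner roots; deleting that leaf,
respectively all the roots, gives F_{m+1} = F_m + q^{m+1} F_{t(m+1)} with F_0 = 1
(`forestCount_succ`, `forestSeries_succ`). With [j] = 1 + t + ... + t^{j-1}, the explicit series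
Λ_k(q) = ∑_m (-1)^m q^{k[m]} ∏_{i≤m} q^{[i]}/(1-q^{[i]}) obey the same recursion
(`ladderSeries_succ_sub`). A bounded solution that vanishes at m = 0 vanishes identically for |q| ≤
1/4, so Λ_0 F_m = Λ_m (`ladderSeries_mul_forestSeries`). Thus ∑ g_t(n) q^n = Λ_1/Λ_0, and both
series are holomorphic in the whole unit disc.

The asymptotic formula is singularity analysis on the circle |q| = r = 1/r₃. One exhibits two real
zeros a = 1/ρ < b = 1/ρ₂ < r of Λ_0, shows that the closed disc contains no further zero and that
both are simple, subtracts the two principal parts, and applies Cauchy's estimate to the rest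
(`norm_coeff_remainder_le`). Absence of other zeros needs no winding number: if the denominator,
times a harmless holomorphic factor and divided by (q-a)(q-b), avoids the nonpositive reals on the
circle, then the open mapping theorem forbids zeros inside (`ne_zero_of_mem_slitPlane`).

For 2 ≤ t ≤ 15 everything is certified by fixed-point ball arithmetic evaluated in the kernel. A
sign change isolates each zero and a ball for the derivative encloses its residue
(`CBall.rootTest_sound`). A bisection of the circle into arcs checks the slit plane condition and
bounds the integral of |Λ_1/Λ_0| (`CBall.cover_sound`). The constants are then compared with the
table and the expansions.

For t ≥ 16 only the first two levels of the series matter. With p = q^{t+1}, the denominator times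
(1-q)(1-p) is (1-2q)(1-p) + qp(1+δ), where δ is tiny (`clearing_mul_denom`). In z = 1/q a zero
satisfies z^{t+1}(2-z) = 3-z+δ. One solution lies near 2, with an expansion in y = t/2^{t+1}
(`exists_rho`); another lies near 1 + (log 2)/t and is found from the logarithm of this equation
expanded in x = 1/t (`second_sign_change`). Sign changes at the two ends of the claimed ranges
locate both. The residues are, up to the tails, a rational function of z (`residue_approx`). For 16
≤ t ≤ 39 the tail is not small enough for the analytic treatment of the second zero, and the
certified test takes over (`exists_second_zero`).

On the circle of radius 1/r₃ the cleared denominator is (1-2q)(1-w), where w is close to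
p(3q-1)/(2q-1). Because r₃ omits the cubic term of the expansion of ρ₂, w slightly exceeds 1 at q =
r. Around the circle w is either smaller than 1 in modulus, or on the same side of the real axis as
q, or has real part above 1 while q is to the right of b (`circle_ratio_cases`). In each case 1-w
and b-q lie in a common half plane, which gives the slit plane condition, and |1-w| is at least of
order x², which bounds the quotient by O(t²). -/

/-! ### Recursive enumeration of canonical forests. -/

/-- Nondecreasing sequences of `r` exponents with `∑ t ^ (-x i) = m`. -/
def unitSums (t m r : ℕ) : Set (Fin r → ℕ) :=
  {x | Monotone x ∧ ∑ i, (1 : ℚ) / (t : ℚ) ^ x i = m}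

theorem unitSums_eq_empty_of_lt {t m r : ℕ} (ht : 2 ≤ t) (h : r < m) : unitSums t m r = ∅ := by
  ext x
  simp only [unitSums, Set.mem_ofPred_eq, Set.mem_empty_iff_false, iff_false, not_and]
  intro _ hs
  have h1 : ∑ i, (1 : ℚ) / (t : ℚ) ^ x i ≤ ∑ _i : Fin r, (1 : ℚ) := by
    refine Finset.sum_le_sum fun i _ => ?_
    rw [div_le_one (by positivity)]
    exact one_le_pow₀ (by exact_mod_cast (by omega : 1 ≤ t))
  rw [hs] at h1
  simp only [Finset.sum_const, Finset.card_univ, Fintype.card_fin, nsmul_eq_mul, mul_one] at h1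
  have : m ≤ r := by exact_mod_cast h1
  omega

theorem unitSums_zero_succ {t r : ℕ} (ht : 2 ≤ t) : unitSums t 0 (r + 1) = ∅ := by
  ext x
  simp only [unitSums, Set.mem_ofPred_eq, Set.mem_empty_iff_false, iff_false, not_and]
  intro _ hs
  have : 0 < ∑ i, (1 : ℚ) / (t : ℚ) ^ x i :=
    Finset.sum_pos (fun i _ => by positivity) Finset.univ_nonempty
  rw [hs] at this
  simp at this

theorem unitSums_zero_zero (t : ℕ) : unitSums t 0 0 = Set.univ := by
  ext x
  simp only [unitSums, Set.mem_ofPred_eq, Set.mem_univ, iff_true]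
  refine ⟨fun i => i.elim0, by simp⟩

/-- Either the first exponent is zero, or all exponents are positive. -/
theorem unitSums_succ_succ {t m r : ℕ} (ht : 2 ≤ t) :
    unitSums t (m + 1) (r + 1) =
      (fun x => (Fin.cons 0 x : Fin (r + 1) → ℕ)) '' unitSums t m r ∪
        (fun x i => x i + 1) '' unitSums t (t * (m + 1)) (r + 1) := by
  have ht0 : (t : ℚ) ≠ 0 := by positivity
  ext x
  constructor
  · rintro ⟨hm, hs⟩
    by_cases h0 : x 0 = 0
    · left
      refine ⟨fun i => x i.succ, ⟨fun i j hij => hm (Fin.succ_le_succ_iff.2 hij), ?_⟩, ?_⟩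
      · rw [Fin.sum_univ_succ, h0] at hs
        push_cast at hs
        simp only [pow_zero, div_one] at hs
        linarith
      · rw [← h0]
        exact Fin.cons_self_tail x
    · right
      have hpos : ∀ i, 1 ≤ x i := fun i =>
        (Nat.one_le_iff_ne_zero.2 h0).trans (hm (Fin.zero_le i))
      refine ⟨fun i => x i - 1, ⟨fun i j hij => Nat.sub_le_sub_right (hm hij) 1, ?_⟩, ?_⟩
      · have : ∀ i, (1 : ℚ) / (t : ℚ) ^ (x i - 1) = t * (1 / (t : ℚ) ^ x i) := by
          intro i
          obtain ⟨k, hk⟩ := Nat.exists_eq_add_of_le (hpos i)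
          rw [hk, Nat.add_sub_cancel_left, pow_add]
          field_simp
        rw [Finset.sum_congr rfl fun i _ => this i, ← Finset.mul_sum, hs]
        push_cast
        ring
      · funext i
        exact Nat.sub_add_cancel (hpos i)
  · rintro (⟨y, ⟨hm, hs⟩, rfl⟩ | ⟨y, ⟨hm, hs⟩, rfl⟩)
    · refine ⟨?_, ?_⟩
      · intro i j hij
        cases i using Fin.cases with
        | zero => simp
        | succ i =>
          cases j using Fin.cases with
          | zero => simp at hij
          | succ j => simpa using hm (Fin.succ_le_succ_iff.1 hij)
      · rw [Fin.sum_univ_succ]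
        simp only [Fin.cons_zero, Fin.cons_succ, pow_zero, div_one, hs]
        push_cast
        ring
    · refine ⟨fun i j hij => Nat.add_le_add_right (hm hij) 1, ?_⟩
      have : ∀ i, (1 : ℚ) / (t : ℚ) ^ (y i + 1) = (1 / t) * (1 / (t : ℚ) ^ y i) := by
        intro i
        rw [pow_succ]
        field_simp
      rw [Finset.sum_congr rfl fun i _ => this i, ← Finset.mul_sum, hs]
      push_cast
      field_simp

/-- The number of canonical forests with `m` roots and `n` inner vertices. -/
noncomputable def forestCount (t m n : ℕ) : ℕ := (unitSums t m (m + n * (t - 1))).ncard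

/-- Deleting m+1 inner roots and promoting their t(m+1) children to roots leaves the leaves
unchanged; both sides are the number of leaves. -/
theorem forest_size_eq {t m n : ℕ} (ht : 2 ≤ t) (h : m + 1 ≤ n) :
    m + n * (t - 1) + 1 = t * (m + 1) + (n - (m + 1)) * (t - 1) := by
  obtain ⟨s, rfl⟩ : ∃ s, t = s + 2 := ⟨t - 2, by omega⟩
  obtain ⟨k, rfl⟩ := Nat.exists_eq_add_of_le h
  simp only [show s + 2 - 1 = s + 1 by omega, Nat.add_sub_cancel_left]
  ring

/-- Needed because `Set.ncard` is additive only on finite sets. The recursion either removes a root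
and keeps n, or lowers n and enlarges the number of roots, hence strong induction on n outside and
induction on m inside. -/
theorem finite_unitSums {t : ℕ} (ht : 2 ≤ t) (n m : ℕ) :
    (unitSums t m (m + n * (t - 1))).Finite := by
  induction n using Nat.strong_induction_on generalizing m with
  | _ n ih =>
    induction m with
    | zero =>
      rcases Nat.eq_zero_or_pos (0 + n * (t - 1)) with h | h
      · rw [h]; exact Set.toFinite _
      · obtain ⟨k, hk⟩ := Nat.exists_eq_succ_of_ne_zero h.ne'
        rw [hk, Nat.succ_eq_add_one, unitSums_zero_succ ht]
        exact Set.finite_empty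
    | succ m ihm =>
      rw [show m + 1 + n * (t - 1) = (m + n * (t - 1)) + 1 by ring, unitSums_succ_succ ht]
      refine (ihm.image _).union (Set.Finite.image _ ?_)
      rcases Nat.lt_or_ge n (m + 1) with h | h
      · rw [unitSums_eq_empty_of_lt ht]
        · exact Set.finite_empty
        · obtain ⟨s, rfl⟩ : ∃ s, t = s + 2 := ⟨t - 2, by omega⟩
          simp only [show s + 2 - 1 = s + 1 by omega]
          nlinarith
      · rw [forest_size_eq ht h]
        exact ih (n - (m + 1)) (by omega) (t * (m + 1))

theorem forestCount_zero_zero (t : ℕ) : forestCount t 0 0 = 1 := by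
  rw [forestCount, Nat.zero_mul, Nat.add_zero, unitSums_zero_zero, Set.ncard_univ]
  simp

theorem forestCount_zero_succ {t : ℕ} (ht : 2 ≤ t) (n : ℕ) : forestCount t 0 (n + 1) = 0 := by
  have : 0 < 0 + (n + 1) * (t - 1) := by
    have : 0 < t - 1 := by omega
    positivity
  obtain ⟨k, hk⟩ := Nat.exists_eq_succ_of_ne_zero this.ne'
  rw [forestCount, hk, Nat.succ_eq_add_one, unitSums_zero_succ ht, Set.ncard_empty]

/-- The two cases are disjoint because the first exponent is zero in one and positive in the other.
If n < m+1 the roots cannot all be inner: too few summands would remain, each at most 1, to reach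
t(m+1). -/
theorem forestCount_succ {t : ℕ} (ht : 2 ≤ t) (m n : ℕ) :
    forestCount t (m + 1) n =
      forestCount t m n + if m + 1 ≤ n then forestCount t (t * (m + 1)) (n - (m + 1)) else 0 := by
  have hfin := finite_unitSums ht n (m + 1)
  rw [forestCount]
  rw [show m + 1 + n * (t - 1) = (m + n * (t - 1)) + 1 by ring] at hfin ⊢
  rw [unitSums_succ_succ ht] at hfin ⊢
  rw [Set.ncard_union_eq ?_ (hfin.subset Set.subset_union_left)
    (hfin.subset Set.subset_union_right)]
  · rw [Set.ncard_image_of_injective _ (Fin.cons_right_injective (α := fun _ => ℕ) 0),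
      Set.ncard_image_of_injective]
    · congr 1
      split_ifs with h
      · rw [forestCount, forest_size_eq ht h]
      · rw [unitSums_eq_empty_of_lt ht, Set.ncard_empty]
        obtain ⟨s, rfl⟩ : ∃ s, t = s + 2 := ⟨t - 2, by omega⟩
        simp only [show s + 2 - 1 = s + 1 by omega]
        nlinarith
    · intro x y hxy
      funext i
      simpa using congrFun hxy i
  · rw [Set.disjoint_left]
    rintro _ ⟨x, _, rfl⟩ ⟨y, _, hy⟩
    simpa using congrFun hy 0

theorem gCount_eq_forestCount (t n : ℕ) : gCount t n = forestCount t 1 n := by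
  rw [gCount, huffmanCount, forestCount, ← Nat.card_coe_set_eq]
  simp only [unitSums, Nat.cast_one]
  rfl

/-- Unfolding the recursion in m, the count is at most 2^{n-1} + 2^{n-2} + ... + 2^{n-m} = 2^n -
2^{n-m} for m ≤ n, and it is constant for m ≥ n. The bound provides a common disc of convergence for
all m. -/
theorem forestCount_le {t : ℕ} (ht : 2 ≤ t) (n m : ℕ) : forestCount t m n ≤ 2 ^ n := by
  induction n using Nat.strong_induction_on generalizing m with
  | _ n ih =>
    rcases Nat.eq_zero_or_pos n with rfl | hn
    · induction m with
      | zero => simp [forestCount_zero_zero]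
      | succ m ihm => rw [forestCount_succ ht]; simpa using ihm
    · have key : ∀ m, m ≤ n → forestCount t m n + 2 ^ (n - m) ≤ 2 ^ n := by
        intro m
        induction m with
        | zero =>
          intro _
          obtain ⟨k, rfl⟩ := Nat.exists_eq_succ_of_ne_zero hn.ne'
          simp [forestCount_zero_succ ht]
        | succ m ihm =>
          intro hm
          have h1 := ihm (by omega)
          have h2 := ih (n - (m + 1)) (by omega) (t * (m + 1))
          rw [forestCount_succ ht, if_pos hm]
          have h3 : 2 ^ (n - m) = 2 ^ (n - (m + 1)) + 2 ^ (n - (m + 1)) := by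
            rw [show n - m = n - (m + 1) + 1 by omega, pow_succ]; ring
          omega
      have key2 : ∀ k, forestCount t (n + k) n ≤ 2 ^ n := by
        intro k
        induction k with
        | zero => exact (Nat.le_add_right _ _).trans (key n le_rfl)
        | succ k ihk =>
          rw [← add_assoc, forestCount_succ ht, if_neg (by omega)]
          simpa using ihk
      rcases le_total m n with h | h
      · exact (Nat.le_add_right _ _).trans (key m h)
      · obtain ⟨k, rfl⟩ := Nat.exists_eq_add_of_le h
        exact key2 k

/-! ### Repunits and the ladder series. -/

open Finset in
/-- The repunit `1 + t + ⋯ + t ^ (j - 1)`. -/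
def repunit (t j : ℕ) : ℕ := ∑ i ∈ range j, t ^ i

theorem repunit_zero (t : ℕ) : repunit t 0 = 0 := rfl

theorem repunit_succ (t j : ℕ) : repunit t (j + 1) = 1 + t * repunit t j := by
  rw [repunit, Finset.sum_range_succ', repunit, Finset.mul_sum, pow_zero, add_comm]
  congr 1
  exact Finset.sum_congr rfl fun i _ => pow_succ' t i

theorem repunit_one (t : ℕ) : repunit t 1 = 1 := by simp [repunit]

theorem repunit_two (t : ℕ) : repunit t 2 = t + 1 := by
  rw [repunit_succ, repunit_one]; ring

theorem repunit_mono (t : ℕ) : Monotone (repunit t) := fun _ _ h =>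
  Finset.sum_le_sum_of_subset (Finset.range_mono h)

theorem le_repunit {t : ℕ} (ht : 2 ≤ t) (j : ℕ) : j ≤ repunit t j := by
  induction j with
  | zero => simp
  | succ j ih => rw [repunit_succ]; nlinarith

theorem repunit_succ_ne_zero (t j : ℕ) : repunit t (j + 1) ≠ 0 := by
  rw [repunit_succ]; omega

/-- The factor `q ^ [i] / (1 - q ^ [i])`. -/
noncomputable def ladder (t i : ℕ) (q : ℂ) : ℂ := q ^ repunit t i / (1 - q ^ repunit t i)

/-- The `m`-th term of the series `ladderSeries`. -/
noncomputable def ladderTerm (t k j m : ℕ) (q : ℂ) : ℂ :=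
  q ^ (k * repunit t (j + m)) * ((-1) ^ m * ∏ i ∈ Finset.range m, ladder t (j + i + 1) q)

/-- The series `∑ (-1) ^ m q ^ (k [j + m]) ∏ q ^ [i] / (1 - q ^ [i])`, the product being over
`j < i ≤ j + m`. -/
noncomputable def ladderSeries (t k j : ℕ) (q : ℂ) : ℂ := ∑' m, ladderTerm t k j m q

theorem norm_ladder_le {t i : ℕ} {q : ℂ} {M : ℝ} (hM : M < 1) (hq : ‖q‖ ^ repunit t i ≤ M) :
    ‖ladder t i q‖ ≤ M / (1 - M) := by
  rw [ladder, norm_div, norm_pow]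
  have h1 : 1 - M ≤ ‖1 - q ^ repunit t i‖ := by
    have := norm_sub_norm_le (1 : ℂ) (q ^ repunit t i)
    rw [norm_one, norm_pow] at this
    linarith
  have h0 : 0 ≤ M := le_trans (by positivity) hq
  gcongr

theorem one_sub_pow_ne_zero {q : ℂ} (hq : ‖q‖ < 1) {n : ℕ} (hn : n ≠ 0) : 1 - q ^ n ≠ 0 := by
  intro h
  have : ‖q ^ n‖ = 1 := by rw [← sub_eq_zero.1 h, norm_one]
  rw [norm_pow] at this
  exact absurd this (pow_lt_one₀ (norm_nonneg _) hq hn).ne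

/-- Replacing the repunit by the smaller index i + 1 costs little and gives a bound independent of
t, k and j and uniform on |q| ≤ r, which serves both holomorphy and the boundedness in k. -/
theorem norm_ladderTerm_le {t : ℕ} (ht : 2 ≤ t) (k j m : ℕ) {q : ℂ} {r : ℝ} (hr : r < 1)
    (hq : ‖q‖ ≤ r) :
    ‖ladderTerm t k j m q‖ ≤ ∏ i ∈ Finset.range m, r ^ (i + 1) / (1 - r) := by
  have hr0 : 0 ≤ r := (norm_nonneg q).trans hq
  rw [ladderTerm, norm_mul, norm_mul, norm_pow, norm_pow, norm_neg, norm_one, one_pow, one_mul]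
  have h1 : ‖q‖ ^ (k * repunit t (j + m)) ≤ 1 := pow_le_one₀ (norm_nonneg _) (hq.trans hr.le)
  have h2 : ‖∏ i ∈ Finset.range m, ladder t (j + i + 1) q‖ ≤
      ∏ i ∈ Finset.range m, r ^ (i + 1) / (1 - r) := by
    rw [norm_prod]
    refine Finset.prod_le_prod (fun _ _ => norm_nonneg _) fun i _ => ?_
    have h3 : r ^ repunit t (j + i + 1) ≤ r ^ (i + 1) :=
      pow_le_pow_of_le_one hr0 hr.le ((by omega : i + 1 ≤ j + i + 1).trans (le_repunit ht _))
    have h4 : r ^ (i + 1) ≤ r := by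
      simpa using pow_le_pow_of_le_one hr0 hr.le (by omega : 1 ≤ i + 1)
    have h5 : ‖q‖ ^ repunit t (j + i + 1) ≤ r ^ (i + 1) :=
      (pow_le_pow_left₀ (norm_nonneg _) hq _).trans h3
    refine (norm_ladder_le (h4.trans_lt hr) h5).trans ?_
    gcongr
  calc _ ≤ 1 * _ := mul_le_mul h1 h2 (norm_nonneg _) zero_le_one
    _ = _ := one_mul _

theorem summable_ladder_bound {r : ℝ} (hr0 : 0 ≤ r) (hr : r < 1) :
    Summable fun m => ∏ i ∈ Finset.range m, r ^ (i + 1) / (1 - r) := by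
  -- For r = 0 the terms vanish from m = 1 on, so the ratio test, which needs nonzero terms, does
  -- not apply.
  rcases hr0.eq_or_lt with rfl | hr0
  · refine summable_of_ne_finset_zero (s := {0}) fun m hm => ?_
    rw [Finset.mem_singleton] at hm
    exact Finset.prod_eq_zero (Finset.mem_range.2 (Nat.pos_of_ne_zero hm)) (by simp)
  have h1 : 0 < 1 - r := by linarith
  have hpos : ∀ m, 0 < ∏ i ∈ Finset.range m, r ^ (i + 1) / (1 - r) := fun m =>
    Finset.prod_pos fun i _ => by positivity
  refine summable_of_ratio_test_tendsto_lt_one (l := 0) one_pos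
    (Filter.Eventually.of_forall fun m => (hpos m).ne') ?_
  have : Filter.Tendsto (fun m : ℕ => r ^ (m + 1) / (1 - r)) Filter.atTop (nhds 0) := by
    simpa using ((tendsto_pow_atTop_nhds_zero_of_lt_one hr0.le hr).comp
      (Filter.tendsto_add_atTop_nat 1)).div_const (1 - r)
  refine this.congr fun m => ?_
  rw [Finset.prod_range_succ, norm_mul, mul_div_cancel_left₀ _ (norm_pos_iff.2 (hpos m).ne').ne',
    Real.norm_of_nonneg (by positivity)]

theorem summable_norm_ladderTerm {t : ℕ} (ht : 2 ≤ t) (k j : ℕ) {q : ℂ} (hq : ‖q‖ < 1) :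
    Summable fun m => ‖ladderTerm t k j m q‖ :=
  (summable_ladder_bound (norm_nonneg q) hq).of_nonneg_of_le (fun _ => norm_nonneg _)
    fun m => norm_ladderTerm_le ht k j m hq le_rfl

theorem summable_ladderTerm {t : ℕ} (ht : 2 ≤ t) (k j : ℕ) {q : ℂ} (hq : ‖q‖ < 1) :
    Summable fun m => ladderTerm t k j m q :=
  (summable_norm_ladderTerm ht k j hq).of_norm

theorem differentiableOn_ladder (t i : ℕ) :
    DifferentiableOn ℂ (ladder t (i + 1)) (Metric.ball 0 1) := by
  refine DifferentiableOn.div (by fun_prop) (by fun_prop) fun q hq => ?_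
  exact one_sub_pow_ne_zero (by simpa using hq) (repunit_succ_ne_zero t i)

theorem differentiableOn_ladderSeries {t : ℕ} (ht : 2 ≤ t) (k j : ℕ) :
    DifferentiableOn ℂ (ladderSeries t k j) (Metric.ball 0 1) := by
  intro q hq
  obtain ⟨r, hr1, hr2⟩ := exists_between (by simpa using hq : ‖q‖ < 1)
  have hr0 : 0 ≤ r := (norm_nonneg q).trans hr1.le
  have : DifferentiableOn ℂ (fun w => ∑' m, ladderTerm t k j m w) (Metric.ball 0 r) := by
    refine Complex.differentiableOn_tsum_of_summable_norm (summable_ladder_bound hr0 hr2)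
      (fun m => ?_) Metric.isOpen_ball fun m w hw =>
        norm_ladderTerm_le ht k j m hr2 (by simpa using (Metric.mem_ball.1 hw).le)
    refine DifferentiableOn.mul (by fun_prop) (DifferentiableOn.mul (by fun_prop) ?_)
    exact DifferentiableOn.fun_finsetProd fun i _ =>
      (differentiableOn_ladder t _).mono (Metric.ball_subset_ball hr2.le)
  exact ((this q (by simpa using hr1)).differentiableAt
    (Metric.isOpen_ball.mem_nhds (by simpa using hr1))).differentiableWithinAt

/-- All terms after the first share the factor -`ladder t (j + 1) q`; what remains is the same
series one level higher. Evaluation proceeds by this recursion in j. -/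
theorem ladderSeries_eq {t : ℕ} (ht : 2 ≤ t) (k j : ℕ) {q : ℂ} (hq : ‖q‖ < 1) :
    ladderSeries t k j q =
      q ^ (k * repunit t j) - ladder t (j + 1) q * ladderSeries t k (j + 1) q := by
  rw [ladderSeries, (summable_ladderTerm ht k j hq).tsum_eq_zero_add, ladderSeries, ← tsum_mul_left,
    sub_eq_add_neg, ← tsum_neg]
  congr 1
  · simp [ladderTerm]
  · refine tsum_congr fun m => ?_
    rw [ladderTerm, ladderTerm, Finset.prod_range_succ']
    have : ∀ i, j + (i + 1) + 1 = j + 1 + i + 1 := fun i => by ring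
    simp only [this, add_zero, show j + (m + 1) = j + 1 + m by ring]
    ring

/-- Each ladder factor above level j is at most M/(1-M) ≤ 4M/3 ≤ 1/3, so the terms after the first
are dominated by a geometric series of sum (4M/3)/(1-4M/3) ≤ 2M. -/
theorem norm_ladderSeries_sub_le {t : ℕ} (ht : 2 ≤ t) (k j : ℕ) {q : ℂ} (hq : ‖q‖ < 1) {M : ℝ}
    (hM : ‖q‖ ^ repunit t (j + 1) ≤ M) (hM4 : M ≤ 1 / 4) :
    ‖ladderSeries t k j q - q ^ (k * repunit t j)‖ ≤ 2 * M := by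
  have hM0 : 0 ≤ M := le_trans (by positivity) hM
  have hl : ∀ i, ‖ladder t (j + i + 1) q‖ ≤ 4 / 3 * M := fun i => by
    refine (norm_ladder_le (by linarith) ((pow_le_pow_of_le_one (norm_nonneg _) hq.le
      (repunit_mono t (by omega : j + 1 ≤ j + i + 1))).trans hM)).trans ?_
    rw [div_le_iff₀ (by linarith)]
    nlinarith
  rw [ladderSeries, (summable_ladderTerm ht k j hq).tsum_eq_zero_add]
  have h0 : ladderTerm t k j 0 q = q ^ (k * repunit t j) := by simp [ladderTerm]
  rw [h0, add_sub_cancel_left]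
  have hb : ∀ m, ‖ladderTerm t k j (m + 1) q‖ ≤ 4 / 3 * M * (4 / 3 * M) ^ m := fun m => by
    rw [ladderTerm, norm_mul, norm_mul, norm_pow, norm_pow, norm_neg, norm_one, one_pow, one_mul,
      ← pow_succ']
    have h1 : ‖q‖ ^ (k * repunit t (j + (m + 1))) ≤ 1 := pow_le_one₀ (norm_nonneg _) hq.le
    have h2 : ‖∏ i ∈ Finset.range (m + 1), ladder t (j + i + 1) q‖ ≤ (4 / 3 * M) ^ (m + 1) := by
      rw [norm_prod]
      calc _ ≤ ∏ _i ∈ Finset.range (m + 1), (4 / 3 * M) :=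
            Finset.prod_le_prod (fun _ _ => norm_nonneg _) fun i _ => hl i
        _ = _ := by simp
    calc _ ≤ 1 * _ := mul_le_mul h1 h2 (norm_nonneg _) zero_le_one
      _ = _ := one_mul _
  have hs := (hasSum_geometric_of_lt_one (by positivity : 0 ≤ 4 / 3 * M) (by linarith)).mul_left
    (4 / 3 * M)
  refine (tsum_of_norm_bounded hs hb).trans ?_
  rw [← div_eq_mul_inv, div_le_iff₀ (by linarith)]
  nlinarith

theorem ladderSeries_conj (t k j : ℕ) (q : ℂ) :
    ladderSeries t k j (starRingEnd ℂ q) = starRingEnd ℂ (ladderSeries t k j q) := by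
  rw [ladderSeries, ladderSeries, Complex.conj_tsum]
  refine tsum_congr fun m => ?_
  simp [ladderTerm, ladder, map_prod]

/-- In q^{(k+1)[m]} - q^{k[m]} = -q^{k[m]}(1-q^{[m]}) the last factor cancels the denominator of the
last ladder factor, and [m+1] = 1 + t[m] turns the shifted series into the one with parameter
t(k+1). This is the recursion of the forest series. -/
theorem ladderSeries_succ_sub {t : ℕ} (ht : 2 ≤ t) (k : ℕ) {q : ℂ} (hq : ‖q‖ < 1) :
    ladderSeries t (k + 1) 0 q - ladderSeries t k 0 q =
      q ^ (k + 1) * ladderSeries t (t * (k + 1)) 0 q := by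
  have h1 := summable_ladderTerm ht (k + 1) 0 hq
  have h2 := summable_ladderTerm ht k 0 hq
  rw [ladderSeries, ladderSeries, ← h1.tsum_sub h2, (h1.sub h2).tsum_eq_zero_add, ladderSeries,
    ← tsum_mul_left]
  have h0 : ladderTerm t (k + 1) 0 0 q - ladderTerm t k 0 0 q = 0 := by
    simp [ladderTerm, repunit_zero]
  rw [h0, zero_add]
  refine tsum_congr fun m => ?_
  have h3 : (1 - q ^ repunit t (m + 1)) * ladder t (m + 1) q = q ^ repunit t (m + 1) := by
    rw [ladder, mul_div_cancel₀ _ (one_sub_pow_ne_zero hq (repunit_succ_ne_zero t m))]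
  simp only [ladderTerm, zero_add, Finset.prod_range_succ]
  generalize ∏ i ∈ Finset.range m, ladder t (i + 1) q = P
  have h4 : q ^ (k + 1) * q ^ (t * (k + 1) * repunit t m) =
      q ^ (k * repunit t (m + 1)) * q ^ repunit t (m + 1) := by
    rw [← pow_add, ← pow_add, repunit_succ]
    congr 1
    ring
  rw [← mul_assoc (q ^ (k + 1)), h4, show (k + 1) * repunit t (m + 1) =
    k * repunit t (m + 1) + repunit t (m + 1) by ring, pow_add, pow_succ (-1 : ℂ) m]
  linear_combination q ^ (k * repunit t (m + 1)) * (-1) ^ m * P * h3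

/-! ### The generating function as a quotient of ladder series. -/

/-- The generating function of forests with `m` roots by number of inner vertices. -/
noncomputable def forestSeries (t m : ℕ) (q : ℂ) : ℂ := ∑' n, (forestCount t m n : ℂ) * q ^ n

theorem norm_forestCount_mul_le {t : ℕ} (ht : 2 ≤ t) (m n : ℕ) {q : ℂ} (hq : ‖q‖ ≤ 1 / 4) :
    ‖(forestCount t m n : ℂ) * q ^ n‖ ≤ (1 / 2) ^ n := by
  rw [norm_mul, norm_pow, Complex.norm_natCast]
  calc (forestCount t m n : ℝ) * ‖q‖ ^ n ≤ 2 ^ n * (1 / 4) ^ n := by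
        gcongr
        exact_mod_cast forestCount_le ht n m
    _ = _ := by rw [← mul_pow]; norm_num

theorem summable_forestSeries {t : ℕ} (ht : 2 ≤ t) (m : ℕ) {q : ℂ} (hq : ‖q‖ ≤ 1 / 4) :
    Summable fun n => (forestCount t m n : ℂ) * q ^ n :=
  Summable.of_norm_bounded (summable_geometric_of_lt_one (by norm_num) (by norm_num))
    fun n => norm_forestCount_mul_le ht m n hq

theorem norm_forestSeries_le {t : ℕ} (ht : 2 ≤ t) (m : ℕ) {q : ℂ} (hq : ‖q‖ ≤ 1 / 4) :
    ‖forestSeries t m q‖ ≤ 2 := by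
  have := tsum_of_norm_bounded (hasSum_geometric_of_lt_one (by norm_num : (0:ℝ) ≤ 1 / 2)
    (by norm_num)) (fun n => norm_forestCount_mul_le ht m n hq)
  refine this.trans (by norm_num)

theorem forestSeries_zero {t : ℕ} (ht : 2 ≤ t) (q : ℂ) : forestSeries t 0 q = 1 := by
  rw [forestSeries, tsum_eq_single 0]
  · simp [forestCount_zero_zero]
  · intro n hn
    obtain ⟨k, rfl⟩ := Nat.exists_eq_succ_of_ne_zero hn
    simp [forestCount_zero_succ ht]

theorem forestSeries_succ {t : ℕ} (ht : 2 ≤ t) (m : ℕ) {q : ℂ} (hq : ‖q‖ ≤ 1 / 4) :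
    forestSeries t (m + 1) q =
      forestSeries t m q + q ^ (m + 1) * forestSeries t (t * (m + 1)) q := by
  have h1 := summable_forestSeries ht (t * (m + 1)) hq
  have h2 : HasSum (fun n => ((if m + 1 ≤ n then forestCount t (t * (m + 1)) (n - (m + 1)) else 0 :
      ℕ) : ℂ) * q ^ n) (q ^ (m + 1) * forestSeries t (t * (m + 1)) q) := by
    have h3 := h1.hasSum.mul_left (q ^ (m + 1))
    have hinj : Function.Injective fun n : ℕ => n + (m + 1) := add_left_injective _
    rw [← Function.Injective.hasSum_iff hinj]
    · have heq : (fun n => ((if m + 1 ≤ n then forestCount t (t * (m + 1)) (n - (m + 1)) else 0 :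
          ℕ) : ℂ) * q ^ n) ∘ (fun n : ℕ => n + (m + 1)) =
          fun n => q ^ (m + 1) * ((forestCount t (t * (m + 1)) n : ℂ) * q ^ n) := by
        funext n
        simp only [Function.comp, if_pos (Nat.le_add_left (m + 1) n), Nat.add_sub_cancel, pow_add]
        ring
      rw [heq]
      exact h3
    · intro n hn
      have : ¬ m + 1 ≤ n := fun h => hn ⟨n - (m + 1), Nat.sub_add_cancel h⟩
      simp [this]
  rw [forestSeries, forestSeries, ← h2.tsum_eq, ← (summable_forestSeries ht m hq).tsum_add
    h2.summable]
  refine tsum_congr fun n => ?_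
  rw [forestCount_succ ht]
  push_cast
  ring

/-- The difference of the two sides satisfies the homogeneous recursion, vanishes at m = 0 and is
bounded uniformly in m. For |q| ≤ 1/4 the recursion contracts the uniform bound, so the difference
is zero. -/
theorem ladderSeries_mul_forestSeries {t : ℕ} (ht : 2 ≤ t) (m : ℕ) {q : ℂ} (hq : ‖q‖ ≤ 1 / 4) :
    ladderSeries t 0 0 q * forestSeries t m q = ladderSeries t m 0 q := by
  have hq1 : ‖q‖ < 1 := by linarith
  set Δ : ℕ → ℂ := fun m => ladderSeries t 0 0 q * forestSeries t m q - ladderSeries t m 0 q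
    with hΔ
  have h0 : Δ 0 = 0 := by simp [hΔ, forestSeries_zero ht]
  have hstep : ∀ m, Δ (m + 1) = Δ m + q ^ (m + 1) * Δ (t * (m + 1)) := fun m => by
    simp only [hΔ]
    have := ladderSeries_succ_sub ht m hq1
    rw [forestSeries_succ ht m hq]
    linear_combination -this
  obtain ⟨B, hB⟩ : ∃ B, ∀ m, ‖Δ m‖ ≤ B := by
    set S := ∑' m, ∏ i ∈ Finset.range m, ‖q‖ ^ (i + 1) / (1 - ‖q‖)
    have hS : ∀ k, ‖ladderSeries t k 0 q‖ ≤ S := fun k =>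
      tsum_of_norm_bounded (summable_ladder_bound (norm_nonneg q) hq1).hasSum fun m =>
        norm_ladderTerm_le ht k 0 m hq1 le_rfl
    refine ⟨S * 2 + S, fun m => (norm_sub_le _ _).trans ?_⟩
    have := hS 0
    rw [norm_mul]
    gcongr
    · exact norm_forestSeries_le ht m hq
    · exact hS m
  have hpow : ∀ k, ∀ m, ‖Δ m‖ ≤ B * (1 / 2) ^ k := by
    intro k
    induction k with
    | zero => simpa using hB
    | succ k ih =>
      have hB0 : 0 ≤ B * (1 / 2) ^ k := (norm_nonneg _).trans (ih 0)
      -- Summing the recursion from 0 to m gives the factor ∑_{i=1}^m 4^{-i} = (1-4^{-m})/3 ≤ 1/2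
      -- against the previous bound, simultaneously for all m.
      have : ∀ m, ‖Δ m‖ ≤ (1 - (1 / 4) ^ m) * (1 / 3) * (B * (1 / 2) ^ k) := by
        intro m
        induction m with
        | zero => simp [h0]
        | succ m ihm =>
          rw [hstep]
          have h1 : ‖q ^ (m + 1) * Δ (t * (m + 1))‖ ≤ (1 / 4) ^ (m + 1) * (B * (1 / 2) ^ k) := by
            rw [norm_mul, norm_pow]
            gcongr
            exact ih _
          refine (norm_add_le _ _).trans ((add_le_add ihm h1).trans (le_of_eq ?_))
          rw [pow_succ]; ring
      intro m
      refine (this m).trans ?_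
      rw [pow_succ]
      have : (0 : ℝ) ≤ (1 / 4) ^ m := by positivity
      nlinarith
  have hlim : Filter.Tendsto (fun k : ℕ => B * (1 / 2 : ℝ) ^ k) Filter.atTop (nhds 0) := by
    simpa using (tendsto_pow_atTop_nhds_zero_of_lt_one (by norm_num : (0 : ℝ) ≤ 1 / 2)
      (by norm_num)).const_mul B
  have : ‖Δ m‖ ≤ 0 := ge_of_tendsto' hlim fun k => hpow k m
  exact sub_eq_zero.1 (norm_le_zero_iff.1 this)

/-! ### Excluding further zeros, and Cauchy's estimate without two poles. -/

/-- A function holomorphic near a closed disc whose values on the boundary circle avoid the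
nonpositive reals has no zero in the disc. -/
theorem ne_zero_of_mem_slitPlane {f : ℂ → ℂ} {r s : ℝ} (hr : 0 < r) (hrs : r < s)
    (hf : DifferentiableOn ℂ f (Metric.ball 0 s))
    (hslit : ∀ q : ℂ, ‖q‖ = r → f q ∈ Complex.slitPlane) {q : ℂ} (hq : ‖q‖ ≤ r) : f q ≠ 0 := by
  intro h0
  have hsub : Metric.closedBall (0 : ℂ) r ⊆ Metric.ball 0 s := Metric.closedBall_subset_ball hrs
  have hcont : ContinuousOn f (Metric.closedBall 0 r) := hf.continuousOn.mono hsub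
  -- A zero would make this compact set nonempty. At its point of least real value, which is not on
  -- the circle, f is either constant, carrying a forbidden value to the circle, or open, so that it
  -- attains a slightly smaller real value nearby; both are impossible.
  set T : Set ℂ := Metric.closedBall 0 r ∩ f ⁻¹' {w | w.im = 0 ∧ w.re ≤ 0} with hT
  have hTc : IsCompact T := by
    refine (isCompact_closedBall (0 : ℂ) r).of_isClosed_subset ?_ Set.inter_subset_left
    refine hcont.preimage_isClosed_of_isClosed Metric.isClosed_closedBall ?_
    exact (isClosed_eq Complex.continuous_im continuous_const).inter
      (isClosed_le Complex.continuous_re continuous_const)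
  have hTn : T.Nonempty := ⟨q, by simpa using hq, by simp [h0]⟩
  obtain ⟨z, hzT, hmin⟩ := hTc.exists_isMinOn hTn
    (Complex.continuous_re.comp_continuousOn (hcont.mono Set.inter_subset_left))
  obtain ⟨hzr, hzim, hzre⟩ := hzT
  have hns : f z ∉ Complex.slitPlane := by
    rw [Complex.mem_slitPlane_iff]
    push Not
    exact ⟨hzre, hzim⟩
  have hzlt : ‖z‖ < r := by
    refine lt_of_le_of_ne (by simpa using hzr) fun h => hns (hslit z h)
  have han : AnalyticOnNhd ℂ f (Metric.ball 0 s) := fun w hw =>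
    hf.analyticAt (Metric.isOpen_ball.mem_nhds hw)
  have hzs : z ∈ Metric.ball (0 : ℂ) s := hsub hzr
  rcases (han z hzs).eventually_constant_or_nhds_le_map_nhds with hc | ho
  · have := (han.eqOn_of_preconnected_of_eventuallyEq (analyticOnNhd_const (v := f z))
      (convex_ball _ _).isPreconnected hzs hc)
    have hr' : (r : ℂ) ∈ Metric.ball (0 : ℂ) s := by
      simpa [abs_of_pos hr] using hrs
    have h1 := this hr'
    have h2 := hslit r (by simp [abs_of_pos hr])
    rw [h1] at h2
    exact hns h2
  · have hnear : f '' Metric.ball 0 r ∈ nhds (f z) :=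
      ho (Filter.image_mem_map (Metric.isOpen_ball.mem_nhds (by simpa using hzlt)))
    obtain ⟨ε, hε, hball⟩ := Metric.mem_nhds_iff.1 hnear
    have hmem : f z - (ε / 2 : ℝ) ∈ Metric.ball (f z) ε := by
      rw [Metric.mem_ball, dist_eq_norm, sub_sub_cancel_left, norm_neg, Complex.norm_real,
        Real.norm_of_nonneg (by positivity)]
      linarith
    obtain ⟨w, hw, hfw⟩ := hball hmem
    have hwT : w ∈ T := by
      refine ⟨Metric.ball_subset_closedBall hw, ?_, ?_⟩
      · rw [hfw]; simp [hzim]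
      · rw [hfw]; simp; linarith
    have h1 : (f z).re ≤ (f w).re := hmin hwT
    rw [hfw] at h1
    simp at h1
    linarith

/-- The denominator of the generating function of canonical trees. -/
noncomputable abbrev denom (t : ℕ) : ℂ → ℂ := ladderSeries t 0 0

/-- The numerator of the generating function of canonical trees. -/
noncomputable abbrev numer (t : ℕ) : ℂ → ℂ := ladderSeries t 1 0

/-- Minus the residue of the generating function at a simple zero of the denominator. -/
noncomputable def residue (t : ℕ) (q : ℂ) : ℂ := -numer t q / deriv (denom t) q

/-- The generating function with the principal parts at `a` and `b` removed. -/
noncomputable def remainder (t : ℕ) (a b q : ℂ) : ℂ :=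
  numer t q / denom t q - residue t a / (a - q) - residue t b / (b - q)

theorem hasSum_pole {a q R : ℂ} (ha : a ≠ 0) (hq : ‖q‖ < ‖a‖) :
    HasSum (fun n : ℕ => R * (a⁻¹) ^ (n + 1) * q ^ n) (R / (a - q)) := by
  have h1 : ‖q / a‖ < 1 := by
    rw [norm_div, div_lt_one (norm_pos_iff.2 ha)]; exact hq
  have h2 := (hasSum_geometric_of_norm_lt_one h1).mul_left (R * a⁻¹)
  have h3 : a - q ≠ 0 := fun h => by
    rw [sub_eq_zero] at h; rw [h] at hq; exact lt_irrefl _ hq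
  have h4 : R / (a - q) = R * a⁻¹ * (1 - q / a)⁻¹ := by
    have : 1 - q / a ≠ 0 := by
      rw [one_sub_div ha]; exact div_ne_zero h3 ha
    field_simp
  rw [h4]
  have h5 : (fun n : ℕ => R * (a⁻¹) ^ (n + 1) * q ^ n) = fun n => R * a⁻¹ * (q / a) ^ n := by
    funext n
    rw [div_pow, inv_pow, pow_succ]
    field_simp
  rw [h5]
  exact h2

/-- Dividing the denominator by (q-a)(q-b) leaves F, zero-free in the closed disc by the slit plane
hypothesis; P is a free holomorphic factor, later the product clearing denominators. Then the
quotient minus its two principal parts extends holomorphically across the closed disc, its Taylor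
coefficients are the left-hand quantities, and Cauchy's formula bounds them by the mean of the
modulus on the circle. -/
theorem norm_coeff_remainder_le {t : ℕ} (ht : 2 ≤ t) {a b : ℂ} {r : ℝ} {P : ℂ → ℂ} (hr : r < 1)
    (ha0 : a ≠ 0) (hb0 : b ≠ 0) (har : ‖a‖ < r) (hbr : ‖b‖ < r) (hab : a ≠ b)
    (hda : denom t a = 0) (hdb : denom t b = 0) (hP : DifferentiableOn ℂ P (Metric.ball 0 1))
    (hslit : ∀ q : ℂ, ‖q‖ = r → P q * denom t q / ((q - a) * (q - b)) ∈ Complex.slitPlane)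
    (n : ℕ) :
    ‖(gCount t n : ℂ) - residue t a * (a⁻¹) ^ (n + 1) - residue t b * (b⁻¹) ^ (n + 1)‖ ≤
      ((2 * Real.pi)⁻¹ * ∫ θ in (0 : ℝ)..2 * Real.pi, ‖remainder t a b (circleMap 0 r θ)‖) *
        (r⁻¹) ^ n := by
  have hr0 : 0 < r := (norm_nonneg a).trans_lt har
  have hD := differentiableOn_ladderSeries ht 0 0
  have hN := differentiableOn_ladderSeries ht 1 0
  have hnhds : ∀ c : ℂ, ‖c‖ < 1 → Metric.ball (0 : ℂ) 1 ∈ nhds c := fun c hc =>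
    Metric.isOpen_ball.mem_nhds (by simpa using hc)
  set F₁ : ℂ → ℂ := dslope (denom t) a with hF₁
  set F : ℂ → ℂ := dslope F₁ b with hF
  have hF₁d : DifferentiableOn ℂ F₁ (Metric.ball 0 1) :=
    (Complex.differentiableOn_dslope (hnhds a (har.trans hr))).2 hD
  have hFd : DifferentiableOn ℂ F (Metric.ball 0 1) :=
    (Complex.differentiableOn_dslope (hnhds b (hbr.trans hr))).2 hF₁d
  have e1 : ∀ q, denom t q = (q - a) * F₁ q := fun q => by
    have := sub_smul_dslope (denom t) a q
    rw [hda, sub_zero, smul_eq_mul] at this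
    exact this.symm
  have hF₁b : F₁ b = 0 := by
    have := e1 b
    rw [hdb] at this
    exact (mul_eq_zero.1 this.symm).resolve_left (sub_ne_zero.2 hab.symm)
  have e2 : ∀ q, F₁ q = (q - b) * F q := fun q => by
    have := sub_smul_dslope F₁ b q
    rw [hF₁b, sub_zero, smul_eq_mul] at this
    exact this.symm
  have e3 : ∀ q, denom t q = (q - a) * (q - b) * F q := fun q => by rw [e1, e2, mul_assoc]
  have hne : ∀ q : ℂ, ‖q‖ ≤ r → F q ≠ 0 := by
    intro q hq hFq
    refine ne_zero_of_mem_slitPlane (f := fun q => P q * F q) hr0 hr (hP.mul hFd) ?_ hq ?_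
    · intro z hz
      have hza : z - a ≠ 0 := fun h => by rw [sub_eq_zero.1 h] at hz; exact har.ne hz
      have hzb : z - b ≠ 0 := fun h => by rw [sub_eq_zero.1 h] at hz; exact hbr.ne hz
      have := hslit z hz
      rwa [e3, mul_comm ((z - a) * (z - b)), ← mul_assoc,
        mul_div_cancel_right₀ _ (mul_ne_zero hza hzb)] at this
    · simp [hFq]
  have hda' : deriv (denom t) a = (a - b) * F a := by
    rw [← e2, hF₁, dslope_same]
  have hdb' : deriv (denom t) b = (b - a) * F b := by
    have h1 : HasDerivAt F₁ (F b) b := by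
      have := (hF₁d.differentiableAt (hnhds b (hbr.trans hr))).hasDerivAt
      rwa [hF, dslope_same]
    have h2 := ((hasDerivAt_id b).sub_const a).mul h1
    have h3 : denom t = fun q => (q - a) * F₁ q := funext e1
    rw [h3]
    have h4 := h2.deriv
    simp only [id, hF₁b, mul_zero, zero_add] at h4
    exact h4
  set V : Set ℂ := Metric.ball 0 1 ∩ F ⁻¹' {0}ᶜ with hV
  have hVo : IsOpen V :=
    hFd.continuousOn.isOpen_inter_preimage Metric.isOpen_ball isOpen_compl_singleton
  have hVr : Metric.closedBall (0 : ℂ) r ⊆ V := fun q hq => by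
    rw [mem_closedBall_zero_iff] at hq
    exact ⟨by simpa using hq.trans_lt hr, hne q hq⟩
  set H : ℂ → ℂ := fun q => numer t q / F q with hH
  have hHd : DifferentiableOn ℂ H V :=
    (hN.mono Set.inter_subset_left).div (hFd.mono Set.inter_subset_left) fun q hq => hq.2
  have hVn : ∀ c : ℂ, ‖c‖ < r → V ∈ nhds c := fun c hc =>
    hVo.mem_nhds (hVr (by simpa using hc.le))
  set H₁ : ℂ → ℂ := dslope H a with hH₁
  -- The generating function is H/((q-a)(q-b)), and the second divided difference of H at a and b is
  -- exactly this function without its two principal parts.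
  set E : ℂ → ℂ := dslope H₁ b with hE
  have hH₁d : DifferentiableOn ℂ H₁ V := (Complex.differentiableOn_dslope (hVn a har)).2 hHd
  have hEd : DifferentiableOn ℂ E V := (Complex.differentiableOn_dslope (hVn b hbr)).2 hH₁d
  have hErem : ∀ q, ‖q‖ ≤ r → q ≠ a → q ≠ b → E q = remainder t a b q := by
    intro q hq hqa hqb
    have hqa' : q - a ≠ 0 := sub_ne_zero.2 hqa
    have hqb' : q - b ≠ 0 := sub_ne_zero.2 hqb
    have hqa'' : a - q ≠ 0 := sub_ne_zero.2 hqa.symm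
    have hqb'' : b - q ≠ 0 := sub_ne_zero.2 hqb.symm
    have hab' : a - b ≠ 0 := sub_ne_zero.2 hab
    have hba' : b - a ≠ 0 := sub_ne_zero.2 hab.symm
    have hFa := hne a har.le
    have hFb := hne b hbr.le
    have hFq := hne q hq
    have h1 : (q - b) * E q = H₁ q - H₁ b := sub_smul_dslope H₁ b q
    have h2 : (q - a) * H₁ q = H q - H a := sub_smul_dslope H a q
    have h3 : (b - a) * H₁ b = H b - H a := sub_smul_dslope H a b
    have h4 : H₁ q = (H q - H a) / (q - a) := by rw [eq_div_iff hqa', ← h2]; ring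
    have h5 : H₁ b = (H b - H a) / (b - a) := by rw [eq_div_iff hba', ← h3]; ring
    have h6 : E q = (H₁ q - H₁ b) / (q - b) := by rw [eq_div_iff hqb', ← h1]; ring
    rw [h6, h4, h5, remainder, residue, residue, hda', hdb', e3, hH]
    dsimp only
    generalize numer t q = x at *
    generalize numer t a = y at *
    generalize numer t b = z at *
    generalize F a = fa at *
    generalize F b = fb at *
    generalize F q = fq at *
    have k1 : b - a = -(a - b) := by ring
    have k2 : a - q = -(q - a) := by ring
    have k3 : b - q = -(q - b) := by ring
    rw [k1, k2, k3]
    have k4 : q - b = (q - a) + (a - b) := by ring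
    rw [k4] at hqb' ⊢
    generalize q - a = u at *
    generalize a - b = v at *
    field_simp
    ring
  have hps : HasFPowerSeriesAt E (cauchyPowerSeries E 0 r) 0 := by
    have := (DifferentiableOn.hasFPowerSeriesOnBall (R := ⟨r, hr0.le⟩) (hEd.mono hVr) hr0)
    exact this.hasFPowerSeriesAt
  set c : ℕ → ℂ := fun n =>
    (gCount t n : ℂ) - residue t a * (a⁻¹) ^ (n + 1) - residue t b * (b⁻¹) ^ (n + 1) with hc
  have hps' : HasFPowerSeriesAt E (FormalMultilinearSeries.ofScalars ℂ c) 0 := by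
    rw [hasFPowerSeriesAt_iff]
    -- Inside 1/4 the combinatorial series converges and equals the quotient; inside |a| and |b| the
    -- principal parts are geometric series. Uniqueness of power series at 0 does the rest.
    have hev : ∀ᶠ z : ℂ in nhds 0, ‖z‖ < min (1 / 4) (min r (min ‖a‖ ‖b‖)) := by
      have : (0 : ℝ) < min (1 / 4) (min r (min ‖a‖ ‖b‖)) := by
        simp [hr0, ha0, hb0]
      filter_upwards [Metric.ball_mem_nhds (0 : ℂ) this] with z hz
      simpa using hz
    filter_upwards [hev] with z hz
    simp only [lt_min_iff] at hz
    obtain ⟨hz4, hzr, hza, hzb⟩ := hz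
    have hza' : z ≠ a := fun h => by rw [h] at hza; exact lt_irrefl _ hza
    have hzb' : z ≠ b := fun h => by rw [h] at hzb; exact lt_irrefl _ hzb
    have hDz : denom t z ≠ 0 := by
      rw [e3]
      exact mul_ne_zero (mul_ne_zero (sub_ne_zero.2 hza') (sub_ne_zero.2 hzb')) (hne z hzr.le)
    rw [zero_add, hErem z hzr.le hza' hzb', remainder]
    have hg := (summable_forestSeries ht 1 hz4.le).hasSum
    have hg2 : forestSeries t 1 z = numer t z / denom t z := by
      rw [eq_div_iff hDz, mul_comm]
      exact ladderSeries_mul_forestSeries ht 1 hz4.le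
    rw [← forestSeries, hg2] at hg
    have := (hg.sub (hasSum_pole (R := residue t a) ha0 hza)).sub
      (hasSum_pole (R := residue t b) hb0 hzb)
    convert this using 2 with n
    simp only [FormalMultilinearSeries.coeff_ofScalars, hc, gCount_eq_forestCount, smul_eq_mul]
    ring
  have hcoef : c n = (cauchyPowerSeries E 0 r).coeff n := by
    rw [hps.eq_formalMultilinearSeries hps', FormalMultilinearSeries.coeff_ofScalars]
  have hle := norm_cauchyPowerSeries_le E 0 r n
  rw [FormalMultilinearSeries.norm_apply_eq_norm_coef, ← hcoef, abs_of_pos hr0] at hle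
  have hint : ∫ θ in (0 : ℝ)..2 * Real.pi, ‖E (circleMap 0 r θ)‖ =
      ∫ θ in (0 : ℝ)..2 * Real.pi, ‖remainder t a b (circleMap 0 r θ)‖ := by
    refine intervalIntegral.integral_congr fun θ _ => ?_
    have hθ : ‖circleMap 0 r θ‖ = r := by rw [norm_circleMap_zero, abs_of_pos hr0]
    rw [hErem _ hθ.le (fun h => by rw [h] at hθ; exact har.ne hθ)
      (fun h => by rw [h] at hθ; exact hbr.ne hθ)]
  rw [hint] at hle
  exact hle

/-! ### Complex ball arithmetic in fixed point. -/

/-- A complex ball in fixed-point arithmetic with `p` fractional bits, together with a bound for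
the absolute values of its points. -/
structure CBall (p : ℕ) where
  re : ℤ
  im : ℤ
  err : ℕ
  mag : ℕ

namespace CBall

variable {p : ℕ}

/-- The point `z` belongs to the ball and obeys its magnitude bound. -/
def Mem (z : ℂ) (b : CBall p) : Prop :=
  ‖z * 2 ^ p - (⟨b.re, b.im⟩ : ℂ)‖ ≤ b.err ∧ ‖z‖ * 2 ^ p ≤ b.mag

instance : One (CBall p) := ⟨⟨2 ^ p, 0, 0, 2 ^ p⟩⟩

instance : Sub (CBall p) :=
  ⟨fun x y => ⟨x.re - y.re, x.im - y.im, x.err + y.err, x.mag + y.mag⟩⟩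

/-- The error uses zw - c_x c_y = z(w-c_y) + (z-c_x)c_y with |c_y| ≤ mag + err. Of the added 3, two
units pay for truncating the real and imaginary parts and one for truncating the error itself. -/
instance : Mul (CBall p) :=
  ⟨fun x y => ⟨(x.re * y.re - x.im * y.im) >>> p, (x.re * y.im + x.im * y.re) >>> p,
    ((x.mag * y.err + x.err * (y.mag + y.err)) >>> p) + 3, ((x.mag * y.mag) >>> p) + 1⟩⟩

theorem mem_one : Mem 1 (1 : CBall p) := by
  constructor
  · have : (1 : ℂ) * 2 ^ p - (⟨((1 : CBall p).re : ℝ), ((1 : CBall p).im : ℝ)⟩ : ℂ) = 0 := by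
      have h1 : (1 : CBall p).re = 2 ^ p := rfl
      have h2 : (1 : CBall p).im = 0 := rfl
      rw [h1, h2]
      apply Complex.ext
      · simp [← Complex.ofReal_ofNat, ← Complex.ofReal_pow]
      · simp [← Complex.ofReal_ofNat, ← Complex.ofReal_pow]
    rw [this, norm_zero]
    positivity
  · have : (1 : CBall p).mag = 2 ^ p := rfl
    rw [this]
    simp

theorem Mem.sub {z w : ℂ} {x y : CBall p} (hz : Mem z x) (hw : Mem w y) : Mem (z - w) (x - y) := by
  have h1 : (x - y).re = x.re - y.re := rfl
  have h2 : (x - y).im = x.im - y.im := rfl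
  have h3 : (x - y).err = x.err + y.err := rfl
  have h4 : (x - y).mag = x.mag + y.mag := rfl
  constructor
  · rw [h1, h2, h3]
    have : (z - w) * 2 ^ p - (⟨((x.re - y.re : ℤ) : ℝ), ((x.im - y.im : ℤ) : ℝ)⟩ : ℂ) =
        (z * 2 ^ p - (⟨x.re, x.im⟩ : ℂ)) - (w * 2 ^ p - (⟨y.re, y.im⟩ : ℂ)) := by
      apply Complex.ext <;> simp <;> ring
    rw [this]
    push_cast
    exact (norm_sub_le _ _).trans (add_le_add hz.1 hw.1)
  · rw [h4]
    push_cast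
    have := norm_sub_le z w
    nlinarith [hz.2, hw.2, (by positivity : (0 : ℝ) < 2 ^ p)]

theorem shiftRight_sub_div (a : ℤ) (p : ℕ) :
    |(a : ℝ) / 2 ^ p - ((a >>> p : ℤ) : ℝ)| ≤ 1 := by
  rw [Int.shiftRight_eq_div_pow]
  have h2 : (0 : ℤ) < 2 ^ p := by positivity
  have h1 := Int.ediv_mul_add_emod a (2 ^ p)
  have h3 := Int.emod_nonneg a h2.ne'
  have h4 := Int.emod_lt_of_pos a h2
  have hp : (0 : ℝ) < 2 ^ p := by positivity
  push_cast
  have e : (a : ℝ) / 2 ^ p - ((a / 2 ^ p : ℤ) : ℝ) = ((a % 2 ^ p : ℤ) : ℝ) / 2 ^ p := by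
    rw [div_sub' hp.ne', div_left_inj' hp.ne']
    have : (a : ℝ) = ((a / 2 ^ p : ℤ) : ℝ) * 2 ^ p + ((a % 2 ^ p : ℤ) : ℝ) := by exact_mod_cast h1.symm
    linarith
  rw [e, abs_of_nonneg (by positivity), div_le_one hp]
  exact_mod_cast h4.le

theorem le_shiftRight_add_one (a p : ℕ) : (a : ℝ) / 2 ^ p ≤ ((a >>> p : ℕ) : ℝ) + 1 := by
  rw [Nat.shiftRight_eq_div_pow]
  have := (Nat.lt_floor_add_one ((a : ℝ) / ((2 ^ p : ℕ) : ℝ))).le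
  rw [Nat.floor_div_natCast, Nat.floor_natCast] at this
  exact_mod_cast this

theorem Mem.mul {z w : ℂ} {x y : CBall p} (hz : Mem z x) (hw : Mem w y) : Mem (z * w) (x * y) := by
  have h1 : (x * y).re = (x.re * y.re - x.im * y.im) >>> p := rfl
  have h2 : (x * y).im = (x.re * y.im + x.im * y.re) >>> p := rfl
  have h3 : (x * y).err = ((x.mag * y.err + x.err * (y.mag + y.err)) >>> p) + 3 := rfl
  have h4 : (x * y).mag = ((x.mag * y.mag) >>> p) + 1 := rfl
  have hp : (0 : ℝ) < 2 ^ p := by positivity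
  constructor
  · rw [h1, h2, h3]
    set cx : ℂ := ⟨x.re, x.im⟩ with hcx
    set cy : ℂ := ⟨y.re, y.im⟩ with hcy
    have hcyn : ‖cy‖ ≤ y.mag + y.err := by
      have := norm_sub_le (w * 2 ^ p) (w * 2 ^ p - cy)
      rw [sub_sub_cancel] at this
      refine this.trans (add_le_add ?_ hw.1)
      rw [norm_mul, norm_pow, Complex.norm_ofNat]
      exact hw.2
    set ce : ℂ := ⟨((x.re * y.re - x.im * y.im : ℤ) : ℝ) / 2 ^ p -
        (((x.re * y.re - x.im * y.im) >>> p : ℤ) : ℝ),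
      ((x.re * y.im + x.im * y.re : ℤ) : ℝ) / 2 ^ p -
        (((x.re * y.im + x.im * y.re) >>> p : ℤ) : ℝ)⟩ with hce
    have hcen : ‖ce‖ ≤ 2 := by
      refine (Complex.norm_le_abs_re_add_abs_im ce).trans ?_
      have a1 := shiftRight_sub_div (x.re * y.re - x.im * y.im) p
      have a2 := shiftRight_sub_div (x.re * y.im + x.im * y.re) p
      rw [hce]
      dsimp only
      linarith
    have key : z * w * 2 ^ p - (⟨(((x.re * y.re - x.im * y.im) >>> p : ℤ) : ℝ),
        (((x.re * y.im + x.im * y.re) >>> p : ℤ) : ℝ)⟩ : ℂ) =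
        (z * 2 ^ p * (w * 2 ^ p - cy) + (z * 2 ^ p - cx) * cy) / 2 ^ p + ce := by
      have : ce = cx * cy / ((2 ^ p : ℝ) : ℂ) - (⟨(((x.re * y.re - x.im * y.im) >>> p : ℤ) : ℝ),
        (((x.re * y.im + x.im * y.re) >>> p : ℤ) : ℝ)⟩ : ℂ) := by
        apply Complex.ext
        · rw [Complex.sub_re, Complex.div_ofReal_re]
          simp [hce, hcx, hcy]
        · rw [Complex.sub_im, Complex.div_ofReal_im]
          simp [hce, hcx, hcy]
      rw [this]
      push_cast
      field_simp
      ring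
    rw [key]
    refine (norm_add_le _ _).trans ?_
    rw [norm_div, norm_pow, Complex.norm_ofNat]
    have hb : ‖z * 2 ^ p * (w * 2 ^ p - cy) + (z * 2 ^ p - cx) * cy‖ ≤
        ((x.mag * y.err + x.err * (y.mag + y.err) : ℕ) : ℝ) := by
      refine (norm_add_le _ _).trans ?_
      rw [norm_mul, norm_mul, norm_mul, norm_pow, Complex.norm_ofNat]
      push_cast
      exact add_le_add (mul_le_mul hz.2 hw.1 (norm_nonneg _) (by positivity))
        (mul_le_mul hz.1 hcyn (norm_nonneg _) (by positivity))
    have h5 := le_shiftRight_add_one (x.mag * y.err + x.err * (y.mag + y.err)) p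
    have h6 : _ / (2 : ℝ) ^ p ≤ _ / 2 ^ p := div_le_div_of_nonneg_right hb hp.le
    rw [Nat.cast_add, Nat.cast_ofNat]
    linarith
  · rw [h4]
    have h5 := le_shiftRight_add_one (x.mag * y.mag) p
    rw [Nat.cast_add, Nat.cast_one]
    refine le_trans ?_ h5
    rw [le_div_iff₀ hp, norm_mul]
    push_cast
    calc ‖z‖ * ‖w‖ * 2 ^ p * 2 ^ p = (‖z‖ * 2 ^ p) * (‖w‖ * 2 ^ p) := by ring
      _ ≤ _ := mul_le_mul hz.2 hw.2 (by positivity) (by positivity)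

end CBall

/-! ### Generic evaluation of numerator and denominator by ring operations. -/

/-- A relation between codes and functions that is compatible with the ring operations. -/
structure IsSound {α : Type*} [One α] [Sub α] [Mul α] (R : (ℂ → ℂ) → α → Prop) : Prop where
  one : R (fun _ => 1) 1
  sub : ∀ {f g a b}, R f a → R g b → R (fun q => f q - g q) (a - b)
  mul : ∀ {f g a b}, R f a → R g b → R (fun q => f q * g q) (a * b)

/-- Binary powering; `n ≤ 2 ^ fuel` is not needed as an exhausted fuel falls back on iteration. -/
def fastPow {α : Type*} [One α] [Mul α] (x : α) : ℕ → ℕ → α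
  | 0, n => n.rec 1 fun _ y => y * x
  | fuel + 1, n =>
    match n with
    | 0 => 1
    | 1 => x
    | n + 2 =>
      let y := fastPow x fuel ((n + 2) / 2)
      if (n + 2) % 2 = 0 then y * y else y * y * x

/-- Evaluation of the numerator and denominator cleared of the factors `1 - q ^ [i]`. -/
def ladderEval {α : Type*} [One α] [Sub α] [Mul α] (t : ℕ) (Q TX TV : α) : ℕ → α → α × α × α
  -- `TV` encloses q^[J] minus the tail series of the numerator, not the series itself, because the
  -- difference is small and fits into a ball around zero.
  | 0, P => (TX, P - TV, 1)
  | n + 1, P =>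
    -- This is q^[j+1] = q (q^[j])^t. Fuel 7 reduces exponents below 2^8 to at most 1, so squaring
    -- suffices for every t ≤ 39 evaluated here.
    let P' := Q * fastPow P 7 t
    let s := ladderEval t Q TX TV n P'
    let c := (1 - P') * s.2.2
    (c - P' * s.1, P * c - P' * s.2.1, c)

theorem IsSound.fastPow {α : Type*} [One α] [Sub α] [Mul α] {R : (ℂ → ℂ) → α → Prop}
    (hR : IsSound R) {f : ℂ → ℂ} {x : α} (hx : R f x) (fuel n : ℕ) :
    R (fun q => f q ^ n) (_root_.fastPow x fuel n) := by
  induction fuel generalizing n with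
  | zero =>
    induction n with
    | zero => simpa [_root_.fastPow] using hR.one
    | succ n ih =>
      have := hR.mul ih hx
      simp only [← pow_succ] at this
      exact this
  | succ fuel ih =>
    match n with
    | 0 => simpa [_root_.fastPow] using hR.one
    | 1 => simpa [_root_.fastPow] using hx
    | n + 2 =>
      rw [_root_.fastPow]
      have h1 := ih ((n + 2) / 2)
      split_ifs with h
      · have h2 := hR.mul h1 h1
        simp only [← pow_add] at h2
        rwa [show (n + 2) / 2 + (n + 2) / 2 = n + 2 by omega] at h2
      · have h2 := hR.mul (hR.mul h1 h1) hx
        simp only [← pow_add, ← pow_succ] at h2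
        rwa [show (n + 2) / 2 + (n + 2) / 2 + 1 = n + 2 by omega] at h2

/-- The product of the factors `1 - q ^ [i]` for `j < i ≤ j + n`. -/
noncomputable def clearing (t j n : ℕ) (q : ℂ) : ℂ :=
  ∏ i ∈ Finset.range n, (1 - q ^ repunit t (j + i + 1))

theorem clearing_zero (t j : ℕ) (q : ℂ) : clearing t j 0 q = 1 := rfl

theorem clearing_succ (t j n : ℕ) (q : ℂ) :
    clearing t j (n + 1) q = (1 - q ^ repunit t (j + 1)) * clearing t (j + 1) n q := by
  rw [clearing, Finset.prod_range_succ', clearing, mul_comm]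
  congr 1
  refine Finset.prod_congr rfl fun i _ => ?_
  rw [show j + (i + 1) + 1 = j + 1 + i + 1 by ring]

/-- Multiplying the recursion in j by the missing factors removes every division, so that any
relation sound for 1, subtraction and multiplication can be propagated through it. -/
theorem clearing_mul_ladderSeries {t : ℕ} (ht : 2 ≤ t) (k j n : ℕ) {q : ℂ} (hq : ‖q‖ < 1) :
    clearing t j (n + 1) q * ladderSeries t k j q =
      q ^ (k * repunit t j) * clearing t j (n + 1) q -
        q ^ repunit t (j + 1) * (clearing t (j + 1) n q * ladderSeries t k (j + 1) q) := by
  rw [ladderSeries_eq ht k j hq, clearing_succ, ladder]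
  have := one_sub_pow_ne_zero hq (repunit_succ_ne_zero t j)
  field_simp

theorem IsSound.pow_repunit_succ {α : Type*} [One α] [Sub α] [Mul α] {R : (ℂ → ℂ) → α → Prop}
    (hR : IsSound R) {t : ℕ} {Q : α} (hQ : R (fun q => q) Q) {j : ℕ} {P : α}
    (hP : R (fun q => q ^ repunit t j) P) :
    R (fun q => q ^ repunit t (j + 1)) (Q * _root_.fastPow P 7 t) := by
  have := hR.mul hQ (hR.fastPow hP 7 t)
  simp only [← pow_mul, ← pow_succ'] at this
  rwa [show repunit t j * t + 1 = repunit t (j + 1) by rw [repunit_succ]; ring] at this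

/-- Soundness of `ladderEval`; the relation has to be invariant under changing the functions
outside the open unit disc. -/
theorem IsSound.ladderEval {α : Type*} [One α] [Sub α] [Mul α] {R : (ℂ → ℂ) → α → Prop}
    (hR : IsSound R) (hloc : ∀ {f g a}, R f a → (∀ q : ℂ, ‖q‖ < 1 → f q = g q) → R g a)
    {t : ℕ} (ht : 2 ≤ t) {Q TX TV : α} (hQ : R (fun q => q) Q) (n j : ℕ) {P : α}
    (hP : R (fun q => q ^ repunit t j) P) (hTX : R (ladderSeries t 0 (j + n)) TX)
    (hTV : R (fun q => q ^ repunit t (j + n) - ladderSeries t 1 (j + n) q) TV) :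
    R (fun q => clearing t j n q * ladderSeries t 0 j q) (_root_.ladderEval t Q TX TV n P).1 ∧
    R (fun q => clearing t j n q * ladderSeries t 1 j q) (_root_.ladderEval t Q TX TV n P).2.1 ∧
    R (clearing t j n) (_root_.ladderEval t Q TX TV n P).2.2 := by
  induction n generalizing j P with
  | zero =>
    simp only [_root_.ladderEval, clearing_zero, one_mul]
    refine ⟨hTX, ?_, hR.one⟩
    refine hloc (hR.sub hP hTV) fun q _ => ?_
    simp
  | succ n ih =>
    have hP' := hR.pow_repunit_succ (t := t) hQ hP
    have e : j + 1 + n = j + (n + 1) := by ring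
    obtain ⟨i1, i2, i3⟩ := ih (j + 1) hP' (by rwa [e]) (by rwa [e])
    have hc := hR.mul (hR.sub hR.one hP') i3
    simp only [_root_.ladderEval]
    refine ⟨?_, ?_, ?_⟩
    · refine hloc (hR.sub hc (hR.mul hP' i1)) fun q hq => ?_
      rw [clearing_mul_ladderSeries ht 0 j n hq, clearing_succ]
      simp
    · refine hloc (hR.sub (hR.mul hP hc) (hR.mul hP' i2)) fun q hq => ?_
      rw [clearing_mul_ladderSeries ht 1 j n hq, clearing_succ, one_mul]
    · refine hloc hc fun q _ => ?_
      rw [clearing_succ]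

/-! ### Certified covering of a half-angle parametrised circle. -/

namespace CBall

/-- A ball for the arc `u ∈ [k / 2 ^ d, (k + 1) / 2 ^ d]` of `s (num / den) (1 + i u) / (1 - i u)`. -/
def arc (p num den : ℕ) (s : ℤ) (d k : ℕ) : CBall p :=
  -- The ball is centred at the point with the midpoint n/m of the parameter interval. Half the
  -- length is 2^{-d-1} and the parametrisation has Lipschitz constant at most 2, whence the error
  -- 2^{p-d}; the 2 covers rounding of the two coordinates.
  let n : ℕ := 2 * k + 1
  let m : ℕ := 2 ^ (d + 1)
  let D : ℤ := (den * (m * m + n * n) : ℕ)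
  ⟨s * ((num * 2 ^ p : ℕ) * (((m * m : ℕ) : ℤ) - (n * n : ℕ))) / D,
    s * (num * 2 ^ p * (2 * n * m) : ℕ) / D, 2 ^ (p - d) + 2, num * 2 ^ p / den + 1⟩

/-- The product of `x` with the conjugate of `y`, with an error bound from the centers. -/
def mulConj {p : ℕ} (x y : CBall p) : ℤ × ℤ × ℕ :=
  (x.re * y.re + x.im * y.im, x.im * y.re - x.re * y.im,
    (y.re.natAbs + y.im.natAbs) * x.err + (x.re.natAbs + x.im.natAbs + x.err) * y.err)

/-- The certified test on one arc; it returns a bound for `1024 |N / D|`. -/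
def arcTest {p : ℕ} (t J : ℕ) (A B TX TV Q : CBall p) : Option ℕ :=
  let s := ladderEval t Q TX TV J 1
  let z := mulConj s.1 ((Q - A) * (Q - B))
  -- A lower bound for the cleared denominator; truncated subtraction makes it 0 when the ball is
  -- too large, and the last condition of the test then fails.
  let m := max s.1.re.natAbs s.1.im.natAbs - s.1.err
  if (decide ((z.2.2 : ℤ) < z.1) || Nat.blt z.2.2 z.2.1.natAbs) && Nat.blt s.1.err (10 * m) then
    some ((s.2.1.re.natAbs + s.2.1.im.natAbs + s.2.1.err) * 1024 / m + 1)
  else none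

/-- Bisection along the binary tree whose preorder is given by the bits of the last argument,
with one bits at the inner nodes; the unread bits are returned. -/
def cover {p : ℕ} (t J num den : ℕ) (A B TX TV : CBall p) (s : ℤ) :
    ℕ → ℕ → ℕ → ℕ → Option (ℕ × ℕ)
  | 0, _, _, _ => none
  | fuel + 1, d, k, N =>
    match N % 2 with
    | 0 =>
      match arcTest t J A B TX TV (arc p num den s d k) with
      -- The weight 2^{-d} of the arc is scaled by 2^30 to stay integral. Since the angle is 2
      -- arctan u, an arc is no longer than 2·2^{-d}, so a total S stands for the integral bound
      -- S/(512·2^30).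
      | some b => some (b * 2 ^ (30 - d), N / 2)
      | none => none
    | _ + 1 =>
      match cover t J num den A B TX TV s fuel (d + 1) (2 * k) (N / 2) with
      | none => none
      | some x =>
        match cover t J num den A B TX TV s fuel (d + 1) (2 * k + 1) x.2 with
        | none => none
        | some y => some (x.1 + y.1, y.2)

end CBall

namespace CBall

variable {p : ℕ}

theorem isSound_mem (p : ℕ) (q : ℂ) : IsSound fun f (a : CBall p) => Mem (f q) a :=
  ⟨mem_one, Mem.sub, Mem.mul⟩

theorem intDiv_sub_le (a : ℤ) {b : ℤ} (hb : 0 < b) : |(a : ℝ) / b - ((a / b : ℤ) : ℝ)| ≤ 1 := by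
  have h1 := Int.ediv_mul_add_emod a b
  have h3 := Int.emod_nonneg a hb.ne'
  have h4 := Int.emod_lt_of_pos a hb
  have hp : (0 : ℝ) < b := by exact_mod_cast hb
  have e : (a : ℝ) / b - ((a / b : ℤ) : ℝ) = ((a % b : ℤ) : ℝ) / b := by
    rw [div_sub' hp.ne', div_left_inj' hp.ne']
    have : (a : ℝ) = ((a / b : ℤ) : ℝ) * b + ((a % b : ℤ) : ℝ) := by exact_mod_cast h1.symm
    linarith
  rw [e, abs_of_nonneg (div_nonneg (by exact_mod_cast h3) hp.le), div_le_one hp]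
  exact_mod_cast h4.le

theorem natDiv_add_one_ge (a b : ℕ) : (a : ℝ) / b ≤ ((a / b : ℕ) : ℝ) + 1 := by
  have := (Nat.lt_floor_add_one ((a : ℝ) / (b : ℝ))).le
  rwa [Nat.floor_div_natCast, Nat.floor_natCast] at this

/-- The point of the circle of radius `r` with half-angle tangent `u`, or its antipode. -/
noncomputable def circlePoint (r : ℝ) (s : ℤ) (u : ℝ) : ℂ :=
  s * (r * ((1 + u * Complex.I) / (1 - u * Complex.I)))

theorem norm_one_sub_mul_I (u : ℝ) : 1 ≤ ‖1 - u * Complex.I‖ := by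
  have := Complex.abs_re_le_norm (1 - u * Complex.I)
  simpa using this

theorem one_sub_mul_I_ne_zero (u : ℝ) : 1 - u * Complex.I ≠ 0 := fun h => by
  have := norm_one_sub_mul_I u
  rw [h, norm_zero] at this
  linarith

theorem norm_one_add_div (u : ℝ) : ‖(1 + u * Complex.I) / (1 - u * Complex.I)‖ = 1 := by
  have h : 1 + u * Complex.I = starRingEnd ℂ (1 - u * Complex.I) := by simp
  rw [norm_div, h, RCLike.norm_conj, div_self (norm_ne_zero_iff.2 (one_sub_mul_I_ne_zero u))]

theorem norm_circlePoint {r : ℝ} (hr : 0 ≤ r) {s : ℤ} (hs : s = 1 ∨ s = -1) (u : ℝ) :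
    ‖circlePoint r s u‖ = r := by
  rw [circlePoint, norm_mul, norm_mul, norm_one_add_div, Complex.norm_real, Real.norm_of_nonneg hr]
  rcases hs with rfl | rfl <;> simp

/-- The two Möbius images differ by 2i(u-v)/((1-iu)(1-iv)), and both denominators have modulus at
least 1. -/
theorem norm_circlePoint_sub_le {r : ℝ} (hr : 0 ≤ r) {s : ℤ} (hs : s = 1 ∨ s = -1) (u v : ℝ) :
    ‖circlePoint r s u - circlePoint r s v‖ ≤ 2 * r * |u - v| := by
  have h1 := one_sub_mul_I_ne_zero u
  have h2 := one_sub_mul_I_ne_zero v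
  have e : circlePoint r s u - circlePoint r s v = s * (r * (2 * ((u - v : ℝ) : ℂ) * Complex.I /
      ((1 - u * Complex.I) * (1 - v * Complex.I)))) := by
    rw [circlePoint, circlePoint, ← mul_sub, ← mul_sub]
    congr 2
    rw [div_sub_div _ _ h1 h2]
    congr 1
    push_cast
    ring
  rw [e, norm_mul, norm_mul, norm_div, norm_mul, norm_mul, norm_mul, Complex.norm_real,
    Complex.norm_real, Complex.norm_I, Complex.norm_ofNat, Real.norm_of_nonneg hr, Real.norm_eq_abs]
  have h3 : ‖(s : ℂ)‖ = 1 := by rcases hs with rfl | rfl <;> simp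
  have h4 := norm_one_sub_mul_I u
  have h5 := norm_one_sub_mul_I v
  have h6 : 1 ≤ ‖1 - u * Complex.I‖ * ‖1 - v * Complex.I‖ := by nlinarith
  rw [h3, one_mul, mul_one]
  have h7 : 2 * |u - v| / (‖1 - u * Complex.I‖ * ‖1 - v * Complex.I‖) ≤ 2 * |u - v| :=
    div_le_self (by positivity) h6
  calc _ ≤ r * (2 * |u - v|) := mul_le_mul_of_nonneg_left h7 hr
    _ = _ := by ring

theorem mem_arc {num den : ℕ} (hd : 0 < den) (hnd : num ≤ den) {s : ℤ} (hs : s = 1 ∨ s = -1)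
    {d k : ℕ} {u : ℝ} (h1 : (k : ℝ) / 2 ^ d ≤ u) (h2 : u ≤ ((k + 1 : ℕ) : ℝ) / 2 ^ d) :
    Mem (circlePoint ((num : ℝ) / den) s u) (arc p num den s d k) := by
  have hden : (0 : ℝ) < den := by exact_mod_cast hd
  have hr0 : (0 : ℝ) ≤ (num : ℝ) / den := by positivity
  have hr1 : (num : ℝ) / den ≤ 1 := (div_le_one hden).2 (by exact_mod_cast hnd)
  have hp : (0 : ℝ) < 2 ^ p := by positivity
  constructor
  · set n : ℕ := 2 * k + 1 with hn
    set m : ℕ := 2 ^ (d + 1) with hm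
    have hm0 : (0 : ℝ) < m := by rw [hm]; positivity
    set D : ℤ := ((den * (m * m + n * n) : ℕ) : ℤ) with hD
    have hDpos : 0 < D := by
      have : 0 < den * (m * m + n * n) := by
        have : 0 < m := by rw [hm]; positivity
        positivity
      rw [hD]
      exact_mod_cast this
    have hDpos' : (0 : ℝ) < D := by exact_mod_cast hDpos
    set a : ℤ := s * (((num * 2 ^ p : ℕ) : ℤ) * (((m * m : ℕ) : ℤ) - (n * n : ℕ))) with ha
    set b : ℤ := s * ((num * 2 ^ p * (2 * n * m) : ℕ) : ℤ) with hb
    have hre : (arc p num den s d k).re = a / D := rfl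
    have him : (arc p num den s d k).im = b / D := rfl
    have herr : (arc p num den s d k).err = 2 ^ (p - d) + 2 := rfl
    rw [hre, him, herr]
    set u₀ : ℝ := (n : ℝ) / m with hu₀
    have hmid : |u - u₀| ≤ 1 / 2 ^ (d + 1) := by
      have e1 : (k : ℝ) / 2 ^ d = u₀ - 1 / 2 ^ (d + 1) := by
        rw [hu₀, hn, hm, pow_succ]; push_cast; field_simp; ring
      have e2 : ((k + 1 : ℕ) : ℝ) / 2 ^ d = u₀ + 1 / 2 ^ (d + 1) := by
        rw [hu₀, hn, hm, pow_succ]; push_cast; field_simp; ring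
      rw [abs_le]
      constructor <;> linarith
    have hq0 : circlePoint ((num : ℝ) / den) s u₀ * 2 ^ p = (⟨(a : ℝ) / D, (b : ℝ) / D⟩ : ℂ) := by
      have hz : (1 + u₀ * Complex.I) / (1 - u₀ * Complex.I) =
          (⟨((m : ℝ) * m - n * n) / (m * m + n * n), 2 * n * m / (m * m + n * n)⟩ : ℂ) := by
        rw [div_eq_iff (one_sub_mul_I_ne_zero u₀)]
        have : (0 : ℝ) < m * m + n * n := by positivity
        apply Complex.ext
        · simp [hu₀]; field_simp; ring
        · simp [hu₀]; field_simp; ring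
      rw [circlePoint, hz]
      have h2p : (2 : ℂ) ^ p = ((2 ^ p : ℝ) : ℂ) := by push_cast; rfl
      have hsc : (s : ℂ) = ((s : ℝ) : ℂ) := by push_cast; rfl
      have hpos : (0 : ℝ) < m * m + n * n := by positivity
      rw [h2p, hsc]
      apply Complex.ext
      · rw [Complex.re_mul_ofReal, Complex.re_ofReal_mul, Complex.re_ofReal_mul, ha, hD]
        push_cast
        field_simp
      · rw [Complex.im_mul_ofReal, Complex.im_ofReal_mul, Complex.im_ofReal_mul, hb, hD]
        push_cast
        field_simp
    have hround : ‖(⟨(a : ℝ) / D, (b : ℝ) / D⟩ : ℂ) -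
        (⟨((a / D : ℤ) : ℝ), ((b / D : ℤ) : ℝ)⟩ : ℂ)‖ ≤ 2 := by
      refine (Complex.norm_le_abs_re_add_abs_im _).trans ?_
      have a1 := intDiv_sub_le a hDpos
      have a2 := intDiv_sub_le b hDpos
      simp only [Complex.sub_re, Complex.sub_im]
      linarith
    have hmove : ‖(circlePoint ((num : ℝ) / den) s u - circlePoint ((num : ℝ) / den) s u₀) *
        2 ^ p‖ ≤ ((2 ^ (p - d) : ℕ) : ℝ) := by
      rw [norm_mul, norm_pow, Complex.norm_ofNat]
      have h3 := norm_circlePoint_sub_le hr0 hs u u₀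
      have h4 : 2 * ((num : ℝ) / den) * |u - u₀| ≤ 2 * 1 * (1 / 2 ^ (d + 1)) := by gcongr
      have h5 : (2 : ℝ) ^ p ≤ 2 ^ (p - d) * 2 ^ d := by
        rw [← pow_add]
        exact pow_le_pow_right₀ (by norm_num) (by omega)
      have h6 : (2 : ℝ) * 1 * (1 / 2 ^ (d + 1)) * (2 ^ (p - d) * 2 ^ d) = 2 ^ (p - d) := by
        rw [pow_succ]; field_simp
      rw [Nat.cast_pow, Nat.cast_ofNat, ← h6]
      exact mul_le_mul (h3.trans h4) h5 hp.le (by positivity)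
    have e : circlePoint ((num : ℝ) / den) s u * 2 ^ p -
        (⟨((a / D : ℤ) : ℝ), ((b / D : ℤ) : ℝ)⟩ : ℂ) =
        (circlePoint ((num : ℝ) / den) s u - circlePoint ((num : ℝ) / den) s u₀) * 2 ^ p +
        ((⟨(a : ℝ) / D, (b : ℝ) / D⟩ : ℂ) - (⟨((a / D : ℤ) : ℝ), ((b / D : ℤ) : ℝ)⟩ : ℂ)) := by
      rw [← hq0]; ring
    rw [e, Nat.cast_add, Nat.cast_ofNat]
    exact (norm_add_le _ _).trans (add_le_add hmove hround)
  · rw [norm_circlePoint hr0 hs]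
    have hmag : (arc p num den s d k).mag = num * 2 ^ p / den + 1 := rfl
    rw [hmag]
    have := natDiv_add_one_ge (num * 2 ^ p) den
    push_cast at this ⊢
    calc (num : ℝ) / den * 2 ^ p = num * 2 ^ p / den := by ring
      _ ≤ _ := this

/-- The error is c̄_y(z-c_x) + z·conj(w-c_y) in scaled quantities; moduli of centres are bounded by
sums of absolute coordinates to avoid square roots. -/
theorem mem_mulConj {z w : ℂ} {x y : CBall p} (hz : Mem z x) (hw : Mem w y) :
    ‖z * 2 ^ p * starRingEnd ℂ (w * 2 ^ p) - (⟨(mulConj x y).1, (mulConj x y).2.1⟩ : ℂ)‖ ≤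
      (mulConj x y).2.2 := by
  set cx : ℂ := ⟨x.re, x.im⟩ with hcx
  set cy : ℂ := ⟨y.re, y.im⟩ with hcy
  have h1 : (⟨((mulConj x y).1 : ℝ), ((mulConj x y).2.1 : ℝ)⟩ : ℂ) = cx * starRingEnd ℂ cy := by
    apply Complex.ext
    · simp [mulConj, hcx, hcy]
    · simp [mulConj, hcx, hcy]; ring
  have h2 : ((mulConj x y).2.2 : ℝ) = (|(y.re : ℝ)| + |(y.im : ℝ)|) * x.err +
      (|(x.re : ℝ)| + |(x.im : ℝ)| + x.err) * y.err := by
    simp [mulConj, Nat.cast_natAbs]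
  rw [h1, h2]
  have e : z * 2 ^ p * starRingEnd ℂ (w * 2 ^ p) - cx * starRingEnd ℂ cy =
      starRingEnd ℂ cy * (z * 2 ^ p - cx) + (cx + (z * 2 ^ p - cx)) *
        starRingEnd ℂ (w * 2 ^ p - cy) := by
    rw [map_sub]; ring
  rw [e]
  refine (norm_add_le _ _).trans ?_
  rw [norm_mul, norm_mul, RCLike.norm_conj, RCLike.norm_conj]
  have hx := Complex.norm_le_abs_re_add_abs_im cx
  have hy := Complex.norm_le_abs_re_add_abs_im cy
  have h3 := (norm_add_le cx (z * 2 ^ p - cx)).trans (add_le_add hx hz.1)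
  exact add_le_add (mul_le_mul hy hz.1 (norm_nonneg _) (by positivity))
    (mul_le_mul h3 hw.1 (norm_nonneg _) (by positivity))

/-- The quotient z/w is a positive multiple of z·conj(w), so it suffices that the ball for this
product lies in the right half plane or avoids the real axis. -/
theorem mem_slitPlane_of_mulConj {z w : ℂ} {x y : CBall p} (hz : Mem z x) (hw : Mem w y)
    (h : ((mulConj x y).2.2 : ℤ) < (mulConj x y).1 ∨
      (mulConj x y).2.2 < (mulConj x y).2.1.natAbs) : z / w ∈ Complex.slitPlane := by
  have hm := mem_mulConj hz hw
  set c := mulConj x y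
  set v : ℂ := z * 2 ^ p * starRingEnd ℂ (w * 2 ^ p) with hv
  have hvs : 0 < v.re ∨ v.im ≠ 0 := by
    rcases h with h | h
    · left
      have h1 := (abs_le.1 ((Complex.abs_re_le_norm _).trans hm)).1
      have h2 : ((c.2.2 : ℕ) : ℝ) < c.1 := by exact_mod_cast h
      simp only [Complex.sub_re] at h1
      linarith
    · right
      intro h0
      have h1 := (Complex.abs_im_le_norm _).trans hm
      simp only [Complex.sub_im, h0, zero_sub, abs_neg] at h1
      have h2 : ((c.2.2 : ℕ) : ℝ) < |(c.2.1 : ℝ)| := by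
        rw [← Int.cast_abs, ← Nat.cast_natAbs]
        exact_mod_cast h
      exact absurd h1 (not_le.2 h2)
  have hw0 : w ≠ 0 := by
    rintro rfl
    rw [hv] at hvs
    simp at hvs
  have e : z / w = ((((2 : ℝ) ^ p * 2 ^ p * Complex.normSq w)⁻¹ : ℝ) : ℂ) * v := by
    have h1 : (Complex.normSq w : ℂ) = w * starRingEnd ℂ w := (Complex.mul_conj w).symm
    rw [hv, map_mul, map_pow, Complex.conj_ofNat]
    push_cast
    rw [h1]
    have : starRingEnd ℂ w ≠ 0 := by simpa using hw0
    field_simp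
  have hpos : (0 : ℝ) < ((2 : ℝ) ^ p * 2 ^ p * Complex.normSq w)⁻¹ := by
    have := Complex.normSq_pos.2 hw0
    positivity
  rw [e, Complex.mem_slitPlane_iff, Complex.re_ofReal_mul, Complex.im_ofReal_mul]
  rcases hvs with h | h
  · exact Or.inl (mul_pos hpos h)
  · exact Or.inr (mul_ne_zero hpos.ne' h)

/-- The clearing factor is kept in the slit plane statement, where a holomorphic factor is allowed,
and cancels in the bound for numerator against denominator. -/
theorem arcTest_sound {t J : ℕ} (ht : 2 ≤ t) {a b q : ℂ} {A B TX TV Q : CBall p} {v : ℕ}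
    (hq1 : ‖q‖ < 1) (ha : Mem a A) (hb : Mem b B) (hQ : Mem q Q)
    (hTX : Mem (ladderSeries t 0 J q) TX)
    (hTV : Mem (q ^ repunit t J - ladderSeries t 1 J q) TV)
    (h : arcTest t J A B TX TV Q = some v) :
    clearing t 0 J q * denom t q / ((q - a) * (q - b)) ∈ Complex.slitPlane ∧
      ‖numer t q‖ ≤ v / 1024 * ‖denom t q‖ := by
  obtain ⟨s1, s2, -⟩ := (isSound_mem p q).ladderEval (α := CBall p)
    (fun {f g a} hf hfg => by rwa [← hfg q hq1]) ht hQ J 0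
    (P := 1) (by simpa [repunit_zero] using mem_one) (by simpa using hTX) (by simpa using hTV)
  set s := ladderEval t Q TX TV J 1
  have hw : Mem ((q - a) * (q - b)) ((Q - A) * (Q - B)) := (hQ.sub ha).mul (hQ.sub hb)
  simp only [arcTest] at h
  change (if _ then _ else _) = _ at h
  split_ifs at h with hc
  rw [Bool.and_eq_true, Bool.or_eq_true, decide_eq_true_eq, Nat.blt_eq, Nat.blt_eq] at hc
  refine ⟨mem_slitPlane_of_mulConj s1 hw hc.1, ?_⟩
  have hC : clearing t 0 J q ≠ 0 :=
    Finset.prod_ne_zero_iff.2 fun i _ => one_sub_pow_ne_zero hq1 (repunit_succ_ne_zero t _)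
  set m := max s.1.re.natAbs s.1.im.natAbs - s.1.err with hm
  have hp : (0 : ℝ) < 2 ^ p := by positivity
  have hmpos : 0 < m := by omega
  have hmX : (m : ℝ) ≤ ‖clearing t 0 J q * denom t q‖ * 2 ^ p := by
    have h1 := s1.1
    have h2 : (max |(s.1.re : ℝ)| |(s.1.im : ℝ)|) ≤ ‖(⟨s.1.re, s.1.im⟩ : ℂ)‖ :=
      max_le (Complex.abs_re_le_norm ⟨(s.1.re : ℝ), (s.1.im : ℝ)⟩)
        (Complex.abs_im_le_norm ⟨(s.1.re : ℝ), (s.1.im : ℝ)⟩)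
    have h3 := norm_sub_norm_le (⟨s.1.re, s.1.im⟩ : ℂ) (clearing t 0 J q * denom t q * 2 ^ p)
    rw [norm_sub_rev, norm_mul _ ((2 : ℂ) ^ p), norm_pow, Complex.norm_ofNat] at h3
    have h4 : (m : ℝ) = max |(s.1.re : ℝ)| |(s.1.im : ℝ)| - s.1.err := by
      rw [hm, Nat.cast_sub (by omega), Nat.cast_max, Nat.cast_natAbs, Nat.cast_natAbs]
      push_cast
      rfl
    change ‖clearing t 0 J q * denom t q * 2 ^ p - _‖ ≤ _ at h1
    linarith
  have hV : ‖clearing t 0 J q * numer t q‖ * 2 ^ p ≤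
      ((s.2.1.re.natAbs + s.2.1.im.natAbs + s.2.1.err : ℕ) : ℝ) := by
    have h1 := s2.1
    have h2 := Complex.norm_le_abs_re_add_abs_im (⟨s.2.1.re, s.2.1.im⟩ : ℂ)
    have h3 := norm_sub_norm_le (clearing t 0 J q * numer t q * 2 ^ p) (⟨s.2.1.re, s.2.1.im⟩ : ℂ)
    rw [norm_mul _ ((2 : ℂ) ^ p), norm_pow, Complex.norm_ofNat] at h3
    change ‖clearing t 0 J q * numer t q * 2 ^ p - _‖ ≤ _ at h1
    push_cast [Nat.cast_natAbs]
    linarith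
  set n := s.2.1.re.natAbs + s.2.1.im.natAbs + s.2.1.err with hn
  have hv : (n : ℝ) * 1024 / m ≤ v := by
    have h1 := natDiv_add_one_ge (n * 1024) m
    have h2 : n * 1024 / m + 1 = v := by simpa using h
    rw [← h2]
    push_cast at h1 ⊢
    exact h1
  rw [norm_mul] at hmX hV
  have hm' : (0 : ℝ) < m := by exact_mod_cast hmpos
  have hC' : 0 < ‖clearing t 0 J q‖ := norm_pos_iff.2 hC
  rw [div_le_iff₀ hm'] at hv
  have h5 : ‖clearing t 0 J q‖ * 2 ^ p * (‖numer t q‖ * 1024) ≤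
      ‖clearing t 0 J q‖ * 2 ^ p * (v * ‖denom t q‖) := by
    have hv0 : (0 : ℝ) ≤ v := by positivity
    nlinarith
  have h6 := le_of_mul_le_mul_left h5 (by positivity)
  linarith

theorem arctan_sub_le {x y : ℝ} (h : x ≤ y) : Real.arctan y - Real.arctan x ≤ y - x := by
  have hm : Monotone fun x : ℝ => x - Real.arctan x := by
    refine monotone_of_deriv_nonneg (differentiable_id.sub Real.differentiable_arctan) fun x => ?_
    have h1 := ((hasDerivAt_id x).sub (Real.hasDerivAt_arctan x)).deriv
    change deriv (id - Real.arctan) x ≥ 0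
    rw [h1, ge_iff_le, sub_nonneg, div_le_one (by positivity)]
    nlinarith [sq_nonneg x]
  have := hm h
  dsimp only at this
  linarith

/-- Induction along the bisection tree. The integrand is an arbitrary integrable f dominated by the
quotient, for two reasons: continuity of the quotient is only known once the first conclusion has
excluded zeros on the circle, and the opposite quadrant needs a translated f. -/
theorem cover_sound {t J num den : ℕ} (ht : 2 ≤ t) (hd : 0 < den) (hnd : num < den) {a b : ℂ}
    {A B TX TV : CBall p} {s : ℤ} (hs : s = 1 ∨ s = -1) (ha : Mem a A) (hb : Mem b B)
    (hTX : ∀ q : ℂ, ‖q‖ = (num : ℝ) / den → Mem (ladderSeries t 0 J q) TX)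
    (hTV : ∀ q : ℂ, ‖q‖ = (num : ℝ) / den → Mem (q ^ repunit t J - ladderSeries t 1 J q) TV)
    (fuel d k N S N' : ℕ) (hdf : d + fuel ≤ 31)
    (h : cover t J num den A B TX TV s fuel d k N = some (S, N')) :
    (∀ u : ℝ, (k : ℝ) / 2 ^ d ≤ u → u ≤ ((k + 1 : ℕ) : ℝ) / 2 ^ d →
      clearing t 0 J (circlePoint ((num : ℝ) / den) s u) *
        denom t (circlePoint ((num : ℝ) / den) s u) /
        ((circlePoint ((num : ℝ) / den) s u - a) * (circlePoint ((num : ℝ) / den) s u - b)) ∈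
          Complex.slitPlane) ∧
    ∀ f : ℝ → ℝ, (∀ x y, IntervalIntegrable f MeasureTheory.volume x y) →
      (∀ u, f (2 * Real.arctan u) * ‖denom t (circlePoint ((num : ℝ) / den) s u)‖ ≤
        ‖numer t (circlePoint ((num : ℝ) / den) s u)‖) →
      ∫ θ in 2 * Real.arctan ((k : ℝ) / 2 ^ d)..2 * Real.arctan (((k + 1 : ℕ) : ℝ) / 2 ^ d), f θ ≤
        S / (512 * 2 ^ 30) := by
  induction fuel generalizing d k N S N' with
  | zero => simp [cover] at h
  | succ fuel ih =>
    have hr1 : (num : ℝ) / den < 1 :=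
      (div_lt_one (by exact_mod_cast hd)).2 (by exact_mod_cast hnd)
    have hr0 : (0 : ℝ) ≤ (num : ℝ) / den := by positivity
    rw [cover] at h
    split at h
    · split at h
      swap
      · exact absurd h (by simp)
      rename_i v hv
      have hS : v * 2 ^ (30 - d) = S := congrArg Prod.fst (Option.some.inj h)
      have key : ∀ u : ℝ, (k : ℝ) / 2 ^ d ≤ u → u ≤ ((k + 1 : ℕ) : ℝ) / 2 ^ d →
          _ := fun u h1 h2 => arcTest_sound (q := circlePoint ((num : ℝ) / den) s u) ht
            (by rw [norm_circlePoint hr0 hs]; exact hr1) ha hb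
            (mem_arc hd hnd.le hs h1 h2) (hTX _ (norm_circlePoint hr0 hs u))
            (hTV _ (norm_circlePoint hr0 hs u)) hv
      refine ⟨fun u h1 h2 => (key u h1 h2).1, fun f hfi hf => ?_⟩
      have hle : (k : ℝ) / 2 ^ d ≤ ((k + 1 : ℕ) : ℝ) / 2 ^ d := by
        gcongr; exact_mod_cast k.le_succ
      have hθ : 2 * Real.arctan ((k : ℝ) / 2 ^ d) ≤
          2 * Real.arctan (((k + 1 : ℕ) : ℝ) / 2 ^ d) := by
        have := Real.arctan_strictMono.monotone hle
        linarith
      have hb : ∀ θ ∈ Set.Icc (2 * Real.arctan ((k : ℝ) / 2 ^ d))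
          (2 * Real.arctan (((k + 1 : ℕ) : ℝ) / 2 ^ d)), f θ ≤ v / 1024 := by
        rintro θ ⟨h1, h2⟩
        have h3 : Real.arctan (Real.tan (θ / 2)) = θ / 2 := by
          refine Real.arctan_tan ?_ ?_
          · have := Real.neg_pi_div_two_lt_arctan ((k : ℝ) / 2 ^ d)
            linarith
          · have := Real.arctan_lt_pi_div_two (((k + 1 : ℕ) : ℝ) / 2 ^ d)
            linarith
        have h4 : 2 * Real.arctan (Real.tan (θ / 2)) = θ := by rw [h3]; ring
        have h5 := key (Real.tan (θ / 2))
          (Real.arctan_strictMono.le_iff_le.1 (by rw [h3]; linarith))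
          (Real.arctan_strictMono.le_iff_le.1 (by rw [h3]; linarith))
        have h6 := (hf (Real.tan (θ / 2))).trans h5.2
        rw [h4] at h6
        refine le_of_mul_le_mul_right h6 (norm_pos_iff.2 fun h0 => ?_)
        have h7 := h5.1
        rw [h0, mul_zero, zero_div] at h7
        exact Complex.slitPlane_ne_zero h7 rfl
      have hmono := intervalIntegral.integral_mono_on hθ (hfi _ _)
        (intervalIntegrable_const (c := (v : ℝ) / 1024)) hb
      rw [intervalIntegral.integral_const, smul_eq_mul] at hmono
      refine hmono.trans ?_
      have hlip := arctan_sub_le hle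
      have h8 : ((k + 1 : ℕ) : ℝ) / 2 ^ d - (k : ℝ) / 2 ^ d = 1 / 2 ^ d := by
        push_cast; field_simp; ring
      rw [h8] at hlip
      -- Here the depth must not exceed 30, since otherwise the truncated exponent 30 - d would lose
      -- the weight; this is why the depth and the fuel are bounded together.
      have h9 : (2 : ℝ) ^ 30 = 2 ^ (30 - d) * 2 ^ d := by
        rw [← pow_add]; congr 1; omega
      have h10 : ((S : ℕ) : ℝ) / (512 * 2 ^ 30) = 2 * (1 / 2 ^ d) * (v / 1024) := by
        rw [← hS, h9]; push_cast; field_simp; ring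
      rw [h10]
      have : (0 : ℝ) ≤ (v : ℝ) / 1024 := by positivity
      gcongr
      linarith
    · split at h
      · exact absurd h (by simp)
      · rename_i x hx
        split at h
        · exact absurd h (by simp)
        · rename_i y hy
          have hS : x.1 + y.1 = S := congrArg Prod.fst (Option.some.inj h)
          obtain ⟨i1, i2⟩ := ih (d + 1) (2 * k) _ x.1 x.2 (by omega) hx
          obtain ⟨j1, j2⟩ := ih (d + 1) (2 * k + 1) _ y.1 y.2 (by omega) hy
          have e1 : ((2 * k : ℕ) : ℝ) / 2 ^ (d + 1) = (k : ℝ) / 2 ^ d := by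
            rw [pow_succ]; push_cast; field_simp
          have e2 : ((2 * k + 1 + 1 : ℕ) : ℝ) / 2 ^ (d + 1) = ((k + 1 : ℕ) : ℝ) / 2 ^ d := by
            rw [pow_succ]; push_cast; field_simp; ring
          rw [e1] at i1 i2
          rw [e2] at j1 j2
          refine ⟨fun u h1 h2 => ?_, fun f hfi hf => ?_⟩
          · rcases le_total u (((2 * k + 1 : ℕ) : ℝ) / 2 ^ (d + 1)) with h3 | h3
            · exact i1 u h1 h3
            · exact j1 u h3 h2
          · rw [← intervalIntegral.integral_add_adjacent_intervals
              (hfi _ (2 * Real.arctan (((2 * k + 1 : ℕ) : ℝ) / 2 ^ (d + 1)))) (hfi _ _), ← hS]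
            have := add_le_add (i2 f hfi hf) (j2 f hfi hf)
            rw [← add_div] at this
            exact_mod_cast this

end CBall

/-! ### From certified arcs to a coefficient bound. -/

-- Negation and conjugation move every point of the circle into the first quadrant, where the
-- tangent of the half angle lies in [0, 1].
open CBall in
theorem exists_circlePoint {r : ℝ} (hr : 0 < r) {q : ℂ} (hq : ‖q‖ = r) :
    ∃ s : ℤ, (s = 1 ∨ s = -1) ∧ ∃ u : ℝ, 0 ≤ u ∧ u ≤ 1 ∧
      (q = circlePoint r s u ∨ starRingEnd ℂ q = circlePoint r s u) := by
  have main : ∀ w : ℂ, ‖w‖ = 1 → 0 ≤ w.re → 0 ≤ w.im → ∃ u : ℝ, 0 ≤ u ∧ u ≤ 1 ∧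
      w = (1 + u * Complex.I) / (1 - u * Complex.I) := by
    intro w hw h1 h2
    have hsq : w.re * w.re + w.im * w.im = 1 := by
      have := Complex.normSq_eq_norm_sq w
      rw [hw, Complex.normSq_apply] at this
      linarith
    have h3 : 0 < 1 + w.re := by linarith
    -- The tangent of the half angle is sin/(1 + cos).
    obtain ⟨u, hu⟩ : ∃ u : ℝ, w.im = u * (1 + w.re) := ⟨w.im / (1 + w.re), by field_simp⟩
    have hu0 : 0 ≤ u := by
      rw [hu] at h2
      exact nonneg_of_mul_nonneg_left h2 h3
    have hre : w.re + u * u * (1 + w.re) = 1 := by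
      rw [hu] at hsq
      refine mul_left_cancel₀ h3.ne' ?_
      linear_combination hsq
    refine ⟨u, hu0, ?_, ?_⟩
    · nlinarith
    · rw [eq_div_iff (one_sub_mul_I_ne_zero _)]
      apply Complex.ext
      · simp [hu]
        linear_combination hre
      · simp [hu]
        ring
  have main2 : ∀ w : ℂ, ‖w‖ = 1 → 0 ≤ w.re → ∃ u : ℝ, 0 ≤ u ∧ u ≤ 1 ∧
      (w = (1 + u * Complex.I) / (1 - u * Complex.I) ∨
        starRingEnd ℂ w = (1 + u * Complex.I) / (1 - u * Complex.I)) := by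
    intro w hw h1
    rcases le_total 0 w.im with h | h
    · obtain ⟨u, h2, h3, h4⟩ := main w hw h1 h
      exact ⟨u, h2, h3, Or.inl h4⟩
    · obtain ⟨u, h2, h3, h4⟩ := main (starRingEnd ℂ w) (by rwa [RCLike.norm_conj]) (by simpa)
        (by simpa)
      exact ⟨u, h2, h3, Or.inr h4⟩
  have hrc : (r : ℂ) ≠ 0 := by exact_mod_cast hr.ne'
  have hn : ‖q / r‖ = 1 := by
    rw [norm_div, Complex.norm_real, Real.norm_of_nonneg hr.le, hq, div_self hr.ne']
  rcases le_total 0 (q / r).re with h | h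
  · obtain ⟨u, h1, h2, h3⟩ := main2 (q / r) hn h
    refine ⟨1, Or.inl rfl, u, h1, h2, ?_⟩
    simp only [circlePoint, Int.cast_one, one_mul]
    refine h3.imp (fun e => ?_) fun e => ?_
    · rw [← e, mul_div_cancel₀ _ hrc]
    · rw [← e, map_div₀, Complex.conj_ofReal, mul_div_cancel₀ _ hrc]
  · obtain ⟨u, h1, h2, h3⟩ := main2 (-(q / r)) (by rwa [norm_neg]) (by
      rw [Complex.neg_re]; linarith)
    refine ⟨-1, Or.inr rfl, u, h1, h2, ?_⟩
    simp only [circlePoint]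
    refine h3.imp (fun e => ?_) fun e => ?_
    · rw [← e]; push_cast; field_simp
    · rw [← e, map_neg, map_div₀, Complex.conj_ofReal]; push_cast; field_simp

open CBall in
theorem circleMap_two_arctan (r u : ℝ) :
    circleMap 0 r (2 * Real.arctan u) = circlePoint r 1 u := by
  have h1 : Complex.exp (Real.arctan u * Complex.I) = (1 + u * Complex.I) / (√(1 + u ^ 2) : ℝ) := by
    rw [Complex.exp_mul_I, ← Complex.ofReal_cos, ← Complex.ofReal_sin, Real.cos_arctan,
      Real.sin_arctan]
    push_cast
    ring
  have h2 : (((√(1 + u ^ 2) : ℝ) : ℂ)) ^ 2 = (1 + u * Complex.I) * (1 - u * Complex.I) := by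
    rw [← Complex.ofReal_pow, Real.sq_sqrt (by positivity)]
    push_cast
    linear_combination ((u : ℂ) ^ 2) * Complex.I_sq
  have h3 : 1 + u * Complex.I ≠ 0 := by
    have := one_sub_mul_I_ne_zero (-u)
    simpa using this
  rw [circleMap, circlePoint, zero_add, Int.cast_one, one_mul]
  congr 1
  have h4 : ((2 * Real.arctan u : ℝ) : ℂ) * Complex.I =
      ((2 : ℕ) : ℂ) * (Real.arctan u * Complex.I) := by
    push_cast; ring
  rw [h4, Complex.exp_nat_mul, h1, div_pow, h2]
  have := one_sub_mul_I_ne_zero u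
  field_simp

open CBall in
theorem circleMap_pi_add_two_arctan (r u : ℝ) :
    circleMap 0 r (Real.pi + 2 * Real.arctan u) = circlePoint r (-1) u := by
  have h := circleMap_two_arctan r u
  rw [circleMap, circlePoint] at *
  push_cast at *
  rw [add_mul, Complex.exp_add, Complex.exp_pi_mul_I]
  simp only [zero_add, one_mul] at *
  linear_combination -h

theorem denom_conj (t : ℕ) (q : ℂ) : denom t (starRingEnd ℂ q) = starRingEnd ℂ (denom t q) :=
  ladderSeries_conj t 0 0 q

theorem numer_conj (t : ℕ) (q : ℂ) : numer t (starRingEnd ℂ q) = starRingEnd ℂ (numer t q) :=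
  ladderSeries_conj t 1 0 q

theorem clearing_conj (t j n : ℕ) (q : ℂ) :
    clearing t j n (starRingEnd ℂ q) = starRingEnd ℂ (clearing t j n q) := by
  simp [clearing, map_prod]

theorem conj_mem_slitPlane {z : ℂ} (h : starRingEnd ℂ z ∈ Complex.slitPlane) :
    z ∈ Complex.slitPlane := by
  rw [Complex.mem_slitPlane_iff] at h ⊢
  simpa using h

theorem differentiable_clearing (t j n : ℕ) : Differentiable ℂ (clearing t j n) := by
  unfold clearing
  fun_prop

/-- Real version of `norm_coeff_remainder_le` with the principal parts estimated separately. -/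
theorem norm_coeff_le {t : ℕ} (ht : 2 ≤ t) {a b r : ℝ} (hr : r < 1) (ha0 : 0 < a) (hb0 : 0 < b)
    (har : a < r) (hbr : b < r) (hab : a ≠ b) (hda : denom t a = 0) (hdb : denom t b = 0) {J : ℕ}
    (hslit : ∀ q : ℂ, ‖q‖ = r →
      clearing t 0 J q * denom t q / ((q - a) * (q - b)) ∈ Complex.slitPlane) {K : ℝ}
    (hK : ∫ θ in (0 : ℝ)..2 * Real.pi,
      ‖numer t (circleMap 0 r θ) / denom t (circleMap 0 r θ)‖ ≤ 2 * Real.pi * K) (n : ℕ) :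
    ‖(gCount t n : ℂ) - residue t a * (a⁻¹) ^ (n + 1) - residue t b * (b⁻¹) ^ (n + 1)‖ ≤
      (K + ‖residue t a‖ / (r - a) + ‖residue t b‖ / (r - b)) * (r⁻¹) ^ n := by
  have hr0 : 0 < r := ha0.trans har
  have hmap : ∀ θ, ‖circleMap 0 r θ‖ = r := fun θ => by
    rw [norm_circleMap_zero, abs_of_pos hr0]
  have hne : ∀ θ, denom t (circleMap 0 r θ) ≠ 0 := fun θ h0 => by
    have := hslit _ (hmap θ)
    rw [h0, mul_zero, zero_div] at this
    exact Complex.slitPlane_ne_zero this rfl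
  have hc : ∀ k, Continuous fun θ => ladderSeries t k 0 (circleMap 0 r θ) := fun k =>
    (differentiableOn_ladderSeries ht k 0).continuousOn.comp_continuous (continuous_circleMap 0 r)
      fun θ => by simpa [hmap] using hr
  have hca : ∀ c : ℝ, 0 < c → c < r → ∀ θ, (c : ℂ) - circleMap 0 r θ ≠ 0 := fun c h0 h1 θ h => by
    have := hmap θ
    rw [← sub_eq_zero.1 h, Complex.norm_real, Real.norm_of_nonneg h0.le] at this
    exact h1.ne this
  have hna : ∀ c : ℝ, 0 < c → c < r → ∀ θ, r - c ≤ ‖(c : ℂ) - circleMap 0 r θ‖ :=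
      fun c h0 h1 θ => by
    have := norm_sub_norm_le (circleMap 0 r θ) (c : ℂ)
    rw [hmap, Complex.norm_real, Real.norm_of_nonneg h0.le, norm_sub_rev] at this
    exact this
  have h := norm_coeff_remainder_le ht (a := a) (b := b) (P := clearing t 0 J) hr
    (by exact_mod_cast ha0.ne') (by exact_mod_cast hb0.ne')
    (by rwa [Complex.norm_real, Real.norm_of_nonneg ha0.le])
    (by rwa [Complex.norm_real, Real.norm_of_nonneg hb0.le]) (by exact_mod_cast hab) hda hdb
    (differentiable_clearing t 0 J).differentiableOn hslit n
  simp only [Complex.ofReal_inv]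
  refine h.trans ?_
  have hcq : Continuous fun θ => numer t (circleMap 0 r θ) / denom t (circleMap 0 r θ) :=
    (hc 1).div (hc 0) hne
  have hcr : Continuous fun θ => remainder t a b (circleMap 0 r θ) := by
    have e : ∀ c : ℝ, 0 < c → c < r →
        Continuous fun θ => residue t c / ((c : ℂ) - circleMap 0 r θ) := fun c h0 h1 =>
      continuous_const.div (continuous_const.sub (continuous_circleMap 0 r)) (hca c h0 h1)
    exact (hcq.sub (e a ha0 har)).sub (e b hb0 hbr)
  have hint : ∫ θ in (0 : ℝ)..2 * Real.pi, ‖remainder t a b (circleMap 0 r θ)‖ ≤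
      2 * Real.pi * (K + ‖residue t a‖ / (r - a) + ‖residue t b‖ / (r - b)) := by
    have h1 : ∫ θ in (0 : ℝ)..2 * Real.pi, ‖remainder t a b (circleMap 0 r θ)‖ ≤
        ∫ θ in (0 : ℝ)..2 * Real.pi, (‖numer t (circleMap 0 r θ) / denom t (circleMap 0 r θ)‖ +
          (‖residue t a‖ / (r - a) + ‖residue t b‖ / (r - b))) := by
      refine intervalIntegral.integral_mono_on (by positivity) (hcr.norm.intervalIntegrable _ _)
        ((hcq.norm.add continuous_const).intervalIntegrable _ _) fun θ _ => ?_
      rw [remainder, sub_sub]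
      refine (norm_sub_le _ _).trans (add_le_add le_rfl ((norm_add_le _ _).trans ?_))
      rw [norm_div, norm_div]
      have e1 := hna a ha0 har θ
      have e2 := hna b hb0 hbr θ
      have e3 : 0 < r - a := by linarith
      have e4 : 0 < r - b := by linarith
      gcongr
    rw [intervalIntegral.integral_add (hcq.norm.intervalIntegrable _ _)
      (continuous_const.intervalIntegrable _ _), intervalIntegral.integral_const, smul_eq_mul] at h1
    linarith
  have hpi := Real.pi_pos
  have : (2 * Real.pi)⁻¹ * ∫ θ in (0 : ℝ)..2 * Real.pi, ‖remainder t a b (circleMap 0 r θ)‖ ≤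
      K + ‖residue t a‖ / (r - a) + ‖residue t b‖ / (r - b) := by
    rw [inv_mul_le_iff₀ (by positivity)]
    exact hint
  gcongr

-- The two covers treat the angles [0, π/2] and [π, 3π/2]; conjugation supplies the other two
-- quadrants and doubles the sum. Dividing by 2π and using π > 3 produces the factor 3 in the
-- denominator.
open CBall in
theorem norm_coeff_le_of_cover {p t J num den : ℕ} (ht : 2 ≤ t) (hn : 0 < num) (hd : num < den)
    {a b : ℝ} (ha0 : 0 < a) (hb0 : 0 < b) (har : a < (num : ℝ) / den) (hbr : b < (num : ℝ) / den)
    (hab : a ≠ b) (hda : denom t a = 0) (hdb : denom t b = 0) {A B TX TV : CBall p}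
    (hA : Mem a A) (hB : Mem b B)
    (hTX : ∀ q : ℂ, ‖q‖ = (num : ℝ) / den → Mem (ladderSeries t 0 J q) TX)
    (hTV : ∀ q : ℂ, ‖q‖ = (num : ℝ) / den → Mem (q ^ repunit t J - ladderSeries t 1 J q) TV)
    {fuel N₁ N₁' S₁ N₂ N₂' S₂ : ℕ} (hf : fuel ≤ 31)
    (h1 : cover t J num den A B TX TV 1 fuel 0 0 N₁ = some (S₁, N₁'))
    (h2 : cover t J num den A B TX TV (-1) fuel 0 0 N₂ = some (S₂, N₂')) (n : ℕ) :
    ‖(gCount t n : ℂ) - residue t a * (a⁻¹) ^ (n + 1) - residue t b * (b⁻¹) ^ (n + 1)‖ ≤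
      ((S₁ + S₂ : ℕ) / (512 * 2 ^ 30 * 3) + ‖residue t a‖ / ((num : ℝ) / den - a) +
        ‖residue t b‖ / ((num : ℝ) / den - b)) * ((den : ℝ) / num) ^ n := by
  have hden : 0 < den := hn.trans hd
  have hr0 : (0 : ℝ) < (num : ℝ) / den := by positivity
  have hr1 : (num : ℝ) / den < 1 := (div_lt_one (by exact_mod_cast hden)).2 (by exact_mod_cast hd)
  obtain ⟨sl1, in1⟩ := cover_sound ht hden hd (Or.inl rfl) hA hB hTX hTV fuel 0 0 N₁ S₁ N₁' (by omega) h1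
  obtain ⟨sl2, in2⟩ := cover_sound ht hden hd (Or.inr rfl) hA hB hTX hTV fuel 0 0 N₂ S₂ N₂' (by omega) h2
  set r : ℝ := (num : ℝ) / den with hr
  have hslit : ∀ q : ℂ, ‖q‖ = r →
      clearing t 0 J q * denom t q / ((q - a) * (q - b)) ∈ Complex.slitPlane := by
    intro q hq
    obtain ⟨s, hs, u, hu0, hu1, hqu⟩ := exists_circlePoint hr0 hq
    have key : clearing t 0 J (circlePoint r s u) * denom t (circlePoint r s u) /
        ((circlePoint r s u - a) * (circlePoint r s u - b)) ∈ Complex.slitPlane := by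
      rcases hs with rfl | rfl
      · exact sl1 u (by simpa using hu0) (by simpa using hu1)
      · exact sl2 u (by simpa using hu0) (by simpa using hu1)
    rcases hqu with hqu | hqu
    · rwa [hqu]
    · rw [← hqu, clearing_conj, denom_conj] at key
      apply conj_mem_slitPlane
      rw [map_div₀, map_mul, map_mul, map_sub, map_sub, Complex.conj_ofReal, Complex.conj_ofReal]
      exact key
  set f : ℝ → ℝ := fun θ => ‖numer t (circleMap 0 r θ) / denom t (circleMap 0 r θ)‖ with hfdef
  have hmap : ∀ θ, ‖circleMap 0 r θ‖ = r := fun θ => by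
    rw [norm_circleMap_zero, abs_of_pos hr0]
  have hne : ∀ θ, denom t (circleMap 0 r θ) ≠ 0 := fun θ h0 => by
    have := hslit _ (hmap θ)
    rw [h0, mul_zero, zero_div] at this
    exact Complex.slitPlane_ne_zero this rfl
  have hc : ∀ k, Continuous fun θ => ladderSeries t k 0 (circleMap 0 r θ) := fun k =>
    (differentiableOn_ladderSeries ht k 0).continuousOn.comp_continuous (continuous_circleMap 0 r)
      fun θ => by simpa [hmap] using hr1
  have hfc : Continuous f := ((hc 1).div (hc 0) hne).norm
  have hfi : ∀ x y, IntervalIntegrable f MeasureTheory.volume x y := fun x y =>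
    hfc.intervalIntegrable x y
  have hfD : ∀ θ, f θ * ‖denom t (circleMap 0 r θ)‖ = ‖numer t (circleMap 0 r θ)‖ := fun θ => by
    rw [hfdef]
    dsimp only
    rw [norm_div, div_mul_cancel₀ _ (norm_ne_zero_iff.2 (hne θ))]
  have hf2 : ∀ θ, f (2 * Real.pi - θ) = f θ := by
    intro θ
    have : circleMap 0 r (2 * Real.pi - θ) = starRingEnd ℂ (circleMap 0 r θ) := by
      rw [circleMap, circleMap, zero_add, zero_add, map_mul, Complex.conj_ofReal, ← Complex.exp_conj]
      congr 1
      rw [map_mul, Complex.conj_ofReal, Complex.conj_I]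
      push_cast
      rw [sub_mul, Complex.exp_sub, Complex.exp_two_pi_mul_I, mul_neg, Complex.exp_neg, one_div]
    rw [hfdef]
    dsimp only
    rw [this, numer_conj, denom_conj, ← map_div₀, RCLike.norm_conj]
  have I1 := in1 f hfi fun u => by rw [← circleMap_two_arctan, hfD]
  have I2 := in2 (fun θ => f (Real.pi + θ)) (fun x y =>
    (hfc.comp (continuous_const.add continuous_id)).intervalIntegrable x y) fun u => by
      rw [← circleMap_pi_add_two_arctan, hfD]
  have z1 : 2 * Real.arctan (((0 : ℕ) : ℝ) / 2 ^ 0) = 0 := by simp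
  have z2 : 2 * Real.arctan (((0 + 1 : ℕ) : ℝ) / 2 ^ 0) = Real.pi / 2 := by
    simp [Real.arctan_one]; ring
  rw [z1, z2] at I1 I2
  rw [intervalIntegral.integral_comp_add_left (fun θ => f θ), add_zero] at I2
  have I3 : ∫ θ in Real.pi / 2..Real.pi, f θ = ∫ θ in Real.pi..Real.pi + Real.pi / 2, f θ := by
    have := intervalIntegral.integral_comp_sub_left f (2 * Real.pi)
      (a := Real.pi / 2) (b := Real.pi)
    simp only [hf2] at this
    rw [this]
    congr 1 <;> ring
  have I4 : ∫ θ in Real.pi + Real.pi / 2..2 * Real.pi, f θ = ∫ θ in (0 : ℝ)..Real.pi / 2, f θ := by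
    have := intervalIntegral.integral_comp_sub_left f (2 * Real.pi)
      (a := Real.pi + Real.pi / 2) (b := 2 * Real.pi)
    simp only [hf2] at this
    rw [this]
    congr 1 <;> ring
  have hsum : ∫ θ in (0 : ℝ)..2 * Real.pi, f θ ≤
      2 * Real.pi * ((S₁ + S₂ : ℕ) / (512 * 2 ^ 30 * 3)) := by
    rw [← intervalIntegral.integral_add_adjacent_intervals (hfi 0 (Real.pi / 2)) (hfi _ _),
      ← intervalIntegral.integral_add_adjacent_intervals (hfi (Real.pi / 2) Real.pi) (hfi _ _),
      ← intervalIntegral.integral_add_adjacent_intervals (hfi Real.pi (Real.pi + Real.pi / 2))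
        (hfi _ _), I3, I4]
    have e : 2 * Real.pi * ((S₁ + S₂ : ℕ) / (512 * 2 ^ 30 * 3)) =
        Real.pi / 3 * (2 * ((S₁ : ℝ) / (512 * 2 ^ 30) + S₂ / (512 * 2 ^ 30))) := by
      push_cast; ring
    rw [e]
    have h3 : 1 ≤ Real.pi / 3 := by linarith [Real.pi_gt_three]
    have h4 : (0 : ℝ) ≤ 2 * ((S₁ : ℝ) / (512 * 2 ^ 30) + S₂ / (512 * 2 ^ 30)) := by positivity
    nlinarith
  have := norm_coeff_le ht hr1 ha0 hb0 har hbr hab hda hdb hslit hsum n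
  rwa [hr, inv_div] at this

/-! ### Ball enclosures of the tails. -/

namespace CBall

variable {p : ℕ}

instance : Add (CBall p) :=
  ⟨fun x y => ⟨x.re + y.re, x.im + y.im, x.err + y.err, x.mag + y.mag⟩⟩

theorem Mem.add {z w : ℂ} {x y : CBall p} (hz : Mem z x) (hw : Mem w y) : Mem (z + w) (x + y) := by
  have h1 : (x + y).re = x.re + y.re := rfl
  have h2 : (x + y).im = x.im + y.im := rfl
  have h3 : (x + y).err = x.err + y.err := rfl
  have h4 : (x + y).mag = x.mag + y.mag := rfl
  constructor
  · rw [h1, h2, h3]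
    have : (z + w) * 2 ^ p - (⟨((x.re + y.re : ℤ) : ℝ), ((x.im + y.im : ℤ) : ℝ)⟩ : ℂ) =
        (z * 2 ^ p - (⟨x.re, x.im⟩ : ℂ)) + (w * 2 ^ p - (⟨y.re, y.im⟩ : ℂ)) := by
      apply Complex.ext <;> simp <;> ring
    rw [this]
    push_cast
    exact (norm_add_le _ _).trans (add_le_add hz.1 hw.1)
  · rw [h4]
    push_cast
    have := norm_add_le z w
    nlinarith [hz.2, hw.2, (by positivity : (0 : ℝ) < 2 ^ p)]

/-- The ball `|z| ≤ M / 2 ^ p`. -/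
def small (p M : ℕ) : CBall p := ⟨0, 0, M, M⟩

/-- The ball `|z - 1| ≤ M / 2 ^ p`. -/
def nearOne (p M : ℕ) : CBall p := ⟨2 ^ p, 0, M, 2 ^ p + M⟩

/-- The real interval `[n / 2 ^ p, (n + e) / 2 ^ p]`. -/
def interval (p n e : ℕ) : CBall p := ⟨n, 0, e, n + e⟩

theorem mem_small {z : ℂ} {M : ℕ} (h : ‖z‖ * 2 ^ p ≤ M) : Mem z (small p M) := by
  refine ⟨?_, h⟩
  have : (⟨((small p M).re : ℝ), ((small p M).im : ℝ)⟩ : ℂ) = 0 := by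
    apply Complex.ext <;> simp [small]
  rw [this, sub_zero, norm_mul, norm_pow, Complex.norm_ofNat]
  exact h

theorem mem_nearOne {z : ℂ} {M : ℕ} (h : ‖z - 1‖ * 2 ^ p ≤ M) : Mem z (nearOne p M) := by
  constructor
  · have : (⟨((nearOne p M).re : ℝ), ((nearOne p M).im : ℝ)⟩ : ℂ) = ((2 ^ p : ℝ) : ℂ) := by
      apply Complex.ext
      · simp only [nearOne, Complex.ofReal_re]
        push_cast
        rfl
      · simp only [nearOne, Int.cast_zero, Complex.ofReal_im]
    rw [this]
    push_cast
    have h2 : z * 2 ^ p - 2 ^ p = (z - 1) * 2 ^ p := by ring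
    rw [h2, norm_mul, norm_pow, Complex.norm_ofNat]
    exact h
  · have := norm_add_le (1 : ℂ) (z - 1)
    rw [add_sub_cancel, norm_one] at this
    simp only [nearOne]
    push_cast
    nlinarith [(by positivity : (0 : ℝ) < 2 ^ p)]

theorem mem_interval {x : ℝ} {n e : ℕ} (h1 : (n : ℝ) / 2 ^ p ≤ x) (h2 : x ≤ (n + e : ℕ) / 2 ^ p) :
    Mem x (interval p n e) := by
  have hp : (0 : ℝ) < 2 ^ p := by positivity
  rw [div_le_iff₀ hp] at h1
  rw [le_div_iff₀ hp] at h2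
  push_cast at h2
  have hx : (x : ℂ) * 2 ^ p = ((x * 2 ^ p : ℝ) : ℂ) := by push_cast; rfl
  constructor
  · have : (⟨((interval p n e).re : ℝ), ((interval p n e).im : ℝ)⟩ : ℂ) = ((n : ℝ) : ℂ) := by
      apply Complex.ext
      · simp [interval]
      · simp only [interval, Int.cast_zero, Complex.ofReal_im]
    rw [this, hx, ← Complex.ofReal_sub, Complex.norm_real, Real.norm_of_nonneg (by linarith)]
    simp only [interval]
    linarith
  · have hx0 : 0 ≤ x := by
      have : (0 : ℝ) ≤ x * 2 ^ p := le_trans (by positivity) h1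
      exact nonneg_of_mul_nonneg_left this hp
    rw [Complex.norm_real, Real.norm_of_nonneg hx0]
    simp only [interval]
    push_cast
    exact h2

/-- A ball for `q ^ [J + 1]`. -/
def tailPow (t : ℕ) (Q : CBall p) : ℕ → CBall p
  | 0 => Q
  | n + 1 => Q * fastPow (tailPow t Q n) 7 t

theorem mem_tailPow (t : ℕ) {q : ℂ} {Q : CBall p} (hQ : Mem q Q) (J : ℕ) :
    Mem (q ^ repunit t (J + 1)) (tailPow t Q J) := by
  induction J with
  | zero => simpa [repunit_one, tailPow] using hQ
  | succ J ih =>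
    exact (isSound_mem p q).pow_repunit_succ (R := fun f (a : CBall p) => Mem (f q) a) hQ ih

/-- These are the starting values of the recursive evaluation: after J levels the two remaining
series are 1 and q^[J] up to twice a bound for |q|^[J+1]. -/
theorem tail_bounds {t : ℕ} (ht : 2 ≤ t) {q : ℂ} (hq : ‖q‖ < 1) {Q : CBall p} (hQ : Mem q Q)
    {J : ℕ} (h4 : 4 * (tailPow t Q J).mag ≤ 2 ^ p) :
    ‖ladderSeries t 0 J q - 1‖ * 2 ^ p ≤ (2 * (tailPow t Q J).mag : ℕ) ∧
      ‖q ^ repunit t J - ladderSeries t 1 J q‖ * 2 ^ p ≤ (2 * (tailPow t Q J).mag : ℕ) := by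
  have hp : (0 : ℝ) < 2 ^ p := by positivity
  set M := (tailPow t Q J).mag with hM
  have h1 : ‖q‖ ^ repunit t (J + 1) ≤ M / 2 ^ p := by
    have := (mem_tailPow t hQ J).2
    rwa [norm_pow, ← le_div_iff₀ hp] at this
  have h2 : (M : ℝ) / 2 ^ p ≤ 1 / 4 := by
    rw [div_le_div_iff₀ hp (by norm_num)]
    have : ((4 * M : ℕ) : ℝ) ≤ ((2 ^ p : ℕ) : ℝ) := by exact_mod_cast h4
    push_cast at this
    linarith
  have h5 := norm_ladderSeries_sub_le ht 0 J hq h1 h2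
  have h6 := norm_ladderSeries_sub_le ht 1 J hq h1 h2
  rw [zero_mul, pow_zero] at h5
  rw [one_mul, norm_sub_rev] at h6
  have h7 : 2 * ((M : ℝ) / 2 ^ p) * 2 ^ p = (2 * M : ℕ) := by
    push_cast; field_simp
  exact ⟨by rw [← h7]; gcongr, by rw [← h7]; gcongr⟩

end CBall

/-! ### Balls for a value together with a derivative. -/

/-- A pair of balls for a function value and a derivative. -/
structure DBall (p : ℕ) where
  val : CBall p
  der : CBall p

namespace DBall

open CBall

variable {p : ℕ}

instance : One (DBall p) := ⟨⟨1, small p 0⟩⟩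

instance : Sub (DBall p) := ⟨fun x y => ⟨x.val - y.val, x.der - y.der⟩⟩

instance : Mul (DBall p) := ⟨fun x y => ⟨x.val * y.val, x.der * y.val + x.val * y.der⟩⟩

/-- The function has its value and its derivative at `q` in the two balls. -/
def Holds (q : ℂ) (f : ℂ → ℂ) (a : DBall p) : Prop :=
  Mem (f q) a.val ∧ ∃ f' : ℂ, HasDerivAt f f' q ∧ Mem f' a.der

theorem isSound_holds (p : ℕ) (q : ℂ) : IsSound (Holds (p := p) q) where
  one := ⟨mem_one, 0, hasDerivAt_const q 1, mem_small (by simp)⟩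
  sub := fun ⟨h1, f', h2, h3⟩ ⟨k1, g', k2, k3⟩ => ⟨h1.sub k1, f' - g', h2.sub k2, h3.sub k3⟩
  mul := fun ⟨h1, f', h2, h3⟩ ⟨k1, g', k2, k3⟩ =>
    ⟨h1.mul k1, _, h2.mul k2, (h3.mul k1).add (h1.mul k3)⟩

theorem Holds.congr {q : ℂ} (hq : ‖q‖ < 1) {f g : ℂ → ℂ} {a : DBall p} (hf : Holds q f a)
    (hfg : ∀ z : ℂ, ‖z‖ < 1 → f z = g z) : Holds q g a := by
  obtain ⟨h1, f', h2, h3⟩ := hf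
  refine ⟨by rwa [← hfg q hq], f', h2.congr_of_eventuallyEq ?_, h3⟩
  filter_upwards [Metric.isOpen_ball.mem_nhds (by simpa using hq : q ∈ Metric.ball (0 : ℂ) 1)]
    with z hz
  exact (hfg z (by simpa using hz)).symm

/-- If `f` is near a constant on the disc of radius `2 ^ (-k)`, then its derivative is small. -/
theorem norm_deriv_mul_le {f : ℂ → ℂ} {q c : ℂ} {k : ℕ} {M : ℝ}
    (hf : DifferentiableOn ℂ f (Metric.ball 0 1)) (hq : ‖q‖ + 1 / 2 ^ k < 1)
    (hM : ∀ z : ℂ, ‖z‖ ≤ ‖q‖ + 1 / 2 ^ k → ‖f z - c‖ ≤ M) : ‖deriv f q‖ ≤ M * 2 ^ k := by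
  have hk : (0 : ℝ) < 1 / 2 ^ k := by positivity
  have h1 : deriv f q = deriv (fun z => f z - c) q := by rw [deriv_sub_const_fun]
  have hz : ∀ z ∈ Metric.closedBall q (1 / 2 ^ k), ‖z‖ ≤ ‖q‖ + 1 / 2 ^ k := fun z hz => by
    have := norm_sub_norm_le z q
    rw [mem_closedBall_iff_norm] at hz
    linarith
  rw [h1]
  have h2 := Complex.norm_deriv_le_of_forall_mem_sphere_norm_le (f := fun z => f z - c) (c := q)
    hk ((hf.mono (s := Metric.closedBall q (1 / 2 ^ k)) fun z h => by
      simpa using (hz z h).trans_lt hq).sub_const c |>.mono Metric.closure_ball_subset_closedBall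
      |>.diffContOnCl) fun z h => hM z (hz z (Metric.sphere_subset_closedBall h))
  rwa [div_div_eq_mul_div, div_one] at h2

/-- The tails stay near a constant on the whole disc of radius |q| + 2^{-k}; Cauchy's estimate on a
disc of radius 2^{-k} therefore encloses their derivatives at the cost of a factor 2^k. -/
theorem holds_tail {t : ℕ} (ht : 2 ≤ t) {q : ℂ} {k J : ℕ} {Q' : CBall p}
    (hQ' : ∀ z : ℂ, ‖z‖ ≤ ‖q‖ + 1 / 2 ^ k → Mem z Q') (hq : ‖q‖ + 1 / 2 ^ k < 1)
    (h4 : 4 * (tailPow t Q' J).mag ≤ 2 ^ p) :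
    Holds q (ladderSeries t 0 J) ⟨nearOne p (2 * (tailPow t Q' J).mag),
        small p (2 * (tailPow t Q' J).mag * 2 ^ k)⟩ ∧
      Holds q (fun z => z ^ repunit t J - ladderSeries t 1 J z)
        ⟨small p (2 * (tailPow t Q' J).mag), small p (2 * (tailPow t Q' J).mag * 2 ^ k)⟩ := by
  have hp : (0 : ℝ) < 2 ^ p := by positivity
  have hk : (0 : ℝ) < 1 / 2 ^ k := by positivity
  have hq1 : ‖q‖ < 1 := by linarith
  set M := (tailPow t Q' J).mag with hM
  have hb : ∀ z : ℂ, ‖z‖ ≤ ‖q‖ + 1 / 2 ^ k → _ := fun z hz =>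
    tail_bounds ht (q := z) (by linarith) (hQ' z hz) h4
  have hdiff : ∀ j, DifferentiableOn ℂ (ladderSeries t j J) (Metric.ball 0 1) := fun j =>
    differentiableOn_ladderSeries ht j J
  have hmem : Metric.ball (0 : ℂ) 1 ∈ nhds q := Metric.isOpen_ball.mem_nhds (by simpa using hq1)
  obtain ⟨b1, b2⟩ := hb q (by linarith)
  have d0 := hdiff 0
  have d1 : DifferentiableOn ℂ (fun z => z ^ repunit t J - ladderSeries t 1 J z)
      (Metric.ball 0 1) := DifferentiableOn.sub (by fun_prop) (hdiff 1)
  refine ⟨⟨mem_nearOne b1, _, (d0.differentiableAt hmem).hasDerivAt, mem_small ?_⟩,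
    ⟨mem_small b2, _, (d1.differentiableAt hmem).hasDerivAt, mem_small ?_⟩⟩
  · have := norm_deriv_mul_le (c := 1) (M := (2 * M : ℕ) / 2 ^ p) d0 hq fun z hz => by
      rw [le_div_iff₀ hp]
      exact (hb z hz).1
    rw [← le_div_iff₀ hp]
    refine this.trans (le_of_eq ?_)
    push_cast; ring
  · have := norm_deriv_mul_le (c := 0) (M := (2 * M : ℕ) / 2 ^ p) d1 hq fun z hz => by
      rw [le_div_iff₀ hp, sub_zero]
      exact (hb z hz).2
    rw [← le_div_iff₀ hp]
    refine this.trans (le_of_eq ?_)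
    push_cast; ring

end DBall

/-! ### Certified real zeros and residues. -/

theorem ladderSeries_im (t k j : ℕ) (x : ℝ) : (ladderSeries t k j x).im = 0 := by
  have := ladderSeries_conj t k j x
  rw [Complex.conj_ofReal] at this
  exact Complex.conj_eq_iff_im.1 this.symm

theorem residue_im (t : ℕ) (x : ℝ) : (residue t x).im = 0 := by
  apply Complex.conj_eq_iff_im.1
  have h : (starRingEnd ℂ ∘ denom t ∘ starRingEnd ℂ) = denom t := by
    funext q
    simp [denom_conj]
  have h1 : starRingEnd ℂ (deriv (denom t) x) = deriv (denom t) x := by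
    conv_rhs => rw [← h, deriv_conj_conj]
    simp
  rw [residue, map_div₀, map_neg, h1, ← numer_conj, Complex.conj_ofReal]

theorem clearing_ofReal_pos {t : ℕ} {x : ℝ} (h0 : 0 ≤ x) (h1 : x < 1) (j n : ℕ) :
    ∃ c : ℝ, 0 < c ∧ clearing t j n x = c := by
  refine ⟨∏ i ∈ Finset.range n, (1 - x ^ repunit t (j + i + 1)), Finset.prod_pos fun i _ => ?_, ?_⟩
  · have := pow_lt_one₀ h0 h1 (repunit_succ_ne_zero t (j + i))
    linarith
  · simp [clearing]

theorem exists_denom_eq_zero {t : ℕ} (ht : 2 ≤ t) {x y : ℝ} (hx : 0 ≤ x) (hxy : x ≤ y) (hy : y < 1)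
    (h : (0 < (denom t x).re ∧ (denom t y).re < 0) ∨ ((denom t x).re < 0 ∧ 0 < (denom t y).re)) :
    ∃ z : ℝ, x ≤ z ∧ z ≤ y ∧ denom t z = 0 := by
  have hc : ContinuousOn (fun z : ℝ => (denom t z).re) (Set.Icc x y) := by
    refine Complex.continuous_re.comp_continuousOn ((differentiableOn_ladderSeries ht 0 0).continuousOn.comp
      Complex.continuous_ofReal.continuousOn fun z hz => ?_)
    rw [mem_ball_zero_iff, Complex.norm_real, Real.norm_of_nonneg (hx.trans hz.1)]
    exact hz.2.trans_lt hy
  have h0 : ∃ z ∈ Set.Icc x y, (denom t z).re = 0 := by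
    rcases h with ⟨h1, h2⟩ | ⟨h1, h2⟩
    · exact intermediate_value_Icc' hxy hc ⟨h2.le, h1.le⟩
    · exact intermediate_value_Icc hxy hc ⟨h1.le, h2.le⟩
  obtain ⟨z, hz, hz0⟩ := h0
  exact ⟨z, hz.1, hz.2, Complex.ext hz0 (ladderSeries_im t 0 0 z)⟩

namespace CBall

variable {p : ℕ}

theorem Mem.re_pos {z : ℂ} {b : CBall p} (h : Mem z b) (hb : (b.err : ℤ) < b.re) : 0 < z.re := by
  have h1 := (abs_le.1 ((Complex.abs_re_le_norm _).trans h.1)).1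
  have h2 : ((b.err : ℕ) : ℝ) < b.re := by exact_mod_cast hb
  have h3 : (z * 2 ^ p).re = z.re * 2 ^ p := by
    rw [show (2 : ℂ) ^ p = ((2 ^ p : ℝ) : ℂ) by push_cast; rfl, Complex.re_mul_ofReal]
  rw [Complex.sub_re, h3] at h1
  have h4 : 0 < z.re * 2 ^ p := by
    change -(b.err : ℝ) ≤ z.re * 2 ^ p - b.re at h1
    linarith
  exact pos_of_mul_pos_left h4 (by positivity)

theorem Mem.re_neg {z : ℂ} {b : CBall p} (h : Mem z b) (hb : b.re < -(b.err : ℤ)) : z.re < 0 := by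
  have h1 := (abs_le.1 ((Complex.abs_re_le_norm _).trans h.1)).2
  have h2 : (b.re : ℝ) < -((b.err : ℕ) : ℝ) := by exact_mod_cast hb
  have h3 : (z * 2 ^ p).re = z.re * 2 ^ p := by
    rw [show (2 : ℂ) ^ p = ((2 ^ p : ℝ) : ℂ) by push_cast; rfl, Complex.re_mul_ofReal]
  rw [Complex.sub_re, h3] at h1
  have h4 : z.re * 2 ^ p < 0 := by
    change z.re * 2 ^ p - b.re ≤ (b.err : ℝ) at h1
    linarith
  by_contra h5
  have : 0 ≤ z.re * 2 ^ p := mul_nonneg (not_lt.1 h5) (by positivity)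
  linarith

/-- A bound for the absolute value of the points of the ball. -/
def upper (b : CBall p) : ℕ := b.re.natAbs + b.im.natAbs + b.err

/-- A lower bound for the absolute value of the points of the ball. -/
def lower (b : CBall p) : ℕ := max b.re.natAbs b.im.natAbs - b.err

theorem Mem.norm_le_upper {z : ℂ} {b : CBall p} (h : Mem z b) : ‖z‖ * 2 ^ p ≤ b.upper := by
  have h1 := h.1
  have h2 := Complex.norm_le_abs_re_add_abs_im (⟨b.re, b.im⟩ : ℂ)
  have h3 := norm_sub_norm_le (z * 2 ^ p) (⟨b.re, b.im⟩ : ℂ)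
  rw [norm_mul, norm_pow, Complex.norm_ofNat] at h3
  rw [upper]
  push_cast [Nat.cast_natAbs]
  linarith

theorem Mem.lower_le_norm {z : ℂ} {b : CBall p} (h : Mem z b) : (b.lower : ℝ) ≤ ‖z‖ * 2 ^ p := by
  rcases le_total (max b.re.natAbs b.im.natAbs) b.err with hle | hle
  · rw [lower, Nat.sub_eq_zero_of_le hle, Nat.cast_zero]
    positivity
  have h1 := h.1
  have h2 : (max |(b.re : ℝ)| |(b.im : ℝ)|) ≤ ‖(⟨b.re, b.im⟩ : ℂ)‖ :=
    max_le (Complex.abs_re_le_norm ⟨(b.re : ℝ), (b.im : ℝ)⟩)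
      (Complex.abs_im_le_norm ⟨(b.re : ℝ), (b.im : ℝ)⟩)
  have h3 := norm_sub_norm_le (⟨b.re, b.im⟩ : ℂ) (z * 2 ^ p)
  rw [norm_sub_rev, norm_mul, norm_pow, Complex.norm_ofNat] at h3
  rw [lower, Nat.cast_sub hle, Nat.cast_max, Nat.cast_natAbs, Nat.cast_natAbs]
  push_cast
  linarith

/-- The sign change part of the root test on `[n / 2 ^ p, (n + w) / 2 ^ p]`. -/
def signTest (p t J n w : ℕ) (TX TV : CBall p) : Bool :=
  let lo := (ladderEval t (interval p n 0) TX TV J 1).1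
  let hi := (ladderEval t (interval p (n + w) 0) TX TV J 1).1
  (decide ((lo.err : ℤ) < lo.re) && decide (hi.re < -(hi.err : ℤ))) ||
    (decide (lo.re < -(lo.err : ℤ)) && decide ((hi.err : ℤ) < hi.re))

/-- The part of the root test which encloses the residue in `[(m - E) / 2 ^ p, (m + E) / 2 ^ p]`. -/
def residueTest (p t J n w k m E M : ℕ) : Bool :=
  let s := ladderEval t (⟨interval p n w, 1⟩ : DBall p) ⟨nearOne p M, small p (M * 2 ^ k)⟩
    ⟨small p M, small p (M * 2 ^ k)⟩ J 1
  Nat.blt 0 s.1.der.lower &&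
    Nat.ble ((s.2.1.val + interval p m 0 * s.1.der).upper * 2 ^ p) (E * s.1.der.lower)

/-- The certified test for a zero of the denominator and the residue. -/
def rootTest (p t J n w k m E : ℕ) : Bool :=
  let N := n + w + 2 ^ (p - k)
  let M := (tailPow t (small p N) J).mag
  Nat.blt N (2 ^ p) && Nat.ble (4 * M) (2 ^ p) &&
    signTest p t J n w (nearOne p (2 * M)) (small p (2 * M)) && residueTest p t J n w k m E (2 * M)

theorem ladderEval_mem {t : ℕ} (ht : 2 ≤ t) {q : ℂ} (hq : ‖q‖ < 1) {Q TX TV : CBall p}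
    (hQ : Mem q Q) {J : ℕ} (hTX : Mem (ladderSeries t 0 J q) TX)
    (hTV : Mem (q ^ repunit t J - ladderSeries t 1 J q) TV) :
    Mem (clearing t 0 J q * denom t q) (ladderEval t Q TX TV J 1).1 :=
  ((isSound_mem p q).ladderEval (α := CBall p) (fun {f g a} hf hfg => by rwa [← hfg q hq]) ht hQ J 0
    (P := 1) (by simpa [repunit_zero] using mem_one) (by simpa using hTX) (by simpa using hTV)).1

/-- The clearing factor is positive on (0, 1), so a sign change of the cleared denominator gives a
zero x. At x the derivative of the cleared denominator is the clearing factor times the derivative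
of the denominator, and the factor cancels in the residue. -/
theorem rootTest_sound {t J n w k m E : ℕ} (ht : 2 ≤ t) (h : rootTest p t J n w k m E = true) :
    ∃ x : ℝ, (n : ℝ) / 2 ^ p ≤ x ∧ x ≤ (n + w : ℕ) / 2 ^ p ∧ denom t x = 0 ∧
      ∃ R : ℝ, residue t x = R ∧ |R - m / 2 ^ p| ≤ E / 2 ^ p := by
  have hp : (0 : ℝ) < 2 ^ p := by positivity
  -- N/2^p bounds the radius of a disc containing the interval and the 2^{-k}-neighbourhoods needed
  -- for the derivative of the tails.
  set N := n + w + 2 ^ (p - k) with hN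
  set M := (tailPow t (small p N) J).mag with hM
  have h' : (Nat.blt N (2 ^ p) && Nat.ble (4 * M) (2 ^ p) &&
    signTest p t J n w (nearOne p (2 * M)) (small p (2 * M)) &&
      residueTest p t J n w k m E (2 * M)) = true := h
  rw [Bool.and_eq_true, Bool.and_eq_true, Bool.and_eq_true, Nat.blt_eq, Nat.ble_eq] at h'
  obtain ⟨⟨⟨hN1, h4⟩, hs⟩, hr⟩ := h'
  have hpk : (2 : ℝ) ^ p ≤ 2 ^ (p - k) * 2 ^ k := by
    rw [← pow_add]
    exact pow_le_pow_right₀ (by norm_num) (by omega)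
  have hk : (1 : ℝ) / 2 ^ k * 2 ^ p ≤ 2 ^ (p - k) := by
    rw [one_div_mul_eq_div, div_le_iff₀ (by positivity)]
    exact hpk
  have hN1' : (N : ℝ) < 2 ^ p := by exact_mod_cast hN1
  have hNc : (N : ℝ) = n + w + 2 ^ (p - k) := by rw [hN]; push_cast; rfl
  have hq : ∀ x : ℝ, 0 ≤ x → x ≤ (n + w : ℕ) / 2 ^ p →
      (‖(x : ℂ)‖ + 1 / 2 ^ k) * 2 ^ p ≤ N := fun x h0 h1 => by
    rw [le_div_iff₀ hp] at h1
    push_cast at h1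
    rw [Complex.norm_real, Real.norm_of_nonneg h0, add_mul, hNc]
    linarith
  have hlt : ∀ x : ℝ, 0 ≤ x → x ≤ (n + w : ℕ) / 2 ^ p → ‖(x : ℂ)‖ + 1 / 2 ^ k < 1 :=
      fun x h0 h1 => by
    have := (hq x h0 h1).trans_lt hN1'
    nlinarith
  have hlt1 : ∀ x : ℝ, 0 ≤ x → x ≤ (n + w : ℕ) / 2 ^ p → ‖(x : ℂ)‖ < 1 := fun x h0 h1 => by
    have := hlt x h0 h1
    have : (0 : ℝ) < 1 / 2 ^ k := by positivity
    linarith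
  have hsm : ∀ x : ℝ, 0 ≤ x → x ≤ (n + w : ℕ) / 2 ^ p →
      ∀ z : ℂ, ‖z‖ ≤ ‖(x : ℂ)‖ + 1 / 2 ^ k → Mem z (small p N) := fun x h0 h1 z hz => by
    refine mem_small (le_trans ?_ (hq x h0 h1))
    gcongr
  have hsign : ∀ e : ℕ, e ≤ w → Mem (clearing t 0 J (((n + e : ℕ) / 2 ^ p : ℝ) : ℂ) *
      denom t (((n + e : ℕ) / 2 ^ p : ℝ) : ℂ))
      (ladderEval t (interval p (n + e) 0) (nearOne p (2 * M)) (small p (2 * M)) J 1).1 := by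
    intro e he
    have h0 : (0 : ℝ) ≤ (n + e : ℕ) / 2 ^ p := by positivity
    have h1 : ((n + e : ℕ) / 2 ^ p : ℝ) ≤ (n + w : ℕ) / 2 ^ p := by
      gcongr
    have hb := tail_bounds ht (hlt1 _ h0 h1) (hsm _ h0 h1 _ (le_add_of_nonneg_right (by positivity)))
      h4
    exact ladderEval_mem ht (hlt1 _ h0 h1) (mem_interval le_rfl le_rfl) (mem_nearOne hb.1)
      (mem_small hb.2)
  have hone : ((n + w : ℕ) / 2 ^ p : ℝ) < 1 := by
    have := hlt1 ((n + w : ℕ) / 2 ^ p) (by positivity) le_rfl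
    rwa [Complex.norm_real, Real.norm_of_nonneg (by positivity)] at this
  have hle : (n : ℝ) / 2 ^ p ≤ (n + w : ℕ) / 2 ^ p := by
    gcongr; linarith
  have hx0 : (0 : ℝ) ≤ (n : ℝ) / 2 ^ p := by positivity
  have hlo := hsign 0 (by norm_num)
  have hhi := hsign w le_rfl
  rw [Nat.add_zero] at hlo
  obtain ⟨c, hc, hc'⟩ := clearing_ofReal_pos (t := t) hx0 (hle.trans_lt hone) 0 J
  obtain ⟨c₁, hc₁, hc₁'⟩ := clearing_ofReal_pos (t := t) (hx0.trans hle) hone 0 J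
  rw [hc'] at hlo
  rw [hc₁'] at hhi
  have hroot : ∃ x : ℝ, (n : ℝ) / 2 ^ p ≤ x ∧ x ≤ (n + w : ℕ) / 2 ^ p ∧ denom t x = 0 := by
    refine exists_denom_eq_zero ht hx0 hle hone ?_
    simp only [signTest, Bool.or_eq_true, Bool.and_eq_true, decide_eq_true_eq] at hs
    have pos : ∀ {c : ℝ} {z : ℂ}, 0 < c → 0 < ((c : ℂ) * z).re → 0 < z.re := fun hc h => by
      rw [Complex.re_ofReal_mul] at h
      exact pos_of_mul_pos_right h hc.le
    have neg : ∀ {c : ℝ} {z : ℂ}, 0 < c → ((c : ℂ) * z).re < 0 → z.re < 0 := fun hc h => by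
      rw [Complex.re_ofReal_mul] at h
      exact neg_of_mul_neg_right h hc.le
    refine hs.imp (fun h => ⟨?_, ?_⟩) fun h => ⟨?_, ?_⟩
    · exact pos hc (hlo.re_pos h.1)
    · exact neg hc₁ (hhi.re_neg h.2)
    · exact neg hc (hlo.re_neg h.1)
    · exact pos hc₁ (hhi.re_pos h.2)
  obtain ⟨x, hx1, hx2, hx⟩ := hroot
  refine ⟨x, hx1, hx2, hx, (residue t x).re, Complex.ext rfl (residue_im t x), ?_⟩
  have hx0' := hx0.trans hx1
  have hxn := hlt1 x hx0' hx2
  obtain ⟨t1, t2⟩ := DBall.holds_tail ht (hsm x hx0' hx2) (hlt x hx0' hx2) h4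
  obtain ⟨⟨-, X', s1, s2⟩, ⟨s3, -⟩, -⟩ := (DBall.isSound_holds p (x : ℂ)).ladderEval (α := DBall p)
    (fun hf hfg => hf.congr hxn hfg) ht (Q := ⟨interval p n w, 1⟩)
    ⟨mem_interval hx1 hx2, 1, hasDerivAt_id _, mem_one⟩ J 0 (P := 1)
    (by simpa [repunit_zero] using (DBall.isSound_holds p (x : ℂ)).one) (by rw [zero_add]; exact t1)
    (by simp only [zero_add]; exact t2)
  simp only [residueTest, Bool.and_eq_true, Nat.blt_eq, Nat.ble_eq] at hr
  set s := ladderEval t (⟨interval p n w, 1⟩ : DBall p) ⟨nearOne p (2 * M), small p (2 * M * 2 ^ k)⟩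
    ⟨small p (2 * M), small p (2 * M * 2 ^ k)⟩ J 1
  have hC : clearing t 0 J x ≠ 0 :=
    Finset.prod_ne_zero_iff.2 fun i _ => one_sub_pow_ne_zero hxn (repunit_succ_ne_zero t _)
  have hX' : X' = clearing t 0 J x * deriv (denom t) x := by
    have d1 := (differentiable_clearing t 0 J).differentiableAt.hasDerivAt (x := (x : ℂ))
    have d2 := ((differentiableOn_ladderSeries ht 0 0).differentiableAt
      (Metric.isOpen_ball.mem_nhds (by simpa using hxn : (x : ℂ) ∈ Metric.ball 0 1))).hasDerivAt
    have d3 := s1.unique (d1.mul d2)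
    rw [d3]
    change _ * denom t x + _ = _
    rw [hx, mul_zero, zero_add]
  have hlow := s2.lower_le_norm
  have hup := (s3.add ((mem_interval (x := m / 2 ^ p) (n := m) (e := 0) le_rfl le_rfl).mul
    s2)).norm_le_upper
  have hlpos : (0 : ℝ) < s.1.der.lower := by exact_mod_cast hr.1
  have hX'n : 0 < ‖X'‖ := by
    have := hlpos.trans_le hlow
    exact pos_of_mul_pos_left this hp.le
  have hres : residue t x * X' = -(clearing t 0 J x * numer t x) := by
    have : deriv (denom t) x ≠ 0 := by
      intro h0
      rw [hX', h0, mul_zero, norm_zero] at hX'n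
      exact lt_irrefl _ hX'n
    rw [residue, hX']
    field_simp
  -- The quantity tested is numerator plus (m/2^p) times derivative: it is minus (residue - m/2^p)
  -- times the derivative, so comparing it with the lower bound for the derivative yields the error
  -- of the residue without a division.
  have hdiff : clearing t 0 J x * numer t x + ((m / 2 ^ p : ℝ) : ℂ) * X' =
      -((residue t x - ((m / 2 ^ p : ℝ) : ℂ)) * X') := by
    linear_combination hres
  change ‖clearing t 0 J x * numer t x + _‖ * _ ≤ _ at hup
  rw [hdiff, norm_neg, norm_mul] at hup
  have hre : |(residue t x).re - m / 2 ^ p| ≤ ‖residue t x - ((m / 2 ^ p : ℝ) : ℂ)‖ := by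
    have := Complex.abs_re_le_norm (residue t x - ((m / 2 ^ p : ℝ) : ℂ))
    rwa [Complex.sub_re, Complex.ofReal_re] at this
  refine hre.trans ?_
  rw [le_div_iff₀ hp]
  refine le_of_mul_le_mul_right ?_ hlpos
  have h5 : ((s.2.1.val + interval p m 0 * s.1.der).upper : ℝ) * 2 ^ p ≤ E * s.1.der.lower := by
    exact_mod_cast hr.2
  refine le_trans ?_ h5
  calc ‖residue t x - ((m / 2 ^ p : ℝ) : ℂ)‖ * 2 ^ p * s.1.der.lower
      ≤ ‖residue t x - ((m / 2 ^ p : ℝ) : ℂ)‖ * 2 ^ p * (‖X'‖ * 2 ^ p) := by gcongr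
    _ = ‖residue t x - ((m / 2 ^ p : ℝ) : ℂ)‖ * ‖X'‖ * 2 ^ p * 2 ^ p := by ring
    _ ≤ _ := by gcongr

end CBall

/-! ### The asymptotic formula from certified tests. -/

open CBall in
/-- The arc covering test on the right or left half of the circle, with a bound for the result. -/
def coverTest (t J num den n₁ n₂ : ℕ) (s : ℤ) (N S : ℕ) : Bool :=
  let M := (tailPow t (small 50 (num * 2 ^ 50 / den + 1)) J).mag
  Nat.ble (4 * M) (2 ^ 50) &&
    match cover t J num den (interval 50 (n₁ / 2 ^ 90) 2) (interval 50 (n₂ / 2 ^ 90) 2)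
      (nearOne 50 (2 * M)) (small 50 (2 * M)) s 25 0 0 N with
    | none => false
    | some x => Nat.ble x.1 S

theorem exists_errorTerm {t : ℕ} {R rho R2 rho2 R3 r3 : ℝ} (hR3 : 0 < R3) (hr3 : 0 < r3)
    (h : ∀ n : ℕ, |(gCount t n : ℝ) - R * rho ^ (n + 1) - R2 * rho2 ^ (n + 1)| ≤ R3 * r3 ^ n) :
    ∃ ε : ℕ → ℝ, ∀ n : ℕ, |ε n| ≤ 1 ∧
      (gCount t n : ℝ) = R * rho ^ (n + 1) + R2 * rho2 ^ (n + 1) + R3 * r3 ^ n * ε n := by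
  refine ⟨fun n => ((gCount t n : ℝ) - R * rho ^ (n + 1) - R2 * rho2 ^ (n + 1)) / (R3 * r3 ^ n),
    fun n => ?_⟩
  have hp : 0 < R3 * r3 ^ n := by positivity
  constructor
  · rw [abs_div, abs_of_pos hp, div_le_one hp]
    exact h n
  · field_simp
    ring

-- Zeros are isolated with 140 fractional bits but the arcs use 50. Dropping 90 bits loses less than
-- one unit, and the original width of 2^20 fits into a second one.
open CBall in
theorem interval_coarse {x : ℝ} {n : ℕ} (h1 : (n : ℝ) / 2 ^ 140 ≤ x)
    (h2 : x ≤ (n + 2 ^ 20 : ℕ) / 2 ^ 140) : Mem x (interval 50 (n / 2 ^ 90) 2) := by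
  have e1 : n / 2 ^ 90 * 2 ^ 90 ≤ n := Nat.div_mul_le_self n _
  have e2 : n + 2 ^ 20 ≤ (n / 2 ^ 90 + 2) * 2 ^ 90 := by
    have := Nat.lt_div_mul_add (a := n) (b := 2 ^ 90) (by norm_num)
    rw [add_mul]
    omega
  refine mem_interval (le_trans ?_ h1) (h2.trans ?_)
  · rw [div_le_div_iff₀ (by norm_num) (by norm_num)]
    have : ((n / 2 ^ 90 : ℕ) : ℝ) * 2 ^ 90 ≤ n := by exact_mod_cast e1
    calc ((n / 2 ^ 90 : ℕ) : ℝ) * 2 ^ 140 = (((n / 2 ^ 90 : ℕ) : ℝ) * 2 ^ 90) * 2 ^ 50 := by ring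
      _ ≤ _ := by gcongr
  · rw [div_le_div_iff₀ (by norm_num) (by norm_num)]
    have : ((n + 2 ^ 20 : ℕ) : ℝ) ≤ ((n / 2 ^ 90 + 2 : ℕ) : ℝ) * 2 ^ 90 := by exact_mod_cast e2
    calc ((n + 2 ^ 20 : ℕ) : ℝ) * 2 ^ 50 ≤ (((n / 2 ^ 90 + 2 : ℕ) : ℝ) * 2 ^ 90) * 2 ^ 50 := by gcongr
      _ = _ := by ring

open CBall in
/-- The asymptotic formula for a fixed `t` from the certified tests. -/
theorem exists_constants_of_tests {t J J' num den n₁ m₁ n₂ m₂ N₁ N₂ S₁ S₂ : ℕ} {R3 : ℝ} (ht : 2 ≤ t)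
    (hn : 0 < num) (hd : num < den) (hn1 : 0 < n₁)
    (h12 : n₁ + 2 ^ 20 < n₂) (h2r : (n₂ + 2 ^ 20) * den < num * 2 ^ 140) (hm1 : 2 ^ 40 < m₁)
    (hm2 : 2 ^ 40 < m₂)
    (r1 : rootTest 140 t J n₁ (2 ^ 20) 8 m₁ (2 ^ 40) = true) (r2 : rootTest 140 t J n₂ (2 ^ 20) 8 m₂ (2 ^ 40) = true)
    (c1 : coverTest t J' num den n₁ n₂ 1 N₁ S₁ = true)
    (c2 : coverTest t J' num den n₁ n₂ (-1) N₂ S₂ = true)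
    (hR3 : ((S₁ + S₂ : ℕ) : ℝ) / (512 * 2 ^ 30 * 3) +
      (m₁ + 2 ^ 40 : ℝ) / 2 ^ 140 / ((num : ℝ) / den - (n₁ + 2 ^ 20 : ℕ) / 2 ^ 140) +
      (m₂ + 2 ^ 40 : ℝ) / 2 ^ 140 / ((num : ℝ) / den - (n₂ + 2 ^ 20 : ℕ) / 2 ^ 140) ≤ R3) :
    ∃ rho rho2 R R2 : ℝ, (2 ^ 140 / (n₁ + 2 ^ 20 : ℕ) ≤ rho ∧ rho ≤ 2 ^ 140 / n₁) ∧
      (2 ^ 140 / (n₂ + 2 ^ 20 : ℕ) ≤ rho2 ∧ rho2 ≤ 2 ^ 140 / n₂) ∧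
      |R - m₁ / 2 ^ 140| ≤ 1 / 2 ^ 100 ∧ |R2 - m₂ / 2 ^ 140| ≤ 1 / 2 ^ 100 ∧
      0 < R3 ∧ 0 < R ∧ 0 < R2 ∧ rho2 < rho ∧ (den : ℝ) / num < rho2 ∧
      ∃ ε : ℕ → ℝ, ∀ n : ℕ, |ε n| ≤ 1 ∧ (gCount t n : ℝ) =
        R * rho ^ (n + 1) + R2 * rho2 ^ (n + 1) + R3 * ((den : ℝ) / num) ^ n * ε n := by
  obtain ⟨a, a1, a2, ha, R, hR, hRb⟩ := rootTest_sound ht r1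
  obtain ⟨b, b1, b2, hb, R2, hR2, hR2b⟩ := rootTest_sound ht r2
  have hP : (0 : ℝ) < 2 ^ 140 := by positivity
  have hden : 0 < den := hn.trans hd
  have hnum' : (0 : ℝ) < num := by exact_mod_cast hn
  have hden' : (0 : ℝ) < den := by exact_mod_cast hden
  have hn1' : (0 : ℝ) < n₁ := by exact_mod_cast hn1
  have ha0 : 0 < a := lt_of_lt_of_le (by positivity) a1
  have hn2' : (0 : ℝ) < n₂ := by exact_mod_cast (by omega : 0 < n₂)
  have hb0 : 0 < b := lt_of_lt_of_le (by positivity) b1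
  have hab : a < b := by
    refine (a2.trans_lt ?_).trans_le b1
    gcongr
  have hbr' : ((n₂ + 2 ^ 20 : ℕ) : ℝ) / 2 ^ 140 < (num : ℝ) / den := by
    rw [div_lt_div_iff₀ hP hden']
    exact_mod_cast h2r
  have har' : ((n₁ + 2 ^ 20 : ℕ) : ℝ) / 2 ^ 140 < (num : ℝ) / den := by
    refine lt_of_le_of_lt ?_ hbr'
    gcongr
    omega
  have hbr : b < (num : ℝ) / den := b2.trans_lt hbr'
  have har : a < (num : ℝ) / den := hab.trans hbr
  have hE : ((2 ^ 40 : ℕ) : ℝ) / 2 ^ 140 = 1 / 2 ^ 100 := by norm_num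
  rw [hE] at hRb hR2b
  have hm1' : (1 : ℝ) / 2 ^ 100 < m₁ / 2 ^ 140 := by
    rw [← hE]; gcongr
  have hm2' : (1 : ℝ) / 2 ^ 100 < m₂ / 2 ^ 140 := by
    rw [← hE]; gcongr
  have hRpos : 0 < R := by linarith [(abs_le.1 hRb).1]
  have hR2pos : 0 < R2 := by linarith [(abs_le.1 hR2b).1]
  have hRle : R ≤ (m₁ + 2 ^ 40 : ℝ) / 2 ^ 140 := by
    rw [add_div]
    have : (2 ^ 40 : ℝ) / 2 ^ 140 = 1 / 2 ^ 100 := by norm_num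
    linarith [(abs_le.1 hRb).2]
  have hR2le : R2 ≤ (m₂ + 2 ^ 40 : ℝ) / 2 ^ 140 := by
    rw [add_div]
    have : (2 ^ 40 : ℝ) / 2 ^ 140 = 1 / 2 ^ 100 := by norm_num
    linarith [(abs_le.1 hR2b).2]
  simp only [coverTest, Bool.and_eq_true, Nat.ble_eq] at c1 c2
  -- The tail bound depends only on the radius, so the same enclosure serves both covers and its
  -- copy in the second test can be dropped.
  obtain ⟨h4, c1⟩ := c1
  obtain ⟨-, c2⟩ := c2
  set N := num * 2 ^ 50 / den + 1 with hN
  set M := (tailPow t (small 50 N) J').mag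
  have hr1 : (num : ℝ) / den < 1 := (div_lt_one hden').2 (by exact_mod_cast hd)
  have hsm : ∀ q : ℂ, ‖q‖ = (num : ℝ) / den → Mem q (small 50 N) := fun q hq => by
    refine mem_small ?_
    rw [hq]
    rw [hN, Nat.cast_add_one]
    calc (num : ℝ) / den * 2 ^ 50 = (num * 2 ^ 50 : ℕ) / den := by push_cast; ring
      _ ≤ _ := natDiv_add_one_ge (num * 2 ^ 50) den
  have htl : ∀ q : ℂ, ‖q‖ = (num : ℝ) / den → _ := fun q hq =>
    tail_bounds ht (q := q) (by rw [hq]; exact hr1) (hsm q hq) h4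
  split at c1
  · simp at c1
  rename_i x₁ hx₁
  split at c2
  · simp at c2
  rename_i x₂ hx₂
  have hc1 : x₁.1 ≤ S₁ := by simpa using c1
  have hc2 : x₂.1 ≤ S₂ := by simpa using c2
  have key := norm_coeff_le_of_cover ht hn hd ha0 hb0 har hbr hab.ne ha hb
    (interval_coarse a1 a2) (interval_coarse b1 b2) (fun q hq => mem_nearOne (htl q hq).1)
    (fun q hq => mem_small (htl q hq).2) (by norm_num) hx₁ hx₂
  rw [hR, hR2, Complex.norm_real, Complex.norm_real, Real.norm_of_nonneg hRpos.le,
    Real.norm_of_nonneg hR2pos.le] at key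
  have hbound : ((x₁.1 + x₂.1 : ℕ) : ℝ) / (512 * 2 ^ 30 * 3) + R / ((num : ℝ) / den - a) +
      R2 / ((num : ℝ) / den - b) ≤ R3 := by
    refine le_trans ?_ hR3
    have e1 : 0 < (num : ℝ) / den - (n₁ + 2 ^ 20 : ℕ) / 2 ^ 140 := by linarith
    have e2 : 0 < (num : ℝ) / den - (n₂ + 2 ^ 20 : ℕ) / 2 ^ 140 := by linarith
    gcongr
  have hR3pos : 0 < R3 := by
    refine lt_of_lt_of_le ?_ hbound
    have e1 : 0 < (num : ℝ) / den - a := by linarith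
    have e2 : 0 < (num : ℝ) / den - b := by linarith
    positivity
  refine ⟨a⁻¹, b⁻¹, R, R2, ⟨?_, ?_⟩, ⟨?_, ?_⟩, hRb, hR2b, hR3pos, hRpos, hR2pos, ?_, ?_, ?_⟩
  · rw [← inv_div]
    exact inv_anti₀ ha0 a2
  · rw [← inv_div]
    exact inv_anti₀ (by positivity) a1
  · rw [← inv_div]
    exact inv_anti₀ hb0 b2
  · rw [← inv_div]
    exact inv_anti₀ (by positivity) b1
  · exact (inv_lt_inv₀ hb0 ha0).2 hab
  · rw [← inv_div]
    exact (inv_lt_inv₀ (by positivity) hb0).2 hbr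
  · refine exists_errorTerm hR3pos (by positivity) fun n => ?_
    have h := key n
    have e : (gCount t n : ℂ) - R * ((a⁻¹ : ℝ) : ℂ) ^ (n + 1) - R2 * ((b⁻¹ : ℝ) : ℂ) ^ (n + 1) =
        (((gCount t n : ℝ) - R * a⁻¹ ^ (n + 1) - R2 * b⁻¹ ^ (n + 1) : ℝ) : ℂ) := by
      push_cast; rfl
    rw [e, Complex.norm_real, Real.norm_eq_abs] at h
    refine h.trans ?_
    gcongr

/-- The constants `c` satisfy the asymptotic formula for `g_t`. -/
def AsympConstants.Describes (c : AsympConstants) (t : ℕ) : Prop :=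
  c.r3 < c.rho2 ∧ c.rho2 < c.rho ∧ 0 < c.R ∧ 0 < c.R2 ∧ 0 < c.R3 ∧
    ∃ ε : ℕ → ℝ, ∀ n : ℕ, |ε n| ≤ 1 ∧
      (gCount t n : ℝ) =
        c.R * c.rho ^ (n + 1) + c.R2 * c.rho2 ^ (n + 1) + c.R3 * c.r3 ^ n * ε n

/-- The constants `c` satisfy the expansions claimed for `t ≤ 15`. -/
def AsympConstants.Expands (c : AsympConstants) (t : ℕ) : Prop :=
  (3 ≤ t →
    |c.rho - (2 - 1 / 2 ^ (t + 1) - ((t : ℝ) + 3) / 2 ^ (2 * t + 3)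
      - (3 * (t : ℝ) ^ 2 + 19 * (t : ℝ) + 24) / 2 ^ (3 * t + 6))|
      ≤ 0.28 * (t : ℝ) ^ 3 / 2 ^ (4 * t)) ∧
  (6 ≤ t →
    |c.R - (1 / 8 + ((t : ℝ) - 2) / 2 ^ (t + 5)
      + (2 * (t : ℝ) ^ 2 + 3 * (t : ℝ) - 5) / 2 ^ (2 * t + 7)
      + (9 * (t : ℝ) ^ 3 + 45 * (t : ℝ) ^ 2 + 20 * (t : ℝ) - 68) / 2 ^ (3 * t + 10))|
      ≤ (t : ℝ) ^ 4 / (50 * 2 ^ (4 * t))) ∧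
  |c.R2 - (1 / (4 * (t : ℝ)) - (4 * Real.log 2 + 1) / (8 * (t : ℝ) ^ 2))|
    ≤ 0.77 / (t : ℝ) ^ 3

/-- The radius is 1000/`den`, so that r₃ is a decimal with three places. Each cover may cost 12·2^39
and 512·2^30 = 2^39, hence the integral contributes 24/3 = 8 to R₃; the other two summands bound the
principal parts on the circle. -/
theorem AsympConstants.exists_of_tests {t J J' den n₁ m₁ n₂ m₂ N₁ N₂ : ℕ} {R3 : ℝ} (ht : 2 ≤ t)
    (hd : 1000 < den) (hn1 : 0 < n₁) (h12 : n₁ + 2 ^ 20 < n₂)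
    (h2r : (n₂ + 2 ^ 20) * den < 1000 * 2 ^ 140) (hm1 : 2 ^ 40 < m₁) (hm2 : 2 ^ 40 < m₂)
    (r1 : CBall.rootTest 140 t J n₁ (2 ^ 20) 8 m₁ (2 ^ 40) = true)
    (r2 : CBall.rootTest 140 t J n₂ (2 ^ 20) 8 m₂ (2 ^ 40) = true)
    (c1 : coverTest t J' 1000 den n₁ n₂ 1 N₁ (12 * 2 ^ 39) = true)
    (c2 : coverTest t J' 1000 den n₁ n₂ (-1) N₂ (12 * 2 ^ 39) = true)
    (hR3 : (8 : ℝ) + (m₁ + 2 ^ 40 : ℝ) / 2 ^ 140 / (1000 / den - (n₁ + 2 ^ 20) / 2 ^ 140) +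
      (m₂ + 2 ^ 40 : ℝ) / 2 ^ 140 / (1000 / den - (n₂ + 2 ^ 20) / 2 ^ 140) ≤ R3) :
    ∃ c : AsympConstants, c.Describes t ∧ (2 ^ 140 / (n₁ + 2 ^ 20) ≤ c.rho ∧ c.rho ≤ 2 ^ 140 / n₁) ∧
      (2 ^ 140 / (n₂ + 2 ^ 20) ≤ c.rho2 ∧ c.rho2 ≤ 2 ^ 140 / n₂) ∧
      (m₁ / 2 ^ 140 - 1 / 2 ^ 100 ≤ c.R ∧ c.R ≤ m₁ / 2 ^ 140 + 1 / 2 ^ 100) ∧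
      (m₂ / 2 ^ 140 - 1 / 2 ^ 100 ≤ c.R2 ∧ c.R2 ≤ m₂ / 2 ^ 140 + 1 / 2 ^ 100) ∧
      c.R3 = R3 ∧ c.r3 = den / 1000 := by
  obtain ⟨rho, rho2, R, R2, h1, h2, h3, h4, h5, h6, h7, h8, h9, ε, h10⟩ :=
    exists_constants_of_tests ht (by norm_num) hd hn1 h12 h2r hm1 hm2 r1 r2 c1 c2
      (R3 := R3) (le_trans (le_of_eq (by push_cast; ring)) hR3)
  rw [abs_le] at h3 h4
  simp only [Nat.cast_add, Nat.cast_pow, Nat.cast_ofNat] at h1 h2 h9 h10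
  exact ⟨⟨rho, rho2, den / 1000, R, R2, R3⟩, ⟨h9, h8, h6, h7, h5, ε, h10⟩, h1, h2,
    ⟨by linarith [h3.1], by linarith [h3.2]⟩, ⟨by linarith [h4.1], by linarith [h4.2]⟩, rfl, rfl⟩

/-! ### The rows of the table, 2 ≤ t ≤ 15. -/

/-- In this and the following certificates, n₁ and n₂ are the zeros 1/ρ and 1/ρ₂ in units of
2^{-140}, m₁ and m₂ the residues in the same unit, and N₁ and N₂ the bisection trees of the two
quadrants. J and J' are the levels evaluated explicitly; fewer are needed as t grows because [J]
grows like t^{J-1}. -/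
theorem exists_constants_2 :
    ∃ c : AsympConstants, c.Describes 2 ∧ c.MatchesTable 2 ∧ c.Expands 2 := by
  obtain ⟨c, h, ⟨a1, a2⟩, ⟨b1, b2⟩, ⟨R1, R2⟩, ⟨S1, S2⟩, h3, h4⟩ :=
    AsympConstants.exists_of_tests (t := 2) (J := 8) (J' := 5) (den := 1123) (R3 := 36.6) (n₁ := 776857430976955609592917651881156107665545)
    (m₁ := 197714507206399153205675242588524895810784)
    (n₂ := 1089287263052924873117751990003478925340400)
    (m₂ := 85357553233114590276284023582175026118469)
    (N₁ := 4021498703988948472172961586795388645589062484536215760293099516188793846152172486390971585483401676357290447858914199727295616686013785121807437963033194938492667841699330037536403564334322493281236922573118245691029393997394122142036809422127261839157036720036852615926972293927561152006027739147464583647681332999162376030890912253145117066341132648111825256934266710269005481696342817162260534557261725167012443752545273670040661790819734544128722378232502212936981136119291348157350797663847673233407)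
    (N₂ := 11090744161719587528938433705450310250677599861188891907647818566207024371495877064929123875779518607473771704991)
    (by norm_num) (by norm_num) (by norm_num) (by norm_num) (by norm_num) (by norm_num)
    (by norm_num) (by decide +kernel) (by decide +kernel) (by decide +kernel) (by decide +kernel)
    (by norm_num)
  have l1 := Real.log_two_gt_d9
  have l2 := Real.log_two_lt_d9
  norm_num at a1 a2 b1 b2 R1 R2 S1 S2 h4
  refine ⟨c, h, ⟨?_, ?_, ?_, ?_, ?_, ?_⟩, fun h => ?_, fun h => ?_, ?_⟩
  · norm_num [abs_le]; constructor <;> linarith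
  · norm_num [abs_le]; constructor <;> linarith
  · rw [h4]; norm_num
  · norm_num [abs_le]; constructor <;> linarith
  · norm_num [abs_le]; constructor <;> linarith
  · exact h3
  · norm_num at h
  · norm_num at h
  · norm_num [abs_le]; constructor <;> linarith

theorem exists_constants_3 :
    ∃ c : AsympConstants, c.Describes 3 ∧ c.MatchesTable 3 ∧ c.Expands 3 := by
  obtain ⟨c, h, ⟨a1, a2⟩, ⟨b1, b2⟩, ⟨R1, R2⟩, ⟨S1, S2⟩, h3, h4⟩ :=
    AsympConstants.exists_of_tests (t := 3) (J := 5) (J' := 4) (den := 1098) (R3 := 39.0) (n₁ := 725666411312722590696983208207186488055926)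
    (m₁ := 186584948554826563026774181207427487430363)
    (n₂ := 1150491374499633090428688438449009592862884)
    (m₂ := 70257462296659018624494464041079817446188)
    (N₁ := 152572916468183357899272179143671952930237731631425488156087806214341946912292662929888255)
    (N₂ := 148764327947529247355806045788681633649873668035587369341349495159124888094845088975359)
    (by norm_num) (by norm_num) (by norm_num) (by norm_num) (by norm_num) (by norm_num)
    (by norm_num) (by decide +kernel) (by decide +kernel) (by decide +kernel) (by decide +kernel)
    (by norm_num)
  have l1 := Real.log_two_gt_d9
  have l2 := Real.log_two_lt_d9
  norm_num at a1 a2 b1 b2 R1 R2 S1 S2 h4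
  refine ⟨c, h, ⟨?_, ?_, ?_, ?_, ?_, ?_⟩, fun h => ?_, fun h => ?_, ?_⟩
  · norm_num [abs_le]; constructor <;> linarith
  · norm_num [abs_le]; constructor <;> linarith
  · rw [h4]; norm_num
  · norm_num [abs_le]; constructor <;> linarith
  · norm_num [abs_le]; constructor <;> linarith
  · exact h3
  · norm_num [abs_le]; constructor <;> linarith
  · norm_num at h
  · norm_num [abs_le]; constructor <;> linarith

theorem exists_constants_4 :
    ∃ c : AsympConstants, c.Describes 4 ∧ c.MatchesTable 4 ∧ c.Expands 4 := by
  obtain ⟨c, h, ⟨a1, a2⟩, ⟨b1, b2⟩, ⟨R1, R2⟩, ⟨S1, S2⟩, h3, h4⟩ :=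
    AsympConstants.exists_of_tests (t := 4) (J := 5) (J' := 3) (den := 1083) (R3 := 58.4) (n₁ := 709446712083163719469317160830932669060650)
    (m₁ := 181924359930055618862081838156476038967286)
    (n₂ := 1196229289797360190999783052202184576346848)
    (m₂ := 59096547015759423484812450111691426531400)
    (N₁ := 810305636002602730394999012636427543688641823285689212004520837353678355376890045303613932518740409556233497401157819290510847)
    (N₂ := 431754679670257191251275217892486303)
    (by norm_num) (by norm_num) (by norm_num) (by norm_num) (by norm_num) (by norm_num)
    (by norm_num) (by decide +kernel) (by decide +kernel) (by decide +kernel) (by decide +kernel)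
    (by norm_num)
  have l1 := Real.log_two_gt_d9
  have l2 := Real.log_two_lt_d9
  norm_num at a1 a2 b1 b2 R1 R2 S1 S2 h4
  refine ⟨c, h, ⟨?_, ?_, ?_, ?_, ?_, ?_⟩, fun h => ?_, fun h => ?_, ?_⟩
  · norm_num [abs_le]; constructor <;> linarith
  · norm_num [abs_le]; constructor <;> linarith
  · rw [h4]; norm_num
  · norm_num [abs_le]; constructor <;> linarith
  · norm_num [abs_le]; constructor <;> linarith
  · exact h3
  · norm_num [abs_le]; constructor <;> linarith
  · norm_num at h
  · norm_num [abs_le]; constructor <;> linarith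

theorem exists_constants_5 :
    ∃ c : AsympConstants, c.Describes 5 ∧ c.MatchesTable 5 ∧ c.Expands 5 := by
  obtain ⟨c, h, ⟨a1, a2⟩, ⟨b1, b2⟩, ⟨R1, R2⟩, ⟨S1, S2⟩, h3, h4⟩ :=
    AsympConstants.exists_of_tests (t := 5) (J := 5) (J' := 3) (den := 1074) (R3 := 70.7) (n₁ := 702768517531903478079546369165439084898374)
    (m₁ := 179058069834282269668790771443058434056524)
    (n₂ := 1228599461771416418178248086357933447773505)
    (m₂ := 50639171663431637394525976803525872298096)
    (N₁ := 750317258177663878433462249330007089622790983421585677773073705086162529598725209191798211583834333630482943)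
    (N₂ := 6371742182412933876761636235188259071)
    (by norm_num) (by norm_num) (by norm_num) (by norm_num) (by norm_num) (by norm_num)
    (by norm_num) (by decide +kernel) (by decide +kernel) (by decide +kernel) (by decide +kernel)
    (by norm_num)
  have l1 := Real.log_two_gt_d9
  have l2 := Real.log_two_lt_d9
  norm_num at a1 a2 b1 b2 R1 R2 S1 S2 h4
  refine ⟨c, h, ⟨?_, ?_, ?_, ?_, ?_, ?_⟩, fun h => ?_, fun h => ?_, ?_⟩
  · norm_num [abs_le]; constructor <;> linarith
  · norm_num [abs_le]; constructor <;> linarith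
  · rw [h4]; norm_num
  · norm_num [abs_le]; constructor <;> linarith
  · norm_num [abs_le]; constructor <;> linarith
  · exact h3
  · norm_num [abs_le]; constructor <;> linarith
  · norm_num at h
  · norm_num [abs_le]; constructor <;> linarith

theorem exists_constants_6 :
    ∃ c : AsympConstants, c.Describes 6 ∧ c.MatchesTable 6 ∧ c.Expands 6 := by
  obtain ⟨c, h, ⟨a1, a2⟩, ⟨b1, b2⟩, ⟨R1, R2⟩, ⟨S1, S2⟩, h3, h4⟩ :=
    AsympConstants.exists_of_tests (t := 6) (J := 5) (J' := 3) (den := 1068) (R3 := 50.0) (n₁ := 699733195014197474949993564661195393601536)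
    (m₁ := 177193351955680861545310194365340655474979)
    (n₂ := 1252265694222371759943569368530047079616389)
    (m₂ := 44167397994658063276820655055019049336508)
    (N₁ := 9619687131693679009224081540873309654809596963256626609657414930242054603359458017143494056447)
    (N₂ := 407336847752285143494974785918181612703)
    (by norm_num) (by norm_num) (by norm_num) (by norm_num) (by norm_num) (by norm_num)
    (by norm_num) (by decide +kernel) (by decide +kernel) (by decide +kernel) (by decide +kernel)
    (by norm_num)
  have l1 := Real.log_two_gt_d9
  have l2 := Real.log_two_lt_d9
  norm_num at a1 a2 b1 b2 R1 R2 S1 S2 h4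
  refine ⟨c, h, ⟨?_, ?_, ?_, ?_, ?_, ?_⟩, fun h => ?_, fun h => ?_, ?_⟩
  · norm_num [abs_le]; constructor <;> linarith
  · norm_num [abs_le]; constructor <;> linarith
  · rw [h4]; norm_num
  · norm_num [abs_le]; constructor <;> linarith
  · norm_num [abs_le]; constructor <;> linarith
  · exact h3
  · norm_num [abs_le]; constructor <;> linarith
  · norm_num [abs_le]; constructor <;> linarith
  · norm_num [abs_le]; constructor <;> linarith

theorem exists_constants_7 :
    ∃ c : AsympConstants, c.Describes 7 ∧ c.MatchesTable 7 ∧ c.Expands 7 := by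
  obtain ⟨c, h, ⟨a1, a2⟩, ⟨b1, b2⟩, ⟨R1, R2⟩, ⟨S1, S2⟩, h3, h4⟩ :=
    AsympConstants.exists_of_tests (t := 7) (J := 4) (J' := 3) (den := 1063) (R3 := 59.6) (n₁ := 698289591852037976879076851080759827323320)
    (m₁ := 176005406289869595709430551662150451805134)
    (n₂ := 1270177704024371806462455888510238379464835)
    (m₂ := 39132236473505421090172753159510038929187)
    (N₁ := 2499754663414716133466937175581086450782872507741997139545778662805823059246502684507805160447)
    (N₂ := 1591164113898733089068411858333754495)
    (by norm_num) (by norm_num) (by norm_num) (by norm_num) (by norm_num) (by norm_num)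
    (by norm_num) (by decide +kernel) (by decide +kernel) (by decide +kernel) (by decide +kernel)
    (by norm_num)
  have l1 := Real.log_two_gt_d9
  have l2 := Real.log_two_lt_d9
  norm_num at a1 a2 b1 b2 R1 R2 S1 S2 h4
  refine ⟨c, h, ⟨?_, ?_, ?_, ?_, ?_, ?_⟩, fun h => ?_, fun h => ?_, ?_⟩
  · norm_num [abs_le]; constructor <;> linarith
  · norm_num [abs_le]; constructor <;> linarith
  · rw [h4]; norm_num
  · norm_num [abs_le]; constructor <;> linarith
  · norm_num [abs_le]; constructor <;> linarith
  · exact h3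
  · norm_num [abs_le]; constructor <;> linarith
  · norm_num [abs_le]; constructor <;> linarith
  · norm_num [abs_le]; constructor <;> linarith

theorem exists_constants_8 :
    ∃ c : AsympConstants, c.Describes 8 ∧ c.MatchesTable 8 ∧ c.Expands 8 := by
  obtain ⟨c, h, ⟨a1, a2⟩, ⟨b1, b2⟩, ⟨R1, R2⟩, ⟨S1, S2⟩, h3, h4⟩ :=
    AsympConstants.exists_of_tests (t := 8) (J := 4) (J' := 3) (den := 1059) (R3 := 48.1) (n₁ := 697586964619764810423215860254727595720896)
    (m₁ := 175270475093246294893287446609707459881357)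
    (n₂ := 1284144453280817778410186848633445542538612)
    (m₂ := 35131603063884876823232414818109276247125)
    (N₁ := 152334572593913667148077605149135277293722685102573540135780520841675891306049718853407743)
    (N₂ := 379362001683109731087289840287)
    (by norm_num) (by norm_num) (by norm_num) (by norm_num) (by norm_num) (by norm_num)
    (by norm_num) (by decide +kernel) (by decide +kernel) (by decide +kernel) (by decide +kernel)
    (by norm_num)
  have l1 := Real.log_two_gt_d9
  have l2 := Real.log_two_lt_d9
  norm_num at a1 a2 b1 b2 R1 R2 S1 S2 h4
  refine ⟨c, h, ⟨?_, ?_, ?_, ?_, ?_, ?_⟩, fun h => ?_, fun h => ?_, ?_⟩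
  · norm_num [abs_le]; constructor <;> linarith
  · norm_num [abs_le]; constructor <;> linarith
  · rw [h4]; norm_num
  · norm_num [abs_le]; constructor <;> linarith
  · norm_num [abs_le]; constructor <;> linarith
  · exact h3
  · norm_num [abs_le]; constructor <;> linarith
  · norm_num [abs_le]; constructor <;> linarith
  · norm_num [abs_le]; constructor <;> linarith

theorem exists_constants_9 :
    ∃ c : AsympConstants, c.Describes 9 ∧ c.MatchesTable 9 ∧ c.Expands 9 := by
  obtain ⟨c, h, ⟨a1, a2⟩, ⟨b1, b2⟩, ⟨R1, R2⟩, ⟨S1, S2⟩, h3, h4⟩ :=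
    AsympConstants.exists_of_tests (t := 9) (J := 4) (J' := 2) (den := 1056) (R3 := 24.0) (n₁ := 697240749827673058730121699559492029161835)
    (m₁ := 174827815222753016145975752240725141062836)
    (n₂ := 1295310866296266314290129076772531824427791)
    (m₂ := 31884416971034518725312232112516418414761)
    (N₁ := 138534569194663662778607007954268686323135243858606170680053750341838351995903)
    (N₂ := 1413222131961036509759)
    (by norm_num) (by norm_num) (by norm_num) (by norm_num) (by norm_num) (by norm_num)
    (by norm_num) (by decide +kernel) (by decide +kernel) (by decide +kernel) (by decide +kernel)
    (by norm_num)
  have l1 := Real.log_two_gt_d9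
  have l2 := Real.log_two_lt_d9
  norm_num at a1 a2 b1 b2 R1 R2 S1 S2 h4
  refine ⟨c, h, ⟨?_, ?_, ?_, ?_, ?_, ?_⟩, fun h => ?_, fun h => ?_, ?_⟩
  · norm_num [abs_le]; constructor <;> linarith
  · norm_num [abs_le]; constructor <;> linarith
  · rw [h4]; norm_num
  · norm_num [abs_le]; constructor <;> linarith
  · norm_num [abs_le]; constructor <;> linarith
  · exact h3
  · norm_num [abs_le]; constructor <;> linarith
  · norm_num [abs_le]; constructor <;> linarith
  · norm_num [abs_le]; constructor <;> linarith

theorem exists_constants_10 :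
    ∃ c : AsympConstants, c.Describes 10 ∧ c.MatchesTable 10 ∧ c.Expands 10 := by
  obtain ⟨c, h, ⟨a1, a2⟩, ⟨b1, b2⟩, ⟨R1, R2⟩, ⟨S1, S2⟩, h3, h4⟩ :=
    AsympConstants.exists_of_tests (t := 10) (J := 4) (J' := 2) (den := 1053) (R3 := 19.7) (n₁ := 697069013071762003376129555103139405766147)
    (m₁ := 174567208179417294315320849655127673581513)
    (n₂ := 1304428348331464717748568408018133142875148)
    (m₂ := 29196682768858847677733127483000341312927)
    (N₁ := 135359757418645580561884772071022266240403688500016689566741350154739528703)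
    (N₂ := 5375942868380810943437999)
    (by norm_num) (by norm_num) (by norm_num) (by norm_num) (by norm_num) (by norm_num)
    (by norm_num) (by decide +kernel) (by decide +kernel) (by decide +kernel) (by decide +kernel)
    (by norm_num)
  have l1 := Real.log_two_gt_d9
  have l2 := Real.log_two_lt_d9
  norm_num at a1 a2 b1 b2 R1 R2 S1 S2 h4
  refine ⟨c, h, ⟨?_, ?_, ?_, ?_, ?_, ?_⟩, fun h => ?_, fun h => ?_, ?_⟩
  · norm_num [abs_le]; constructor <;> linarith
  · norm_num [abs_le]; constructor <;> linarith
  · rw [h4]; norm_num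
  · norm_num [abs_le]; constructor <;> linarith
  · norm_num [abs_le]; constructor <;> linarith
  · exact h3
  · norm_num [abs_le]; constructor <;> linarith
  · norm_num [abs_le]; constructor <;> linarith
  · norm_num [abs_le]; constructor <;> linarith

theorem exists_constants_11 :
    ∃ c : AsympConstants, c.Describes 11 ∧ c.MatchesTable 11 ∧ c.Expands 11 := by
  obtain ⟨c, h, ⟨a1, a2⟩, ⟨b1, b2⟩, ⟨R1, R2⟩, ⟨S1, S2⟩, h3, h4⟩ :=
    AsympConstants.exists_of_tests (t := 11) (J := 4) (J' := 2) (den := 1050) (R3 := 20.1) (n₁ := 696983514230541378716714765711873703483538)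
    (m₁ := 174416684451654791946680972707990479762682)
    (n₂ := 1312006717076516902179576276325676004431135)
    (m₂ := 26933688313135796223952293466769400561850)
    (N₁ := 616547904636557603719042905907808169336855581778749591642342894606823525396457471)
    (N₂ := 5802788361137079793374271)
    (by norm_num) (by norm_num) (by norm_num) (by norm_num) (by norm_num) (by norm_num)
    (by norm_num) (by decide +kernel) (by decide +kernel) (by decide +kernel) (by decide +kernel)
    (by norm_num)
  have l1 := Real.log_two_gt_d9
  have l2 := Real.log_two_lt_d9
  norm_num at a1 a2 b1 b2 R1 R2 S1 S2 h4
  refine ⟨c, h, ⟨?_, ?_, ?_, ?_, ?_, ?_⟩, fun h => ?_, fun h => ?_, ?_⟩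
  · norm_num [abs_le]; constructor <;> linarith
  · norm_num [abs_le]; constructor <;> linarith
  · rw [h4]; norm_num
  · norm_num [abs_le]; constructor <;> linarith
  · norm_num [abs_le]; constructor <;> linarith
  · exact h3
  · norm_num [abs_le]; constructor <;> linarith
  · norm_num [abs_le]; constructor <;> linarith
  · norm_num [abs_le]; constructor <;> linarith

theorem exists_constants_12 :
    ∃ c : AsympConstants, c.Describes 12 ∧ c.MatchesTable 12 ∧ c.Expands 12 := by
  obtain ⟨c, h, ⟨a1, a2⟩, ⟨b1, b2⟩, ⟨R1, R2⟩, ⟨S1, S2⟩, h3, h4⟩ :=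
    AsympConstants.exists_of_tests (t := 12) (J := 4) (J' := 2) (den := 1047) (R3 := 26.6) (n₁ := 696940864347525307684289600280263972464798)
    (m₁ := 174331117586797308752436172527075474040325)
    (n₂ := 1318402207610970475630070558493995711877792)
    (m₂ := 25000382073312594671942920044802487678136)
    (N₁ := 6160662928954718650476413645166458909612797058852419609720315969247964487432172964358143)
    (N₂ := 90445419293569457921199)
    (by norm_num) (by norm_num) (by norm_num) (by norm_num) (by norm_num) (by norm_num)
    (by norm_num) (by decide +kernel) (by decide +kernel) (by decide +kernel) (by decide +kernel)
    (by norm_num)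
  have l1 := Real.log_two_gt_d9
  have l2 := Real.log_two_lt_d9
  norm_num at a1 a2 b1 b2 R1 R2 S1 S2 h4
  refine ⟨c, h, ⟨?_, ?_, ?_, ?_, ?_, ?_⟩, fun h => ?_, fun h => ?_, ?_⟩
  · norm_num [abs_le]; constructor <;> linarith
  · norm_num [abs_le]; constructor <;> linarith
  · rw [h4]; norm_num
  · norm_num [abs_le]; constructor <;> linarith
  · norm_num [abs_le]; constructor <;> linarith
  · exact h3
  · norm_num [abs_le]; constructor <;> linarith
  · norm_num [abs_le]; constructor <;> linarith
  · norm_num [abs_le]; constructor <;> linarith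

theorem exists_constants_13 :
    ∃ c : AsympConstants, c.Describes 13 ∧ c.MatchesTable 13 ∧ c.Expands 13 := by
  obtain ⟨c, h, ⟨a1, a2⟩, ⟨b1, b2⟩, ⟨R1, R2⟩, ⟨S1, S2⟩, h3, h4⟩ :=
    AsympConstants.exists_of_tests (t := 13) (J := 4) (J' := 2) (den := 1044) (R3 := 80.6) (n₁ := 696919566144011389492517140461202207603802)
    (m₁ := 174283118324127069453960094002626241347103)
    (n₂ := 1323870292908909358991850625096749462855242)
    (m₂ := 23328287379120685889770164080343328113120)
    (N₁ := 163522532944342420648763205795065018563779965972326074866632174815513204048999836588772597620221951)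
    (N₂ := 23086748602681523170390591)
    (by norm_num) (by norm_num) (by norm_num) (by norm_num) (by norm_num) (by norm_num)
    (by norm_num) (by decide +kernel) (by decide +kernel) (by decide +kernel) (by decide +kernel)
    (by norm_num)
  have l1 := Real.log_two_gt_d9
  have l2 := Real.log_two_lt_d9
  norm_num at a1 a2 b1 b2 R1 R2 S1 S2 h4
  refine ⟨c, h, ⟨?_, ?_, ?_, ?_, ?_, ?_⟩, fun h => ?_, fun h => ?_, ?_⟩
  · norm_num [abs_le]; constructor <;> linarith
  · norm_num [abs_le]; constructor <;> linarith
  · rw [h4]; norm_num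
  · norm_num [abs_le]; constructor <;> linarith
  · norm_num [abs_le]; constructor <;> linarith
  · exact h3
  · norm_num [abs_le]; constructor <;> linarith
  · norm_num [abs_le]; constructor <;> linarith
  · norm_num [abs_le]; constructor <;> linarith

theorem exists_constants_14 :
    ∃ c : AsympConstants, c.Describes 14 ∧ c.MatchesTable 14 ∧ c.Expands 14 := by
  obtain ⟨c, h, ⟨a1, a2⟩, ⟨b1, b2⟩, ⟨R1, R2⟩, ⟨S1, S2⟩, h3, h4⟩ :=
    AsympConstants.exists_of_tests (t := 14) (J := 4) (J' := 2) (den := 1042) (R3 := 43.3) (n₁ := 696908924199889358297156244246650138799301)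
    (m₁ := 174256490748171654873627061363158126633894)
    (n₂ := 1328598457293350195888316506738131052351946)
    (m₂ := 21866952698109254712545726049789306763678)
    (N₁ := 638877832380645164997588023524598324128973197073821174315723373056165364144217518610192851478527)
    (N₂ := 15569952966190929002235218335)
    (by norm_num) (by norm_num) (by norm_num) (by norm_num) (by norm_num) (by norm_num)
    (by norm_num) (by decide +kernel) (by decide +kernel) (by decide +kernel) (by decide +kernel)
    (by norm_num)
  have l1 := Real.log_two_gt_d9
  have l2 := Real.log_two_lt_d9
  norm_num at a1 a2 b1 b2 R1 R2 S1 S2 h4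
  refine ⟨c, h, ⟨?_, ?_, ?_, ?_, ?_, ?_⟩, fun h => ?_, fun h => ?_, ?_⟩
  · norm_num [abs_le]; constructor <;> linarith
  · norm_num [abs_le]; constructor <;> linarith
  · rw [h4]; norm_num
  · norm_num [abs_le]; constructor <;> linarith
  · norm_num [abs_le]; constructor <;> linarith
  · exact h3
  · norm_num [abs_le]; constructor <;> linarith
  · norm_num [abs_le]; constructor <;> linarith
  · norm_num [abs_le]; constructor <;> linarith

theorem exists_constants_15 :
    ∃ c : AsympConstants, c.Describes 15 ∧ c.MatchesTable 15 ∧ c.Expands 15 := by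
  obtain ⟨c, h, ⟨a1, a2⟩, ⟨b1, b2⟩, ⟨R1, R2⟩, ⟨S1, S2⟩, h3, h4⟩ :=
    AsympConstants.exists_of_tests (t := 15) (J := 4) (J' := 2) (den := 1040) (R3 := 39.0) (n₁ := 696903605136960436335022577558245570949480)
    (m₁ := 174241856798232317671533330961800941959394)
    (n₂ := 1332727145623706345483478999157706215731554)
    (m₂ := 20578378494684943421023347187855190066434)
    (N₁ := 181971028603711954035669751708146658669909293572940384655659202979072321986085409682049452027492585471)
    (N₂ := 5942055033286731702525014591)
    (by norm_num) (by norm_num) (by norm_num) (by norm_num) (by norm_num) (by norm_num)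
    (by norm_num) (by decide +kernel) (by decide +kernel) (by decide +kernel) (by decide +kernel)
    (by norm_num)
  have l1 := Real.log_two_gt_d9
  have l2 := Real.log_two_lt_d9
  norm_num at a1 a2 b1 b2 R1 R2 S1 S2 h4
  refine ⟨c, h, ⟨?_, ?_, ?_, ?_, ?_, ?_⟩, fun h => ?_, fun h => ?_, ?_⟩
  · norm_num [abs_le]; constructor <;> linarith
  · norm_num [abs_le]; constructor <;> linarith
  · rw [h4]; norm_num
  · norm_num [abs_le]; constructor <;> linarith
  · norm_num [abs_le]; constructor <;> linarith
  · exact h3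
  · norm_num [abs_le]; constructor <;> linarith
  · norm_num [abs_le]; constructor <;> linarith
  · norm_num [abs_le]; constructor <;> linarith

/-! ### Two-level form of the series for large t. -/

/-- The deviation of the denominator from its first two terms. -/
noncomputable def denomTail (t : ℕ) (q : ℂ) : ℂ := ladderSeries t 0 2 q - 1

/-- The deviation of the numerator from its first three terms. -/
noncomputable def numerTail (t : ℕ) (q : ℂ) : ℂ := ladderSeries t 1 2 q - q ^ (t + 1)

theorem clearing_two (t : ℕ) (q : ℂ) : clearing t 0 2 q = (1 - q) * (1 - q ^ (t + 1)) := by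
  simp [clearing, Finset.prod_range_succ, repunit_one, repunit_two]

/-- With p = q^{t+1}, all deeper levels enter only through the perturbation q p δ; the equation for
a zero is otherwise elementary. -/
theorem clearing_mul_denom {t : ℕ} (ht : 2 ≤ t) {q : ℂ} (hq : ‖q‖ < 1) :
    clearing t 0 2 q * denom t q =
      (1 - 2 * q) * (1 - q ^ (t + 1)) + q * q ^ (t + 1) * (1 + denomTail t q) := by
  have h := clearing_mul_ladderSeries ht 0 1 0 hq
  rw [denom, clearing_mul_ladderSeries ht 0 0 1 hq, h, clearing_two, clearing_succ, clearing_zero]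
  simp only [repunit_one, repunit_two, zero_add, Nat.reduceAdd, denomTail]
  ring

theorem clearing_mul_numer {t : ℕ} (ht : 2 ≤ t) {q : ℂ} (hq : ‖q‖ < 1) :
    clearing t 0 2 q * numer t q =
      (1 - q - q ^ 2) * (1 - q ^ (t + 1)) +
        q * q ^ (t + 1) * (q ^ (t + 1) + numerTail t q) := by
  have h := clearing_mul_ladderSeries ht 1 1 0 hq
  rw [numer, clearing_mul_ladderSeries ht 1 0 1 hq, h, clearing_two, clearing_succ, clearing_zero]
  simp only [repunit_zero, repunit_one, repunit_two, zero_add, Nat.reduceAdd, numerTail]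
  ring

/-- The first neglected exponent is [3] = 1 + t(t+1), slightly more than t(t+1), so the tail is
controlled by the t-th power of |q|^{t+1}. -/
theorem norm_denomTail_le {t : ℕ} (ht : 2 ≤ t) {q : ℂ} {M : ℝ} (hq : ‖q‖ < 1)
    (hM : (‖q‖ ^ (t + 1)) ^ t ≤ M) (hM4 : M ≤ 1 / 4) : ‖denomTail t q‖ ≤ 2 * M := by
  have h := norm_ladderSeries_sub_le ht 0 2 hq (M := M) (le_trans ?_ hM) hM4
  · simpa [denomTail] using h
  · rw [← pow_mul]
    refine pow_le_pow_of_le_one (norm_nonneg q) hq.le ?_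
    rw [repunit_succ, repunit_two]
    nlinarith

theorem norm_numerTail_le {t : ℕ} (ht : 2 ≤ t) {q : ℂ} {M : ℝ} (hq : ‖q‖ < 1)
    (hM : (‖q‖ ^ (t + 1)) ^ t ≤ M) (hM4 : M ≤ 1 / 4) : ‖numerTail t q‖ ≤ 2 * M := by
  have h := norm_ladderSeries_sub_le ht 1 2 hq (M := M) (le_trans ?_ hM) hM4
  · simpa [numerTail, repunit_two] using h
  · rw [← pow_mul]
    refine pow_le_pow_of_le_one (norm_nonneg q) hq.le ?_
    rw [repunit_succ, repunit_two]
    nlinarith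

theorem differentiableOn_denomTail {t : ℕ} (ht : 2 ≤ t) :
    DifferentiableOn ℂ (denomTail t) (Metric.ball 0 1) :=
  (differentiableOn_ladderSeries ht 0 2).sub (differentiableOn_const 1)

theorem denomTail_eq_ofReal (t : ℕ) (x : ℝ) : denomTail t x = ((denomTail t x).re : ℂ) := by
  refine Complex.ext rfl ?_
  rw [denomTail, Complex.sub_im, ladderSeries_im, Complex.ofReal_im, Complex.one_im, sub_zero]

theorem norm_deriv_denomTail_le {t : ℕ} (ht : 2 ≤ t) {x d M : ℝ} (hx : 0 ≤ x) (hd : 0 < d)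
    (h1 : x + d < 1) (hM : ((x + d) ^ (t + 1)) ^ t ≤ M) (hM4 : M ≤ 1 / 4) :
    ‖deriv (denomTail t) x‖ ≤ 2 * M / d := by
  have hb : ∀ z : ℂ, z ∈ Metric.closedBall (x : ℂ) d → ‖z‖ ≤ x + d := fun z hz => by
    have h2 := norm_add_le (x : ℂ) (z - x)
    rw [add_sub_cancel, Complex.norm_real, Real.norm_of_nonneg hx] at h2
    have h3 : ‖z - x‖ ≤ d := by simpa [dist_eq_norm] using hz
    linarith
  refine Complex.norm_deriv_le_of_forall_mem_sphere_norm_le hd ?_ fun z hz => ?_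
  · refine DifferentiableOn.diffContOnCl ((differentiableOn_denomTail ht).mono fun z hz => ?_)
    rw [closure_ball _ hd.ne'] at hz
    simpa using (hb z hz).trans_lt h1
  · have h4 := hb z (Metric.sphere_subset_closedBall hz)
    refine norm_denomTail_le ht (h4.trans_lt h1) (le_trans ?_ hM) hM4
    gcongr

/-- Existence of a zero `1 / z` of the denominator from a sign change. -/
theorem exists_inv_zero {t : ℕ} (ht : 2 ≤ t) {u v ε : ℝ} (hu : 1 < u) (huv : u ≤ v)
    (hε : ∀ z : ℝ, u ≤ z → z ≤ v → ‖denomTail t (z⁻¹ : ℝ)‖ ≤ ε)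
    (h : (u ^ (t + 1) * (2 - u) < 3 - u - ε ∧ 3 - v + ε < v ^ (t + 1) * (2 - v)) ∨
      (3 - u + ε < u ^ (t + 1) * (2 - u) ∧ v ^ (t + 1) * (2 - v) < 3 - v - ε)) :
    ∃ z : ℝ, u ≤ z ∧ z ≤ v ∧ denom t (z⁻¹ : ℝ) = 0 := by
  -- Multiplication of the cleared denominator by z^{t+2} brings the equation for a zero at 1/z into
  -- the form z^{t+1}(2-z) = 3-z+δ.
  have key : ∀ z : ℝ, u ≤ z → z ≤ v → ∃ c : ℝ, 0 < c ∧
      c * (denom t (z⁻¹ : ℝ)).re = 3 - z + (denomTail t (z⁻¹ : ℝ)).re - z ^ (t + 1) * (2 - z) := by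
    intro z h1 h2
    have hz : 1 < z := hu.trans_le h1
    have hz0 : 0 < z := by linarith
    have hz1 : z⁻¹ < 1 := inv_lt_one_of_one_lt₀ hz
    obtain ⟨c, hc, hc'⟩ := clearing_ofReal_pos (t := t) (inv_pos.2 hz0).le hz1 0 2
    refine ⟨z ^ (t + 2) * c, by positivity, ?_⟩
    have h3 := clearing_mul_denom ht (q := (z⁻¹ : ℝ)) (by
      rw [Complex.norm_real, Real.norm_of_nonneg (inv_pos.2 hz0).le]; exact hz1)
    rw [hc', denomTail_eq_ofReal] at h3
    have h4 := congrArg Complex.re h3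
    rw [Complex.re_ofReal_mul] at h4
    have h5 : (1 - 2 * ((z⁻¹ : ℝ) : ℂ)) * (1 - ((z⁻¹ : ℝ) : ℂ) ^ (t + 1)) +
        ((z⁻¹ : ℝ) : ℂ) * ((z⁻¹ : ℝ) : ℂ) ^ (t + 1) * (1 + ((denomTail t (z⁻¹ : ℝ)).re : ℂ)) =
        (((1 - 2 * z⁻¹) * (1 - z⁻¹ ^ (t + 1)) +
          z⁻¹ * z⁻¹ ^ (t + 1) * (1 + (denomTail t (z⁻¹ : ℝ)).re) : ℝ) : ℂ) := by
      push_cast; ring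
    rw [h5, Complex.ofReal_re] at h4
    rw [mul_assoc, h4, inv_pow]
    have : z ^ (t + 1) ≠ 0 := by positivity
    field_simp
    ring
  have hre : ∀ z : ℝ, u ≤ z → z ≤ v → |(denomTail t (z⁻¹ : ℝ)).re| ≤ ε := fun z h1 h2 =>
    (Complex.abs_re_le_norm _).trans (hε z h1 h2)
  have hu0 : 0 < u := by linarith
  have hv0 : 0 < v := by linarith
  obtain ⟨c₁, hc₁, k₁⟩ := key u le_rfl huv
  obtain ⟨c₂, hc₂, k₂⟩ := key v huv le_rfl
  have b₁ := abs_le.1 (hre u le_rfl huv)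
  have b₂ := abs_le.1 (hre v huv le_rfl)
  obtain ⟨x, x1, x2, x3⟩ := exists_denom_eq_zero ht (x := v⁻¹) (y := u⁻¹) (inv_pos.2 hv0).le
    (inv_anti₀ hu0 huv) (inv_lt_one_of_one_lt₀ hu) (by
      rcases h with ⟨h1, h2⟩ | ⟨h1, h2⟩
      · right
        constructor
        · by_contra hn
          have := mul_nonneg hc₂.le (not_lt.1 hn)
          linarith [b₂.2]
        · exact pos_of_mul_pos_right (by linarith [b₁.1] : 0 < c₁ * _) hc₁.le
      · left
        constructor
        · exact pos_of_mul_pos_right (by linarith [b₂.1] : 0 < c₂ * _) hc₂.le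
        · by_contra hn
          have := mul_nonneg hc₁.le (not_lt.1 hn)
          linarith [b₁.2])
  have hx0 : 0 < x := lt_of_lt_of_le (inv_pos.2 hv0) x1
  refine ⟨x⁻¹, ?_, ?_, by rwa [inv_inv]⟩
  · rw [← inv_inv u]
    exact inv_anti₀ hx0 x2
  · rw [← inv_inv v]
    exact inv_anti₀ (inv_pos.2 hv0) x1

/-- The differentiated denominator at a zero. -/
theorem clearing_mul_deriv_denom {t : ℕ} (ht : 2 ≤ t) {q : ℂ} (hq : ‖q‖ < 1) (hq0 : q ≠ 0)
    (h0 : denom t q = 0) :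
    clearing t 0 2 q * deriv (denom t) q = (t + 2) * (2 - q⁻¹) - 2 + q ^ (t + 1) * q⁻¹ +
      q * q ^ (t + 1) * deriv (denomTail t) q := by
  have hmem : Metric.ball (0 : ℂ) 1 ∈ nhds q := Metric.isOpen_ball.mem_nhds (by simpa using hq)
  have d1 := (differentiable_clearing t 0 2).differentiableAt.hasDerivAt (x := q)
  have d2 := ((differentiableOn_ladderSeries ht 0 0).differentiableAt hmem).hasDerivAt
  have d3 := ((differentiableOn_denomTail ht).differentiableAt hmem).hasDerivAt
  have d4 : HasDerivAt (fun x : ℂ => (1 - 2 * x) * (1 - x ^ (t + 1)) +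
      x * x ^ (t + 1) * (1 + denomTail t x)) _ q :=
    ((((hasDerivAt_id q).const_mul 2).const_sub 1).mul ((hasDerivAt_pow (t + 1) q).const_sub 1)).add
      (((hasDerivAt_id q).mul (hasDerivAt_pow (t + 1) q)).mul (d3.const_add 1))
  have d5 := (d4.congr_of_eventuallyEq (Filter.eventuallyEq_of_mem hmem fun x hx =>
    clearing_mul_denom ht (by simpa using hx))).unique (d1.mul d2)
  have h1 := clearing_mul_denom ht hq
  rw [h0, mul_zero] at h1
  have h2 : clearing t 0 2 q * deriv (denom t) q =
      deriv (clearing t 0 2) q * denom t q + clearing t 0 2 q * deriv (denom t) q := by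
    rw [h0, mul_zero, zero_add]
  rw [h2]
  refine d5.symm.trans ?_
  simp only [id, Pi.mul_apply, Nat.cast_add, Nat.cast_one, Nat.add_sub_cancel]
  have h3 : q⁻¹ * q = 1 := inv_mul_cancel₀ hq0
  rw [pow_succ] at h1 ⊢
  -- The equation of the zero, multiplied by (t+2)/q, eliminates δ itself, so that only its
  -- derivative remains.
  linear_combination (-(t + 2) * q⁻¹) * h1 + ((t + 2) * (2 * (1 - q ^ t * q) -
    q ^ t * q * (1 + denomTail t q)) + (t + 1) * q ^ t) * h3

/-- The residue at the zero `1 / z` is, up to the tails, a rational function of `z`. -/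
theorem residue_approx {t : ℕ} (ht : 2 ≤ t) {z ε : ℝ} (hz : 1 < z) (hz2 : z ≤ 2)
    (h0 : denom t (z⁻¹ : ℝ) = 0) (h1 : ‖denomTail t (z⁻¹ : ℝ)‖ ≤ ε)
    (h2 : ‖numerTail t (z⁻¹ : ℝ)‖ ≤ ε) (h3 : ‖deriv (denomTail t) (z⁻¹ : ℝ)‖ ≤ ε)
    (hε : ε ≤ 1 / 100)
    (hpos : 2 * ε < |(t + 2) * (2 - z) - 2 + (2 - z) * z / (3 - z)|) :
    ∃ R e₁ e₂ : ℝ, residue t (z⁻¹ : ℝ) = R ∧ |e₁| ≤ 2 * ε ∧ |e₂| ≤ 2 * ε ∧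
      R * ((t + 2) * (2 - z) - 2 + (2 - z) * z / (3 - z) + e₁) =
        -((2 * z - 3) / (z ^ 2 * (3 - z) ^ 2) + e₂) := by
  have hz0 : 0 < z := by linarith
  obtain ⟨q, hq⟩ : ∃ q : ℝ, q = z⁻¹ := ⟨_, rfl⟩
  rw [← hq] at h0 h1 h2 h3 ⊢
  have hqz : q * z = 1 := by rw [hq]; exact inv_mul_cancel₀ hz0.ne'
  have hq0 : 0 < q := hq ▸ inv_pos.2 hz0
  have hq1 : q < 1 := hq ▸ inv_lt_one_of_one_lt₀ hz
  have hqi : ((q : ℝ) : ℂ)⁻¹ = (z : ℂ) := by rw [hq]; push_cast; rw [inv_inv]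
  have hqn : ‖(q : ℂ)‖ < 1 := by rwa [Complex.norm_real, Real.norm_of_nonneg hq0.le]
  have hq0' : (q : ℂ) ≠ 0 := by exact_mod_cast hq0.ne'
  have hD := clearing_mul_deriv_denom ht hqn hq0' h0
  have hN := clearing_mul_numer ht hqn
  have hY := clearing_mul_denom ht hqn
  rw [h0, mul_zero, denomTail_eq_ofReal] at hY
  rw [hqi] at hD
  have b1 := abs_le.1 ((Complex.abs_re_le_norm _).trans h1)
  have b2 := abs_le.1 ((Complex.abs_re_le_norm _).trans h2)
  have b3 := abs_le.1 ((Complex.abs_re_le_norm _).trans h3)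
  obtain ⟨w, hw⟩ : ∃ w : ℝ, w = q ^ (t + 1) := ⟨_, rfl⟩
  have hwc : (q : ℂ) ^ (t + 1) = (w : ℂ) := by rw [hw]; push_cast; rfl
  have hw0 : 0 < w := by rw [hw]; positivity
  rw [hwc] at hD hN hY
  set τ := (denomTail t q).re
  set υ := (numerTail t q).re with hυ
  set τ' := (deriv (denomTail t) q).re with hτ'
  have hY' : w * (3 - z + τ) = 2 - z := by
    have : (0 : ℝ) = (1 - 2 * q) * (1 - w) + q * w * (1 + τ) := by exact_mod_cast hY
    linear_combination (-z) * this + (2 * (1 - w) - w * (1 + τ)) * hqz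
  have hε0 : 0 ≤ ε := (norm_nonneg _).trans h1
  have h3z : 1 ≤ 3 - z := by linarith
  have hw51 : w ≤ 51 / 100 := by
    by_contra hn
    have := mul_lt_mul_of_pos_right (not_le.1 hn) (by linarith [b1.1] : 0 < 3 - z + τ)
    linarith [b1.1]
  -- This is the value that w = z^{-(t+1)} would have if δ were 0. Replacing w by v makes derivative
  -- and numerator rational in z; the differences are collected in e₁ and e₂.
  set v := (2 - z) / (3 - z) with hv
  have hv3 : v * (3 - z) = 2 - z := div_mul_cancel₀ _ (by linarith)
  have hv0 : 0 ≤ v := div_nonneg (by linarith) (by linarith)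
  have hv1 : v ≤ 1 / 2 := by rw [hv, div_le_iff₀ (by linarith)]; linarith
  have hwv : |w - v| ≤ 51 / 100 * ε := by
    have e : (w - v) * (3 - z) = -(w * τ) := by linear_combination hY' - hv3
    have e' : |w - v| * (3 - z) = w * |τ| := by
      rw [← abs_of_pos (by linarith : 0 < 3 - z), ← abs_mul, e, abs_neg, abs_mul, abs_of_pos hw0]
    have e'' : |τ| ≤ ε := abs_le.2 b1
    calc |w - v| ≤ |w - v| * (3 - z) := le_mul_of_one_le_right (abs_nonneg _) h3z
      _ = w * |τ| := e'
      _ ≤ 51 / 100 * ε := by gcongr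
  have hsmall : ∀ x : ℝ, |x| ≤ ε → |q * w * x| ≤ 51 / 100 * ε := fun x hx => by
    rw [abs_mul, abs_of_pos (by positivity)]
    have : q * w ≤ 51 / 100 := (mul_le_of_le_one_left hw0.le hq1.le).trans hw51
    gcongr
  have hvz : (2 - z) * z / (3 - z) = v * z := by rw [hv]; ring
  have he1 : |(w - v) * z + q * w * τ'| ≤ 2 * ε := by
    refine (abs_add_le _ _).trans ?_
    have := hsmall τ' (abs_le.2 b3)
    have h4 := mul_le_mul hwv hz2 hz0.le (by positivity)
    rw [abs_mul, abs_of_pos hz0]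
    linarith
  refine ⟨(residue t q).re, (w - v) * z + q * w * τ', (w - v) * (q * (w + v) - (1 - q - q ^ 2)) +
    q * w * υ, Complex.ext rfl (residue_im t q), he1, ?_, ?_⟩
  · refine (abs_add_le _ _).trans ?_
    have := hsmall υ (abs_le.2 b2)
    -- Replacing w by v in the numerator costs this factor times 51/100 ε; with another 51/100 ε
    -- from the tail the total stays below 2ε.
    have h5 : |q * (w + v) - (1 - q - q ^ 2)| ≤ 2.1 := by
      have h6 : q * (w + v) ≤ w + v := mul_le_of_le_one_left (by linarith) hq1.le
      have h7 : 0 ≤ q * (w + v) := by positivity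
      have h8 : q ^ 2 ≤ 1 := pow_le_one₀ hq0.le hq1.le
      have h9 : 0 ≤ q ^ 2 := by positivity
      rw [abs_le]
      constructor <;> linarith
    have h6 := mul_le_mul hwv h5 (abs_nonneg _) (by positivity)
    rw [abs_mul]
    linarith
  · have hre : (residue t q).re * ((t + 2) * (2 - z) - 2 + w * z + q * w * τ') =
        -((1 - q - q ^ 2) * (1 - w) + q * w * (w + υ)) := by
      have hne : clearing t 0 2 q * deriv (denom t) q ≠ 0 := by
        intro hn
        rw [hn] at hD
        have := congrArg Complex.re hD
        have e : ((t : ℂ) + 2) * (2 - z) - 2 + w * z + q * w * deriv (denomTail t) q =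
            (((t + 2) * (2 - z) - 2 + w * z : ℝ) : ℂ) +
              ((q * w : ℝ) : ℂ) * deriv (denomTail t) q := by push_cast; ring
        rw [e, Complex.add_re, Complex.re_ofReal_mul, Complex.ofReal_re, Complex.zero_re,
          ← hτ'] at this
        have h4 : (t + 2) * (2 - z) - 2 + v * z = -((w - v) * z + q * w * τ') := by
          linear_combination -this
        rw [hvz, h4, abs_neg] at hpos
        exact absurd he1 (not_le.2 hpos)
      have hres : residue t q * (clearing t 0 2 q * deriv (denom t) q) =
          -(clearing t 0 2 q * numer t q) := by
        have := right_ne_zero_of_mul hne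
        rw [residue]
        field_simp
      have hrr : residue t q = ((residue t q).re : ℂ) := Complex.ext rfl (residue_im t q)
      rw [hD, hN, hrr] at hres
      have := congrArg Complex.re hres
      have e : ((residue t q).re : ℂ) *
          (((t : ℂ) + 2) * (2 - z) - 2 + w * z + q * w * deriv (denomTail t) q) =
            (((residue t q).re * ((t + 2) * (2 - z) - 2 + w * z) : ℝ) : ℂ) +
              (((residue t q).re * (q * w) : ℝ) : ℂ) * deriv (denomTail t) q := by
        push_cast; ring
      have e' : -((1 - (q : ℂ) - (q : ℂ) ^ 2) * (1 - w) + q * w * (w + numerTail t q)) =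
          ((-((1 - q - q ^ 2) * (1 - w) + q * w * w) : ℝ) : ℂ) +
            ((-(q * w) : ℝ) : ℂ) * numerTail t q := by
        push_cast; ring
      rw [e, e', Complex.add_re, Complex.add_re, Complex.re_ofReal_mul, Complex.re_ofReal_mul,
        Complex.ofReal_re, Complex.ofReal_re, ← hτ', ← hυ] at this
      linear_combination this
    have hcn : (2 * z - 3) / (z ^ 2 * (3 - z) ^ 2) = (1 - q - q ^ 2) * (1 - v) + q * v ^ 2 := by
      rw [hq, hv]
      have : 3 - z ≠ 0 := by linarith
      field_simp
      ring
    rw [hcn, hvz]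
    linear_combination hre

/-! ### The zero near 1/2 and its residue, t ≥ 16. -/

/-- The nested form `1 + y (k₀ + y (l₀ + y θ))` of a truncated expansion, with the ranges of its
intermediate values. -/
structure RhoExpansion (x y θ h k l : ℝ) : Prop where
  x_nonneg : 0 ≤ x
  x_le : x ≤ 1 / 16
  y_nonneg : 0 ≤ y
  y_le : y ≤ 1 / 8192
  θ_nonneg : 0 ≤ θ
  θ_le : θ ≤ 1
  l_eq : l = (3 + 19 * x + 24 * x ^ 2) / 8 + y * θ
  k_eq : k = (1 + 3 * x) / 2 + y * l
  h_eq : h = 1 + y * k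

namespace RhoExpansion

variable {x y θ h k l : ℝ}

theorem l_mem (H : RhoExpansion x y θ h k l) : 3 / 8 ≤ l ∧ l ≤ 27 / 50 := by
  obtain ⟨h1, h2, h3, h4, h5, h6, h7, h8, h9⟩ := H
  have : 0 ≤ y * θ := by positivity
  have : y * θ ≤ 1 / 8192 * 1 := by gcongr
  constructor <;> nlinarith

theorem k_mem (H : RhoExpansion x y θ h k l) : 1 / 2 ≤ k ∧ k ≤ 3 / 5 := by
  obtain ⟨m1, m2⟩ := H.l_mem
  obtain ⟨h1, h2, h3, h4, h5, h6, h7, h8, h9⟩ := H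
  have : 0 ≤ y * l := by positivity
  have : y * l ≤ 1 / 8192 * (27 / 50) := by gcongr
  constructor <;> linarith

theorem h_mem (H : RhoExpansion x y θ h k l) : 1 ≤ h ∧ h ≤ 1001 / 1000 := by
  obtain ⟨m1, m2⟩ := H.k_mem
  obtain ⟨h1, h2, h3, h4, h5, h6, h7, h8, h9⟩ := H
  have : 0 ≤ y * k := by positivity
  have : y * k ≤ 1 / 8192 * (3 / 5) := by gcongr
  constructor <;> linarith

/-- With z = 2 - uh, u = 2^{-(t+1)} = xy, the equation of the zero reads h(1-uh/2)^{t+1} = 1 + uh +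
δ. The expansion of h cancels all terms below y³; with θ = 1 the cubic truncation of the power
leaves the positive multiple y³/100 or more, which absorbs the tail. -/
theorem lower (H : RhoExpansion x y 1 h k l) :
    1 + x * y * h + y ^ 3 / 100 ≤ h * (1 - (1 + x) * y * h / 2 + (1 + x) * y ^ 2 * h ^ 2 / 8 -
      (1 - x ^ 2) * y ^ 3 * h ^ 3 / 48) := by
  obtain ⟨l1, l2⟩ := H.l_mem
  obtain ⟨k1, k2⟩ := H.k_mem
  obtain ⟨h1, h2⟩ := H.h_mem
  obtain ⟨x1, x2, y1, y2, t1, t2, h3, h4, h5⟩ := H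
  have key : h * (1 - (1 + x) * y * h / 2 + (1 + x) * y ^ 2 * h ^ 2 / 8 -
      (1 - x ^ 2) * y ^ 3 * h ^ 3 / 48) - 1 - x * y * h = y ^ 3 * (1 - (1 + 2 * x) * l -
        (1 + x) * k ^ 2 / 2 + (1 + x) * (3 * k + 3 * y * k ^ 2 + y ^ 2 * k ^ 3) / 8 -
        (1 - x ^ 2) * h ^ 4 / 48) := by
    subst h5; subst h4; subst h3
    ring
  have e1 : (1 + 2 * x) * l ≤ (1 + 2 * (1 / 16)) * (27 / 50) := by gcongr
  have e2 : (1 + x) * k ^ 2 / 2 ≤ (1 + 1 / 16) * (3 / 5) ^ 2 / 2 := by gcongr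
  have e3 : 0 ≤ (1 + x) * (3 * k + 3 * y * k ^ 2 + y ^ 2 * k ^ 3) / 8 := by positivity
  have e4 : (1 - x ^ 2) * h ^ 4 / 48 ≤ 1 * (1001 / 1000) ^ 4 / 48 := by
    gcongr
    nlinarith
  have e5 : y ^ 3 * (1 / 100) ≤ y ^ 3 * (1 - (1 + 2 * x) * l - (1 + x) * k ^ 2 / 2 +
      (1 + x) * (3 * k + 3 * y * k ^ 2 + y ^ 2 * k ^ 3) / 8 - (1 - x ^ 2) * h ^ 4 / 48) := by
    gcongr
    norm_num at e1 e2 e4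
    linarith
  linarith

/-- The counterpart at the other end θ = 0: the quadratic truncation already overestimates the
power, and the coefficient of y³ is now at most -1/100. -/
theorem upper (H : RhoExpansion x y 0 h k l) :
    h * (1 - (1 + x) * y * h / 2 + (1 + x) * y ^ 2 * h ^ 2 / 8) + y ^ 3 / 100 ≤ 1 + x * y * h := by
  obtain ⟨l1, l2⟩ := H.l_mem
  obtain ⟨k1, k2⟩ := H.k_mem
  obtain ⟨x1, x2, y1, y2, t1, t2, h3, h4, h5⟩ := H
  have key : h * (1 - (1 + x) * y * h / 2 + (1 + x) * y ^ 2 * h ^ 2 / 8) - 1 - x * y * h =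
      -(y ^ 3 * ((1 + 2 * x) * l + (1 + x) * k ^ 2 / 2 -
        (1 + x) * (3 * k + 3 * y * k ^ 2 + y ^ 2 * k ^ 3) / 8)) := by
    subst h5; subst h4; subst h3
    ring
  have e1 : (1 + 2 * 0) * (3 / 8) ≤ (1 + 2 * x) * l := by gcongr
  have e2 : (1 + 0) * (1 / 2) ^ 2 / 2 ≤ (1 + x) * k ^ 2 / 2 := by gcongr
  have e3 : (1 + x) * (3 * k + 3 * y * k ^ 2 + y ^ 2 * k ^ 3) / 8 ≤
      (1 + 1 / 16) * (3 * (3 / 5) + 3 * (1 / 8192) * (3 / 5) ^ 2 +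
        (1 / 8192) ^ 2 * (3 / 5) ^ 3) / 8 := by gcongr
  have e5 : y ^ 3 * (1 / 100) ≤ y ^ 3 * ((1 + 2 * x) * l + (1 + x) * k ^ 2 / 2 -
        (1 + x) * (3 * k + 3 * y * k ^ 2 + y ^ 2 * k ^ 3) / 8) := by
    gcongr
    norm_num at e1 e2 e3
    linarith
  linarith

/-- The expansion of the residue in terms of `m = y h`. -/
noncomputable def residueSeries (x m : ℝ) : ℝ :=
  1 / 8 + m * (1 - 2 * x) / 16 + m ^ 2 * (1 + 2 * x + x ^ 2) / 32 +
    m ^ 3 * (1 + 6 * x + 3 * x ^ 2 - 16 * x ^ 3) / 64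

/-- Substituting h into m = yh and expanding, the terms up to y³ agree exactly, and what is left is
y⁴ times an expression in x, y, θ, k, l of size below 1/5. -/
theorem abs_residueSeries_sub_le (H : RhoExpansion x y θ h k l) :
    |residueSeries x (y * h) - (1 / 8 + y * (1 - 2 * x) / 16 +
      y ^ 2 * (2 + 3 * x - 5 * x ^ 2) / 32 +
      y ^ 3 * (9 + 45 * x + 20 * x ^ 2 - 68 * x ^ 3) / 128)| ≤ 1 / 5 * y ^ 4 := by
  obtain ⟨l1, l2⟩ := H.l_mem
  obtain ⟨k1, k2⟩ := H.k_mem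
  obtain ⟨x1, x2, y1, y2, t1, t2, h3, h4, h5⟩ := H
  have key : residueSeries x (y * h) - (1 / 8 + y * (1 - 2 * x) / 16 +
      y ^ 2 * (2 + 3 * x - 5 * x ^ 2) / 32 +
      y ^ 3 * (9 + 45 * x + 20 * x ^ 2 - 68 * x ^ 3) / 128) =
      y ^ 4 * ((1 - 2 * x) / 16 * θ + (1 + 2 * x + x ^ 2) / 32 * (2 * l + k ^ 2) +
        (1 + 6 * x + 3 * x ^ 2 - 16 * x ^ 3) / 64 * (3 * k + 3 * y * k ^ 2 + y ^ 2 * k ^ 3)) := by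
    rw [residueSeries]
    subst h5; subst h4; subst h3
    ring
  have x2' : 0 ≤ x ^ 2 := by positivity
  have x3' : 0 ≤ x ^ 3 := by positivity
  have x2'' : x ^ 2 ≤ (1 / 16) ^ 2 := by gcongr
  have x3'' : x ^ 3 ≤ (1 / 16) ^ 3 := by gcongr
  have k0 : 0 ≤ k := by linarith
  have e1 : (1 - 2 * x) / 16 * θ ≤ 1 / 16 * 1 := by
    gcongr
    linarith
  have e1' : 0 ≤ (1 - 2 * x) / 16 * θ := mul_nonneg (by linarith) t1
  have e2 : (1 + 2 * x + x ^ 2) / 32 * (2 * l + k ^ 2) ≤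
      (1 + 2 * (1 / 16) + (1 / 16) ^ 2) / 32 * (2 * (27 / 50) + (3 / 5) ^ 2) := by gcongr
  have e2' : 0 ≤ (1 + 2 * x + x ^ 2) / 32 * (2 * l + k ^ 2) :=
    mul_nonneg (by positivity) (by nlinarith)
  have e4 : (1 + 6 * x + 3 * x ^ 2 - 16 * x ^ 3) / 64 ≤ 1 / 45 := by
    norm_num at x2'' x3''
    linarith
  have e4' : 0 ≤ (1 + 6 * x + 3 * x ^ 2 - 16 * x ^ 3) / 64 := by
    norm_num at x2'' x3''
    linarith
  have e3 : (1 + 6 * x + 3 * x ^ 2 - 16 * x ^ 3) / 64 * (3 * k + 3 * y * k ^ 2 + y ^ 2 * k ^ 3) ≤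
      1 / 45 * (3 * (3 / 5) + 3 * (1 / 8192) * (3 / 5) ^ 2 + (1 / 8192) ^ 2 * (3 / 5) ^ 3) := by
    gcongr
  have e3' := mul_nonneg e4' (by positivity : 0 ≤ 3 * k + 3 * y * k ^ 2 + y ^ 2 * k ^ 3)
  rw [key, abs_mul, abs_of_nonneg (by positivity), mul_comm]
  gcongr
  rw [abs_le]
  norm_num at e1 e2 e3
  constructor <;> linarith

/-- At z = 2 - xm the residue without tails is the quotient of 1 - 2xm by the bracketed product.
`residueSeries` is its cubic Taylor polynomial in m, so cross-multiplication leaves only m⁴ and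
higher. -/
theorem abs_one_sub_residueSeries_mul_le {m : ℝ} (hx : 0 ≤ x) (hx' : x ≤ 1 / 16) (hm : 0 ≤ m)
    (hm' : m ≤ 1 / 1000) :
    |1 - 2 * (x * m) - residueSeries x m *
      ((2 - x * m) ^ 2 * (1 + x * m) * (2 - x * m - (1 + x) * m * (1 + x * m)))| ≤
      1 / 5 * m ^ 4 := by
  have key : 1 - 2 * (x * m) - residueSeries x m *
      ((2 - x * m) ^ 2 * (1 + x * m) * (2 - x * m - (1 + x) * m * (1 + x * m))) =
      m ^ 4 * ((1 / 16 + 5 / 8 * x + 21 / 16 * x ^ 2 + m * (1 / 16 * x + 7 / 16 * x ^ 2 +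
        9 / 16 * x ^ 3) + m ^ 2 * (3 / 16 * x ^ 5 + 59 / 32 * x ^ 6) +
        m ^ 3 * (35 / 64 * x ^ 6 + 9 / 32 * x ^ 7) +
        m ^ 4 * (1 / 64 * x ^ 4 + 7 / 64 * x ^ 5 + 9 / 64 * x ^ 6)) -
        (1 / 4 * x ^ 3 + 13 / 16 * x ^ 4 + m * (13 / 16 * x ^ 4 + 5 / 2 * x ^ 5) +
        m ^ 2 * (3 / 64 * x ^ 2 + 15 / 32 * x ^ 3 + 63 / 64 * x ^ 4) +
        m ^ 3 * (1 / 32 * x ^ 3 + 11 / 64 * x ^ 4 + 3 / 32 * x ^ 5) +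
        m ^ 4 * (13 / 64 * x ^ 7 + 1 / 4 * x ^ 8))) := by
    rw [residueSeries]
    ring
  have hb : ∀ n : ℕ, x ^ n ≤ (1 / 16) ^ n := fun n => by gcongr
  have h0 : ∀ n : ℕ, 0 ≤ x ^ n := fun n => by positivity
  have hc : ∀ (n : ℕ) {c d : ℝ}, 0 ≤ c → c ≤ d → m ^ n * c ≤ (1 / 1000) ^ n * d :=
    fun n c d h1 h2 => by gcongr
  have hc0 : ∀ (n : ℕ) {c : ℝ}, 0 ≤ c → 0 ≤ m ^ n * c := fun n c h1 => by positivity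
  have a1 := hc 1 (c := 1 / 16 * x + 7 / 16 * x ^ 2 + 9 / 16 * x ^ 3) (d := 1) (by positivity)
    (by linarith [hb 2, hb 3])
  have a2 := hc 2 (c := 3 / 16 * x ^ 5 + 59 / 32 * x ^ 6) (d := 1) (by positivity)
    (by linarith [hb 5, hb 6])
  have a3 := hc 3 (c := 35 / 64 * x ^ 6 + 9 / 32 * x ^ 7) (d := 1) (by positivity)
    (by linarith [hb 6, hb 7])
  have a4 := hc 4 (c := 1 / 64 * x ^ 4 + 7 / 64 * x ^ 5 + 9 / 64 * x ^ 6) (d := 1) (by positivity)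
    (by linarith [hb 4, hb 5, hb 6])
  have b1 := hc 1 (c := 13 / 16 * x ^ 4 + 5 / 2 * x ^ 5) (d := 1) (by positivity)
    (by linarith [hb 4, hb 5])
  have b2 := hc 2 (c := 3 / 64 * x ^ 2 + 15 / 32 * x ^ 3 + 63 / 64 * x ^ 4) (d := 1)
    (by positivity) (by linarith [hb 2, hb 3, hb 4])
  have b3 := hc 3 (c := 1 / 32 * x ^ 3 + 11 / 64 * x ^ 4 + 3 / 32 * x ^ 5) (d := 1)
    (by positivity) (by linarith [hb 3, hb 4, hb 5])
  have b4 := hc 4 (c := 13 / 64 * x ^ 7 + 1 / 4 * x ^ 8) (d := 1)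
    (by positivity) (by linarith [hb 7, hb 8])
  have a1' := hc0 1 (c := 1 / 16 * x + 7 / 16 * x ^ 2 + 9 / 16 * x ^ 3) (by positivity)
  have a2' := hc0 2 (c := 3 / 16 * x ^ 5 + 59 / 32 * x ^ 6) (by positivity)
  have a3' := hc0 3 (c := 35 / 64 * x ^ 6 + 9 / 32 * x ^ 7) (by positivity)
  have a4' := hc0 4 (c := 1 / 64 * x ^ 4 + 7 / 64 * x ^ 5 + 9 / 64 * x ^ 6) (by positivity)
  have b1' := hc0 1 (c := 13 / 16 * x ^ 4 + 5 / 2 * x ^ 5) (by positivity)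
  have b2' := hc0 2 (c := 3 / 64 * x ^ 2 + 15 / 32 * x ^ 3 + 63 / 64 * x ^ 4) (by positivity)
  have b3' := hc0 3 (c := 1 / 32 * x ^ 3 + 11 / 64 * x ^ 4 + 3 / 32 * x ^ 5) (by positivity)
  have b4' := hc0 4 (c := 13 / 64 * x ^ 7 + 1 / 4 * x ^ 8) (by positivity)
  rw [key, abs_mul, abs_of_nonneg (by positivity), mul_comm]
  gcongr
  rw [abs_le]
  rw [pow_one] at a1 b1 a1' b1'
  generalize m * (1 / 16 * x + 7 / 16 * x ^ 2 + 9 / 16 * x ^ 3) = A1 at a1 a1' ⊢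
  generalize m ^ 2 * (3 / 16 * x ^ 5 + 59 / 32 * x ^ 6) = A2 at a2 a2' ⊢
  generalize m ^ 3 * (35 / 64 * x ^ 6 + 9 / 32 * x ^ 7) = A3 at a3 a3' ⊢
  generalize m ^ 4 * (1 / 64 * x ^ 4 + 7 / 64 * x ^ 5 + 9 / 64 * x ^ 6) = A4 at a4 a4' ⊢
  generalize m * (13 / 16 * x ^ 4 + 5 / 2 * x ^ 5) = B1 at b1 b1' ⊢
  generalize m ^ 2 * (3 / 64 * x ^ 2 + 15 / 32 * x ^ 3 + 63 / 64 * x ^ 4) = B2 at b2 b2' ⊢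
  generalize m ^ 3 * (1 / 32 * x ^ 3 + 11 / 64 * x ^ 4 + 3 / 32 * x ^ 5) = B3 at b3 b3' ⊢
  generalize m ^ 4 * (13 / 64 * x ^ 7 + 1 / 4 * x ^ 8) = B4 at b4 b4' ⊢
  have c2 := hb 2
  have c3 := hb 3
  have c4 := hb 4
  have d2 := h0 2
  have d3 := h0 3
  have d4 := h0 4
  clear hb h0 hc hc0 key
  norm_num at a1 a2 a3 a4 b1 b2 b3 b4 c2 c3 c4
  constructor <;> linarith

end RhoExpansion

/-- Truncated binomial expansions lie alternately above and below the power. In the induction step,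
multiplication by 1-e leaves a surplus term in the next power of e with known sign; likewise for the
cubic truncation below. -/
theorem one_sub_pow_le {e : ℝ} (h0 : 0 ≤ e) (h1 : e ≤ 1) (n : ℕ) :
    (1 - e) ^ n ≤ 1 - n * e + n * (n - 1) / 2 * e ^ 2 := by
  induction n with
  | zero => simp
  | succ n ih =>
    have hn : (0 : ℝ) ≤ n * (n - 1) := by
      rcases n with _ | n
      · simp
      · push_cast
        have : (0 : ℝ) ≤ n := n.cast_nonneg
        nlinarith
    have h2 := mul_le_mul_of_nonneg_right ih (sub_nonneg.2 h1)
    rw [pow_succ (1 - e)]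
    push_cast
    have h3 : 0 ≤ (n : ℝ) * (n - 1) / 2 * e ^ 3 := by positivity
    linarith

theorem le_one_sub_pow {e : ℝ} (h1 : e ≤ 1) (n : ℕ) :
    1 - n * e + n * (n - 1) / 2 * e ^ 2 - n * (n - 1) * (n - 2) / 6 * e ^ 3 ≤ (1 - e) ^ n := by
  induction n with
  | zero => simp
  | succ n ih =>
    have hn : (0 : ℝ) ≤ n * (n - 1) * (n - 2) := by
      rcases n with _ | _ | n
      · simp
      · simp
      · push_cast
        have : (0 : ℝ) ≤ n := n.cast_nonneg
        have e1 : ((n : ℝ) + 1 + 1) * (n + 1 + 1 - 1) * (n + 1 + 1 - 2) =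
          (n + 2) * (n + 1) * n := by ring
        rw [e1]
        positivity
    have h2 := mul_le_mul_of_nonneg_right ih (sub_nonneg.2 h1)
    rw [pow_succ (1 - e)]
    push_cast
    have h3 : 0 ≤ (n : ℝ) * (n - 1) * (n - 2) / 6 * e ^ 4 := by positivity
    linarith

/-- The constant satisfies (13/25)^17 ≤ 2^{-16}, and 13/25 exceeds the bound 51/100 for 1/z by the
radius 1/100 needed in Cauchy's estimate. -/
theorem pow_pow_le_of_le {q : ℝ} {t : ℕ} (ht : 16 ≤ t) (h0 : 0 ≤ q) (h1 : q ≤ 13 / 25) :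
    (q ^ (t + 1)) ^ t ≤ (1 / 2 ^ 16) ^ t := by
  have : q ^ (t + 1) ≤ 1 / 2 ^ 16 :=
    calc q ^ (t + 1) ≤ (13 / 25) ^ (t + 1) := by gcongr
      _ ≤ (13 / 25) ^ 17 := pow_le_pow_of_le_one (by norm_num) (by norm_num) (by omega)
      _ ≤ _ := by norm_num
  gcongr

/-- The parameters `x = 1 / t` and `y = t / 2 ^ (t + 1)` of the expansion at the zero near `1 / 2`. -/
theorem rhoExpansion {t : ℕ} (ht : 16 ≤ t) {θ : ℝ} (h0 : 0 ≤ θ) (h1 : θ ≤ 1) :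
    ∃ h k l, RhoExpansion (1 / t) (t / 2 ^ (t + 1)) θ h k l := by
  have ht' : (16 : ℝ) ≤ t := by exact_mod_cast ht
  refine ⟨_, _, _, by positivity, ?_, by positivity, ?_, h0, h1, rfl, rfl, rfl⟩
  · rw [div_le_div_iff₀ (by linarith) (by norm_num)]
    linarith
  · rw [div_le_div_iff₀ (by positivity) (by norm_num)]
    clear h0 h1
    induction t, ht using Nat.le_induction with
    | base => norm_num
    | succ n hn ih =>
      have := ih (by exact_mod_cast hn)
      have h2 : (16 : ℝ) ≤ n := by exact_mod_cast hn
      rw [pow_succ]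
      push_cast
      linarith

/-- The tails are of order 2^{-16t}, whereas the required accuracy y⁴ is of order t⁴ 2^{-4t}; they
are negligible in every expansion at this zero. -/
theorem small_tail {t : ℕ} (ht : 16 ≤ t) :
    200 * (1 / 2 ^ 16 : ℝ) ^ t ≤ ((t : ℝ) / 2 ^ (t + 1)) ^ 4 / 10 ^ 6 := by
  have ht' : (16 : ℝ) ≤ t := by exact_mod_cast ht
  have h1 : (2 : ℝ) ^ 40 ≤ (2 ^ 12) ^ t :=
    calc (2 : ℝ) ^ 40 ≤ (2 ^ 12) ^ 16 := by norm_num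
      _ ≤ _ := pow_le_pow_right₀ (by norm_num) ht
  have h2 : (200 : ℝ) * 16 * 10 ^ 6 ≤ t ^ 4 * (2 ^ 12) ^ t := by
    calc (200 : ℝ) * 16 * 10 ^ 6 ≤ 1 * 2 ^ 40 := by norm_num
      _ ≤ _ := by
        gcongr
        exact one_le_pow₀ (by linarith)
  have e : (1 / 2 ^ 16 : ℝ) ^ t = 1 / ((2 ^ 12) ^ t * (2 ^ 4) ^ t) := by
    rw [← mul_pow, div_pow, one_pow]
    norm_num
  have e' : ((t : ℝ) / 2 ^ (t + 1)) ^ 4 = t ^ 4 / ((2 ^ 4) ^ t * 16) := by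
    rw [div_pow, ← pow_mul, add_mul, pow_add, mul_comm t, pow_mul]
    norm_num
  have h0 : (0 : ℝ) < (2 ^ 4) ^ t := by positivity
  rw [e, e', mul_one_div, div_div, div_le_div_iff₀ (by positivity) (by positivity)]
  have := mul_le_mul_of_nonneg_right h2 h0.le
  linarith

/-- The factor 200 is 2 divided by the Cauchy radius 1/100 of the derivative; the two tails
themselves need only the factor 2. -/
theorem norm_tails_le {t : ℕ} (ht : 16 ≤ t) {z : ℝ} (hz : 199 / 100 ≤ z) :
    ‖denomTail t (z⁻¹ : ℝ)‖ ≤ 200 * (1 / 2 ^ 16 : ℝ) ^ t ∧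
    ‖numerTail t (z⁻¹ : ℝ)‖ ≤ 200 * (1 / 2 ^ 16 : ℝ) ^ t ∧
    ‖deriv (denomTail t) (z⁻¹ : ℝ)‖ ≤ 200 * (1 / 2 ^ 16 : ℝ) ^ t := by
  have hz0 : 0 < z := by linarith
  have hq : z⁻¹ ≤ 51 / 100 := by
    rw [inv_le_comm₀ hz0 (by norm_num)]
    norm_num
    linarith
  have hq0 : 0 ≤ z⁻¹ := (inv_pos.2 hz0).le
  have hM : (1 / 2 ^ 16 : ℝ) ^ t ≤ 1 / 4 :=
    (pow_le_pow_of_le_one (by norm_num) (by norm_num) (by omega : 1 ≤ t)).trans (by norm_num)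
  have hM0 : (0 : ℝ) ≤ (1 / 2 ^ 16 : ℝ) ^ t := by positivity
  have hn : ‖((z⁻¹ : ℝ) : ℂ)‖ = z⁻¹ := by rw [Complex.norm_real, Real.norm_of_nonneg hq0]
  have hp : (‖((z⁻¹ : ℝ) : ℂ)‖ ^ (t + 1)) ^ t ≤ (1 / 2 ^ 16) ^ t := by
    rw [hn]
    exact pow_pow_le_of_le ht hq0 (by linarith)
  have hn1 : ‖((z⁻¹ : ℝ) : ℂ)‖ < 1 := by rw [hn]; linarith
  refine ⟨(norm_denomTail_le (by omega) hn1 hp hM).trans (by linarith),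
    (norm_numerTail_le (by omega) hn1 hp hM).trans (by linarith), ?_⟩
  refine (norm_deriv_denomTail_le (by omega) hq0 (d := 1 / 100) (by norm_num) (by linarith)
    (pow_pow_le_of_le ht (by linarith) (by linarith)) hM).trans (by linarith)

/-- The zero near `1 / 2`. -/
theorem exists_rho {t : ℕ} (ht : 16 ≤ t) : ∃ θ h k l : ℝ,
    RhoExpansion (1 / t) (t / 2 ^ (t + 1)) θ h k l ∧
      denom t ((2 - h / 2 ^ (t + 1))⁻¹ : ℝ) = 0 := by
  have ht' : (16 : ℝ) ≤ t := by exact_mod_cast ht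
  have ht0 : (0 : ℝ) < t := by linarith
  obtain ⟨h₁, k₁, l₁, H₁⟩ := rhoExpansion ht zero_le_one le_rfl
  obtain ⟨h₀, k₀, l₀, H₀⟩ := rhoExpansion ht le_rfl zero_le_one
  have tl := small_tail ht
  have hP : (0 : ℝ) < 2 ^ (t + 1) := by positivity
  obtain ⟨x, hx⟩ : ∃ x : ℝ, x = 1 / t := ⟨_, rfl⟩
  obtain ⟨u, hu⟩ : ∃ u : ℝ, u = 1 / 2 ^ (t + 1) := ⟨_, rfl⟩
  obtain ⟨y, hy⟩ : ∃ y : ℝ, y = t / 2 ^ (t + 1) := ⟨_, rfl⟩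
  have hu0 : 0 < u := by rw [hu]; positivity
  have hy0 : 0 < y := by rw [hy]; positivity
  have htu : t * u = y := by rw [hu, hy]; ring
  have hxy : x * y = u := by rw [hx, hy, hu]; field_simp
  rw [← hx, ← hy] at H₁ H₀
  rw [← hy] at tl
  have a₁ := H₁.h_mem
  have a₀ := H₀.h_mem
  have hx1 := H₁.x_le
  have hx0 := H₁.x_nonneg
  have hy1 := H₁.y_le
  have hu1 : u ≤ 1 / 16 * (1 / 8192) := by rw [← hxy]; gcongr
  have hs : ∀ h : ℝ, h / 2 ^ (t + 1) = u * h := fun h => by rw [hu]; ring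
  have hy34 : y ^ 4 ≤ y ^ 3 := pow_le_pow_of_le_one hy0.le (by linarith) (by norm_num)
  have hy3 : 0 < y ^ 3 := by positivity
  have hε : 200 * (1 / 2 ^ 16 : ℝ) ^ t < y ^ 3 / 100 := by linarith
  have h01 : h₀ ≤ h₁ := by
    rw [H₁.h_eq, H₁.k_eq, H₁.l_eq, H₀.h_eq, H₀.k_eq, H₀.l_eq]
    gcongr
    norm_num
  have hpow : ∀ h : ℝ, (2 - u * h) ^ (t + 1) * (u * h) = h * (1 - u * h / 2) ^ (t + 1) := by
    intro h
    have e : 2 - u * h = 2 * (1 - u * h / 2) := by ring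
    rw [e, mul_pow, hu]
    field_simp
  have hub₁ : u * h₁ ≤ 1 / 16 * (1 / 8192) * (1001 / 1000) := by
    gcongr
    exacts [by linarith, a₁.2]
  have hub₀ : u * h₀ ≤ 1 / 16 * (1 / 8192) * (1001 / 1000) := by
    gcongr
    exacts [by linarith, a₀.2]
  have hlb₁ : 0 ≤ u * h₁ := mul_nonneg hu0.le (by linarith)
  have hlb₀ : 0 ≤ u * h₀ := mul_nonneg hu0.le (by linarith)
  obtain ⟨z, z1, z2, z3⟩ := exists_inv_zero (by omega : 2 ≤ t) (u := 2 - u * h₁) (v := 2 - u * h₀)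
    (ε := 200 * (1 / 2 ^ 16 : ℝ) ^ t) (by linarith)
    (by gcongr) (fun z h1 _ => (norm_tails_le ht (by linarith)).1) (Or.inr (by
      rw [sub_sub_cancel, sub_sub_cancel, hpow, hpow]
      constructor
      · have h1 := H₁.lower
        have h2 := le_one_sub_pow (e := u * h₁ / 2) (by linarith) (t + 1)
        have h3 := mul_le_mul_of_nonneg_left h2 (by linarith : 0 ≤ h₁)
        push_cast at h3
        have e : 1 - ((t : ℝ) + 1) * (u * h₁ / 2) + (t + 1) * (t + 1 - 1) / 2 * (u * h₁ / 2) ^ 2 -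
          (t + 1) * (t + 1 - 1) * (t + 1 - 2) / 6 * (u * h₁ / 2) ^ 3 =
          1 - (1 + x) * y * h₁ / 2 + (1 + x) * y ^ 2 * h₁ ^ 2 / 8 -
            (1 - x ^ 2) * y ^ 3 * h₁ ^ 3 / 48 := by
          rw [← htu, hx]
          field_simp
          ring
        rw [e] at h3
        rw [hxy] at h1
        linarith
      · have h1 := H₀.upper
        have h2 := one_sub_pow_le (e := u * h₀ / 2) (by linarith) (by linarith) (t + 1)
        have h3 := mul_le_mul_of_nonneg_left h2 (by linarith : 0 ≤ h₀)
        push_cast at h3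
        have e : 1 - ((t : ℝ) + 1) * (u * h₀ / 2) + (t + 1) * (t + 1 - 1) / 2 * (u * h₀ / 2) ^ 2 =
          1 - (1 + x) * y * h₀ / 2 + (1 + x) * y ^ 2 * h₀ ^ 2 / 8 := by
          rw [← htu, hx]
          field_simp
          ring
        rw [e] at h3
        rw [hxy] at h1
        linarith))
  have hb1 : (2 - z) / u ≤ h₁ := by rw [div_le_iff₀ hu0]; linarith
  have hb0 : h₀ ≤ (2 - z) / u := by rw [le_div_iff₀ hu0]; linarith
  -- The parameter θ is read off from the zero: h lies between the values belonging to θ = 0 and θ =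
  -- 1 and depends on θ affinely and increasingly, so θ lies in [0, 1].
  have hkl : ∀ h θ : ℝ, h = 1 + y * ((1 + 3 * x) / 2 + y * ((3 + 19 * x + 24 * x ^ 2) / 8 + y * θ)) ↔
      θ = (h - (1 + y * ((1 + 3 * x) / 2 + y * ((3 + 19 * x + 24 * x ^ 2) / 8)))) / y ^ 3 := by
    intro h θ
    rw [eq_div_iff hy3.ne']
    constructor <;> intro h <;> linarith
  have e1 := (hkl h₁ 1).1 (by rw [H₁.h_eq, H₁.k_eq, H₁.l_eq])
  have e0 := (hkl h₀ 0).1 (by rw [H₀.h_eq, H₀.k_eq, H₀.l_eq])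
  rw [← hx, ← hy]
  refine ⟨_, (2 - z) / u, _, _, ⟨H₁.x_nonneg, H₁.x_le, H₁.y_nonneg, H₁.y_le, ?_, ?_, rfl, rfl,
    (hkl _ _).2 rfl⟩, ?_⟩
  · exact e0.le.trans (by gcongr)
  · refine le_trans ?_ e1.ge
    gcongr
  · rw [hs, mul_div_cancel₀ _ hu0.ne', sub_sub_cancel]
    exact z3

/-- From R(D-e) = N+f one gets (R-S)(D-e) = (N-SD) + f + Se: an approximate quotient S is tested by
multiplication, and the perturbations enter additively. -/
theorem abs_quotient_sub_le {R D S N e f a b d : ℝ} (h : R * (D - e) = N + f) (hd : 0 < d)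
    (hD : d ≤ D - e) (hS : |S| ≤ 1) (hN : |N - S * D| ≤ a) (he : |e| ≤ b) (hf : |f| ≤ b) :
    |R - S| * d ≤ a + 2 * b := by
  have e1 : (R - S) * (D - e) = (N - S * D) + f + S * e := by linear_combination h
  calc |R - S| * d ≤ |R - S| * (D - e) := by gcongr
    _ = |(R - S) * (D - e)| := by rw [abs_mul, abs_of_pos (hd.trans_le hD)]
    _ ≤ |N - S * D| + |f| + |S * e| := by rw [e1]; exact abs_add_three _ _ _
    _ ≤ a + b + 1 * b := by
      rw [abs_mul S]
      gcongr
    _ = _ := by ring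

theorem abs_residueSeries_sub_le {x m : ℝ} (hx : 0 ≤ x) (hx' : x ≤ 1 / 16) (hm : 0 ≤ m)
    (hm' : m ≤ 1 / 1000) : |RhoExpansion.residueSeries x m - 1 / 8| ≤ 1 / 1000 := by
  have e : RhoExpansion.residueSeries x m - 1 / 8 = m * ((1 - 2 * x) / 16 +
      m * (1 + 2 * x + x ^ 2) / 32 + m ^ 2 * ((1 + 6 * x + 3 * x ^ 2 - 16 * x ^ 3) / 64)) := by
    rw [RhoExpansion.residueSeries]; ring
  have x3 : x ^ 3 ≤ (1 / 16) ^ 3 := by gcongr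
  have x2 : x ^ 2 ≤ (1 / 16) ^ 2 := by gcongr
  have x3' : 0 ≤ x ^ 3 := by positivity
  have x2' : 0 ≤ x ^ 2 := by positivity
  norm_num at x3 x2
  have a1 : m * (1 + 2 * x + x ^ 2) / 32 ≤ 1 / 1000 * 2 / 32 := by
    gcongr
    linarith only [hx', x2]
  have a0 : 0 ≤ (1 + 6 * x + 3 * x ^ 2 - 16 * x ^ 3) / 64 := by linarith only [hx, x3, x2']
  have a2 : m ^ 2 * ((1 + 6 * x + 3 * x ^ 2 - 16 * x ^ 3) / 64) ≤ (1 / 1000) ^ 2 * 1 := by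
    gcongr
    linarith only [hx', x3', x2]
  have a3 : 0 ≤ m ^ 2 * ((1 + 6 * x + 3 * x ^ 2 - 16 * x ^ 3) / 64) := by positivity
  have a4 : 0 ≤ m * (1 + 2 * x + x ^ 2) / 32 := by positivity
  norm_num at a1 a2
  rw [e, abs_of_nonneg (mul_nonneg hm (by linarith only [a3, a4, hx']))]
  refine (mul_le_mul hm' (b := (1 / 1000 : ℝ)) (d := 1) (by linarith only [a1, a2, hx])
    (by linarith only [a3, a4, hx']) (by norm_num)).trans (by norm_num)

/-- The nested form reproduces the printed expansion exactly, and the deviation is -θ t³/2^{4t+4}.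
-/
theorem rho_expansion_eq {t : ℕ} (ht : 16 ≤ t) {x y θ h k l : ℝ} (H : RhoExpansion x y θ h k l)
    (hx : x = 1 / t) (hy : y = t / (2 ^ t * 2)) :
    2 - x * (y * h) - (2 - 1 / 2 ^ (t + 1) - ((t : ℝ) + 3) / 2 ^ (2 * t + 3)
      - (3 * (t : ℝ) ^ 2 + 19 * (t : ℝ) + 24) / 2 ^ (3 * t + 6)) = -(x * y * (y ^ 3 * θ)) := by
  have ht0 : (0 : ℝ) < t := by exact_mod_cast (by omega : 0 < t)
  have e1 : (2 : ℝ) ^ (t + 1) = 2 ^ t * 2 := pow_succ _ _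
  have e2 : (2 : ℝ) ^ (2 * t + 3) = (2 ^ t) ^ 2 * 8 := by
    rw [pow_add, mul_comm 2 t, pow_mul]
    norm_num
  have e3 : (2 : ℝ) ^ (3 * t + 6) = (2 ^ t) ^ 3 * 64 := by
    rw [pow_add, mul_comm 3 t, pow_mul]
    norm_num
  have hP0 : (0 : ℝ) < 2 ^ t := by positivity
  rw [e1, e2, e3, H.h_eq, H.k_eq, H.l_eq, hy, hx]
  generalize (2 : ℝ) ^ t = P at *
  field_simp
  ring

theorem residue_expansion_eq {t : ℕ} (ht : 16 ≤ t) {x y : ℝ} (hx : x = 1 / t)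
    (hy : y = t / (2 ^ t * 2)) :
    1 / 8 + ((t : ℝ) - 2) / 2 ^ (t + 5) + (2 * (t : ℝ) ^ 2 + 3 * (t : ℝ) - 5) / 2 ^ (2 * t + 7)
      + (9 * (t : ℝ) ^ 3 + 45 * (t : ℝ) ^ 2 + 20 * (t : ℝ) - 68) / 2 ^ (3 * t + 10) =
      1 / 8 + y * (1 - 2 * x) / 16 + y ^ 2 * (2 + 3 * x - 5 * x ^ 2) / 32 +
      y ^ 3 * (9 + 45 * x + 20 * x ^ 2 - 68 * x ^ 3) / 128 := by
  have ht0 : (0 : ℝ) < t := by exact_mod_cast (by omega : 0 < t)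
  have e1 : (2 : ℝ) ^ (t + 5) = 2 ^ t * 32 := by
    rw [pow_add]
    norm_num
  have e2 : (2 : ℝ) ^ (2 * t + 7) = (2 ^ t) ^ 2 * 128 := by
    rw [pow_add, mul_comm 2 t, pow_mul]
    norm_num
  have e3 : (2 : ℝ) ^ (3 * t + 10) = (2 ^ t) ^ 3 * 1024 := by
    rw [pow_add, mul_comm 3 t, pow_mul]
    norm_num
  have hP0 : (0 : ℝ) < 2 ^ t := by positivity
  rw [e1, e2, e3, hy, hx]
  generalize (2 : ℝ) ^ t = P at *
  field_simp
  ring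

set_option maxHeartbeats 400000 in
/-- The expansions of `rho` and `R` for large `t`. -/
theorem exists_rho_residue {t : ℕ} (ht : 16 ≤ t) : ∃ z R : ℝ, 199 / 100 ≤ z ∧ z ≤ 2 ∧
    denom t (z⁻¹ : ℝ) = 0 ∧ residue t (z⁻¹ : ℝ) = R ∧ 1 / 9 ≤ R ∧ R ≤ 1 / 7 ∧
    |2 - z| ≤ 2 / 2 ^ (t + 1) ∧
    |z - (2 - 1 / 2 ^ (t + 1) - ((t : ℝ) + 3) / 2 ^ (2 * t + 3)
      - (3 * (t : ℝ) ^ 2 + 19 * (t : ℝ) + 24) / 2 ^ (3 * t + 6))|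
      ≤ 0.28 * (t : ℝ) ^ 3 / 2 ^ (4 * t) ∧
    |R - (1 / 8 + ((t : ℝ) - 2) / 2 ^ (t + 5)
      + (2 * (t : ℝ) ^ 2 + 3 * (t : ℝ) - 5) / 2 ^ (2 * t + 7)
      + (9 * (t : ℝ) ^ 3 + 45 * (t : ℝ) ^ 2 + 20 * (t : ℝ) - 68) / 2 ^ (3 * t + 10))|
      ≤ (t : ℝ) ^ 4 / (50 * 2 ^ (4 * t)) := by
  have ht' : (16 : ℝ) ≤ t := by exact_mod_cast ht
  have ht0 : (0 : ℝ) < t := by linarith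
  obtain ⟨θ, h, k, l, H, hz⟩ := exists_rho ht
  have tl := small_tail ht
  obtain ⟨ε, hε⟩ : ∃ ε : ℝ, ε = 200 * (1 / 2 ^ 16) ^ t := ⟨_, rfl⟩
  obtain ⟨x, hx⟩ : ∃ x : ℝ, x = 1 / t := ⟨_, rfl⟩
  obtain ⟨P, hP⟩ : ∃ P : ℝ, P = 2 ^ t := ⟨_, rfl⟩
  obtain ⟨y, hy⟩ : ∃ y : ℝ, y = t / 2 ^ (t + 1) := ⟨_, rfl⟩
  have hP0 : 0 < P := by rw [hP]; positivity
  have hyP : y = t / (P * 2) := by rw [hy, pow_succ, hP]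
  have hy0 : 0 < y := by rw [hy]; positivity
  rw [← hx, ← hy] at H
  rw [← hy, ← hε] at tl
  have hxyh : h / 2 ^ (t + 1) = x * y * h := by rw [hx, hy]; field_simp
  have hxy : 1 / 2 ^ (t + 1) = x * y := by rw [hx, hy]; field_simp
  have hxt : x * t = 1 := by rw [hx]; field_simp
  have hxyP : x * y = 1 / (P * 2) := by rw [hx, hyP]; field_simp
  rw [hxyh] at hz
  obtain ⟨h1, h2⟩ := H.h_mem
  have hx0 := H.x_nonneg
  have hx1 := H.x_le
  have hy1 := H.y_le
  have hh0 : 0 ≤ h := by linarith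
  obtain ⟨m, hm⟩ : ∃ m : ℝ, m = y * h := ⟨_, rfl⟩
  have hm0 : 0 ≤ m := by rw [hm]; positivity
  have hm1 : m ≤ 1 / 1000 := by
    have : y * h ≤ 1 / 8192 * (1001 / 1000) := by gcongr
    rw [hm]; linarith
  have hxm0 : 0 ≤ x * m := by positivity
  have hxm1 : x * m ≤ 1 / 16 * (1 / 1000) := by gcongr
  have hxm : x * y * h = x * m := by rw [hm]; ring
  rw [hxm] at hz
  have hzz : 199 / 100 ≤ 2 - x * m := by linarith
  obtain ⟨n1, n2, n3⟩ := norm_tails_le ht hzz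
  rw [← hε] at n1 n2 n3
  have hε0 : 0 ≤ ε := (norm_nonneg _).trans n1
  have hy4 : y ^ 4 ≤ (1 / 8192) ^ 4 := by gcongr
  have hε1 : ε ≤ 1 / 10 ^ 6 := by
    refine tl.trans ?_
    gcongr
    refine hy4.trans ?_
    norm_num
  obtain ⟨B, hB⟩ : ∃ B : ℝ, B = 2 - x * m - (1 + x) * m * (1 + x * m) := ⟨_, rfl⟩
  have hB1 : 1.99 ≤ B := by
    have : (1 + x) * m * (1 + x * m) ≤ (1 + 1 / 16) * (1 / 1000) * (1 + 1 / 16 * (1 / 1000)) := by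
      gcongr
    rw [hB]
    norm_num at this ⊢
    linarith
  have hB2 : B ≤ 2 := by
    have : 0 ≤ (1 + x) * m * (1 + x * m) := by positivity
    rw [hB]
    linarith
  have h1xm : 0 < 1 + x * m := by linarith
  have hY : ((t : ℝ) + 2) * (2 - (2 - x * m)) - 2 + (2 - (2 - x * m)) * (2 - x * m) /
      -- With z = 2 - xm, the identity t·xm = m clears t from the derivative factor, which becomes
      -- -B/(1+xm) with B close to 2; in particular it stays away from 0.
      (3 - (2 - x * m)) = -B / (1 + x * m) := by
    have e : (t : ℝ) * (x * m) = m := by linear_combination m * hxt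
    rw [eq_div_iff h1xm.ne', show 3 - (2 - x * m) = 1 + x * m by ring, add_mul,
      div_mul_cancel₀ _ h1xm.ne', hB]
    linear_combination (1 + x * m) * e
  obtain ⟨R, e₁, e₂, hR, he₁, he₂, hRe⟩ := residue_approx (by omega) (by linarith) (by linarith)
    hz n1 n2 n3 (by linarith) (by
      rw [hY, abs_div, abs_neg, abs_of_pos (by linarith), abs_of_pos h1xm, lt_div_iff₀ h1xm]
      nlinarith)
  obtain ⟨D, hD⟩ : ∃ D : ℝ, D = (2 - x * m) ^ 2 * (1 + x * m) * B := ⟨_, rfl⟩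
  have hD1 : 7.8 ≤ D := by
    have : (2 - 1 / 16 * (1 / 1000)) ^ 2 * (1 + 0) * 1.99 ≤ D := by
      rw [hD]
      gcongr
    norm_num at this ⊢
    linarith
  rw [hY] at hRe
  have hz0 : 0 < 2 - x * m := by linarith
  obtain ⟨c, hc⟩ : ∃ c : ℝ, c = (2 - x * m) ^ 2 * (1 + x * m) ^ 2 := ⟨_, rfl⟩
  have hc0 : 0 ≤ c := by rw [hc]; positivity
  have hc1 : c ≤ 5 := by
    have : c ≤ 2 ^ 2 * (1 + 1 / 16 * (1 / 1000)) ^ 2 := by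
      rw [hc]
      gcongr
      linarith
    norm_num at this ⊢
    linarith
  have hRD : R * (D - e₁ * c) = 1 - 2 * (x * m) + e₂ * c := by
    rw [show 2 * (2 - x * m) - 3 = 1 - 2 * (x * m) by ring,
      show 3 - (2 - x * m) = 1 + x * m by ring] at hRe
    have := congrArg (fun s => -(s * c)) hRe
    simp only [hc] at this
    rw [hD, hc]
    field_simp at this
    linear_combination this
  obtain ⟨T, hT⟩ : ∃ T : ℝ, T = 1 / 8 + y * (1 - 2 * x) / 16 +
      y ^ 2 * (2 + 3 * x - 5 * x ^ 2) / 32 +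
      y ^ 3 * (9 + 45 * x + 20 * x ^ 2 - 68 * x ^ 3) / 128 := ⟨_, rfl⟩
  have r1 := RhoExpansion.abs_one_sub_residueSeries_mul_le hx0 hx1 hm0 hm1
  have r2 := H.abs_residueSeries_sub_le
  rw [← hT, ← hm] at r2
  rw [← hB, ← hD] at r1
  have hm4 : m ^ 4 ≤ 1.01 * y ^ 4 := by
    have : h ^ 4 ≤ (1001 / 1000) ^ 4 := by gcongr
    rw [hm, mul_pow, mul_comm]
    gcongr
    norm_num at this ⊢
    linarith
  have hy40 : 0 < y ^ 4 := by positivity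
  have hTs := abs_residueSeries_sub_le hx0 hx1 hm0 hm1
  have hc5 : ∀ e : ℝ, |e| ≤ 2 * ε → |e * c| ≤ 10 * ε := fun e he => by
    rw [abs_mul, abs_of_nonneg hc0]
    calc |e| * c ≤ 2 * ε * 5 := by gcongr
      _ = _ := by ring
  have c₁ := hc5 e₁ he₁
  have c₂ := hc5 e₂ he₂
  obtain ⟨S, hS⟩ : ∃ S : ℝ, S = RhoExpansion.residueSeries x m := ⟨_, rfl⟩
  rw [← hS] at r1 r2 hTs
  have hDc : 7.7 ≤ D - e₁ * c := by linarith [(abs_le.1 c₁).2]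
  have hRS : |R - S| ≤ 1 / 20 * y ^ 4 := by
    have hSle : |S| ≤ 1 := by
      rw [abs_le] at hTs ⊢
      constructor <;> linarith only [hTs.1, hTs.2]
    have := abs_quotient_sub_le hRD (by norm_num) hDc hSle r1 c₁ c₂
    linarith only [this, hm4, tl, hy40]
  -- Since y⁴ = t⁴/(16·2^{4t}), the bound 0.32 y⁴ is exactly t⁴/(50·2^{4t}).
  have hRT : |R - T| ≤ 0.32 * y ^ 4 := by
    linarith only [abs_sub_le R S T, hRS, r2, hy40]
  have hy4' : y ^ 4 ≤ 1 / 1000 := hy4.trans (by norm_num)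
  have hR8 : |R - 1 / 8| ≤ 1 / 500 := by
    linarith only [abs_sub_le R S (1 / 8), hRS, hTs, hy4']
  rw [abs_le] at hR8
  refine ⟨2 - x * m, R, hzz, by linarith only [hxm0], hz, hR, by linarith only [hR8.1],
    by linarith only [hR8.2], ?_, ?_,
    ?_⟩
  · rw [sub_sub_cancel, abs_of_nonneg hxm0, ← hxm, show (2 : ℝ) / 2 ^ (t + 1) = x * y * 2 by
      rw [← hxy]; ring]
    gcongr
    linarith only [h2]
  · have e4 : (2 : ℝ) ^ (4 * t) = P ^ 4 := by rw [mul_comm 4 t, pow_mul, hP]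
    have hθ1 := H.θ_le
    have hθ0 := H.θ_nonneg
    rw [hm, rho_expansion_eq ht H hx (hyP.trans (by rw [hP])), abs_neg, abs_of_nonneg (by positivity), e4]
    -- The product x y⁴ is t³/(16·2^{4t}), and 4.48/16 = 0.28; the deviation itself is several times
    -- smaller.
    calc x * y * (y ^ 3 * θ) ≤ x * y * (y ^ 3 * 4.48) := by gcongr; linarith only [hθ1]
      _ = _ := by
        rw [hx, hyP]
        field_simp
        norm_num
  · have e4 : (2 : ℝ) ^ (4 * t) = P ^ 4 := by rw [mul_comm 4 t, pow_mul, hP]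
    rw [residue_expansion_eq ht hx (hyP.trans (by rw [hP])), ← hT, e4]
    refine hRT.trans (le_of_eq ?_)
    rw [hyP]
    field_simp
    norm_num

/-! ### The second zero, near 1 + (log 2)/t, for t ≥ 40. -/

/-- The logarithm of `z ^ (t + 1) * (2 - z) / (3 - z)`, which is approximately `0` at the
reciprocals of the zeros. -/
noncomputable def gap (t : ℕ) (z : ℝ) : ℝ :=
  (t + 1) * Real.log z + Real.log (2 - z) - Real.log (3 - z)

/-- The expansion of `gap` at `1 + x σ` with `x = 1 / t`. -/
noncomputable def gapSeries (x σ : ℝ) : ℝ :=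
  (1 + x) * (σ - x * σ ^ 2 / 2 + x ^ 2 * σ ^ 3 / 3 - x ^ 3 * σ ^ 4 / 4 + x ^ 4 * σ ^ 5 / 5) -
    Real.log 2 - x * σ / 2 - 3 / 8 * x ^ 2 * σ ^ 2 - 7 / 24 * x ^ 3 * σ ^ 3 -
    15 / 64 * x ^ 4 * σ ^ 4

theorem exp_gap {t : ℕ} {z : ℝ} (h1 : 1 ≤ z) (h2 : z < 2) :
    z ^ (t + 1) * (2 - z) = (3 - z) * Real.exp (gap t z) := by
  have e : ((t : ℝ) + 1) * Real.log z = Real.log (z ^ (t + 1)) := by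
    rw [Real.log_pow]; push_cast; rfl
  have : 0 < z ^ (t + 1) := by positivity
  rw [gap, Real.exp_sub, Real.exp_add, e, Real.exp_log this, Real.exp_log (by linarith),
    Real.exp_log (by linarith), mul_div_cancel₀]
  linarith

theorem abs_log_one_sub_le {s : ℝ} (h0 : 0 ≤ s) (h1 : s < 1) :
    |Real.log (1 - s) + (s + s ^ 2 / 2 + s ^ 3 / 3 + s ^ 4 / 4)| ≤ s ^ 5 / (1 - s) := by
  have := Real.abs_log_sub_add_sum_range_le (x := s) (by rwa [abs_of_nonneg h0]) 4
  rw [abs_of_nonneg h0] at this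
  convert this using 2
  simp only [Finset.sum_range_succ, Finset.sum_range_zero]
  push_cast
  ring

theorem abs_log_one_add_le {s : ℝ} (h0 : 0 ≤ s) (h1 : s < 1) :
    |Real.log (1 + s) - (s - s ^ 2 / 2 + s ^ 3 / 3 - s ^ 4 / 4 + s ^ 5 / 5)| ≤
      s ^ 6 / (1 - s) := by
  have := Real.abs_log_sub_add_sum_range_le (x := -s) (by rwa [abs_neg, abs_of_nonneg h0]) 5
  rw [abs_neg, abs_of_nonneg h0, sub_neg_eq_add] at this
  convert this using 2
  simp only [Finset.sum_range_succ, Finset.sum_range_zero]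
  push_cast
  ring

/-- With s = xσ, log(1+s) is multiplied by t+1 and therefore expanded to order 5, whereas log(1-s)
and log(2-s) = log 2 + log(1-s/2) need order 4; all remainders are then of order x⁵. -/
theorem abs_gap_sub_gapSeries_le {t : ℕ} (ht : 16 ≤ t) {σ : ℝ} (h0 : 0 ≤ σ) (h1 : σ ≤ 7 / 10) :
    |gap t (1 + 1 / t * σ) - gapSeries (1 / t) σ| ≤ 32 / 100 * (1 / t) ^ 5 := by
  have ht' : (16 : ℝ) ≤ t := by exact_mod_cast ht
  obtain ⟨x, hx⟩ : ∃ x : ℝ, x = 1 / t := ⟨_, rfl⟩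
  have hx0 : 0 < x := by rw [hx]; positivity
  have hx1 : x ≤ 1 / 16 := by rw [hx]; gcongr
  have hxt : (t : ℝ) * x = 1 := by rw [hx]; field_simp
  rw [← hx]
  obtain ⟨s, hs⟩ : ∃ s : ℝ, s = x * σ := ⟨_, rfl⟩
  have hs0 : 0 ≤ s := by rw [hs]; positivity
  have hs1 : s ≤ 1 / 16 * (7 / 10) := by rw [hs]; gcongr
  have a1 := abs_log_one_add_le hs0 (by linarith)
  have a2 := abs_log_one_sub_le hs0 (by linarith)
  have a3 := abs_log_one_sub_le (s := s / 2) (by linarith) (by linarith)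
  have e3 : Real.log (3 - (1 + s)) = Real.log 2 + Real.log (1 - s / 2) := by
    rw [← Real.log_mul (by norm_num) (by linarith)]
    congr 1
    ring
  have e2 : 2 - (1 + s) = 1 - s := by ring
  have key : gap t (1 + s) - gapSeries x σ =
      (t + 1) * (Real.log (1 + s) - (s - s ^ 2 / 2 + s ^ 3 / 3 - s ^ 4 / 4 + s ^ 5 / 5)) +
      (Real.log (1 - s) + (s + s ^ 2 / 2 + s ^ 3 / 3 + s ^ 4 / 4)) -
      (Real.log (1 - s / 2) + (s / 2 + (s / 2) ^ 2 / 2 + (s / 2) ^ 3 / 3 + (s / 2) ^ 4 / 4)) := by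
    rw [gap, gapSeries, e3, e2, hs]
    linear_combination (exp := 1) ((σ - x * σ ^ 2 / 2 + x ^ 2 * σ ^ 3 / 3 - x ^ 3 * σ ^ 4 / 4 +
      x ^ 4 * σ ^ 5 / 5)) * hxt
  have b : s ^ 5 ≤ x ^ 5 * (7 / 10) ^ 5 := by rw [hs, mul_pow]; gcongr
  have b6 : s ^ 6 ≤ x ^ 6 * (7 / 10) ^ 6 := by rw [hs, mul_pow]; gcongr
  have c1 : s ^ 6 / (1 - s) ≤ x ^ 6 * (7 / 10) ^ 6 / (1 - 1 / 16 * (7 / 10)) := by gcongr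
  have c2 : s ^ 5 / (1 - s) ≤ x ^ 5 * (7 / 10) ^ 5 / (1 - 1 / 16 * (7 / 10)) := by gcongr
  have c3 : (s / 2) ^ 5 / (1 - s / 2) ≤ x ^ 5 * (7 / 10) ^ 5 / 32 / (1 - 1 / 16 * (7 / 10)) := by
    rw [div_pow, show (2 : ℝ) ^ 5 = 32 by norm_num]
    gcongr
    linarith
  have d1 := mul_le_mul_of_nonneg_left (a1.trans c1) (by positivity : (0 : ℝ) ≤ t + 1)
  have d2 : ((t : ℝ) + 1) * (x ^ 6 * (7 / 10) ^ 6 / (1 - 1 / 16 * (7 / 10))) =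
      (1 + x) * x ^ 5 * ((7 / 10) ^ 6 / (1 - 1 / 16 * (7 / 10))) := by
    linear_combination x ^ 5 * ((7 / 10) ^ 6 / (1 - 1 / 16 * (7 / 10))) * hxt
  have d3 : (1 + x) * x ^ 5 * ((7 / 10) ^ 6 / (1 - 1 / 16 * (7 / 10))) ≤
      (1 + 1 / 16) * x ^ 5 * ((7 / 10) ^ 6 / (1 - 1 / 16 * (7 / 10))) := by gcongr
  have x5 : 0 < x ^ 5 := by positivity
  have d0 : |((t : ℝ) + 1) * (Real.log (1 + s) - (s - s ^ 2 / 2 + s ^ 3 / 3 - s ^ 4 / 4 +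
      s ^ 5 / 5))| ≤ (t + 1) * (x ^ 6 * (7 / 10) ^ 6 / (1 - 1 / 16 * (7 / 10))) := by
    rw [abs_mul, abs_of_pos (by positivity)]
    exact d1
  rw [← hs, key]
  rw [d2] at d0
  rw [abs_le] at d0 a2 a3 ⊢
  norm_num at d0 d3 c2 c3
  constructor <;> linarith only [d0.1, d0.2, d3, c2, c3, a2.1, a2.2, a3.1, a3.2, x5]

theorem gapSeries_eq {L x d σ A β γ : ℝ} (hL : L = Real.log 2) (hσ : σ = L - x * A)
    (hA : A = (L - L ^ 2) / 2 - x * β) (hβ : β = (4 * L ^ 3 + 3 * L ^ 2 + 6 * L) / 24 + x * γ)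
    (hγ : γ = (2 * L ^ 4 + 54 * L ^ 3 - 27 * L ^ 2 - 6 * L) / 48 + x * d) :
    gapSeries x σ = x ^ 4 * (d + (
      1 / 4 * A * L * σ ^ 2 + 1 / 4 * A * L ^ 2 * σ + 1 / 4 * A * L ^ 3 + 1 / 2 * A * β + 1 / 4 *
      A * σ ^ 3 + 2 / 3 * A ^ 2 * L + 1 / 3 * A ^ 2 * σ + 3 / 4 * L ^ 2 * β + 1 / 5 * x * σ ^ 5 +
      1 / 2 * γ + 1 / 5 * σ ^ 5) - (
      1 / 24 * A * L * σ + 1 / 24 * A * L ^ 2 + 1 / 24 * A * σ ^ 2 + 7 / 8 * A ^ 2 + 3 / 2 * L *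
      β + L * γ + 31 / 64 * σ ^ 4)) := by
  rw [gapSeries, ← hL]
  linear_combination
    (1 - 2 / 3 * A * L * x ^ 3 + 1 / 2 * A * x ^ 2 + 7 / 8 * A * x ^ 3 - 1 / 3 * A * x ^ 3 * σ -
      1 / 2 * L * x - 7 / 8 * L * x ^ 2 + 1 / 3 * L * x ^ 2 * σ + 1 / 24 * L * x ^ 3 * σ - 1 / 4
      * L * x ^ 3 * σ ^ 2 + 1 / 3 * L ^ 2 * x ^ 2 + 1 / 24 * L ^ 2 * x ^ 3 - 1 / 4 * L ^ 2 * x ^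
      3 * σ - 1 / 4 * L ^ 3 * x ^ 3 + 1 / 2 * x - 1 / 2 * x * σ - 7 / 8 * x ^ 2 * σ + 1 / 3 * x ^
      2 * σ ^ 2 + 1 / 24 * x ^ 3 * σ ^ 2 - 1 / 4 * x ^ 3 * σ ^ 3) * hσ +
    (-1 / 2 * A * x ^ 3 + L * x ^ 2 + 3 / 2 * L * x ^ 3 - 3 / 4 * L ^ 2 * x ^ 3 - x - 1 / 2 * x
      ^ 2) * hA +
    (-L * x ^ 3 + x ^ 2 + 1 / 2 * x ^ 3) * hβ + (x ^ 3) * hγ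

/-- Positive and negative monomials are evaluated separately at the endpoints of the ranges least
favourable to the bound. The lower bound for γ is the one available for d ≥ 0. -/
theorem gapSeries_lower {L x σ A β γ : ℝ} (hL : 693147 / 1000000 ≤ L) (hL' : L ≤ 173287 / 250000)
    (hx : 0 ≤ x) (hσ : 8631 / 12500 ≤ σ) (hσ' : σ ≤ 173287 / 250000)
    (hA : 991 / 10000 ≤ A) (hA' : A ≤ 2127 / 20000) (hβ : 7221 / 25000 ≤ β)
    (hβ' : β ≤ 2897 / 10000) (hγ : 2737 / 100000 ≤ γ) (hγ' : γ ≤ 847 / 25000) :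
    1029 / 100000 ≤ 26 / 100 + (
      1 / 4 * A * L * σ ^ 2 + 1 / 4 * A * L ^ 2 * σ + 1 / 4 * A * L ^ 3 + 1 / 2 * A * β + 1 / 4 *
      A * σ ^ 3 + 2 / 3 * A ^ 2 * L + 1 / 3 * A ^ 2 * σ + 3 / 4 * L ^ 2 * β + 1 / 5 * x * σ ^ 5 +
      1 / 2 * γ + 1 / 5 * σ ^ 5) - (
      1 / 24 * A * L * σ + 1 / 24 * A * L ^ 2 + 1 / 24 * A * σ ^ 2 + 7 / 8 * A ^ 2 + 3 / 2 * L *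
      β + L * γ + 31 / 64 * σ ^ 4) := by
  have L0 : 0 ≤ L := le_trans (by norm_num) hL
  have σ0 : 0 ≤ σ := le_trans (by norm_num) hσ
  have A0 : 0 ≤ A := le_trans (by norm_num) hA
  have β0 : 0 ≤ β := le_trans (by norm_num) hβ
  have γ0 : 0 ≤ γ := le_trans (by norm_num) hγ
  have h1 : 1 / 4 * (991 / 10000) * (693147 / 1000000) * (8631 / 12500) ^ 2 + 1 / 4 * (991 / 10000) *
      (693147 / 1000000) ^ 2 * (8631 / 12500) + 1 / 4 * (991 / 10000) * (693147 / 1000000) ^ 3 +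
      1 / 2 * (991 / 10000) * (7221 / 25000) + 1 / 4 * (991 / 10000) * (8631 / 12500) ^ 3 + 2 / 3
      * (991 / 10000) ^ 2 * (693147 / 1000000) + 1 / 3 * (991 / 10000) ^ 2 * (8631 / 12500) + 3 /
      4 * (693147 / 1000000) ^ 2 * (7221 / 25000) + 1 / 5 * (0) * (8631 / 12500) ^ 5 + 1 / 2 *
      (2737 / 100000) + 1 / 5 * (8631 / 12500) ^ 5 ≤
      1 / 4 * A * L * σ ^ 2 + 1 / 4 * A * L ^ 2 * σ + 1 / 4 * A * L ^ 3 + 1 / 2 * A * β + 1 / 4 *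
      A * σ ^ 3 + 2 / 3 * A ^ 2 * L + 1 / 3 * A ^ 2 * σ + 3 / 4 * L ^ 2 * β + 1 / 5 * x * σ ^ 5 +
      1 / 2 * γ + 1 / 5 * σ ^ 5 := by gcongr
  have h2 : 1 / 24 * A * L * σ + 1 / 24 * A * L ^ 2 + 1 / 24 * A * σ ^ 2 + 7 / 8 * A ^ 2 + 3 / 2 * L *
      β + L * γ + 31 / 64 * σ ^ 4 ≤
      1 / 24 * (2127 / 20000) * (173287 / 250000) * (173287 / 250000) + 1 / 24 * (2127 / 20000) *
      (173287 / 250000) ^ 2 + 1 / 24 * (2127 / 20000) * (173287 / 250000) ^ 2 + 7 / 8 * (2127 /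
      20000) ^ 2 + 3 / 2 * (173287 / 250000) * (2897 / 10000) + (173287 / 250000) * (847 / 25000)
      + 31 / 64 * (173287 / 250000) ^ 4 := by gcongr
  norm_num only at h1 h2
  linarith only [h1, h2]

/-- At d = -0.26 the bracket is far from 0; the asymmetry with the other end reflects that the true
x⁵ coefficient of ρ₂ is positive. -/
theorem gapSeries_upper {L x σ A β γ : ℝ} (hL : 693147 / 1000000 ≤ L) (hL' : L ≤ 173287 / 250000)
    (hx' : x ≤ 1 / 40) (hσ : 8631 / 12500 ≤ σ) (hσ' : σ ≤ 173287 / 250000)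
    (hA : 991 / 10000 ≤ A) (hA' : A ≤ 2127 / 20000) (hβ : 7221 / 25000 ≤ β)
    (hβ' : β ≤ 2897 / 10000) (hγ : 2087 / 100000 ≤ γ) (hγ' : γ ≤ 847 / 25000) :
    -(26 / 100) + (
      1 / 4 * A * L * σ ^ 2 + 1 / 4 * A * L ^ 2 * σ + 1 / 4 * A * L ^ 3 + 1 / 2 * A * β + 1 / 4 *
      A * σ ^ 3 + 2 / 3 * A ^ 2 * L + 1 / 3 * A ^ 2 * σ + 3 / 4 * L ^ 2 * β + 1 / 5 * x * σ ^ 5 +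
      1 / 2 * γ + 1 / 5 * σ ^ 5) - (
      1 / 24 * A * L * σ + 1 / 24 * A * L ^ 2 + 1 / 24 * A * σ ^ 2 + 7 / 8 * A ^ 2 + 3 / 2 * L *
      β + L * γ + 31 / 64 * σ ^ 4) ≤ -(2 / 5) := by
  have L0 : 0 ≤ L := le_trans (by norm_num) hL
  have σ0 : 0 ≤ σ := le_trans (by norm_num) hσ
  have A0 : 0 ≤ A := le_trans (by norm_num) hA
  have β0 : 0 ≤ β := le_trans (by norm_num) hβ
  have γ0 : 0 ≤ γ := le_trans (by norm_num) hγ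
  have h1 : 1 / 4 * A * L * σ ^ 2 + 1 / 4 * A * L ^ 2 * σ + 1 / 4 * A * L ^ 3 + 1 / 2 * A * β + 1 / 4 *
      A * σ ^ 3 + 2 / 3 * A ^ 2 * L + 1 / 3 * A ^ 2 * σ + 3 / 4 * L ^ 2 * β + 1 / 5 * x * σ ^ 5 +
      1 / 2 * γ + 1 / 5 * σ ^ 5 ≤
      1 / 4 * (2127 / 20000) * (173287 / 250000) * (173287 / 250000) ^ 2 + 1 / 4 * (2127 / 20000)
      * (173287 / 250000) ^ 2 * (173287 / 250000) + 1 / 4 * (2127 / 20000) * (173287 / 250000) ^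
      3 + 1 / 2 * (2127 / 20000) * (2897 / 10000) + 1 / 4 * (2127 / 20000) * (173287 / 250000) ^
      3 + 2 / 3 * (2127 / 20000) ^ 2 * (173287 / 250000) + 1 / 3 * (2127 / 20000) ^ 2 * (173287 /
      250000) + 3 / 4 * (173287 / 250000) ^ 2 * (2897 / 10000) + 1 / 5 * (1 / 40) * (173287 /
      250000) ^ 5 + 1 / 2 * (847 / 25000) + 1 / 5 * (173287 / 250000) ^ 5 := by gcongr
  have h2 : 1 / 24 * (991 / 10000) * (693147 / 1000000) * (8631 / 12500) + 1 / 24 * (991 / 10000) *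
      (693147 / 1000000) ^ 2 + 1 / 24 * (991 / 10000) * (8631 / 12500) ^ 2 + 7 / 8 * (991 /
      10000) ^ 2 + 3 / 2 * (693147 / 1000000) * (7221 / 25000) + (693147 / 1000000) * (2087 /
      100000) + 31 / 64 * (8631 / 12500) ^ 4 ≤
      1 / 24 * A * L * σ + 1 / 24 * A * L ^ 2 + 1 / 24 * A * σ ^ 2 + 7 / 8 * A ^ 2 + 3 / 2 * L *
      β + L * γ + 31 / 64 * σ ^ 4 := by gcongr
  norm_num only at h1 h2
  linarith only [h1, h2]

/-- Cross-multiplied test of the approximation x/4 - (4L+1)x²/8 to the residue: substituting σ = L -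
xA cancels the terms up to x². -/
theorem residue_poly_eq {L x σ A : ℝ} (hσ : σ = L - x * A) :
    x * (1 - 2 * (x * σ)) - (x / 4 - (4 * L + 1) * x ^ 2 / 8) * ((1 + x * σ) ^ 2 * (2 - x * σ) *
      ((1 + x) * (1 - x * σ) * (2 - x * σ) - x * (1 + x * σ))) = x ^ 3 * ((
      1 / 4 + 2 * A + L + 1 / 2 * L * x ^ 2 * σ ^ 3 + L * x ^ 3 * σ ^ 3 + 3 / 2 * L * x ^ 3 * σ ^
      4 + 2 * L * x ^ 4 * σ ^ 4 + 13 / 8 * x * σ ^ 2 + 1 / 4 * x ^ 3 * σ ^ 3 + 1 / 4 * x ^ 3 * σ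
      ^ 5 + 1 / 2 * x ^ 4 * σ ^ 4 + 1 / 8 * x ^ 4 * σ ^ 5 + 5 / 4 * σ + 7 / 4 * σ ^ 2) - (
      5 / 2 * L * x * σ + 7 / 2 * L * x * σ ^ 2 + 5 * L * x ^ 2 * σ ^ 2 + 1 / 2 * L * x ^ 4 * σ ^
      5 + 1 / 2 * L * x ^ 5 * σ ^ 5 + 5 / 8 * x * σ + 1 / 4 * x * σ ^ 3 + 5 / 4 * x ^ 2 * σ ^ 2 +
      3 / 8 * x ^ 2 * σ ^ 3 + 3 / 4 * x ^ 2 * σ ^ 4 + 5 / 8 * x ^ 3 * σ ^ 4 + 1 / 8 * x ^ 5 * σ ^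
      5)) := by
  linear_combination (-2 * x ^ 2) * hσ

theorem abs_residue_poly_le {L x σ A : ℝ} (hσ : σ = L - x * A) (hL : 0 ≤ L) (hL' : L ≤ 7 / 10)
    (hx : 0 ≤ x) (hx' : x ≤ 1 / 40) (hσ0 : 0 ≤ σ) (hσ' : σ ≤ 7 / 10) (hA : 0 ≤ A)
    (hA' : A ≤ 11 / 100) :
    |x * (1 - 2 * (x * σ)) - (x / 4 - (4 * L + 1) * x ^ 2 / 8) * ((1 + x * σ) ^ 2 * (2 - x * σ) *
      ((1 + x) * (1 - x * σ) * (2 - x * σ) - x * (1 + x * σ)))| ≤ 3 * x ^ 3 := by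
  have h1 : 1 / 4 + 2 * A + L + 1 / 2 * L * x ^ 2 * σ ^ 3 + L * x ^ 3 * σ ^ 3 + 3 / 2 * L * x ^ 3 * σ ^
      4 + 2 * L * x ^ 4 * σ ^ 4 + 13 / 8 * x * σ ^ 2 + 1 / 4 * x ^ 3 * σ ^ 3 + 1 / 4 * x ^ 3 * σ
      ^ 5 + 1 / 2 * x ^ 4 * σ ^ 4 + 1 / 8 * x ^ 4 * σ ^ 5 + 5 / 4 * σ + 7 / 4 * σ ^ 2 ≤
      1 / 4 + 2 * (11 / 100) + (7 / 10) + 1 / 2 * (7 / 10) * (1 / 40) ^ 2 * (7 / 10) ^ 3 + (7 /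
      10) * (1 / 40) ^ 3 * (7 / 10) ^ 3 + 3 / 2 * (7 / 10) * (1 / 40) ^ 3 * (7 / 10) ^ 4 + 2 * (7
      / 10) * (1 / 40) ^ 4 * (7 / 10) ^ 4 + 13 / 8 * (1 / 40) * (7 / 10) ^ 2 + 1 / 4 * (1 / 40) ^
      3 * (7 / 10) ^ 3 + 1 / 4 * (1 / 40) ^ 3 * (7 / 10) ^ 5 + 1 / 2 * (1 / 40) ^ 4 * (7 / 10) ^
      4 + 1 / 8 * (1 / 40) ^ 4 * (7 / 10) ^ 5 + 5 / 4 * (7 / 10) + 7 / 4 * (7 / 10) ^ 2 := by gcongr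
  have h2 : 5 / 2 * L * x * σ + 7 / 2 * L * x * σ ^ 2 + 5 * L * x ^ 2 * σ ^ 2 + 1 / 2 * L * x ^ 4 * σ ^
      5 + 1 / 2 * L * x ^ 5 * σ ^ 5 + 5 / 8 * x * σ + 1 / 4 * x * σ ^ 3 + 5 / 4 * x ^ 2 * σ ^ 2 +
      3 / 8 * x ^ 2 * σ ^ 3 + 3 / 4 * x ^ 2 * σ ^ 4 + 5 / 8 * x ^ 3 * σ ^ 4 + 1 / 8 * x ^ 5 * σ ^
      5 ≤
      5 / 2 * (7 / 10) * (1 / 40) * (7 / 10) + 7 / 2 * (7 / 10) * (1 / 40) * (7 / 10) ^ 2 + 5 *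
      (7 / 10) * (1 / 40) ^ 2 * (7 / 10) ^ 2 + 1 / 2 * (7 / 10) * (1 / 40) ^ 4 * (7 / 10) ^ 5 + 1
      / 2 * (7 / 10) * (1 / 40) ^ 5 * (7 / 10) ^ 5 + 5 / 8 * (1 / 40) * (7 / 10) + 1 / 4 * (1 /
      40) * (7 / 10) ^ 3 + 5 / 4 * (1 / 40) ^ 2 * (7 / 10) ^ 2 + 3 / 8 * (1 / 40) ^ 2 * (7 / 10)
      ^ 3 + 3 / 4 * (1 / 40) ^ 2 * (7 / 10) ^ 4 + 5 / 8 * (1 / 40) ^ 3 * (7 / 10) ^ 4 + 1 / 8 *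
      (1 / 40) ^ 5 * (7 / 10) ^ 5 := by gcongr
  have h3 : 0 ≤ 1 / 4 + 2 * A + L + 1 / 2 * L * x ^ 2 * σ ^ 3 + L * x ^ 3 * σ ^ 3 + 3 / 2 * L * x ^ 3 * σ ^
      4 + 2 * L * x ^ 4 * σ ^ 4 + 13 / 8 * x * σ ^ 2 + 1 / 4 * x ^ 3 * σ ^ 3 + 1 / 4 * x ^ 3 * σ
      ^ 5 + 1 / 2 * x ^ 4 * σ ^ 4 + 1 / 8 * x ^ 4 * σ ^ 5 + 5 / 4 * σ + 7 / 4 * σ ^ 2 := by positivity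
  have h4 : 0 ≤ 5 / 2 * L * x * σ + 7 / 2 * L * x * σ ^ 2 + 5 * L * x ^ 2 * σ ^ 2 + 1 / 2 * L * x ^ 4 * σ ^
      5 + 1 / 2 * L * x ^ 5 * σ ^ 5 + 5 / 8 * x * σ + 1 / 4 * x * σ ^ 3 + 5 / 4 * x ^ 2 * σ ^ 2 +
      3 / 8 * x ^ 2 * σ ^ 3 + 3 / 4 * x ^ 2 * σ ^ 4 + 5 / 8 * x ^ 3 * σ ^ 4 + 1 / 8 * x ^ 5 * σ ^
      5 := by positivity
  norm_num only at h1 h2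
  rw [residue_poly_eq hσ, abs_mul, abs_of_nonneg (by positivity), mul_comm]
  gcongr
  rw [abs_le]
  constructor <;> linarith only [h1, h2, h3, h4]

/-- The left side decreases from t = 40 on, since (41/40)^5 · 29/50 < 1; the bound is essentially
the value at 40. -/
theorem pow_five_mul_pow_le {t : ℕ} (ht : 40 ≤ t) : (t : ℝ) ^ 5 * (29 / 50) ^ t ≤ 71 / 2000 := by
  induction t, ht using Nat.le_induction with
  | base => norm_num
  | succ n hn ih =>
    have hn' : (40 : ℝ) ≤ n := by exact_mod_cast hn
    have h1 : ((n : ℝ) + 1) ^ 5 ≤ (41 / 40 * n) ^ 5 := by gcongr; linarith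
    have h2 : (0 : ℝ) < (n : ℝ) ^ 5 * (29 / 50) ^ n := by positivity
    push_cast
    rw [pow_succ (29 / 50 : ℝ)]
    calc ((n : ℝ) + 1) ^ 5 * ((29 / 50) ^ n * (29 / 50))
        ≤ (41 / 40 * n) ^ 5 * ((29 / 50) ^ n * (29 / 50)) := by gcongr
      _ = (n : ℝ) ^ 5 * (29 / 50) ^ n * ((41 / 40) ^ 5 * (29 / 50)) := by ring
      _ ≤ (n : ℝ) ^ 5 * (29 / 50) ^ n * 1 := by gcongr; norm_num
      _ ≤ 71 / 2000 := by rwa [mul_one]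

theorem exp_neg_le : Real.exp (-(57 / 100)) ≤ 29 / 50 := by
  have h := Real.quadratic_le_exp_of_nonneg (x := 57 / 100) (by norm_num)
  rw [Real.exp_neg, inv_le_comm₀ (Real.exp_pos _) (by norm_num)]
  norm_num at h ⊢
  linarith

/-- By 1 - s ≤ e^{-s}, the t-th power of q is at most e^{-57/100} ≤ 29/50, and one more t-th power
follows. -/
theorem pow_pow_le_of_le_one_sub {t : ℕ} (ht : 40 ≤ t) {q : ℝ} (h0 : 0 ≤ q)
    (h1 : q ≤ 1 - 57 / 100 * (1 / t)) : (q ^ (t + 1)) ^ t ≤ (29 / 50) ^ t := by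
  have ht0 : (0 : ℝ) < t := by exact_mod_cast (by omega : 0 < t)
  have h2 : q ≤ Real.exp (-(57 / 100 * (1 / t))) := by
    have := Real.add_one_le_exp (-(57 / 100 * (1 / t : ℝ)))
    linarith
  have h3 : q ^ t ≤ 29 / 50 := by
    calc q ^ t ≤ Real.exp (-(57 / 100 * (1 / t))) ^ t := by gcongr
      _ = Real.exp (-(57 / 100)) := by
        rw [← Real.exp_nat_mul]
        congr 1
        field_simp
      _ ≤ _ := exp_neg_le
  have h4 : q ≤ 1 := h1.trans (by
    have : 0 ≤ 57 / 100 * (1 / t : ℝ) := by positivity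
    linarith)
  have h5 : q ^ (t + 1) ≤ 29 / 50 := (pow_le_pow_of_le_one h0 h4 (by omega)).trans h3
  gcongr

/-- The bound 1/z ≤ 1 - 0.67x leaves room for a Cauchy radius x/10 within 1 - 0.57x. Division by
this radius turns 0.071 x⁵ into 0.71 x⁴ for the derivative. -/
theorem norm_tails_le_large {t : ℕ} (ht : 40 ≤ t) {z : ℝ} (hz : 1 + 69 / 100 * (1 / t) ≤ z) :
    ‖denomTail t (z⁻¹ : ℝ)‖ ≤ 71 / 1000 * (1 / t) ^ 5 ∧
    ‖numerTail t (z⁻¹ : ℝ)‖ ≤ 71 / 1000 * (1 / t) ^ 5 ∧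
    ‖deriv (denomTail t) (z⁻¹ : ℝ)‖ ≤ 71 / 100 * (1 / t) ^ 4 := by
  have ht' : (40 : ℝ) ≤ t := by exact_mod_cast ht
  obtain ⟨x, hx⟩ : ∃ x : ℝ, x = 1 / t := ⟨_, rfl⟩
  have hx0 : 0 < x := by rw [hx]; positivity
  have hx1 : x ≤ 1 / 40 := by rw [hx]; gcongr
  rw [← hx] at hz ⊢
  have hz0 : 0 < z := by linarith
  have hq0 : 0 < z⁻¹ := inv_pos.2 hz0
  have hq : z⁻¹ ≤ 1 - 67 / 100 * x := by
    refine (inv_anti₀ (by linarith) hz).trans ?_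
    rw [inv_le_iff_one_le_mul₀ (by linarith)]
    nlinarith
  have hM : (29 / 50 : ℝ) ^ t ≤ 71 / 2000 * x ^ 5 := by
    have := pow_five_mul_pow_le ht
    rw [hx, div_pow (1 : ℝ), one_pow, mul_one_div, le_div_iff₀ (by positivity), mul_comm]
    exact this
  have hx5 : x ^ 5 ≤ 1 := pow_le_one₀ hx0.le (by linarith)
  have hn : ‖((z⁻¹ : ℝ) : ℂ)‖ = z⁻¹ := by rw [Complex.norm_real, Real.norm_of_nonneg hq0.le]
  have hp : (‖((z⁻¹ : ℝ) : ℂ)‖ ^ (t + 1)) ^ t ≤ (29 / 50) ^ t := by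
    rw [hn]
    refine pow_pow_le_of_le_one_sub ht hq0.le ?_
    rw [← hx]
    linarith
  have hn1 : ‖((z⁻¹ : ℝ) : ℂ)‖ < 1 := by rw [hn]; linarith
  refine ⟨(norm_denomTail_le (by omega) hn1 hp (by linarith)).trans (by linarith),
    (norm_numerTail_le (by omega) hn1 hp (by linarith)).trans (by linarith), ?_⟩
  refine (norm_deriv_denomTail_le (by omega) hq0.le (d := x / 10) (by linarith) (by linarith)
    (pow_pow_le_of_le_one_sub ht (by linarith) ?_) (by linarith)).trans ?_
  · rw [← hx]
    linarith
  · rw [div_le_iff₀ (by linarith)]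
    calc 2 * (29 / 50 : ℝ) ^ t ≤ 2 * (71 / 2000 * x ^ 5) := by gcongr
      _ = _ := by ring

/-- The zero `1 / z` has the expansion of `1 / rho2`, and its residue `R` that of `R2`. -/
structure IsSecondZero (t : ℕ) (z R : ℝ) : Prop where
  denom_eq : denom t (z⁻¹ : ℝ) = 0
  residue_eq : residue t (z⁻¹ : ℝ) = R
  zero_expansion : |z - (1 + Real.log 2 / (t : ℝ) -
    (Real.log 2 - Real.log 2 ^ 2) / (2 * (t : ℝ) ^ 2)
    + (4 * Real.log 2 ^ 3 + 3 * Real.log 2 ^ 2 + 6 * Real.log 2) / (24 * (t : ℝ) ^ 3)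
    + (2 * Real.log 2 ^ 4 + 54 * Real.log 2 ^ 3 - 27 * Real.log 2 ^ 2 - 6 * Real.log 2)
        / (48 * (t : ℝ) ^ 4))| ≤ 0.26 / (t : ℝ) ^ 5
  residue_expansion :
    |R - (1 / (4 * (t : ℝ)) - (4 * Real.log 2 + 1) / (8 * (t : ℝ) ^ 2))| ≤ 0.77 / (t : ℝ) ^ 3

/-- The nested form of the expansion `L - x A` of `t (rho2 - 1)`, and the ranges of its
intermediate values. -/
structure Rho2Expansion (L x d σ A β γ : ℝ) : Prop where
  σ_eq : σ = L - x * A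
  A_eq : A = (L - L ^ 2) / 2 - x * β
  β_eq : β = (4 * L ^ 3 + 3 * L ^ 2 + 6 * L) / 24 + x * γ
  γ_eq : γ = (2 * L ^ 4 + 54 * L ^ 3 - 27 * L ^ 2 - 6 * L) / 48 + x * d

theorem exists_rho2Expansion (L x d : ℝ) : ∃ σ A β γ, Rho2Expansion L x d σ A β γ :=
  ⟨_, _, _, _, rfl, rfl, rfl, rfl⟩

/-- The ranges are found from the inside outwards: γ from d, then β, A and σ. The sharper lower
bound for γ when d ≥ 0 is needed for the delicate end of the sign change. -/
theorem Rho2Expansion.bounds {L x d σ A β γ : ℝ} (H : Rho2Expansion L x d σ A β γ)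
    (hL : 693147 / 1000000 ≤ L) (hL' : L ≤ 173287 / 250000) (hx : 0 ≤ x) (hx' : x ≤ 1 / 40)
    (hd : |d| ≤ 26 / 100) :
    (8631 / 12500 ≤ σ ∧ σ ≤ 173287 / 250000) ∧ (991 / 10000 ≤ A ∧ A ≤ 2127 / 20000) ∧
      (7221 / 25000 ≤ β ∧ β ≤ 2897 / 10000) ∧
      (2087 / 100000 ≤ γ ∧ γ ≤ 847 / 25000 ∧ (0 ≤ d → 2737 / 100000 ≤ γ)) := by
  obtain ⟨h1, h2, h3, h4⟩ := H
  rw [abs_le] at hd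
  have L0 : 0 ≤ L := le_trans (by norm_num) hL
  have p2 : (693147 / 1000000) ^ 2 ≤ L ^ 2 := by gcongr
  have p3 : (693147 / 1000000) ^ 3 ≤ L ^ 3 := by gcongr
  have p4 : (693147 / 1000000) ^ 4 ≤ L ^ 4 := by gcongr
  have q2 : L ^ 2 ≤ (173287 / 250000) ^ 2 := by gcongr
  have q3 : L ^ 3 ≤ (173287 / 250000) ^ 3 := by gcongr
  have q4 : L ^ 4 ≤ (173287 / 250000) ^ 4 := by gcongr
  norm_num only at p2 p3 p4 q2 q3 q4
  have hxd : -(26 / 100 * (1 / 40)) ≤ x * d ∧ x * d ≤ 26 / 100 * (1 / 40) := by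
    constructor <;> nlinarith
  norm_num only at hxd
  have γ1 : 2087 / 100000 ≤ γ := by linarith only [h4, hxd.1, p3, p4, q2, hL']
  have γ2 : γ ≤ 847 / 25000 := by linarith only [h4, hxd.2, q3, q4, p2, hL]
  have γ3 : 0 ≤ d → 2737 / 100000 ≤ γ := fun h => by
    have : 0 ≤ x * d := mul_nonneg hx h
    linarith only [h4, this, p3, p4, q2, hL']
  have hxγ : 0 ≤ x * γ := mul_nonneg hx (by linarith only [γ1])
  have hxγ' : x * γ ≤ 1 / 40 * (847 / 25000) :=
    mul_le_mul hx' γ2 (by linarith only [γ1]) (by norm_num)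
  have β1 : 7221 / 25000 ≤ β := by linarith only [h3, hxγ, p3, p2, hL]
  have β2 : β ≤ 2897 / 10000 := by linarith only [h3, hxγ', q3, q2, hL']
  have hxβ : 0 ≤ x * β := mul_nonneg hx (by linarith only [β1])
  have hxβ' : x * β ≤ 1 / 40 * (2897 / 10000) :=
    mul_le_mul hx' β2 (by linarith only [β1]) (by norm_num)
  have A1 : 991 / 10000 ≤ A := by linarith only [h2, hxβ', q2, hL]
  have A2 : A ≤ 2127 / 20000 := by linarith only [h2, hxβ, p2, hL']
  have hxA : 0 ≤ x * A := mul_nonneg hx (by linarith only [A1])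
  have hxA' : x * A ≤ 1 / 40 * (2127 / 20000) :=
    mul_le_mul hx' A2 (by linarith only [A1]) (by norm_num)
  exact ⟨⟨by linarith only [h1, hxA', hL], by linarith only [h1, hxA, hL']⟩, ⟨A1, A2⟩, ⟨β1, β2⟩,
    γ1, γ2, γ3⟩

theorem log_two_mem : 693147 / 1000000 ≤ Real.log 2 ∧ Real.log 2 ≤ 173287 / 250000 := by
  have h1 := Real.log_two_gt_d9
  have h2 := Real.log_two_lt_d9
  constructor <;> linarith

/-- The sign change which locates the second zero. -/
theorem second_sign_change {t : ℕ} (ht : 40 ≤ t) {σ A β γ d : ℝ}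
    (H : Rho2Expansion (Real.log 2) (1 / t) d σ A β γ) :
    (d = 26 / 100 → 3 - (1 + 1 / t * σ) + 71 / 1000 * (1 / t) ^ 5 <
      (1 + 1 / t * σ) ^ (t + 1) * (2 - (1 + 1 / t * σ))) ∧
    (d = -(26 / 100) → (1 + 1 / t * σ) ^ (t + 1) * (2 - (1 + 1 / t * σ)) <
      3 - (1 + 1 / t * σ) - 71 / 1000 * (1 / t) ^ 5) := by
  have ht' : (40 : ℝ) ≤ t := by exact_mod_cast ht
  obtain ⟨L1, L2⟩ := log_two_mem
  obtain ⟨x, hx⟩ : ∃ x : ℝ, x = 1 / t := ⟨_, rfl⟩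
  have hx0 : 0 < x := by rw [hx]; positivity
  have hx1 : x ≤ 1 / 40 := by rw [hx]; gcongr
  have key : |d| ≤ 26 / 100 → 0 ≤ σ ∧ σ ≤ 7 / 10 := fun hd => by
    obtain ⟨⟨h1, h2⟩, -⟩ := H.bounds L1 L2 (hx ▸ hx0.le) (hx ▸ hx1) hd
    constructor <;> linarith
  have hg := fun hd => abs_le.1 (abs_gap_sub_gapSeries_le (by omega : 16 ≤ t) (key hd).1 (key hd).2)
  have hE : |d| ≤ 26 / 100 → (1 + 1 / t * σ) ^ (t + 1) * (2 - (1 + 1 / t * σ)) =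
      (3 - (1 + 1 / t * σ)) * Real.exp (gap t (1 + 1 / t * σ)) := fun hd => by
    obtain ⟨h1, h2⟩ := key hd
    have h3 : 1 / (t : ℝ) * σ ≤ 1 / 40 * (7 / 10) := by rw [← hx]; gcongr
    have h4 : 0 ≤ 1 / (t : ℝ) * σ := by positivity
    exact exp_gap (by linarith) (by linarith)
  have hS := gapSeries_eq rfl H.σ_eq H.A_eq H.β_eq H.γ_eq
  rw [← hx] at H hg hE hS ⊢
  have hx5 : x ^ 5 ≤ x ^ 4 * (1 / 40) := by rw [pow_succ]; gcongr
  have hx4 : 0 < x ^ 4 := by positivity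
  have hx41 : x ^ 4 ≤ 1 / 1000 := by
    have : x ^ 4 ≤ (1 / 40) ^ 4 := by gcongr
    norm_num at this
    linarith
  constructor
  · rintro rfl
    have hd : |(26 / 100 : ℝ)| ≤ 26 / 100 := by norm_num
    obtain ⟨⟨σ1, σ2⟩, ⟨A1, A2⟩, ⟨β1, β2⟩, γ1, γ2, γ3⟩ := H.bounds L1 L2 hx0.le hx1 hd
    have h := mul_le_mul_of_nonneg_left (gapSeries_lower L1 L2 hx0.le σ1 σ2 A1 A2 β1 β2
      (γ3 (by norm_num)) γ2) hx4.le
    rw [← hS] at h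
    -- The margin 0.01029 x⁴ exceeds the remainder 0.32 x⁵ ≤ 0.008 x⁴ by at least 0.002 x⁴, which
    -- after multiplication by 3-z still beats the tail 0.071 x⁵.
    have hp : 2 / 1000 * x ^ 4 ≤ gap t (1 + x * σ) := by linarith only [h, (hg hd).1, hx5, hx4]
    have he := Real.add_one_le_exp (gap t (1 + x * σ))
    have hσ : x * σ ≤ 1 / 40 * 1 := by
      gcongr
      linarith only [σ2]
    rw [hE hd]
    have h5 := mul_le_mul_of_nonneg_left ((add_le_add_left hp 1).trans he)
      (by linarith only [hσ] : 0 ≤ 3 - (1 + x * σ))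
    have h6 : (3 - (1 + x * σ)) * (2 / 1000 * x ^ 4) ≥ 19 / 10 * (2 / 1000 * x ^ 4) := by
      gcongr
      linarith only [hσ]
    linarith only [h5, h6, hx5, hx4]
  · rintro rfl
    have hd : |(-(26 / 100) : ℝ)| ≤ 26 / 100 := by norm_num
    obtain ⟨⟨σ1, σ2⟩, ⟨A1, A2⟩, ⟨β1, β2⟩, γ1, γ2, -⟩ := H.bounds L1 L2 hx0.le hx1 hd
    have h := mul_le_mul_of_nonneg_left (gapSeries_upper L1 L2 hx1 σ1 σ2 A1 A2 β1 β2
      γ1 γ2) hx4.le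
    rw [← hS] at h
    have hp : gap t (1 + x * σ) ≤ -(1 / 10 * x ^ 4) := by linarith only [h, (hg hd).2, hx5, hx4]
    have hσ : x * σ ≤ 1 / 40 * 1 := by
      gcongr
      linarith only [σ2]
    have he : Real.exp (gap t (1 + x * σ)) ≤ 1 - 1 / 20 * x ^ 4 := by
      refine (Real.exp_le_exp.2 hp).trans ?_
      rw [Real.exp_neg, inv_le_iff_one_le_mul₀ (Real.exp_pos _)]
      have h1 := Real.add_one_le_exp (1 / 10 * x ^ 4)
      have h2 := mul_le_mul_of_nonneg_left h1 (by linarith only [hx41] : 0 ≤ 1 - 1 / 20 * x ^ 4)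
      nlinarith
    rw [hE hd]
    have h5 := mul_le_mul_of_nonneg_left he (by linarith only [hσ] : 0 ≤ 3 - (1 + x * σ))
    have h6 : (3 - (1 + x * σ)) * (1 / 20 * x ^ 4) ≥ 19 / 10 * (1 / 20 * x ^ 4) := by
      gcongr
      linarith only [hσ]
    linarith only [h5, h6, hx5, hx4]

theorem rho2_expansion_eq {L x d σ A β γ t : ℝ} (ht : 0 < t) (hx : x = 1 / t)
    (H : Rho2Expansion L x d σ A β γ) :
    1 + x * σ - (1 + L / t - (L - L ^ 2) / (2 * t ^ 2)
    + (4 * L ^ 3 + 3 * L ^ 2 + 6 * L) / (24 * t ^ 3)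
    + (2 * L ^ 4 + 54 * L ^ 3 - 27 * L ^ 2 - 6 * L) / (48 * t ^ 4)) = d / t ^ 5 := by
  rw [H.σ_eq, H.A_eq, H.β_eq, H.γ_eq, hx]
  field_simp
  ring

/-- The sign change between d = -0.26 and d = 0.26 gives the zero and its expansion at once. The
residue follows from the perturbed quotient, whose denominator is close to 4. -/
theorem exists_second_zero_large {t : ℕ} (ht : 40 ≤ t) : ∃ z R : ℝ, IsSecondZero t z R := by
  have ht' : (40 : ℝ) ≤ t := by exact_mod_cast ht
  have ht0 : (0 : ℝ) < t := by linarith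
  obtain ⟨L1, L2⟩ := log_two_mem
  obtain ⟨σ₁, A₁, β₁, γ₁, H₁⟩ := exists_rho2Expansion (Real.log 2) (1 / t) (26 / 100)
  obtain ⟨σ₀, A₀, β₀, γ₀, H₀⟩ := exists_rho2Expansion (Real.log 2) (1 / t) (-(26 / 100))
  have s₁ := (second_sign_change ht H₁).1 rfl
  have s₀ := (second_sign_change ht H₀).2 rfl
  have e₁ := rho2_expansion_eq ht0 rfl H₁
  have e₀ := rho2_expansion_eq ht0 rfl H₀
  obtain ⟨x, hx⟩ : ∃ x : ℝ, x = 1 / t := ⟨_, rfl⟩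
  have hxt : x * t = 1 := by rw [hx]; field_simp
  have htl := fun z => norm_tails_le_large ht (z := z)
  simp only [← hx] at H₁ H₀ s₁ s₀ e₁ e₀ htl
  have hx0 : 0 < x := by rw [hx]; positivity
  have hx1 : x ≤ 1 / 40 := by rw [hx]; gcongr
  have hd₁ : |(26 / 100 : ℝ)| ≤ 26 / 100 := by norm_num
  have hd₀ : |(-(26 / 100) : ℝ)| ≤ 26 / 100 := by norm_num
  obtain ⟨⟨σ1, σ2⟩, ⟨A1, A2⟩, -⟩ := H₁.bounds L1 L2 hx0.le hx1 hd₁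
  obtain ⟨⟨σ1', σ2'⟩, ⟨A1', A2'⟩, -⟩ := H₀.bounds L1 L2 hx0.le hx1 hd₀
  have hle : 1 + x * σ₀ ≤ 1 + x * σ₁ := by
    have h1 : (26 / 100 : ℝ) / t ^ 5 ≥ 0 := by positivity
    have h2 : (-(26 / 100) : ℝ) / t ^ 5 ≤ 0 := by
      rw [neg_div]; linarith only [h1]
    linarith only [h1, h2, e₁, e₀]
  have hz69 : 1 + 69 / 100 * x ≤ 1 + x * σ₀ := by nlinarith only [σ1', hx0]
  obtain ⟨z, z1, z2, z3⟩ := exists_inv_zero (by omega : 2 ≤ t) (by nlinarith only [σ1', hx0]) hle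
    (fun z h1 _ => (htl z (hz69.trans h1)).1) (Or.inl ⟨s₀, s₁⟩)
  obtain ⟨n1, n2, n3⟩ := htl z (hz69.trans z1)
  obtain ⟨σ, hσ⟩ : ∃ σ : ℝ, σ = (z - 1) / x := ⟨_, rfl⟩
  have hzσ : z = 1 + x * σ := by rw [hσ, mul_div_cancel₀ _ hx0.ne']; ring
  have hσ₀ : σ₀ ≤ σ := by rw [hzσ] at z1; exact le_of_mul_le_mul_left (by linarith only [z1, z2]) hx0
  have hσ₁ : σ ≤ σ₁ := by rw [hzσ] at z2; exact le_of_mul_le_mul_left (by linarith only [z1, z2]) hx0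
  -- A is recovered from the zero itself. It decreases in σ, hence lies between A₁ and A₀, which is
  -- what the polynomial estimate of the residue requires.
  obtain ⟨A, hA⟩ : ∃ A : ℝ, A = (Real.log 2 - σ) / x := ⟨_, rfl⟩
  have hσA : σ = Real.log 2 - x * A := by rw [hA, mul_div_cancel₀ _ hx0.ne']; ring
  have hA₁ : A₁ ≤ A := le_of_mul_le_mul_left (by linarith only [H₁.σ_eq, hσA, hσ₁] : x * A₁ ≤ x * A) hx0
  have hA₀ : A ≤ A₀ := le_of_mul_le_mul_left (by linarith only [H₀.σ_eq, hσA, hσ₀] : x * A ≤ x * A₀) hx0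
  have hσ0 : 0 ≤ σ := by linarith only [hσ₀, σ1']
  have hs : x * σ ≤ 1 / 40 * (7 / 10) := by
    gcongr
    linarith only [hσ₁, σ2]
  have hs0 : 0 ≤ x * σ := by positivity
  have hx5 : x ^ 5 ≤ x ^ 4 * (1 / 40) := by rw [pow_succ]; gcongr
  have hx4 : x ^ 4 ≤ x ^ 3 * (1 / 40) := by rw [pow_succ]; gcongr
  have hx4p : 0 < x ^ 4 := by positivity
  have hx3 : 0 < x ^ 3 := by positivity
  have hx31 : x ^ 3 ≤ (1 / 40) ^ 3 := by gcongr
  norm_num only at hx31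
  obtain ⟨ε, hε⟩ : ∃ ε : ℝ, ε = 71 / 100 * x ^ 4 := ⟨_, rfl⟩
  have hε0 : 0 ≤ ε := by rw [hε]; positivity
  have hεx : ε ≤ 1 / 50 * x ^ 3 := by rw [hε]; linarith only [hx4, hx3]
  have hε1 : ε ≤ 1 / 1000 := by linarith only [hεx, hx31]
  obtain ⟨B, hB⟩ : ∃ B : ℝ, B = (1 + x) * (1 - x * σ) * (2 - x * σ) - x * (1 + x * σ) := ⟨_, rfl⟩
  have h2s : 0 < 2 - x * σ := by linarith only [hs]
  have hs2 : (x * σ) ^ 2 ≤ x * σ * (1 / 40 * (7 / 10)) := by rw [sq]; gcongr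
  have hs3 : (x * σ) ^ 3 ≤ x * σ * (1 / 40 * (7 / 10)) ^ 2 := by
    calc (x * σ) ^ 3 = x * σ * (x * σ) ^ 2 := by ring
      _ ≤ _ := by gcongr
  have hxs : x * (x * σ) ≤ x * (1 / 40 * (7 / 10)) := by gcongr
  have hxss : 0 ≤ x * (x * σ) ^ 2 := by positivity
  have hB0 : 2 - 3 * (x * σ) + 93 / 100 * x ≤ B := by
    rw [hB]
    linarith only [sq_nonneg (x * σ), hxs, hxss]
  have hB1 : 2 - 3 / 10 ≤ B := by linarith only [hB0, hs, hx0]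
  have hY : ((t : ℝ) + 2) * (2 - z) - 2 + (2 - z) * z / (3 - z) = B / (x * (2 - x * σ)) := by
    rw [hzσ, show 3 - (1 + x * σ) = 2 - x * σ by ring, eq_div_iff (by positivity), hB]
    have e : (2 - (1 + x * σ)) * (1 + x * σ) / (2 - x * σ) * (2 - x * σ) =
      (2 - (1 + x * σ)) * (1 + x * σ) := div_mul_cancel₀ _ h2s.ne'
    linear_combination x * e + (1 - x * σ) * (2 - x * σ) * hxt
  have hYpos : 1 ≤ B / (x * (2 - x * σ)) := by
    rw [le_div_iff₀ (by positivity)]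
    nlinarith only [hB1, hx0, hx1, hs0, hs, mul_nonneg hx0.le hs0]
  obtain ⟨R, e₁', e₂', hR, he₁, he₂, hRe⟩ := residue_approx (by omega) (z := z) (ε := ε)
    (by nlinarith only [σ1', hx0, z1])
    (by linarith only [hzσ, hs]) z3 (n1.trans (by linarith only [hε, hx5, hx4p]))
    (n2.trans (by linarith only [hε, hx5, hx4p])) (n3.trans hε.ge)
    (by linarith only [hε1]) (by
      rw [hY, abs_of_pos (by linarith only [hYpos])]
      linarith only [hYpos, hε1])
  have hpoly := abs_residue_poly_le hσA (by linarith only [L1]) (by linarith only [L2]) hx0.le hx1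
    hσ0 (by linarith only [hσ₁, σ2]) (by linarith only [hA₁, A1]) (by linarith only [hA₀, A2'])
  rw [← hB] at hpoly
  rw [hY, hzσ] at hRe
  have h1s : 1 ≤ 1 + x * σ := by linarith only [hs0]
  have hRe' : R * ((1 + x * σ) ^ 2 * (2 - x * σ) * B -
      -(x * ((1 + x * σ) ^ 2 * (2 - x * σ) ^ 2) * e₁')) =
      x * (1 - 2 * (x * σ)) + -(x * ((1 + x * σ) ^ 2 * (2 - x * σ) ^ 2) * e₂') := by
    have e1 : B / (x * (2 - x * σ)) * (x * (2 - x * σ)) = B :=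
      div_mul_cancel₀ _ (by positivity)
    have e2 : (2 * (1 + x * σ) - 3) / ((1 + x * σ) ^ 2 * (3 - (1 + x * σ)) ^ 2) *
        ((1 + x * σ) ^ 2 * (3 - (1 + x * σ)) ^ 2) = 2 * (1 + x * σ) - 3 := by
      refine div_mul_cancel₀ _ ?_
      rw [show 3 - (1 + x * σ) = 2 - x * σ by ring]
      positivity
    linear_combination (x * ((1 + x * σ) ^ 2 * (2 - x * σ) ^ 2)) * hRe - x * e2 -
      R * ((1 + x * σ) ^ 2 * (2 - x * σ)) * e1
  have hW : (1 + x * σ) ^ 2 * (2 - x * σ) ^ 2 ≤ 5 := by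
    have h' : 0 ≤ (x * σ) ^ 4 := by positivity
    have h'' : (1 + x * σ) ^ 2 * (2 - x * σ) ^ 2 = (2 + x * σ - (x * σ) ^ 2) ^ 2 := by ring
    rw [h'']
    calc (2 + x * σ - (x * σ) ^ 2) ^ 2 ≤ (11 / 5) ^ 2 :=
          pow_le_pow_left₀ (by linarith only [hs2, hs0, hs])
            (by linarith only [sq_nonneg (x * σ), hs]) 2
      _ ≤ 5 := by norm_num
  have hW0 : 0 ≤ (1 + x * σ) ^ 2 * (2 - x * σ) ^ 2 := by positivity
  have herr : ∀ e : ℝ, |e| ≤ 2 * ε →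
      |-(x * ((1 + x * σ) ^ 2 * (2 - x * σ) ^ 2) * e)| ≤ 10 * (x * ε) := fun e he => by
    rw [abs_neg, abs_mul, abs_mul, abs_of_pos hx0, abs_of_nonneg hW0]
    calc x * ((1 + x * σ) ^ 2 * (2 - x * σ) ^ 2) * |e| ≤ x * 5 * (2 * ε) := by gcongr
      _ = 10 * (x * ε) := by ring
  have hxε : x * ε ≤ 1 / 1000 * x ^ 3 := by
    calc x * ε ≤ 1 / 40 * (1 / 50 * x ^ 3) := by gcongr
      _ ≤ _ := by linarith only [hx3]
  have hDen : 397 / 100 ≤ (1 + x * σ) ^ 2 * (2 - x * σ) * B := by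
    have hc : 2 + 29 / 10 * (x * σ) ≤ (1 + x * σ) ^ 2 * (2 - x * σ) := by
      linarith only [hs3, hs0]
    have h := mul_le_mul hc hB0 (by linarith only [hs, hx0]) (by positivity)
    have h' : 0 ≤ x * σ * x := by positivity
    linarith only [h, hs2, hs, hx0, h']
  -- The cubic error 3x³ divided by 3.96 is below 0.758 x³; the tails, at most 0.02 x³ before
  -- division, keep the total under 0.77 x³.
  have hfin := abs_quotient_sub_le hRe' (d := 396 / 100) (S := x / 4 - (4 * Real.log 2 + 1) * x ^ 2 / 8)
    (a := 3 * x ^ 3) (b := 10 * (x * ε)) (by norm_num)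
    (by linarith only [hDen, neg_le_of_abs_le (herr e₁' he₁), le_of_abs_le (herr e₁' he₁), hxε, hx31])
    (by
      rw [abs_le]
      constructor <;> nlinarith only [hx0, hx1, L1, L2])
    hpoly (herr e₁' he₁) (herr e₂' he₂)
  refine ⟨z, R, z3, hR, ?_, ?_⟩
  · rw [abs_le]
    have h1 : (0.26 : ℝ) / t ^ 5 = 26 / 100 / t ^ 5 := by norm_num
    have h2 : (-(26 / 100) : ℝ) / t ^ 5 = -(26 / 100 / t ^ 5) := neg_div _ _
    rw [h1]
    rw [h2] at e₀
    constructor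
    · linarith only [z1, e₀]
    · linarith only [z2, e₁]
  · have e : 1 / (4 * (t : ℝ)) - (4 * Real.log 2 + 1) / (8 * (t : ℝ) ^ 2) =
        x / 4 - (4 * Real.log 2 + 1) * x ^ 2 / 8 := by
      rw [hx]
      field_simp
    have e' : 0.77 / (t : ℝ) ^ 3 = 77 / 100 * x ^ 3 := by
      rw [hx]
      field_simp
      norm_num
    rw [e, e']
    linarith only [hfin, hxε, hx3]

/-! ### The second zero for 16 ≤ t ≤ 39 by certified computation. -/

/-- The coefficients of the expansion of `rho2` to nine digits. -/
theorem rho2_coeff_mem :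
    (693147180 / 10 ^ 9 ≤ Real.log 2 ∧ Real.log 2 ≤ 693147181 / 10 ^ 9) ∧
    (106347083 / 10 ^ 9 ≤ (Real.log 2 - Real.log 2 ^ 2) / 2 ∧
      (Real.log 2 - Real.log 2 ^ 2) / 2 ≤ 106347084 / 10 ^ 9) ∧
    (288847530 / 10 ^ 9 ≤ (4 * Real.log 2 ^ 3 + 3 * Real.log 2 ^ 2 + 6 * Real.log 2) / 24 ∧
      (4 * Real.log 2 ^ 3 + 3 * Real.log 2 ^ 2 + 6 * Real.log 2) / 24 ≤ 288847531 / 10 ^ 9) ∧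
    (27372643 / 10 ^ 9 ≤ (2 * Real.log 2 ^ 4 + 54 * Real.log 2 ^ 3 - 27 * Real.log 2 ^ 2 -
        6 * Real.log 2) / 48 ∧
      (2 * Real.log 2 ^ 4 + 54 * Real.log 2 ^ 3 - 27 * Real.log 2 ^ 2 - 6 * Real.log 2) / 48 ≤
        27372646 / 10 ^ 9) := by
  have h1 := Real.log_two_gt_d9
  have h2 := Real.log_two_lt_d9
  have h0 : 0 ≤ Real.log 2 := by linarith
  norm_num only at h1 h2
  have p2 : (6931471803 / 10 ^ 10) ^ 2 ≤ Real.log 2 ^ 2 := by gcongr; norm_num; linarith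
  have p3 : (6931471803 / 10 ^ 10) ^ 3 ≤ Real.log 2 ^ 3 := by gcongr; norm_num; linarith
  have p4 : (6931471803 / 10 ^ 10) ^ 4 ≤ Real.log 2 ^ 4 := by gcongr; norm_num; linarith
  have q2 : Real.log 2 ^ 2 ≤ (6931471808 / 10 ^ 10) ^ 2 := by gcongr; norm_num; linarith
  have q3 : Real.log 2 ^ 3 ≤ (6931471808 / 10 ^ 10) ^ 3 := by gcongr; norm_num; linarith
  have q4 : Real.log 2 ^ 4 ≤ (6931471808 / 10 ^ 10) ^ 4 := by gcongr; norm_num; linarith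
  norm_num only at p2 p3 p4 q2 q3 q4 ⊢
  refine ⟨⟨?_, ?_⟩, ⟨?_, ?_⟩, ⟨?_, ?_⟩, ?_, ?_⟩ <;> linarith

/-- The zero lies in [n, n + 2^20]/2^70, and the hypotheses compare its reciprocal with rational
enclosures of the expansion. The residue is tested with 0.76 instead of 0.77, using nine-digit
bounds for 4 log 2 + 1. -/
theorem IsSecondZero.exists_of_test {t n m : ℕ} (ht : 2 ≤ t) (hn : 0 < n)
    (h : CBall.rootTest 70 t 3 n (2 ^ 20) 10 m (2 ^ 30) = true)
    (h1 : (1 + 693147181 / 10 ^ 9 / t - 106347083 / 10 ^ 9 / t ^ 2 + 288847531 / 10 ^ 9 / t ^ 3 +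
      27372646 / 10 ^ 9 / t ^ 4 - 26 / 100 / t ^ 5 : ℝ) * (n + 2 ^ 20) ≤ 2 ^ 70)
    (h2 : 2 ^ 70 ≤ (1 + 693147180 / 10 ^ 9 / t - 106347084 / 10 ^ 9 / t ^ 2 + 288847530 / 10 ^ 9 / t ^ 3 +
      27372643 / 10 ^ 9 / t ^ 4 + 26 / 100 / t ^ 5 : ℝ) * n)
    (h3 : (m : ℝ) / 2 ^ 70 + 1 / 2 ^ 40 ≤
      1 / (4 * t) - 3772588724 / 10 ^ 9 / (8 * t ^ 2) + 76 / 100 / t ^ 3)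
    (h4 : (1 / (4 * t) - 3772588720 / 10 ^ 9 / (8 * t ^ 2) - 76 / 100 / t ^ 3 : ℝ) ≤
      m / 2 ^ 70 - 1 / 2 ^ 40) : ∃ z R : ℝ, IsSecondZero t z R := by
  obtain ⟨x, x1, x2, hx, R, hR, hRb⟩ := CBall.rootTest_sound ht h
  have hP : (0 : ℝ) < 2 ^ 70 := by positivity
  have hn' : (0 : ℝ) < n := by exact_mod_cast hn
  have ht' : (0 : ℝ) < t := by exact_mod_cast (by omega : 0 < t)
  have hx0 : 0 < x := lt_of_lt_of_le (by positivity) x1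
  obtain ⟨z, hz⟩ : ∃ z : ℝ, z = x⁻¹ := ⟨_, rfl⟩
  have hzx : z⁻¹ = x := by rw [hz, inv_inv]
  have hzx' : z * x = 1 := by rw [hz]; exact inv_mul_cancel₀ hx0.ne'
  have hz0 : 0 < z := by rw [hz]; positivity
  rw [div_le_iff₀ hP] at x1
  rw [le_div_iff₀ hP] at x2
  push_cast at x2
  have z1 : z * n ≤ 2 ^ 70 := by
    calc z * n ≤ z * (x * 2 ^ 70) := by gcongr
      _ = 2 ^ 70 := by rw [← mul_assoc, hzx', one_mul]
  have z2 : 2 ^ 70 ≤ z * (n + 2 ^ 20) := by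
    calc (2 : ℝ) ^ 70 = z * (x * 2 ^ 70) := by rw [← mul_assoc, hzx', one_mul]
      _ ≤ _ := by gcongr; exact x2.trans_eq (by norm_num)
  have z3 := le_of_mul_le_mul_right (z1.trans h2) hn'
  have z4 := le_of_mul_le_mul_right (h1.trans z2) (by positivity)
  obtain ⟨⟨c1, c1'⟩, ⟨c2, c2'⟩, ⟨c3, c3'⟩, c4, c4'⟩ := rho2_coeff_mem
  have d1 := div_le_div_of_nonneg_right c1 ht'.le
  have d1' := div_le_div_of_nonneg_right c1' ht'.le
  have d2 := div_le_div_of_nonneg_right c2 (pow_pos ht' 2).le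
  have d2' := div_le_div_of_nonneg_right c2' (pow_pos ht' 2).le
  rw [div_div (_ - _)] at d2 d2'
  have d3 := div_le_div_of_nonneg_right c3 (pow_pos ht' 3).le
  have d3' := div_le_div_of_nonneg_right c3' (pow_pos ht' 3).le
  rw [div_div (_ + _)] at d3 d3'
  have d4 := div_le_div_of_nonneg_right c4 (pow_pos ht' 4).le
  have d4' := div_le_div_of_nonneg_right c4' (pow_pos ht' 4).le
  rw [div_div (_ - _)] at d4 d4'
  have k : (3772588720 : ℝ) / 10 ^ 9 ≤ 4 * Real.log 2 + 1 := by norm_num at c1 ⊢; linarith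
  have k' : 4 * Real.log 2 + 1 ≤ (3772588724 : ℝ) / 10 ^ 9 := by norm_num at c1' ⊢; linarith
  have r := div_le_div_of_nonneg_right k (by positivity : 0 ≤ 8 * (t : ℝ) ^ 2)
  have r' := div_le_div_of_nonneg_right k' (by positivity : 0 ≤ 8 * (t : ℝ) ^ 2)
  have hE : ((2 ^ 30 : ℕ) : ℝ) / 2 ^ 70 = 1 / 2 ^ 40 := by norm_num
  have e5 : (0.26 : ℝ) / t ^ 5 = 26 / 100 / t ^ 5 := by norm_num
  have e3 : (76 / 100 : ℝ) / t ^ 3 ≤ 0.77 / t ^ 3 := by gcongr; norm_num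
  rw [hE, abs_le] at hRb
  refine ⟨z, R, hzx ▸ hx, hzx ▸ hR, ?_, ?_⟩
  · rw [e5, abs_le]
    constructor
    · linarith only [z4, d1', d2, d3', d4']
    · linarith only [z3, d1, d2', d3, d4]
  · rw [abs_le]
    constructor
    · linarith only [hRb.1, h4, r, e3]
    · linarith only [hRb.2, h3, r', e3]

theorem exists_second_zero {t : ℕ} (ht : 16 ≤ t) : ∃ z R : ℝ, IsSecondZero t z R := by
  rcases le_or_gt 40 t with h | h
  · exact exists_second_zero_large h
  interval_cases t
  · exact IsSecondZero.exists_of_test (n := 1131943926810434671767) (m := 16460690498358499961) (by norm_num)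
      (by norm_num) (by decide +kernel) (by norm_num) (by norm_num) (by norm_num) (by norm_num)
  · exact IsSecondZero.exists_of_test (n := 1134677442901335620682) (m := 15593035686044978788) (by norm_num)
      (by norm_num) (by decide +kernel) (by norm_num) (by norm_num) (by norm_num) (by norm_num)
  · exact IsSecondZero.exists_of_test (n := 1137119769227761300645) (m := 14812189476174754669) (by norm_num)
      (by norm_num) (by decide +kernel) (by norm_num) (by norm_num) (by norm_num) (by norm_num)
  · exact IsSecondZero.exists_of_test (n := 1139315114106091409200) (m := 14105720342929680865) (by norm_num)
      (by norm_num) (by decide +kernel) (by norm_num) (by norm_num) (by norm_num) (by norm_num)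
  · exact IsSecondZero.exists_of_test (n := 1141299168094137401822) (m := 13463477889719352630) (by norm_num)
      (by norm_num) (by decide +kernel) (by norm_num) (by norm_num) (by norm_num) (by norm_num)
  · exact IsSecondZero.exists_of_test (n := 1143101058975493468453) (m := 12877086054101452348) (by norm_num)
      (by norm_num) (by decide +kernel) (by norm_num) (by norm_num) (by norm_num) (by norm_num)
  · exact IsSecondZero.exists_of_test (n := 1144744793221160611267) (m := 12339568041226629790) (by norm_num)
      (by norm_num) (by decide +kernel) (by norm_num) (by norm_num) (by norm_num) (by norm_num)
  · exact IsSecondZero.exists_of_test (n := 1146250334084242493674) (m := 11845063942783725332) (by norm_num)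
      (by norm_num) (by decide +kernel) (by norm_num) (by norm_num) (by norm_num) (by norm_num)
  · exact IsSecondZero.exists_of_test (n := 1147634418587456994408) (m := 11388614885101980224) (by norm_num)
      (by norm_num) (by decide +kernel) (by norm_num) (by norm_num) (by norm_num) (by norm_num)
  · exact IsSecondZero.exists_of_test (n := 1148911184180883462404) (m := 10965995810764023458) (by norm_num)
      (by norm_num) (by decide +kernel) (by norm_num) (by norm_num) (by norm_num) (by norm_num)
  · exact IsSecondZero.exists_of_test (n := 1150092654805598659989) (m := 10573584397997918867) (by norm_num)
      (by norm_num) (by decide +kernel) (by norm_num) (by norm_num) (by norm_num) (by norm_num)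
  · exact IsSecondZero.exists_of_test (n := 1151189121812342670584) (m := 10208257225273441494) (by norm_num)
      (by norm_num) (by decide +kernel) (by norm_num) (by norm_num) (by norm_num) (by norm_num)
  · exact IsSecondZero.exists_of_test (n := 1152209445339500418786) (m := 9867306742351191301) (by norm_num)
      (by norm_num) (by decide +kernel) (by norm_num) (by norm_num) (by norm_num) (by norm_num)
  · exact IsSecondZero.exists_of_test (n := 1153161294875093021791) (m := 9548374312953430562) (by norm_num)
      (by norm_num) (by decide +kernel) (by norm_num) (by norm_num) (by norm_num) (by norm_num)
  · exact IsSecondZero.exists_of_test (n := 1154051342856303049502) (m := 9249395798893468241) (by norm_num)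
      (by norm_num) (by decide +kernel) (by norm_num) (by norm_num) (by norm_num) (by norm_num)
  · exact IsSecondZero.exists_of_test (n := 1154885421667980539269) (m := 8968557021203541037) (by norm_num)
      (by norm_num) (by decide +kernel) (by norm_num) (by norm_num) (by norm_num) (by norm_num)
  · exact IsSecondZero.exists_of_test (n := 1155668651868824190919) (m := 8704257065078213975) (by norm_num)
      (by norm_num) (by decide +kernel) (by norm_num) (by norm_num) (by norm_num) (by norm_num)
  · exact IsSecondZero.exists_of_test (n := 1156405547616745929215) (m := 8455077861826738626) (by norm_num)
      (by norm_num) (by decide +kernel) (by norm_num) (by norm_num) (by norm_num) (by norm_num)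
  · exact IsSecondZero.exists_of_test (n := 1157100103889031851871) (m := 8219758829616226621) (by norm_num)
      (by norm_num) (by decide +kernel) (by norm_num) (by norm_num) (by norm_num) (by norm_num)
  · exact IsSecondZero.exists_of_test (n := 1157755869063678565807) (m := 7997175618074585952) (by norm_num)
      (by norm_num) (by decide +kernel) (by norm_num) (by norm_num) (by norm_num) (by norm_num)
  · exact IsSecondZero.exists_of_test (n := 1158376005651335972712) (m := 7786322202569128341) (by norm_num)
      (by norm_num) (by decide +kernel) (by norm_num) (by norm_num) (by norm_num) (by norm_num)
  · exact IsSecondZero.exists_of_test (n := 1158963341375743923349) (m := 7586295728362078390) (by norm_num)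
      (by norm_num) (by decide +kernel) (by norm_num) (by norm_num) (by norm_num) (by norm_num)
  · exact IsSecondZero.exists_of_test (n := 1159520412346520688814) (m := 7396283624517127422) (by norm_num)
      (by norm_num) (by decide +kernel) (by norm_num) (by norm_num) (by norm_num) (by norm_num)
  · exact IsSecondZero.exists_of_test (n := 1160049499717017202188) (m := 7215552600877588204) (by norm_num)
      (by norm_num) (by decide +kernel) (by norm_num) (by norm_num) (by norm_num) (by norm_num)

/-! ### The circle of radius 1/r₃ for t ≥ 16. -/

-- Multiplying by the conjugate of 2q-1 gives (3q-1)(2q̄-1) = 6r²+1-5rc - irs, which is then rotated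
-- by the argument of p.
open Complex in
theorem circle_ratio {r c s P C S : ℝ} (hcs : c ^ 2 + s ^ 2 = 1) (hCS : C ^ 2 + S ^ 2 = 1)
    (hD : 0 < 4 * r ^ 2 + 1 - 4 * r * c) {q p w : ℂ} (hq : q = r * (c + s * I))
    (hp : p = P * (C + S * I)) (hw : w = p * (3 * q - 1) / (2 * q - 1)) :
    w.re = P * ((6 * r ^ 2 + 1 - 5 * r * c) * C + r * s * S) / (4 * r ^ 2 + 1 - 4 * r * c) ∧
      w.im = P * ((6 * r ^ 2 + 1 - 5 * r * c) * S - r * s * C) / (4 * r ^ 2 + 1 - 4 * r * c) ∧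
      ‖w‖ ^ 2 = P ^ 2 * (9 * r ^ 2 + 1 - 6 * r * c) / (4 * r ^ 2 + 1 - 4 * r * c) := by
  have hN : normSq (2 * q - 1) = 4 * r ^ 2 + 1 - 4 * r * c := by
    rw [normSq_apply, hq]
    simp
    linear_combination 4 * r ^ 2 * hcs
  have h0 : 2 * q - 1 ≠ 0 := fun h => by
    rw [h, map_zero] at hN
    exact hD.ne hN
  obtain ⟨X, hX⟩ : ∃ X : ℝ, X =
    P * ((6 * r ^ 2 + 1 - 5 * r * c) * C + r * s * S) / (4 * r ^ 2 + 1 - 4 * r * c) := ⟨_, rfl⟩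
  obtain ⟨Y, hY⟩ : ∃ Y : ℝ, Y =
    P * ((6 * r ^ 2 + 1 - 5 * r * c) * S - r * s * C) / (4 * r ^ 2 + 1 - 4 * r * c) := ⟨_, rfl⟩
  have hX' : X * (4 * r ^ 2 + 1 - 4 * r * c) =
      P * ((6 * r ^ 2 + 1 - 5 * r * c) * C + r * s * S) := by
    rw [hX, div_mul_cancel₀ _ hD.ne']
  have hY' : Y * (4 * r ^ 2 + 1 - 4 * r * c) =
      P * ((6 * r ^ 2 + 1 - 5 * r * c) * S - r * s * C) := by
    rw [hY, div_mul_cancel₀ _ hD.ne']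
  have hwe : w = X + Y * I := by
    rw [hw, div_eq_iff h0]
    have hD' : ((4 * r ^ 2 + 1 - 4 * r * c : ℝ) : ℂ) ≠ 0 := by exact_mod_cast hD.ne'
    refine mul_left_cancel₀ hD' ?_
    have e1 := congrArg (fun y : ℝ => (y : ℂ)) hX'
    have e2 := congrArg (fun y : ℝ => (y : ℂ)) hY'
    have e3 := congrArg (fun y : ℝ => (y : ℂ)) hcs
    push_cast at e1 e2 e3 ⊢
    rw [hq, hp]
    linear_combination (-(2 * (r * (c + s * I)) - 1)) * e1 -
      I * (2 * (r * (c + s * I)) - 1) * e2 - 2 * r ^ 2 * P * (C + S * I) * e3 +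
      (r * P * S * s - 2 * r ^ 2 * c * P * S * s + 2 * r ^ 2 * P * C * s ^ 2) * I_sq
  have hre : w.re = X := by simp [hwe]
  have him : w.im = Y := by simp [hwe]
  refine ⟨hre.trans hX, him.trans hY, ?_⟩
  rw [← normSq_eq_norm_sq, normSq_apply, hre, him, eq_div_iff hD.ne']
  refine mul_right_cancel₀ hD.ne' ?_
  linear_combination (X * (4 * r ^ 2 + 1 - 4 * r * c) +
    P * ((6 * r ^ 2 + 1 - 5 * r * c) * C + r * s * S)) * hX' + (Y * (4 * r ^ 2 + 1 - 4 * r * c) +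
    P * ((6 * r ^ 2 + 1 - 5 * r * c) * S - r * s * C)) * hY' + P ^ 2 * r ^ 2 * hcs +
    P ^ 2 * ((6 * r ^ 2 + 1 - 5 * r * c) ^ 2 + r ^ 2 * s ^ 2) * hCS

theorem exp_neg_gap {t : ℕ} {z : ℝ} (h1 : 1 ≤ z) (h2 : z < 2) :
    z⁻¹ ^ (t + 1) * (3 * z⁻¹ - 1) / (2 * z⁻¹ - 1) = Real.exp (-gap t z) := by
  have h := exp_gap (t := t) h1 h2
  have hz : 0 < z := by linarith
  have h3 : 2 - z ≠ 0 := by linarith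
  have h4 : 2 * z⁻¹ - 1 ≠ 0 := by
    have : z * z⁻¹ = 1 := mul_inv_cancel₀ hz.ne'
    intro h0
    apply h3
    linear_combination z * h0 - 2 * this
  rw [Real.exp_neg, div_eq_iff h4, eq_comm, inv_mul_eq_iff_eq_mul₀ (Real.exp_pos _).ne', inv_pow]
  field_simp
  linear_combination h

/-- At `1 / r3` the dominant factor is slightly larger than one. -/
theorem gap_r3_mem {t : ℕ} (ht : 16 ≤ t) {σ : ℝ}
    (hσ : σ = Real.log 2 - 1 / t * ((Real.log 2 - Real.log 2 ^ 2) / 2)) :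
    -(3 / 10 * (1 / t) ^ 2) ≤ gap t (1 + 1 / t * σ) ∧
      gap t (1 + 1 / t * σ) ≤ -(1 / 4 * (1 / t) ^ 2) ∧ 68 / 100 ≤ σ ∧ σ ≤ 173287 / 250000 := by
  have ht' : (16 : ℝ) ≤ t := by exact_mod_cast ht
  obtain ⟨x, hx⟩ : ∃ x : ℝ, x = 1 / t := ⟨_, rfl⟩
  have hx0 : 0 < x := by rw [hx]; positivity
  have hx1 : x ≤ 1 / 16 := by rw [hx]; gcongr
  obtain ⟨L1, L2⟩ := log_two_mem
  have hg := fun h h' => abs_le.1 (abs_gap_sub_gapSeries_le ht (σ := σ) h h')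
  rw [← hx] at hg hσ ⊢
  obtain ⟨L, hL⟩ : ∃ L, L = Real.log 2 := ⟨_, rfl⟩
  obtain ⟨A, hA⟩ : ∃ A, A = (L - L ^ 2) / 2 := ⟨_, rfl⟩
  rw [← hL] at hσ L1 L2
  rw [← hA] at hσ
  -- Here σ lacks the next correction of the zero's expansion, about 0.289 x², and the gap has
  -- derivative close to 1 in σ; so its leading term is about -0.289 x², between the two claimed
  -- bounds.
  have hE : gapSeries x σ = x ^ 2 * (1 / 2 * A * L + 1 / 2 * A * σ + 1 / 24 * x * σ ^ 3 +
      1 / 5 * x ^ 2 * σ ^ 5 + 1 / 5 * x ^ 3 * σ ^ 5 + 1 / 3 * σ ^ 3 -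
      (1 / 2 * A + 1 / 4 * x * σ ^ 4 + 31 / 64 * x ^ 2 * σ ^ 4 + 7 / 8 * σ ^ 2)) := by
    rw [gapSeries, ← hL]
    linear_combination (1 - 1 / 2 * L * x + 1 / 2 * x - 1 / 2 * x * σ) * hσ - x * hA
  have A1 : 1063 / 10000 ≤ A := by
    rw [hA]
    nlinarith only [L1, L2]
  have A2 : A ≤ 1064 / 10000 := by
    rw [hA]
    nlinarith only [L1, L2]
  have L0 : 0 ≤ L := le_trans (by norm_num) L1
  have A0 : 0 ≤ A := le_trans (by norm_num) A1
  have hxA : x * A ≤ 1 / 16 * (1064 / 10000) := by gcongr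
  have hxA0 : 0 ≤ x * A := by positivity
  have σ1 : 686 / 1000 ≤ σ := by linarith only [hσ, L1, hxA]
  have σ2 : σ ≤ 173287 / 250000 := by linarith only [hσ, L2, hxA0]
  have σ0 : 0 ≤ σ := le_trans (by norm_num) σ1
  have h1 : 1 / 2 * A * L + 1 / 2 * A * σ + 1 / 24 * x * σ ^ 3 + 1 / 5 * x ^ 2 * σ ^ 5 +
      1 / 5 * x ^ 3 * σ ^ 5 + 1 / 3 * σ ^ 3 ≤ 1 / 2 * (1064 / 10000) * (173287 / 250000) +
      1 / 2 * (1064 / 10000) * (173287 / 250000) + 1 / 24 * (1 / 16) * (173287 / 250000) ^ 3 +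
      1 / 5 * (1 / 16) ^ 2 * (173287 / 250000) ^ 5 + 1 / 5 * (1 / 16) ^ 3 * (173287 / 250000) ^ 5 +
      1 / 3 * (173287 / 250000) ^ 3 := by gcongr
  have h2 : 1 / 2 * (1063 / 10000) * (693147 / 1000000) + 1 / 2 * (1063 / 10000) * (686 / 1000) +
      1 / 24 * 0 * (686 / 1000) ^ 3 + 1 / 5 * 0 * (686 / 1000) ^ 5 + 1 / 5 * 0 * (686 / 1000) ^ 5 +
      1 / 3 * (686 / 1000) ^ 3 ≤ 1 / 2 * A * L + 1 / 2 * A * σ + 1 / 24 * x * σ ^ 3 +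
      1 / 5 * x ^ 2 * σ ^ 5 + 1 / 5 * x ^ 3 * σ ^ 5 + 1 / 3 * σ ^ 3 := by gcongr <;> positivity
  have h3 : 1 / 2 * A + 1 / 4 * x * σ ^ 4 + 31 / 64 * x ^ 2 * σ ^ 4 + 7 / 8 * σ ^ 2 ≤
      1 / 2 * (1064 / 10000) + 1 / 4 * (1 / 16) * (173287 / 250000) ^ 4 +
      31 / 64 * (1 / 16) ^ 2 * (173287 / 250000) ^ 4 + 7 / 8 * (173287 / 250000) ^ 2 := by gcongr
  have h4 : 1 / 2 * (1063 / 10000) + 1 / 4 * 0 * (686 / 1000) ^ 4 +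
      31 / 64 * 0 * (686 / 1000) ^ 4 + 7 / 8 * (686 / 1000) ^ 2 ≤
      1 / 2 * A + 1 / 4 * x * σ ^ 4 + 31 / 64 * x ^ 2 * σ ^ 4 + 7 / 8 * σ ^ 2 := by
    gcongr <;> positivity
  norm_num only at h1 h2 h3 h4
  have hx2 : 0 ≤ x ^ 2 := sq_nonneg x
  have hx5 : 32 / 100 * x ^ 5 ≤ x ^ 2 * (1 / 1000) := by
    calc 32 / 100 * x ^ 5 = x ^ 2 * (32 / 100 * x ^ 3) := by ring
      _ ≤ x ^ 2 * (32 / 100 * (1 / 16) ^ 3) := by gcongr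
      _ ≤ _ := by gcongr; norm_num
  obtain ⟨g1, g2⟩ := hg σ0 (σ2.trans (by norm_num))
  rw [hE] at g1 g2
  have u := mul_le_mul_of_nonneg_left (sub_le_sub h1 h4) hx2
  have v := mul_le_mul_of_nonneg_left (sub_le_sub h2 h3) hx2
  refine ⟨?_, ?_, by linarith only [σ1], σ2⟩
  · linarith only [v, g1, hx5, hx2]
  · linarith only [u, g2, hx5, hx2]

/-- The circle of radius `1 / r3`: either the dominant factor is small, or it lies in the upper
half plane, or it is near the real axis to the right of one. -/
theorem circle_ratio_cases {t : ℕ} (ht : 16 ≤ t) {r θ W x : ℝ} (hx : x = 1 / t)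
    (hr : 957 / 1000 ≤ r) (hr1 : r ≤ 1) (hθ : 0 ≤ θ) (hθπ : θ ≤ Real.pi)
    (hW : r ^ (t + 1) * (3 * r - 1) / (2 * r - 1) = W) (hW1 : 1 + 1 / 4 * x ^ 2 ≤ W)
    (hW2 : W ≤ 1 + 2 / 5 * x ^ 2) {q w : ℂ} (hq : q = circleMap 0 r θ)
    (hw : w = q ^ (t + 1) * (3 * q - 1) / (2 * q - 1)) :
    ‖w‖ ≤ W ∧ ((‖w‖ ≤ 1 - 3 / 20 * x ^ 2 ∧ q.re ≤ r * (1 - 3 / 5 * x ^ 2)) ∨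
      (1 / 10 * x ^ 2 ≤ w.im ∧ 0 < q.im) ∨
      (1 + 1 / 10 * x ^ 2 ≤ w.re ∧ r * (1 - 1 / 20 * x ^ 4) ≤ q.re)) := by
  have ht' : (16 : ℝ) ≤ t := by exact_mod_cast ht
  have hx0 : 0 < x := by rw [hx]; positivity
  have hx1 : x ≤ 1 / 16 := by rw [hx]; gcongr
  have hxt : (t : ℝ) * x = 1 := by rw [hx]; field_simp
  have hr0 : 0 < r := by linarith
  obtain ⟨P, hP⟩ : ∃ P : ℝ, P = r ^ (t + 1) := ⟨_, rfl⟩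
  have hP0 : 0 < P := by rw [hP]; positivity
  rw [← hP] at hW
  have h2r : 0 < 2 * r - 1 := by linarith
  have h3r : 0 < 3 * r - 1 := by linarith
  have hW' : P * (3 * r - 1) = W * (2 * r - 1) := by rw [← hW, div_mul_cancel₀ _ h2r.ne']
  have hx2 : x ^ 2 ≤ (1 / 16) ^ 2 := by gcongr
  have hx2' : 0 < x ^ 2 := by positivity
  have hW0 : 0 < W := by linarith
  obtain ⟨φ, hφ⟩ : ∃ φ : ℝ, φ = (t + 1) * θ := ⟨_, rfl⟩
  obtain ⟨c, hc⟩ : ∃ c : ℝ, c = Real.cos θ := ⟨_, rfl⟩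
  obtain ⟨s, hs⟩ : ∃ s : ℝ, s = Real.sin θ := ⟨_, rfl⟩
  have hcs : c ^ 2 + s ^ 2 = 1 := by rw [hc, hs]; exact Real.cos_sq_add_sin_sq θ
  have hc1 : c ≤ 1 := hc ▸ Real.cos_le_one θ
  have hs0 : 0 ≤ s := hs ▸ Real.sin_nonneg_of_nonneg_of_le_pi hθ hθπ
  have hsθ : s ≤ θ := hs ▸ Real.sin_le hθ
  have hqe : q = r * (c + s * Complex.I) := by
    rw [hq, circleMap_zero, Complex.exp_mul_I, hc, hs]
    push_cast
    rfl
  have hpe : q ^ (t + 1) = P * (Real.cos φ + Real.sin φ * Complex.I) := by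
    rw [hq, circleMap_zero, mul_pow, ← Complex.exp_nat_mul, hP, hφ]
    push_cast
    rw [← Complex.exp_mul_I]
    ring_nf
  have hD : (2 * r - 1) ^ 2 ≤ 4 * r ^ 2 + 1 - 4 * r * c := by nlinarith only [hc1, hr0]
  have hD0 : 0 < 4 * r ^ 2 + 1 - 4 * r * c := lt_of_lt_of_le (by positivity) hD
  obtain ⟨wre, wim, wn⟩ := circle_ratio hcs (Real.cos_sq_add_sin_sq φ) hD0 hqe hpe hw
  have qre : q.re = r * c := by simp [hqe]
  have qim : q.im = r * s := by simp [hqe]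
  obtain ⟨D, hDe⟩ : ∃ D : ℝ, D = 4 * r ^ 2 + 1 - 4 * r * c := ⟨_, rfl⟩
  obtain ⟨v, hv⟩ : ∃ v : ℝ, v = 1 - c := ⟨_, rfl⟩
  have hv0 : 0 ≤ v := by linarith only [hv, hc1]
  have hDv : D = (2 * r - 1) ^ 2 + 4 * r * v := by rw [hDe, hv]; ring
  rw [← hDe] at hD hD0 wre wim wn
  have hN : 9 * r ^ 2 + 1 - 6 * r * c ≤ (3 * r - 1) ^ 2 * (1 + 33 / 20 * v) := by
    have : 6 * r * v ≤ (3 * r - 1) ^ 2 * (33 / 20) * v := by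
      refine mul_le_mul_of_nonneg_right ?_ hv0
      linarith only [hr, sq_nonneg (r - 957 / 1000)]
    rw [hv] at this ⊢
    linarith only [this]
  have hD4 : (2 * r - 1) ^ 2 * (1 + 4 * v) ≤ D := by
    have h : (2 * r - 1) ^ 2 ≤ r := by nlinarith only [hr, hr1]
    linarith only [mul_le_mul_of_nonneg_right h hv0, hDv]
  -- In v = 1 - cos θ, leaving the positive real axis increases |2q-1|² by a factor of at least 1 +
  -- 4v but |3q-1|² only by at most 1 + 1.65v; thus |w| drops below its value W at q = r.
  have hwn : ‖w‖ ^ 2 * (1 + 4 * v) ≤ W ^ 2 * (1 + 33 / 20 * v) := by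
    rw [wn, div_mul_eq_mul_div, div_le_iff₀ hD0]
    have e : P ^ 2 * (3 * r - 1) ^ 2 = W ^ 2 * (2 * r - 1) ^ 2 := by
      rw [← mul_pow, hW', mul_pow]
    calc P ^ 2 * (9 * r ^ 2 + 1 - 6 * r * c) * (1 + 4 * v)
        ≤ P ^ 2 * ((3 * r - 1) ^ 2 * (1 + 33 / 20 * v)) * (1 + 4 * v) := by gcongr
      _ = W ^ 2 * (1 + 33 / 20 * v) * ((2 * r - 1) ^ 2 * (1 + 4 * v)) := by
          linear_combination (1 + 33 / 20 * v) * (1 + 4 * v) * e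
      _ ≤ _ := by gcongr
  refine ⟨?_, ?_⟩
  · refine (pow_le_pow_iff_left₀ (norm_nonneg _) hW0.le two_ne_zero).1 ?_
    have h1 : W ^ 2 * (1 + 33 / 20 * v) ≤ W ^ 2 * (1 + 4 * v) := by gcongr; norm_num
    exact le_of_mul_le_mul_right (hwn.trans h1) (by linarith only [hv0])
  have hθφ : 17 * θ ≤ φ := by
    rw [hφ]
    gcongr
    linarith only [ht']
  have hθφ' : θ ≤ φ * x := by
    rw [hφ]
    have : 0 ≤ θ * x := by positivity
    linarith only [this, congrArg (θ * ·) hxt, mul_assoc θ (t : ℝ) x]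
  -- φ = (t+1)θ is the argument of q^{t+1}. Once it reaches 6/5, θ ≥ 1.12x and v ≥ 0.6x², and the
  -- drop in modulus outweighs the excess of W over 1.
  rcases le_or_gt (6 / 5) φ with hA | hA
  · left
    have hθ0 : 112 / 100 * x ≤ θ := by
      have : φ * x = θ + θ * x := by rw [hφ]; linear_combination θ * hxt
      nlinarith only [this, hA, hx0, hx1, hθ]
    have hv1 : 3 / 5 * x ^ 2 ≤ v := by
      obtain ⟨y, hy⟩ : ∃ y : ℝ, y = 112 / 100 * x := ⟨_, rfl⟩
      have hy0 : 0 ≤ y := by rw [hy]; positivity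
      have h1 : c ≤ Real.cos y := by
        rw [hc]
        exact Real.cos_le_cos_of_nonneg_of_le_pi hy0 hθπ (hy ▸ hθ0)
      have hy1 : |y| ≤ 1 := by rw [abs_of_nonneg hy0, hy]; linarith only [hx1]
      have h2 := (abs_le.1 (Real.cos_bound hy1)).2
      rw [abs_of_nonneg hy0, hy] at h2
      have h3 : x ^ 4 ≤ x ^ 2 * (1 / 16) ^ 2 := by
        calc x ^ 4 = x ^ 2 * x ^ 2 := by ring
          _ ≤ _ := by gcongr
      rw [hy] at h1
      linarith only [h1, h2, h3, hv, hx2']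
    refine ⟨?_, ?_⟩
    · refine (pow_le_pow_iff_left₀ (norm_nonneg _) (by linarith only [hx2, hx2']) two_ne_zero).1 ?_
      have h1 : W ^ 2 ≤ (1 + 2 / 5 * x ^ 2) ^ 2 := by gcongr
      obtain ⟨y, hy⟩ : ∃ y : ℝ, y = x ^ 2 := ⟨_, rfl⟩
      rw [← hy] at h1 hv1 hx2 hx2' ⊢
      have h2 : (1 + 2 / 5 * y) ^ 2 * (1 + 33 / 20 * v) ≤ (1 - 3 / 20 * y) ^ 2 * (1 + 4 * v) := by
        have k1 : (1 + 2 / 5 * y) ^ 2 ≤ 1 + 81 / 100 * y := by nlinarith only [hx2, hx2']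
        have k2 : 1 - 3 / 10 * y ≤ (1 - 3 / 20 * y) ^ 2 := by nlinarith only [hx2, hx2']
        calc (1 + 2 / 5 * y) ^ 2 * (1 + 33 / 20 * v) ≤ (1 + 81 / 100 * y) * (1 + 33 / 20 * v) := by
              gcongr
          _ ≤ (1 - 3 / 10 * y) * (1 + 4 * v) := by
              have : y * v ≤ (1 / 16) ^ 2 * v := by gcongr
              linarith only [this, hv1, hv0]
          _ ≤ _ := by gcongr
      refine le_of_mul_le_mul_right (hwn.trans (le_trans ?_ h2)) (by linarith only [hv0] : 0 < 1 + 4 * v)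
      gcongr
    · rw [qre]
      gcongr
      linarith only [hv1, hv]
  right
  have hφ0 : 0 ≤ φ := by linarith only [hθφ, hθ]
  -- Close to the axis cos φ loses at most 0.045 x², so the real part of w keeps an excess over 1.
  -- Between the two thresholds sin φ is large enough to make the imaginary part positive.
  rcases le_or_gt φ (3 / 10 * x) with hB | hB
  · right
    have hφ2 : φ ^ 2 ≤ 9 / 100 * x ^ 2 := by
      calc φ ^ 2 ≤ (3 / 10 * x) ^ 2 := by gcongr
        _ = _ := by ring
    have hcφ : 1 - 9 / 200 * x ^ 2 ≤ Real.cos φ := by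
      linarith only [Real.one_sub_sq_div_two_le_cos (x := φ), hφ2]
    have hv1 : v ≤ 1 / 20 * x ^ 4 := by
      have h1 := Real.one_sub_sq_div_two_le_cos (x := θ)
      have h2 : θ ^ 2 ≤ (φ * x) ^ 2 := by gcongr
      have h3 : φ ^ 2 * x ^ 2 ≤ 9 / 100 * x ^ 2 * x ^ 2 := by gcongr
      have h4 : 0 ≤ x ^ 4 := by positivity
      rw [← hc] at h1
      linarith only [h1, h2, h3, h4, hv]
    refine ⟨?_, ?_⟩
    · have hv2 : v ≤ 1 / 1000 * x ^ 2 := by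
        refine hv1.trans ?_
        have : x ^ 2 * x ^ 2 ≤ x ^ 2 * (1 / 16) ^ 2 := by gcongr
        linarith only [this, hx2']
      have hc0 : 0 ≤ Real.cos φ := by linarith only [hcφ, hx2, hx2']
      have hS0 : 0 ≤ Real.sin φ :=
        Real.sin_nonneg_of_nonneg_of_le_pi hφ0 (by linarith only [hA, Real.pi_gt_three])
      rw [wre, le_div_iff₀ hD0]
      have hD5 : D ≤ (2 * r - 1) ^ 2 * (1 + 5 * v) := by
        have : 4 * r * v ≤ (2 * r - 1) ^ 2 * 5 * v := by
          refine mul_le_mul_of_nonneg_right ?_ hv0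
          linarith only [hr, sq_nonneg (r - 957 / 1000)]
        linarith only [this, hDv]
      have hg : (3 * r - 1) * (2 * r - 1) ≤ 6 * r ^ 2 + 1 - 5 * r * c := by
        nlinarith only [hc1, hr0]
      have k : (1 + 1 / 10 * x ^ 2) * (1 + 5 * v) ≤ W * Real.cos φ := by
        calc (1 + 1 / 10 * x ^ 2) * (1 + 5 * v) ≤
            (1 + 1 / 10 * x ^ 2) * (1 + 5 * (1 / 1000 * x ^ 2)) := by gcongr
          _ ≤ (1 + 1 / 4 * x ^ 2) * (1 - 9 / 200 * x ^ 2) := by nlinarith only [hx2, hx2']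
          _ ≤ W * Real.cos φ := by
            gcongr
            linarith only [hx2]
      calc (1 + 1 / 10 * x ^ 2) * D ≤ (1 + 1 / 10 * x ^ 2) * ((2 * r - 1) ^ 2 * (1 + 5 * v)) := by
            gcongr
        _ = (2 * r - 1) ^ 2 * ((1 + 1 / 10 * x ^ 2) * (1 + 5 * v)) := by ring
        _ ≤ (2 * r - 1) ^ 2 * (W * Real.cos φ) := by gcongr
        _ = P * ((3 * r - 1) * (2 * r - 1) * Real.cos φ + 0) := by
            linear_combination (-(2 * r - 1) * Real.cos φ) * hW'
        _ ≤ _ := by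
            gcongr
            positivity
    · rw [qre]
      gcongr
      linarith only [hv1, hv]
  · left
    have hθpos : 0 < θ := by
      have : 0 < φ := lt_trans (by positivity) hB
      rw [hφ] at this
      exact pos_of_mul_pos_right this (by positivity)
    have hπ := Real.pi_gt_three
    have hπ' := Real.pi_lt_d2
    refine ⟨?_, ?_⟩
    · have hsin : 3 / 5 * φ ≤ Real.sin φ := by
        refine le_trans ?_ (Real.mul_le_sin hφ0 (by linarith only [hA, hπ]))
        have h1 : 3 / 5 ≤ 2 / Real.pi := by
          rw [le_div_iff₀ Real.pi_pos]
          linarith only [hπ']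
        exact mul_le_mul_of_nonneg_right h1 hφ0
      have hv1 : v ≤ 1 / 100 := by
        have h1 := Real.one_sub_sq_div_two_le_cos (x := θ)
        have h2 : θ ^ 2 ≤ (6 / 5 / 17) ^ 2 := by
          gcongr
          linarith only [hθφ, hA]
        rw [← hc] at h1
        linarith only [h1, h2, hv]
      have hD2 : D ≤ 11 / 10 := by nlinarith only [hDv, hv1, hv0, hr, hr1]
      have hPlow : 47 / 100 ≤ P := by
        have h1 : 2 * r - 1 ≤ P * (3 * r - 1) := by
          rw [hW']
          exact le_mul_of_one_le_left h2r.le (by linarith only [hW1, hx2'])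
        by_contra hcon
        have h2 : P * (3 * r - 1) ≤ 47 / 100 * (3 * r - 1) := by
          gcongr
          exact (not_le.1 hcon).le
        linarith only [h1, h2, hr]
      have hg : 17 / 10 ≤ 6 * r ^ 2 + 1 - 5 * r * c := by
        have : 5 * r * c ≤ 5 * r * 1 := by gcongr
        nlinarith only [this, hr, hr1]
      have hcos := Real.cos_le_one φ
      have hcos0 : 0 ≤ Real.cos φ := Real.cos_nonneg_of_neg_pi_div_two_le_of_le
        (by linarith only [hφ0, hπ]) (by linarith only [hA, hπ])
      have hIm : 9 / 10 * φ ≤ (6 * r ^ 2 + 1 - 5 * r * c) * Real.sin φ - r * s * Real.cos φ := by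
        have h1 : 17 / 10 * (3 / 5 * φ) ≤ (6 * r ^ 2 + 1 - 5 * r * c) * Real.sin φ := by gcongr
        have h2 : r * s * Real.cos φ ≤ 1 * θ * 1 := by gcongr
        linarith only [h1, h2, hθφ, hφ0]
      rw [wim, le_div_iff₀ hD0]
      calc 1 / 10 * x ^ 2 * D ≤ 1 / 10 * x ^ 2 * (11 / 10) := by gcongr
        _ ≤ 47 / 100 * (9 / 10 * (3 / 10 * x)) := by
            have : x * x ≤ x * (1 / 16) := by gcongr
            linarith only [this, hx0]
        _ ≤ P * ((6 * r ^ 2 + 1 - 5 * r * c) * Real.sin φ - r * s * Real.cos φ) := by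
            gcongr
            linarith only [hIm, hB]
    · rw [qim, hs]
      have : 0 < Real.sin θ := Real.sin_pos_of_pos_of_lt_pi hθpos (by linarith only [hθφ, hA, hπ])
      positivity

/-- On the circle q^{t+1} has modulus at most 501/1000, so this makes the tails small compared with
x², the scale on which w differs from 1. -/
theorem sq_mul_pow_le {t : ℕ} (ht : 16 ≤ t) : (t : ℝ) ^ 2 * (501 / 1000) ^ t ≤ 1 / 200 := by
  induction t, ht using Nat.le_induction with
  | base => norm_num
  | succ n hn ih =>
    have hn' : (16 : ℝ) ≤ n := by exact_mod_cast hn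
    have h1 : ((n : ℝ) + 1) ^ 2 ≤ (17 / 16 * n) ^ 2 := by gcongr; linarith
    have h2 : (0 : ℝ) < (n : ℝ) ^ 2 * (501 / 1000) ^ n := by positivity
    push_cast
    rw [pow_succ (501 / 1000 : ℝ)]
    calc ((n : ℝ) + 1) ^ 2 * ((501 / 1000) ^ n * (501 / 1000))
        ≤ (17 / 16 * n) ^ 2 * ((501 / 1000) ^ n * (501 / 1000)) := by gcongr
      _ = (n : ℝ) ^ 2 * (501 / 1000) ^ n * ((17 / 16) ^ 2 * (501 / 1000)) := by ring
      _ ≤ (n : ℝ) ^ 2 * (501 / 1000) ^ n * 1 := by gcongr; norm_num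
      _ ≤ _ := by linarith

/-- If u = cv with c real and nonpositive, then the real parts, and likewise the imaginary parts,
cannot both be strictly of the same sign. -/
theorem div_mem_slitPlane {u v : ℂ}
    (h : (0 < u.re ∧ 0 < v.re) ∨ (u.im < 0 ∧ v.im < 0) ∨ (u.re < 0 ∧ v.re < 0)) :
    u / v ∈ Complex.slitPlane := by
  have hv : v ≠ 0 := by
    rintro rfl
    simp at h
  by_contra hc
  rw [Complex.mem_slitPlane_iff, not_or, not_lt, not_not] at hc
  obtain ⟨c, hcd⟩ : ∃ c : ℂ, c = u / v := ⟨_, rfl⟩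
  rw [← hcd] at hc
  have hu : u = c * v := by rw [hcd, div_mul_cancel₀ _ hv]
  have hre : u.re = c.re * v.re := by rw [hu, Complex.mul_re, hc.2]; ring
  have him : u.im = c.re * v.im := by rw [hu, Complex.mul_im, hc.2]; ring
  rcases h with ⟨h1, h2⟩ | ⟨h1, h2⟩ | ⟨h1, h2⟩ <;> nlinarith [hc.1]

/-- The parameters of the circle of integration: `r` is its radius, `a` and `b` the zeros inside,
and `W` the dominant factor on the positive real axis. -/
structure CircleData (t : ℕ) (r a b W x : ℝ) : Prop where
  x_eq : x = 1 / t
  r_ge : 957 / 1000 ≤ r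
  r_lt : r < 1
  W_eq : r ^ (t + 1) * (3 * r - 1) / (2 * r - 1) = W
  W_ge : 1 + 1 / 4 * x ^ 2 ≤ W
  W_le : W ≤ 1 + 2 / 5 * x ^ 2
  a_ge : 1 / 2 ≤ a
  a_le : a ≤ 1 / 2 + 3 / 10 * (1 / 2) ^ t
  b_ge : r - 3 / 10 * x ^ 3 ≤ b
  b_le : b ≤ r - 1 / 5 * x ^ 3

/-- The quotient to be tested equals 2u/(b-q) with u near 1-w₀. In the three cases of
`circle_ratio_cases`, u and b-q lie both in the right, both in the lower or both in the left half
plane. The cleared numerator is at most 8 and the cleared denominator at least 0.08 x², whence 100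
t². -/
theorem CircleData.upper_bounds {t : ℕ} (ht : 16 ≤ t) {r a b W x : ℝ} (H : CircleData t r a b W x)
    {q : ℂ} (hq : ‖q‖ = r) (hq0 : 0 ≤ q.im) :
    clearing t 0 2 q * denom t q / ((q - a) * (q - b)) ∈ Complex.slitPlane ∧
      ‖numer t q / denom t q‖ ≤ 100 * (t : ℝ) ^ 2 := by
  obtain ⟨hx, hr, hr1, hW, hW1, hW2, ha1, ha2, hb1, hb2⟩ := H
  have ht' : (16 : ℝ) ≤ t := by exact_mod_cast ht
  have hx0 : 0 < x := by rw [hx]; positivity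
  have hx1 : x ≤ 1 / 16 := by rw [hx]; gcongr
  have hxt : (t : ℝ) * x = 1 := by rw [hx]; field_simp
  have hr0 : 0 < r := by linarith
  have hx2 : x ^ 2 ≤ (1 / 16) ^ 2 := by gcongr
  have hx2' : 0 < x ^ 2 := by positivity
  have hx3 : x ^ 3 ≤ x ^ 2 * (1 / 16) := by rw [pow_succ]; gcongr
  have hx3' : 0 < x ^ 3 := by positivity
  have hx4 : x ^ 4 ≤ x ^ 3 * (1 / 16) := by rw [pow_succ]; gcongr
  have hqθ : q = circleMap 0 r q.arg := by
    rw [circleMap_zero, ← hq, Complex.norm_mul_exp_arg_mul_I]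
  obtain ⟨w₀, hw₀⟩ : ∃ w, w = q ^ (t + 1) * (3 * q - 1) / (2 * q - 1) := ⟨_, rfl⟩
  obtain ⟨hwW, hcases⟩ := circle_ratio_cases ht hx hr hr1.le (Complex.arg_nonneg_iff.2 hq0)
    (Complex.arg_le_pi q) hW hW1 hW2 hqθ hw₀
  obtain ⟨M, hM⟩ : ∃ M : ℝ, M = (501 / 1000) ^ t := ⟨_, rfl⟩
  have hMx : M ≤ 1 / 200 * x ^ 2 := by
    have h := sq_mul_pow_le ht
    rw [← hM] at h
    calc M = x ^ 2 * ((t : ℝ) ^ 2 * M) := by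
          rw [← mul_assoc, ← mul_pow, mul_comm x, hxt, one_pow, one_mul]
      _ ≤ x ^ 2 * (1 / 200) := by gcongr
      _ = _ := by ring
  have hM0 : 0 ≤ M := by rw [hM]; positivity
  have h2r : 0 < 2 * r - 1 := by linarith
  have hP : r ^ (t + 1) ≤ 501 / 1000 := by
    have h1 : r ^ (t + 1) * (3 * r - 1) = W * (2 * r - 1) := by
      rw [← hW, div_mul_cancel₀ _ h2r.ne']
    have h2 : W * (2 * r - 1) ≤ 1002 / 1000 * (2 * r - 1) := by
      gcongr
      linarith
    by_contra hcon
    have h3 : 501 / 1000 * (3 * r - 1) < r ^ (t + 1) * (3 * r - 1) :=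
      mul_lt_mul_of_pos_right (not_le.1 hcon) (by linarith)
    linarith
  have hp : ‖q ^ (t + 1)‖ ≤ 501 / 1000 := by rw [norm_pow, hq]; exact hP
  have hMq : (‖q‖ ^ (t + 1)) ^ t ≤ M := by
    rw [hq, hM]
    gcongr
  have hM4 : M ≤ 1 / 4 := by linarith
  have hqn : ‖q‖ < 1 := hq ▸ hr1
  have hδ := (norm_denomTail_le (by omega) hqn hMq hM4).trans
    (by linarith : 2 * M ≤ 1 / 100 * x ^ 2)
  have hν := (norm_numerTail_le (by omega) hqn hMq hM4).trans
    (by linarith : 2 * M ≤ 1 / 100 * x ^ 2)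
  have hY := clearing_mul_denom (t := t) (by omega) hqn
  have hV := clearing_mul_numer (t := t) (by omega) hqn
  obtain ⟨δ, hδe⟩ : ∃ δ, δ = denomTail t q := ⟨_, rfl⟩
  obtain ⟨ν, hνe⟩ : ∃ ν, ν = numerTail t q := ⟨_, rfl⟩
  obtain ⟨p, hpe⟩ : ∃ p, p = q ^ (t + 1) := ⟨_, rfl⟩
  rw [← hδe] at hδ hY
  rw [← hνe] at hν hV
  rw [← hpe] at hp hY hV hw₀
  have h2q : 2 * r - 1 ≤ ‖2 * q - 1‖ := by
    have := norm_sub_norm_le (2 * q) 1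
    rw [norm_mul, hq, Complex.norm_ofNat, norm_one] at this
    exact this
  have h2q0 : 2 * q - 1 ≠ 0 := norm_pos_iff.1 (h2r.trans_le h2q)
  obtain ⟨w, hw⟩ : ∃ w, w = w₀ + p * q * δ / (2 * q - 1) := ⟨_, rfl⟩
  have hYw : clearing t 0 2 q * denom t q = (1 - 2 * q) * (1 - w) := by
    have e1 : w₀ * (2 * q - 1) = p * (3 * q - 1) := by rw [hw₀, div_mul_cancel₀ _ h2q0]
    have e2 : p * q * δ / (2 * q - 1) * (2 * q - 1) = p * q * δ := div_mul_cancel₀ _ h2q0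
    rw [hY, hw]
    linear_combination -e1 - e2
  have hww : ‖w - w₀‖ ≤ 1 / 100 * x ^ 2 := by
    rw [hw, add_sub_cancel_left, norm_div, div_le_iff₀ (h2r.trans_le h2q), norm_mul, norm_mul, hq]
    calc ‖p‖ * r * ‖δ‖ ≤ 501 / 1000 * 1 * (1 / 100 * x ^ 2) := by gcongr
      _ ≤ 1 / 100 * x ^ 2 * (2 * r - 1) := by nlinarith only [hx2', hr]
      _ ≤ _ := by gcongr
  have hpow : ((1 : ℝ) / 2) ^ t ≤ M := by
    rw [hM]
    exact pow_le_pow_left₀ (by norm_num) (by norm_num) t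
  have hqa : 45 / 100 ≤ ‖q - a‖ := by
    have := norm_sub_norm_le q a
    rw [hq, Complex.norm_real, Real.norm_of_nonneg (by linarith)] at this
    linarith
  have hqa0 : q - a ≠ 0 := norm_pos_iff.1 (lt_of_lt_of_le (by norm_num) hqa)
  -- The factor 1-2q vanishes at 1/2 rather than at a: q - 1/2 = (q-a)(1+κ), and κ is tiny because a
  -- is exponentially close to 1/2.
  obtain ⟨κ, hκ⟩ : ∃ κ : ℂ, κ = ((a - 1 / 2 : ℝ) : ℂ) / (q - a) := ⟨_, rfl⟩
  have hκn : ‖κ‖ ≤ 4 / 1000 * x ^ 2 := by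
    rw [hκ, norm_div, div_le_iff₀ (by linarith), Complex.norm_real,
      Real.norm_of_nonneg (by linarith)]
    calc a - 1 / 2 ≤ 3 / 10 * (1 / 200 * x ^ 2) := by linarith
      _ ≤ 4 / 1000 * x ^ 2 * (45 / 100) := by linarith
      _ ≤ _ := by gcongr
  have h1w : ‖1 - w‖ ≤ 5 / 2 := by
    have e : 1 - w = 1 - w₀ - (w - w₀) := by ring
    rw [e]
    have k1 := norm_sub_le (1 - w₀) (w - w₀)
    have k2 := norm_sub_le 1 w₀
    rw [norm_one] at k2
    linarith
  obtain ⟨u, hu⟩ : ∃ u, u = (1 + κ) * (1 - w) := ⟨_, rfl⟩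
  have huw : ‖u - (1 - w₀)‖ ≤ 2 / 100 * x ^ 2 := by
    have e : u - (1 - w₀) = κ * (1 - w) - (w - w₀) := by rw [hu]; ring
    rw [e]
    have k1 := norm_sub_le (κ * (1 - w)) (w - w₀)
    have k2 : ‖κ * (1 - w)‖ ≤ 4 / 1000 * x ^ 2 * (5 / 2) := by
      rw [norm_mul]
      gcongr
    linarith
  have hratio : clearing t 0 2 q * denom t q / ((q - a) * (q - b)) = 2 * u / (b - q) := by
    have e : (1 - 2 * q) * (1 - w) = -2 * (q - a) * u := by
      have e1 : κ * (q - a) = ((a - 1 / 2 : ℝ) : ℂ) := by rw [hκ, div_mul_cancel₀ _ hqa0]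
      push_cast at e1
      rw [hu]
      linear_combination (2 * (1 - w)) * e1
    rw [hYw, e, mul_assoc, mul_left_comm, mul_div_mul_left _ _ hqa0, ← neg_sub q (b : ℂ), div_neg,
      neg_mul, neg_div]
  have hre := abs_le.1 ((Complex.abs_re_le_norm _).trans huw)
  have him := abs_le.1 ((Complex.abs_im_le_norm _).trans huw)
  have hre' := abs_le.1 ((Complex.abs_re_le_norm _).trans hww)
  have him' := abs_le.1 ((Complex.abs_im_le_norm _).trans hww)
  have hn1 := Complex.abs_re_le_norm (1 - w)
  have hn2 := Complex.abs_im_le_norm (1 - w)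
  simp only [Complex.sub_re, Complex.sub_im, Complex.one_re, Complex.one_im] at hre him hre' him' hn1 hn2
  have h2u : (2 * u).re = 2 * u.re ∧ (2 * u).im = 2 * u.im := by simp
  have hbq : ((b : ℂ) - q).re = b - q.re ∧ ((b : ℂ) - q).im = -q.im := by simp
  rw [hratio]
  have key : 2 * u / (b - q) ∈ Complex.slitPlane ∧ 9 / 100 * x ^ 2 ≤ ‖1 - w‖ := by
    rcases hcases with ⟨h1, h2⟩ | ⟨h1, h2⟩ | ⟨h1, h2⟩
    · have h3 := Complex.re_le_norm w₀
      have h4 : 957 / 1000 * (3 / 5 * x ^ 2) ≤ r * (3 / 5 * x ^ 2) := by gcongr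
      refine ⟨div_mem_slitPlane (Or.inl ⟨?_, ?_⟩), ?_⟩
      · rw [h2u.1]; linarith only [hre.1, h1, h3, hx2']
      · rw [hbq.1]; linarith only [h2, h4, hb1, hx3, hx2']
      · linarith only [hn1, le_abs_self (1 - w.re), hre'.2, h3, h1, hx2']
    · refine ⟨div_mem_slitPlane (Or.inr (Or.inl ⟨?_, ?_⟩)), ?_⟩
      · rw [h2u.2]; linarith only [him.2, h1, hx2']
      · rw [hbq.2]; linarith only [h2]
      · linarith only [hn2, neg_abs_le (0 - w.im), him'.1, h1, hx2']
    -- Here q is so near to r that it passes b: the loss r x⁴/20 is smaller than the distance of at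
    -- least x³/5 between b and r.
    · have h3 : r * (1 / 20 * x ^ 4) ≤ 1 * (1 / 20 * (x ^ 3 * (1 / 16))) := by gcongr
      refine ⟨div_mem_slitPlane (Or.inr (Or.inr ⟨?_, ?_⟩)), ?_⟩
      · rw [h2u.1]; linarith only [hre.2, h1, hx2']
      · rw [hbq.1]; linarith only [h2, h3, hb2, hx3']
      · linarith only [hn1, neg_abs_le (1 - w.re), hre'.1, h1, hx2']
  refine ⟨key.1, ?_⟩
  have hYn : 8 / 100 * x ^ 2 ≤ ‖clearing t 0 2 q * denom t q‖ := by
    rw [hYw, norm_mul, norm_sub_rev]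
    calc 8 / 100 * x ^ 2 ≤ (2 * r - 1) * (9 / 100 * x ^ 2) := by nlinarith only [hx2', hr]
      _ ≤ _ := by gcongr; exact key.2
  have hVn : ‖clearing t 0 2 q * numer t q‖ ≤ 8 := by
    rw [hV]
    have k1 : ‖1 - q - q ^ 2‖ ≤ 3 := by
      have h1 := norm_sub_le (1 - q) (q ^ 2)
      have h2 := norm_sub_le 1 q
      have h3 : r ^ 2 ≤ 1 := pow_le_one₀ hr0.le hr1.le
      rw [norm_one] at h2
      rw [norm_pow] at h1
      rw [hq] at h1 h2
      linarith only [h1, h2, h3, hr1]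
    have k2 : ‖1 - p‖ ≤ 2 := by
      have h2 := norm_sub_le 1 p
      rw [norm_one] at h2
      linarith only [h2, hp]
    have k3 : ‖p + ν‖ ≤ 1 := by
      linarith only [norm_add_le p ν, hp, hν, hx2]
    calc _ ≤ ‖(1 - q - q ^ 2) * (1 - p)‖ + ‖q * p * (p + ν)‖ := norm_add_le _ _
      _ ≤ 3 * 2 + 1 * 1 * 1 := by
        rw [norm_mul, norm_mul, norm_mul, hq]
        have : ‖p‖ ≤ 1 := hp.trans (by norm_num)
        gcongr
      _ ≤ 8 := by norm_num
  have hY0 : 0 < ‖clearing t 0 2 q * denom t q‖ := lt_of_lt_of_le (by positivity) hYn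
  have hc0 : clearing t 0 2 q ≠ 0 := left_ne_zero_of_mul (norm_pos_iff.1 hY0)
  rw [← mul_div_mul_left (numer t q) (denom t q) hc0, norm_div, div_le_iff₀ hY0]
  calc _ ≤ (8 : ℝ) := hVn
    _ = 8 * ((t : ℝ) * x) ^ 2 := by rw [hxt]; norm_num
    _ = 100 * (t : ℝ) ^ 2 * (8 / 100 * x ^ 2) := by ring
    _ ≤ _ := by gcongr

theorem CircleData.bounds {t : ℕ} (ht : 16 ≤ t) {r a b W x : ℝ} (H : CircleData t r a b W x)
    {q : ℂ} (hq : ‖q‖ = r) :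
    clearing t 0 2 q * denom t q / ((q - a) * (q - b)) ∈ Complex.slitPlane ∧
      ‖numer t q / denom t q‖ ≤ 100 * (t : ℝ) ^ 2 := by
  rcases le_total 0 q.im with h | h
  · exact H.upper_bounds ht hq h
  · obtain ⟨h1, h2⟩ := H.upper_bounds ht (q := starRingEnd ℂ q) (by rwa [RCLike.norm_conj])
      (by rw [Complex.conj_im]; linarith)
    rw [clearing_conj, denom_conj] at h1
    rw [numer_conj, denom_conj, ← map_div₀, RCLike.norm_conj] at h2
    refine ⟨conj_mem_slitPlane ?_, h2⟩
    rw [map_div₀, map_mul, map_mul, map_sub, map_sub, Complex.conj_ofReal, Complex.conj_ofReal]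
    exact h1

/-- Passing to reciprocals, r - b = (z₂ - r₃) r b keeps the x³ scale, and a - 1/2 = (2 - z₁) a/2
keeps the exponential one. -/
theorem circleData_of_bounds {t : ℕ} {x z₁ z₂ r₃ : ℝ} (hx : x = 1 / t) (hx0 : 0 < x)
    (hx1 : x ≤ 1 / 16) (z₁l : 199 / 100 ≤ z₁) (z₁u : z₁ ≤ 2)
    (h2z : 2 - z₁ ≤ (1 / 2) ^ t) (hr₃1 : 1 < r₃) (hr₃2 : r₃ ≤ 1044 / 1000)
    (g1 : -(3 / 10 * x ^ 2) ≤ gap t r₃) (g2 : gap t r₃ ≤ -(1 / 4 * x ^ 2))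
    (d1 : 28 / 100 * x ^ 3 ≤ z₂ - r₃) (d2 : z₂ - r₃ ≤ 3 / 10 * x ^ 3) :
    CircleData t r₃⁻¹ z₁⁻¹ z₂⁻¹ (Real.exp (-gap t r₃)) x := by
  have hx2 : x ^ 2 ≤ (1 / 16) ^ 2 := by gcongr
  have hx2' : 0 < x ^ 2 := by positivity
  have hx3 : x ^ 3 ≤ (1 / 16) ^ 3 := by gcongr
  have hx3' : 0 < x ^ 3 := by positivity
  norm_num only at hx2 hx3
  have hz₂0 : 0 < z₂ := by linarith
  have hz₂2 : z₂ ≤ 1046 / 1000 := by linarith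
  have hz₁0 : 0 < z₁ := by linarith
  have hr₃0 : 0 < r₃ := by linarith
  obtain ⟨r, hr⟩ : ∃ r : ℝ, r = r₃⁻¹ := ⟨_, rfl⟩
  have hrr : r₃ * r = 1 := by rw [hr]; exact mul_inv_cancel₀ hr₃0.ne'
  have hr0 : 0 < r := by rw [hr]; positivity
  obtain ⟨a, ha⟩ : ∃ a : ℝ, a = z₁⁻¹ := ⟨_, rfl⟩
  have haa : z₁ * a = 1 := by rw [ha]; exact mul_inv_cancel₀ hz₁0.ne'
  have ha0 : 0 < a := by rw [ha]; positivity
  obtain ⟨b, hb⟩ : ∃ b : ℝ, b = z₂⁻¹ := ⟨_, rfl⟩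
  have hbb : z₂ * b = 1 := by rw [hb]; exact mul_inv_cancel₀ hz₂0.ne'
  have hb0 : 0 < b := by rw [hb]; positivity
  have hrb : r - b = (z₂ - r₃) * (r * b) := by linear_combination b * hrr - r * hbb
  have hr1 : r < 1 := by rw [hr]; exact inv_lt_one_of_one_lt₀ hr₃1
  have hrl : 957 / 1000 ≤ r := by
    rw [hr, le_inv_comm₀ (by norm_num) hr₃0]
    exact hr₃2.trans (by norm_num)
  have hbl : 955 / 1000 ≤ b := by
    rw [hb, le_inv_comm₀ (by norm_num) hz₂0]
    exact hz₂2.trans (by norm_num)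
  have hb1 : b ≤ 1 := by rw [hb]; exact inv_le_one_of_one_le₀ (by linarith)
  have ha1 : a ≤ 503 / 1000 := by
    rw [ha, inv_le_comm₀ hz₁0 (by norm_num)]
    exact le_trans (by norm_num) z₁l
  have ha2 : a - 1 / 2 = (2 - z₁) * (a / 2) := by linear_combination (1 / 2) * haa
  rw [← hr, ← ha, ← hb]
  refine ⟨hx, hrl, hr1, hr ▸ exp_neg_gap hr₃1.le (by linarith), ?_, ?_, ?_, ?_, ?_, ?_⟩
  · linarith [Real.add_one_le_exp (-gap t r₃)]
  · calc Real.exp (-gap t r₃) ≤ Real.exp (3 / 10 * x ^ 2) := Real.exp_le_exp.2 (by linarith)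
      _ ≤ 1 + 2 / 5 * x ^ 2 := by
        have h := Real.add_one_le_exp (-(3 / 10 * x ^ 2))
        rw [Real.exp_neg] at h
        have h1 : 0 < -(3 / 10 * x ^ 2) + 1 := by nlinarith
        refine (le_inv_of_le_inv₀ h1 h).trans ?_
        rw [inv_le_iff_one_le_mul₀ h1]
        nlinarith
  · have : 0 ≤ (2 - z₁) * (a / 2) := mul_nonneg (by linarith) (by positivity)
    linarith
  · have : (2 - z₁) * (a / 2) ≤ (1 / 2) ^ t * (3 / 10) := by
      exact mul_le_mul h2z (by linarith only [ha1]) (by positivity) (by positivity)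
    linarith
  · have : (z₂ - r₃) * (r * b) ≤ 3 / 10 * x ^ 3 * (1 * 1) := by gcongr
    linarith
  · have : 28 / 100 * x ^ 3 * (957 / 1000 * (955 / 1000)) ≤ (z₂ - r₃) * (r * b) := by
      have : 0 ≤ z₂ - r₃ := by linarith
      gcongr
    linarith

/-! ### Assembly of the cases. -/

/-- The asymptotic formula and the expansions for `t ≥ 16`. -/
theorem exists_constants_large {t : ℕ} (ht : 16 ≤ t) :
    ∃ c : AsympConstants, c.Describes t ∧ c.Expands t ∧
      |c.rho2 - (1 + Real.log 2 / (t : ℝ) - (Real.log 2 - Real.log 2 ^ 2) / (2 * (t : ℝ) ^ 2)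
          + (4 * Real.log 2 ^ 3 + 3 * Real.log 2 ^ 2 + 6 * Real.log 2) / (24 * (t : ℝ) ^ 3)
          + (2 * Real.log 2 ^ 4 + 54 * Real.log 2 ^ 3 - 27 * Real.log 2 ^ 2 - 6 * Real.log 2)
              / (48 * (t : ℝ) ^ 4))| ≤ 0.26 / (t : ℝ) ^ 5 ∧
      c.r3 = 1 + Real.log 2 / (t : ℝ) - (Real.log 2 - Real.log 2 ^ 2) / (2 * (t : ℝ) ^ 2) ∧
      c.R3 = 5 * (t : ℝ) ^ 4 := by
  have ht' : (16 : ℝ) ≤ t := by exact_mod_cast ht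
  obtain ⟨z₁, R, z₁l, z₁u, hz₁, hR, hR1, hR2, h2z, hexp1, hexp4⟩ := exists_rho_residue ht
  obtain ⟨z₂, R₂, hz₂, hR₂, hexp2, hexp5⟩ := exists_second_zero ht
  obtain ⟨x, hx⟩ : ∃ x : ℝ, x = 1 / t := ⟨_, rfl⟩
  have hx0 : 0 < x := by rw [hx]; positivity
  have hx1 : x ≤ 1 / 16 := by rw [hx]; gcongr
  have hxt : (t : ℝ) * x = 1 := by rw [hx]; field_simp
  have hx2 : x ^ 2 ≤ x * (1 / 16) := by rw [sq]; gcongr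
  have hx2' : 0 < x ^ 2 := by positivity
  have hx3 : x ^ 3 ≤ x ^ 2 * (1 / 16) := by rw [pow_succ]; gcongr
  have hx3' : 0 < x ^ 3 := by positivity
  have hx4 : x ^ 4 ≤ x ^ 3 * (1 / 16) := by rw [pow_succ]; gcongr
  have hx4' : 0 < x ^ 4 := by positivity
  have hx5 : x ^ 5 ≤ x ^ 4 * (1 / 16) := by rw [pow_succ]; gcongr
  obtain ⟨σ, hσ⟩ : ∃ σ : ℝ, σ = Real.log 2 - 1 / t * ((Real.log 2 - Real.log 2 ^ 2) / 2) := ⟨_, rfl⟩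
  obtain ⟨g1, g2, σ1, σ2⟩ := gap_r3_mem ht hσ
  obtain ⟨r₃, hr₃⟩ : ∃ r₃ : ℝ, r₃ = 1 + x * σ := ⟨_, rfl⟩
  have hr₃e : r₃ = 1 + Real.log 2 / (t : ℝ) -
      (Real.log 2 - Real.log 2 ^ 2) / (2 * (t : ℝ) ^ 2) := by
    rw [hr₃, hσ, hx]
    field_simp
    ring
  rw [← hx, ← hr₃] at g1 g2
  have hr₃1 : 1 < r₃ := by
    have : 0 < x * σ := mul_pos hx0 (by linarith)
    linarith
  have hr₃2 : r₃ ≤ 1044 / 1000 := by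
    have : x * σ ≤ 1 / 16 * (173287 / 250000) := by gcongr
    linarith
  obtain ⟨-, -, ⟨c3, c3'⟩, c4, c4'⟩ := rho2_coeff_mem
  -- r₃ is the expansion of ρ₂ cut before its cubic term, whose coefficient is about 0.2888; the
  -- later terms do not leave the interval [0.28, 0.3].
  obtain ⟨d1, d2⟩ : 28 / 100 * x ^ 3 ≤ z₂ - r₃ ∧ z₂ - r₃ ≤ 3 / 10 * x ^ 3 := by
    obtain ⟨C3, hC3⟩ : ∃ C, C =
      (4 * Real.log 2 ^ 3 + 3 * Real.log 2 ^ 2 + 6 * Real.log 2) / 24 := ⟨_, rfl⟩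
    obtain ⟨C4, hC4⟩ : ∃ C, C =
      (2 * Real.log 2 ^ 4 + 54 * Real.log 2 ^ 3 - 27 * Real.log 2 ^ 2 - 6 * Real.log 2) / 48 :=
      ⟨_, rfl⟩
    rw [← hr₃e, ← div_div (_ + _), ← div_div (_ - _), ← hC3, ← hC4] at hexp2
    rw [← hC3] at c3 c3'
    rw [← hC4] at c4 c4'
    have e3 : C3 / (t : ℝ) ^ 3 = x ^ 3 * C3 := by rw [hx]; field_simp
    have e4 : C4 / (t : ℝ) ^ 4 = x ^ 4 * C4 := by rw [hx]; field_simp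
    have e5 : 0.26 / (t : ℝ) ^ 5 = 26 / 100 * x ^ 5 := by rw [hx]; field_simp; norm_num
    rw [e3, e4, e5, abs_le] at hexp2
    have k3 := mul_le_mul_of_nonneg_left c3 hx3'.le
    have k3' := mul_le_mul_of_nonneg_left c3' hx3'.le
    have k4 := mul_le_mul_of_nonneg_left c4 hx4'.le
    have k4' := mul_le_mul_of_nonneg_left c4' hx4'.le
    norm_num only at k3 k3' k4 k4'
    constructor
    · linarith only [hexp2.1, k3, k4, hx5, hx4, hx4', hx3']
    · linarith only [hexp2.2, k3', k4', hx5, hx4, hx4', hx3']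
  have hz₂0 : 0 < z₂ := by linarith
  have hz₂2 : z₂ ≤ 1046 / 1000 := by linarith
  have hz₁0 : 0 < z₁ := by linarith
  have hr₃0 : 0 < r₃ := by linarith
  have hpow : (2 : ℝ) / 2 ^ (t + 1) = (1 / 2) ^ t := by
    rw [one_div, inv_pow, pow_succ]
    field_simp
  have hsmall : ((1 : ℝ) / 2) ^ t ≤ 1 / 100 := by
    calc ((1 : ℝ) / 2) ^ t ≤ (1 / 2) ^ 16 := pow_le_pow_of_le_one (by norm_num) (by norm_num) ht
      _ ≤ 1 / 100 := by norm_num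
  rw [hpow, abs_of_nonneg (by linarith only [z₁u])] at h2z
  have H := circleData_of_bounds (z₂ := z₂) hx hx0 hx1 z₁l z₁u h2z hr₃1 hr₃2 g1 g2 d1 d2
  obtain ⟨r, hr⟩ : ∃ r : ℝ, r = r₃⁻¹ := ⟨_, rfl⟩
  obtain ⟨a, ha⟩ : ∃ a : ℝ, a = z₁⁻¹ := ⟨_, rfl⟩
  obtain ⟨b, hb⟩ : ∃ b : ℝ, b = z₂⁻¹ := ⟨_, rfl⟩
  rw [← hr, ← ha, ← hb] at H
  have hr0 : 0 < r := by rw [hr]; positivity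
  have ha0 : 0 < a := by rw [ha]; positivity
  have hb0 : 0 < b := by rw [hb]; positivity
  have hr1 := H.r_lt
  have ha1 : a ≤ 503 / 1000 := by linarith only [H.a_le, hsmall]
  have hrl := H.r_ge
  have har : a < r := by linarith only [ha1, hrl]
  have hbr : b < r := by linarith only [H.b_le, hx3']
  have hab : a < b := by
    have hx3'' : x ^ 3 ≤ 1 / 16 * (1 / 16) * (1 / 16) := by linarith only [hx3, hx2, hx1]
    linarith only [H.b_ge, ha1, hrl, hx3'']
  have hK : ∫ θ in (0 : ℝ)..2 * Real.pi, ‖numer t (circleMap 0 r θ) / denom t (circleMap 0 r θ)‖ ≤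
      2 * Real.pi * (100 * (t : ℝ) ^ 2) := by
    have h := intervalIntegral.norm_integral_le_of_norm_le_const (a := 0) (b := 2 * Real.pi)
      (f := fun θ => ‖numer t (circleMap 0 r θ) / denom t (circleMap 0 r θ)‖)
      (C := 100 * (t : ℝ) ^ 2) (fun θ _ => by
        rw [norm_norm]
        exact (H.bounds ht (by rw [norm_circleMap_zero, abs_of_pos hr0])).2)
    refine (le_abs_self _).trans (h.trans (le_of_eq ?_))
    rw [sub_zero, abs_of_pos Real.two_pi_pos, mul_comm]
  have hcoef := norm_coeff_le (by omega) hr1 ha0 hb0 har hbr hab.ne (ha ▸ hz₁) (hb ▸ hz₂)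
    (fun q hq => (H.bounds ht hq).1) hK
  obtain ⟨L1, L2⟩ := log_two_mem
  have hR₂b : 0 < R₂ ∧ R₂ ≤ 26 / 100 * x := by
    have e : 1 / (4 * (t : ℝ)) - (4 * Real.log 2 + 1) / (8 * (t : ℝ) ^ 2) =
        x / 4 - (4 * Real.log 2 + 1) / 8 * x ^ 2 := by
      rw [hx]
      field_simp
    have e' : 0.77 / (t : ℝ) ^ 3 = 77 / 100 * x ^ 3 := by
      rw [hx]
      field_simp
      norm_num
    have h := hexp5
    rw [e, e', abs_le] at h
    have u : (4 * Real.log 2 + 1) / 8 * x ^ 2 ≤ (4 * (173287 / 250000) + 1) / 8 * x ^ 2 := by gcongr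
    have v : 0 ≤ (4 * Real.log 2 + 1) / 8 * x ^ 2 := by positivity
    constructor
    · linarith only [h.1, u, hx3, hx2, hx0]
    · linarith only [h.2, v, hx3, hx2, hx0]
  -- The quotient contributes 100 t² and the principal part at a at most 1. The one at b is at most
  -- 0.26x/(x³/5) ≤ 2t²; since t² ≥ 256, the sum is far below 5t⁴.
  have hbound : 100 * (t : ℝ) ^ 2 + ‖residue t a‖ / (r - a) + ‖residue t b‖ / (r - b) ≤
      5 * (t : ℝ) ^ 4 := by
    rw [ha, hb, hR, hR₂, Complex.norm_real, Complex.norm_real, Real.norm_of_nonneg (by linarith),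
      Real.norm_of_nonneg hR₂b.1.le, ← ha, ← hb]
    have k1 : R / (r - a) ≤ 1 := by
      rw [div_le_one (by linarith)]
      linarith
    have k2 : R₂ / (r - b) ≤ 2 * (t : ℝ) ^ 2 := by
      rw [div_le_iff₀ (by linarith)]
      calc R₂ ≤ 26 / 100 * x := hR₂b.2
        _ ≤ 2 / 5 * x := by linarith
        _ = 2 * ((t : ℝ) * x) ^ 2 * (1 / 5 * x) := by rw [hxt]; ring
        _ = 2 * (t : ℝ) ^ 2 * (1 / 5 * x ^ 3) := by ring
        _ ≤ _ := by
          gcongr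
          linarith [H.b_le]
    have k3 : 16 ^ 2 * (t : ℝ) ^ 2 ≤ (t : ℝ) ^ 4 := by
      calc 16 ^ 2 * (t : ℝ) ^ 2 ≤ (t : ℝ) ^ 2 * (t : ℝ) ^ 2 := by gcongr
        _ = _ := by ring
    have k4 : (16 : ℝ) ^ 2 ≤ (t : ℝ) ^ 2 := by gcongr
    linarith
  refine ⟨⟨z₁, z₂, r₃, R, R₂, 5 * (t : ℝ) ^ 4⟩, ⟨by simp only; linarith, by simp only; linarith,
    by simp only; linarith, hR₂b.1, by simp only; positivity, ?_⟩,
    ⟨fun _ => hexp1, fun _ => hexp4, hexp5⟩, hexp2, hr₃e, rfl⟩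
  refine exists_errorTerm (by positivity) hr₃0 fun n => ?_
  have h := hcoef n
  have e : (gCount t n : ℂ) - residue t a * ((a⁻¹ : ℝ) : ℂ) ^ (n + 1) -
      residue t b * ((b⁻¹ : ℝ) : ℂ) ^ (n + 1) =
      (((gCount t n : ℝ) - R * z₁ ^ (n + 1) - R₂ * z₂ ^ (n + 1) : ℝ) : ℂ) := by
    rw [ha, hb, hR, hR₂, inv_inv, inv_inv]
    push_cast
    rfl
  rw [e, Complex.norm_real, Real.norm_eq_abs, hr, inv_inv, ← hr] at h
  refine h.trans ?_
  gcongr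

theorem theorem2 (t : ℕ) (ht : 2 ≤ t) :
    ∃ c : AsympConstants,
      c.r3 < c.rho2 ∧ c.rho2 < c.rho ∧ 0 < c.R ∧ 0 < c.R2 ∧ 0 < c.R3 ∧
      -- the asymptotic formula with two main terms and an explicit error term, for all `n ≥ 0`
      (∃ ε : ℕ → ℝ, ∀ n : ℕ, |ε n| ≤ 1 ∧
        (gCount t n : ℝ) =
          c.R * c.rho ^ (n + 1) + c.R2 * c.rho2 ^ (n + 1) + c.R3 * c.r3 ^ n * ε n) ∧
      -- the expansion of `rho`
      (3 ≤ t →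
        |c.rho - (2 - 1 / 2 ^ (t + 1) - ((t : ℝ) + 3) / 2 ^ (2 * t + 3)
          - (3 * (t : ℝ) ^ 2 + 19 * (t : ℝ) + 24) / 2 ^ (3 * t + 6))|
          ≤ 0.28 * (t : ℝ) ^ 3 / 2 ^ (4 * t)) ∧
      -- the expansion of `rho2`
      (16 ≤ t →
        |c.rho2 - (1 + Real.log 2 / (t : ℝ) - (Real.log 2 - Real.log 2 ^ 2) / (2 * (t : ℝ) ^ 2)
          + (4 * Real.log 2 ^ 3 + 3 * Real.log 2 ^ 2 + 6 * Real.log 2) / (24 * (t : ℝ) ^ 3)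
          + (2 * Real.log 2 ^ 4 + 54 * Real.log 2 ^ 3 - 27 * Real.log 2 ^ 2 - 6 * Real.log 2)
              / (48 * (t : ℝ) ^ 4))|
          ≤ 0.26 / (t : ℝ) ^ 5) ∧
      -- the value of `r3`
      (16 ≤ t →
        c.r3 = 1 + Real.log 2 / (t : ℝ) - (Real.log 2 - Real.log 2 ^ 2) / (2 * (t : ℝ) ^ 2)) ∧
      -- the expansion of `R`
      (6 ≤ t →
        |c.R - (1 / 8 + ((t : ℝ) - 2) / 2 ^ (t + 5)
          + (2 * (t : ℝ) ^ 2 + 3 * (t : ℝ) - 5) / 2 ^ (2 * t + 7)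
          + (9 * (t : ℝ) ^ 3 + 45 * (t : ℝ) ^ 2 + 20 * (t : ℝ) - 68) / 2 ^ (3 * t + 10))|
          ≤ (t : ℝ) ^ 4 / (50 * 2 ^ (4 * t))) ∧
      -- the expansion of `R2`, valid for every `t ≥ 2`
      |c.R2 - (1 / (4 * (t : ℝ)) - (4 * Real.log 2 + 1) / (8 * (t : ℝ) ^ 2))|
        ≤ 0.77 / (t : ℝ) ^ 3 ∧
      -- the value of `R3`
      (16 ≤ t → c.R3 = 5 * (t : ℝ) ^ 4) ∧
      -- the numerical values for small `t`
      (t ≤ 15 → c.MatchesTable t) := by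
  rcases le_or_gt 16 t with h | h
  · obtain ⟨c, ⟨h1, h2, h3, h4, h5, h6⟩, ⟨e1, e4, e5⟩, e2, e3, e6⟩ := exists_constants_large h
    exact ⟨c, h1, h2, h3, h4, h5, h6, e1, fun _ => e2, fun _ => e3, e4, e5, fun _ => e6,
      fun h' => absurd h (by omega)⟩
  · have key : ∃ c : AsympConstants, c.Describes t ∧ c.MatchesTable t ∧ c.Expands t := by
      interval_cases t
      · exact exists_constants_2
      · exact exists_constants_3
      · exact exists_constants_4
      · exact exists_constants_5
      · exact exists_constants_6
      · exact exists_constants_7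
      · exact exists_constants_8
      · exact exists_constants_9
      · exact exists_constants_10
      · exact exists_constants_11
      · exact exists_constants_12
      · exact exists_constants_13
      · exact exists_constants_14
      · exact exists_constants_15
    obtain ⟨c, ⟨h1, h2, h3, h4, h5, h6⟩, hT, e1, e4, e5⟩ := key
    exact ⟨c, h1, h2, h3, h4, h5, h6, e1, fun h' => absurd h' (by omega),
      fun h' => absurd h' (by omega), e4, e5, fun h' => absurd h' (by omega), fun _ => hT⟩
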